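/- **Conventions.** A *tree* is a finite rooted tree (non-planar), possibly with vertices without incoming edges. It generates a coloured symmetric operad $\Omega(T)$ whose colours are the edges of $T$ and which has one generating operation for every vertex, from its incoming edges to its outgoing edge. Let $\Omega$ be the category of trees with $\mathrm{Hom}_\Omega(S,T)=\mathrm{Hom}_{\mathrm{Oper}}(\Omega(S),\Omega(T))$, let $\mathrm{dSet}=[\Omega^{op},\mathrm{Set}]$ be the category of dendroidal sets, and let $\Omega[T]$ be the presheaf represented by $T$. The *faces* of $T$ are the following subobjects of $\Omega[T]$. If $T$ has at least two vertices: an inner face for every inner edge of $T$ (contract the edge), and an outer face for every vertex of $T$ with exactly one inner edge attached to it (chop off the vertex together with its other edges). If $T$ is a corolla (exactly one vertex): a face for every edge of $T$. For a face $a$ of $T$, the *horn* $\Lambda^a[T]\subseteq\Omega[T]$ is the union of all faces of $T$ except $a$. A dendroidal set $D$ is *strictly fully Kan* if for every tree $T$ with at least one vertex and every face $a$ of $T$, each map $\Lambda^a[T]\to D$ extends to a map $\Omega[T]\to D$, and this extension is unique whenever $T$ has more than one vertex. For a small symmetric monoidal category $C$ let $\mathcal O_C$ be the coloured symmetric operad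 with the objects of $C$ as colours, $\mathcal O_C(c_1,\dots,c_n;c)=\mathrm{Hom}_C(c_1\otimes\dots\otimes c_n,c)$ (for a fixed choice of bracketing), composition given by that of $C$, and symmetric group actions given by the symmetry of $C$. Let $N_d(C)$ be the dendroidal set $T\mapsto\mathrm{Hom}_{\mathrm{Oper}}(\Omega(T),\mathcal O_C)$. This defines a functor $N_d:\mathrm{Sym}\to\mathrm{dSet}$ on the category $\mathrm{Sym}$ of small symmetric monoidal categories and lax symmetric monoidal functors. A *Picard groupoid* is a symmetric monoidal category whose underlying category is a groupoid and in which every object $X$ has a tensor inverse, i.e. an object $Y$ with $X\otimes Y\cong 1$. **Corollary 3.3.** The functor $N_d$ sends Picard groupoids to strictly fully Kan dendroidal sets, and its restriction $$N_d:\{\text{Picard groupoids}\}\longrightarrow\{\text{strictly fully Kan dendroidal sets}\}$$ is an equivalence of categories between the full subcategory of $\mathrm{Sym}$ on the Picard groupoids and the full subcategory of $\mathrm{dSet}$ on the strictly fully Kan dendroidal sets. -/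

import Mathlib

open CategoryTheory MonoidalCategory Opposite

universe u v w

namespace Dendroidal

/-! ## Coloured symmetric operads -/

/-- A (small) coloured symmetric operad in sets.  `Op c d` is the set `P(c₁, …, cₙ; d)`.

The composition `comp e _ g f` is the composite of `g ∈ P(b₁, …, bₙ; d)` with operations
`fⱼ ∈ P(aⱼ₁, …, aⱼₖ₍ⱼ₎; bⱼ)`, whose inputs are then put in the order prescribed by the bijection `e`
from the set of all pairs `(j, i)` to `{1, …, m}`; thus the input `aⱼᵢ` becomes the input number
`e (j, i)` of the composite.  Taking for `e` the lexicographic order one gets the usual composition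
`γ(g; f₁, …, fₙ)`, and taking `g` to be an identity one gets the action of the symmetric groups
(see `Operad.act`).  The three laws say that this is associative and unital; for arbitrary
bijections this contains the functoriality of the action and both equivariance laws. -/
structure Operad where
  /-- The colours. -/
  Col : Type u
  /-- The operations with given inputs and output. -/
  Op : {n : ℕ} → (Fin n → Col) → Col → Type u
  /-- The identity operations. -/
  id : (c : Col) → Op (fun _ : Fin 1 => c) c
  /-- Composition, followed by a reordering of the inputs. -/
  comp : {n m : ℕ} → {k : Fin n → ℕ} → (e : (Σ j, Fin (k j)) ≃ Fin m) →
    {b : Fin n → Col} → {a : (j : Fin n) → Fin (k j) → Col} → {r : Fin m → Col} → {d : Col} →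
    (hr : ∀ j i, r (e ⟨j, i⟩) = a j i) → (g : Op b d) → (f : (j : Fin n) → Op (a j) (b j)) → Op r d
  /-- Left unit law: `id_d ∘ f = f`. -/
  id_comp : ∀ {n : ℕ} {a : Fin n → Col} {d : Col} (f : Op a d)
    (e : (Σ _ : Fin 1, Fin n) ≃ Fin n) (he : ∀ j i, e ⟨j, i⟩ = i),
    comp e (a := fun _ => a) (fun j i => congrArg a (he j i)) (id d) (fun _ => f) = f
  /-- Right unit law: `f ∘ (id, …, id) = f`. -/
  comp_id : ∀ {n : ℕ} {a : Fin n → Col} {d : Col} (f : Op a d)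
    (e : (Σ _ : Fin n, Fin 1) ≃ Fin n) (he : ∀ j i, e ⟨j, i⟩ = j),
    comp e (a := fun j _ => a j) (fun j i => congrArg a (he j i)) f (fun j => id (a j)) = f
  /-- Associativity, for all compatible choices of the orders of the inputs. -/
  assoc : ∀ {n m M : ℕ} {k : Fin n → ℕ} {l : Fin m → ℕ} {s : Fin n → ℕ}
    (e : (Σ j, Fin (k j)) ≃ Fin m) (e' : (Σ p, Fin (l p)) ≃ Fin M)
    (ε : ∀ j, (Σ i, Fin (l (e ⟨j, i⟩))) ≃ Fin (s j)) (e'' : (Σ j, Fin (s j)) ≃ Fin M)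
    (he : ∀ j i q, e'' ⟨j, ε j ⟨i, q⟩⟩ = e' ⟨e ⟨j, i⟩, q⟩)
    {b : Fin n → Col} {a : Fin m → Col} {x : (p : Fin m) → Fin (l p) → Col} {r : Fin M → Col}
    {d : Col} (hr : ∀ p q, r (e' ⟨p, q⟩) = x p q)
    (g : Op b d) (f : ∀ j, Op (fun i => a (e ⟨j, i⟩)) (b j)) (h : ∀ p, Op (x p) (a p)),
    comp e' hr (comp e (fun _ _ => rfl) g f) h =
      comp e'' (a := fun j t => r (e'' ⟨j, t⟩)) (fun _ _ => rfl) g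
        (fun j => comp (ε j) (fun i q => (congrArg r (he j i q)).trans (hr (e ⟨j, i⟩) q))
          (f j) (fun i => h (e ⟨j, i⟩)))

namespace Operad

/-- The action of the symmetric groups, `P(c₁, …, cₙ; d) → P(c_σ(1), …, c_σ(n); d)`. -/
def act (P : Operad.{u}) {n : ℕ} {c : Fin n → P.Col} {d : P.Col} (σ : Equiv.Perm (Fin n))
    (f : P.Op c d) : P.Op (c ∘ σ) d :=
  P.comp (k := fun _ : Fin 1 => n) ((Equiv.uniqueSigma _).trans σ.symm) (a := fun _ => c)
    (fun j i => by
      obtain rfl : j = default := Subsingleton.elim _ _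
      exact congrArg c (σ.apply_symm_apply i)) (P.id d) (fun _ => f)

/-- Maps of coloured symmetric operads (possibly between operads in different universes). -/
@[ext]
structure Hom (P : Operad.{u}) (Q : Operad.{v}) where
  /-- The map on colours. -/
  col : P.Col → Q.Col
  /-- The map on operations. -/
  map : {n : ℕ} → {c : Fin n → P.Col} → {d : P.Col} → P.Op c d → Q.Op (fun i => col (c i)) (col d)
  map_id : ∀ c : P.Col, map (P.id c) = Q.id (col c)
  map_comp : ∀ {n m : ℕ} {k : Fin n → ℕ} (e : (Σ j, Fin (k j)) ≃ Fin m) {b : Fin n → P.Col}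
    {a : (j : Fin n) → Fin (k j) → P.Col} {r : Fin m → P.Col} {d : P.Col}
    (hr : ∀ j i, r (e ⟨j, i⟩) = a j i) (g : P.Op b d) (f : ∀ j, P.Op (a j) (b j)),
    map (P.comp e hr g f) =
      Q.comp e (fun j i => congrArg col (hr j i)) (map g) (fun j => map (f j))

namespace Hom

/-- The identity map of an operad. -/
def refl (P : Operad.{u}) : Hom P P where
  col c := c
  map f := f
  map_id _ := rfl
  map_comp := by intros; rfl

/-- Composition of maps of operads. -/
def trans {P : Operad.{u}} {Q : Operad.{v}} {R : Operad.{w}} (F : Hom P Q) (G : Hom Q R) :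
    Hom P R where
  col c := G.col (F.col c)
  map f := G.map (F.map f)
  map_id c := by rw [F.map_id, G.map_id]
  map_comp e _ _ _ _ hr g f := by rw [F.map_comp, G.map_comp]

end Hom

/-- The category of coloured symmetric operads. -/
instance : Category Operad.{u} where
  Hom P Q := Hom P Q
  id P := Hom.refl P
  comp F G := Hom.trans F G

end Operad

/-! ## Trees and the category `Ω` -/

/-- Finite rooted trees (non-planar), given by their edges and their (non-outer) vertices.
Every vertex `v` has an outgoing edge `out v`; it may have any finite number of incoming edges,
including none.  For an edge `x`, `below x` is the vertex of which `x` is an incoming edge; there is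
one for every edge except the root.  The leaves are the edges that are not of the form `out v`.
The last condition says that every edge is connected to the root by a descending path. -/
structure Tree where
  Edge : Type
  Vertex : Type
  finite_edge : Finite Edge
  finite_vertex : Finite Vertex
  root : Edge
  out : Vertex → Edge
  out_injective : Function.Injective out
  below : Edge → Option Vertex
  below_eq_none : ∀ x, below x = none ↔ x = root
  descending : ∃ height : Edge → ℕ, ∀ x v, below x = some v → height (out v) < height x

namespace Tree

/-- `T.IsOp a d` says that the operad generated by `T` has an operation with inputs `a₁, …, aₙ` and
output `d`: this is the smallest collection of operations that contains the identities, contains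
every vertex, with its incoming edges in any order, as an operation to its outgoing edge, and is
closed under composition and reordering of the inputs.  Equivalently, there is a subtree with root
`d` whose leaves are the `aᵢ`, without repetition. -/
inductive IsOp (T : Tree) : {n : ℕ} → (Fin n → T.Edge) → T.Edge → Prop
  | id (x : T.Edge) : IsOp T (fun _ : Fin 1 => x) x
  | vertex (v : T.Vertex) {n : ℕ} (a : Fin n → T.Edge) (ha : Function.Injective a)
      (hv : ∀ x, T.below x = some v ↔ x ∈ Set.range a) : IsOp T a (T.out v)
  | comp {n m : ℕ} {k : Fin n → ℕ} (e : (Σ j, Fin (k j)) ≃ Fin m) {b : Fin n → T.Edge}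
      {a : (j : Fin n) → Fin (k j) → T.Edge} {r : Fin m → T.Edge} {d : T.Edge}
      (hr : ∀ j i, r (e ⟨j, i⟩) = a j i) (g : IsOp T b d) (f : ∀ j, IsOp T (a j) (b j)) : IsOp T r d

/-- The coloured operad `Ω(T)` generated by a tree `T`.  Its colours are the edges.  Since a subtree
is determined by its root and its leaves, there is at most one operation for each choice of inputs
and output. -/
def operad (T : Tree) : Operad.{0} where
  Col := T.Edge
  Op a d := PLift (T.IsOp a d)
  id x := ⟨IsOp.id x⟩
  comp e _ _ _ _ hr g f := ⟨IsOp.comp e hr g.down (fun j => (f j).down)⟩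
  id_comp _ _ _ := rfl
  comp_id _ _ _ := rfl
  assoc := by intros; rfl

/-- The category `Ω`: objects are trees, and maps `S ⟶ T` are the maps of operads
`Ω(S) → Ω(T)`. -/
instance : Category Tree where
  Hom S T := Operad.Hom S.operad T.operad
  id T := Operad.Hom.refl T.operad
  comp F G := Operad.Hom.trans F G

/-- The tree with one edge and no vertex. -/
def eta : Tree where
  Edge := Unit
  Vertex := Empty
  finite_edge := inferInstance
  finite_vertex := inferInstance
  root := ()
  out := Empty.elim
  out_injective x := x.elim
  below _ := none
  below_eq_none _ := by simp
  descending := ⟨fun _ => 0, fun _ _ h => by simp at h⟩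

/-- A map of trees is determined by a map of edges that sends vertices to operations. -/
def homMk {S T : Tree} (φ : S.Edge → T.Edge)
    (hφ : ∀ (v : S.Vertex) {n : ℕ} (a : Fin n → S.Edge), Function.Injective a →
      (∀ x, S.below x = some v ↔ x ∈ Set.range a) → T.IsOp (fun i => φ (a i)) (φ (S.out v))) :
    S ⟶ T where
  col := φ
  map f := ⟨by
    obtain ⟨f⟩ := f
    induction f with
    | id x => exact IsOp.id _
    | vertex v a ha hv => exact hφ v a ha hv
    | comp e hr g f ihg ihf => exact IsOp.comp e (fun j i => congrArg φ (hr j i)) ihg ihf⟩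
  map_id _ := rfl
  map_comp := by intros; rfl

/-! ### Faces -/

/-- The inner face of `T` at the inner edge `out u`, which is an incoming edge of `w`: the edge
`out u` is contracted, and `u` and `w` become one vertex, called `w` again. -/
noncomputable def contract (T : Tree) (u w : T.Vertex) (h : T.below (T.out u) = some w) : Tree where
  Edge := {x : T.Edge // x ≠ T.out u}
  Vertex := {v : T.Vertex // v ≠ u}
  finite_edge := by have := T.finite_edge; infer_instance
  finite_vertex := by have := T.finite_vertex; infer_instance
  root := ⟨T.root, fun h' => by rw [← h', (T.below_eq_none _).2 rfl] at h; cases h⟩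
  out v := ⟨T.out v.1, fun h' => v.2 (T.out_injective h')⟩
  out_injective v v' h' := Subtype.ext (T.out_injective (congrArg Subtype.val h'))
  below x :=
    open Classical in (T.below x.1).map fun v => if hv : v = u then ⟨w, by
      obtain ⟨ht, hh⟩ := T.descending
      rintro rfl
      exact lt_irrefl _ (hh _ _ h)⟩ else ⟨v, hv⟩
  below_eq_none x := by
    rw [Option.map_eq_none_iff, T.below_eq_none, Subtype.ext_iff]
  descending := by
    obtain ⟨ht, hh⟩ := T.descending
    refine ⟨fun x => ht x.1, fun x v hv => ?_⟩
    obtain ⟨v', hv', rfl⟩ := Option.map_eq_some_iff.1 hv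
    dsimp only
    split_ifs with h'
    · subst h'
      exact (hh _ _ h).trans (hh _ _ hv')
    · exact hh _ _ hv'

/-- The outer face of `T` at a vertex `v` other than the root vertex, all of whose incoming edges
are leaves: `v` and its incoming edges are removed. -/
def chopTop (T : Tree) (v : T.Vertex) (hl : ∀ u, T.below (T.out u) ≠ some v) : Tree where
  Edge := {x : T.Edge // T.below x ≠ some v}
  Vertex := {y : T.Vertex // y ≠ v}
  finite_edge := by have := T.finite_edge; infer_instance
  finite_vertex := by have := T.finite_vertex; infer_instance
  root := ⟨T.root, by rw [(T.below_eq_none _).2 rfl]; simp⟩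
  out y := ⟨T.out y.1, hl y.1⟩
  out_injective y y' h' := Subtype.ext (T.out_injective (congrArg Subtype.val h'))
  below x := (T.below x.1).attach.map fun y => ⟨y.1, fun h => x.2 (y.2.trans (congrArg some h))⟩
  below_eq_none x := by
    rw [Option.map_eq_none_iff, Option.attach_eq_none_iff, T.below_eq_none, Subtype.ext_iff]
  descending := by
    obtain ⟨ht, hh⟩ := T.descending
    refine ⟨fun x => ht x.1, fun x y hy => ?_⟩
    obtain ⟨y', -, rfl⟩ := Option.map_eq_some_iff.1 hy
    exact hh _ _ y'.2

/-- The outer face of `T` at the root vertex `v`, where `out u` is the only incoming edge of `v`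
that is not a leaf: `v`, the root, and all incoming edges of `v` except `out u` are removed, and
`out u` becomes the root. -/
noncomputable def chopRoot (T : Tree) (v u : T.Vertex) (hv : T.out v = T.root)
    (hu : T.below (T.out u) = some v) (hl : ∀ u', T.below (T.out u') = some v → u' = u) : Tree where
  Edge := {x : T.Edge // x ≠ T.root ∧ (T.below x = some v → x = T.out u)}
  Vertex := {y : T.Vertex // y ≠ v}
  finite_edge := by have := T.finite_edge; infer_instance
  finite_vertex := by have := T.finite_vertex; infer_instance
  root := ⟨T.out u, (fun h => by simp [(T.below_eq_none _).2 h] at hu), fun _ => rfl⟩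
  out y := ⟨T.out y.1, fun h => y.2 (T.out_injective (h.trans hv.symm)),
    fun h => congrArg T.out (hl _ h)⟩
  out_injective y y' h' := Subtype.ext (T.out_injective (congrArg Subtype.val h'))
  below x :=
    open Classical in if hx : x.1 = T.out u then none else
      (T.below x.1).attach.map fun y => ⟨y.1, fun h => hx (x.2.2 (y.2.trans (congrArg some h)))⟩
  below_eq_none x := by
    have := x.2.1
    classical
    rw [Subtype.ext_iff, dite_eq_left_iff]
    simp only [Option.map_eq_none_iff, Option.attach_eq_none_iff, T.below_eq_none, this]
    tauto
  descending := by
    obtain ⟨ht, hh⟩ := T.descending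
    classical
    refine ⟨fun x => ht x.1, fun x y hy => ?_⟩
    split_ifs at hy
    obtain ⟨y', -, rfl⟩ := Option.map_eq_some_iff.1 hy
    exact hh _ _ y'.2

/-- Substitution in the operad of a tree, stated in terms of sets of inputs. -/
theorem IsOp.subst {T : Tree} {n : ℕ} {b : Fin n → T.Edge} {d : T.Edge} (g : T.IsOp b d)
    (S : Fin n → Set T.Edge)
    (hS : ∀ j, ∃ (k : ℕ) (a : Fin k → T.Edge), Function.Injective a ∧ Set.range a = S j ∧
      T.IsOp a (b j))
    (hd : ∀ i j x, x ∈ S i → x ∈ S j → i = j) {m : ℕ} {r : Fin m → T.Edge}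
    (hr : Function.Injective r) (hrS : ∀ x, x ∈ Set.range r ↔ ∃ j, x ∈ S j) : T.IsOp r d := by
  choose k a hinj hran hop using hS
  have key : ∀ p : Σ j, Fin (k j), ∃ t, r t = a p.1 p.2 := fun p =>
    (hrS _).2 ⟨p.1, by rw [← hran]; exact ⟨_, rfl⟩⟩
  choose e he using key
  have hbij : Function.Bijective e := by
    constructor
    · rintro ⟨j, i⟩ ⟨j', i'⟩ h
      have h1 : a j i = a j' i' := by rw [← he ⟨j, i⟩, ← he ⟨j', i'⟩, h]
      obtain rfl : j = j' := hd j j' (a j i) (by rw [← hran]; exact ⟨_, rfl⟩)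
        (by rw [h1, ← hran]; exact ⟨_, rfl⟩)
      rw [hinj j h1]
    · intro t
      obtain ⟨j, hj⟩ := (hrS (r t)).1 ⟨t, rfl⟩
      rw [← hran] at hj
      obtain ⟨i, hi⟩ := hj
      exact ⟨⟨j, i⟩, hr ((he _).trans hi)⟩
  exact IsOp.comp (Equiv.ofBijective e hbij) (fun j i => he ⟨j, i⟩) g hop

/-- The inclusion of an inner face. -/
noncomputable def contractMap (T : Tree) (u w : T.Vertex) (h : T.below (T.out u) = some w) :
    T.contract u w h ⟶ T :=
  homMk (fun x => x.1) (by
    classical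
    have := T.finite_edge
    have huw : w ≠ u := by
      obtain ⟨ht, hh⟩ := T.descending
      rintro rfl
      exact lt_irrefl _ (hh _ _ h)
    have hset : ∀ s : Set T.Edge, ∃ (k : ℕ) (a : Fin k → T.Edge),
        Function.Injective a ∧ Set.range a = s := by
      intro s
      obtain ⟨k, ⟨e⟩⟩ := Finite.exists_equiv_fin s
      exact ⟨k, fun i => (e.symm i).1, Subtype.val_injective.comp e.symm.injective, by
        ext x
        exact ⟨by rintro ⟨i, rfl⟩; exact (e.symm i).2, fun hx => ⟨e ⟨x, hx⟩, by simp⟩⟩⟩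
    rintro ⟨v, hvu⟩ n a ha hv
    have hbel : ∀ x : T.Edge, (x ≠ T.out u ∧
        (T.below x = some v ∨ T.below x = some u ∧ v = w)) ↔ ∃ i, (a i).1 = x := by
      intro x
      constructor
      · rintro ⟨hx, hx'⟩
        obtain ⟨i, hi⟩ := (hv ⟨x, hx⟩).1 (by
          refine Option.map_eq_some_iff.2 ?_
          rcases hx' with hx' | ⟨hx', rfl⟩
          · exact ⟨v, hx', by simp [hvu]⟩
          · exact ⟨u, hx', by simp⟩)
        exact ⟨i, by rw [hi]⟩
      · rintro ⟨i, rfl⟩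
        refine ⟨(a i).2, ?_⟩
        obtain ⟨v', h1, h2⟩ := Option.map_eq_some_iff.1 ((hv (a i)).2 ⟨i, rfl⟩)
        split_ifs at h2 with h3
        · subst h3
          exact Or.inr ⟨h1, (congrArg Subtype.val h2).symm⟩
        · exact Or.inl (h1.trans (congrArg (fun z => some (Subtype.val z)) h2))
    have hinj : Function.Injective (fun i => (a i).1) := Subtype.val_injective.comp ha
    by_cases hvw : v = w
    · subst hvw
      obtain ⟨k, b, hb, hbr⟩ := hset {x | T.below x = some v}
      have hbx : ∀ j, T.below (b j) = some v := fun j => by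
        have : b j ∈ Set.range b := ⟨j, rfl⟩
        rwa [hbr] at this
      refine IsOp.subst (IsOp.vertex v b hb (fun x => by rw [hbr]; rfl))
        (fun j => if b j = T.out u then {x | T.below x = some u} else {b j}) ?_ ?_ hinj ?_
      · intro j
        split_ifs with hj
        · obtain ⟨l, c, hc, hcr⟩ := hset {x | T.below x = some u}
          exact ⟨l, c, hc, hcr, hj ▸ IsOp.vertex u c hc (fun x => by rw [hcr]; rfl)⟩
        · exact ⟨1, fun _ => b j, Function.injective_of_subsingleton _, by simp, IsOp.id _⟩
      · intro i j x hi hj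
        split_ifs at hi hj with h1 h2 h2
        · exact hb (h1.trans h2.symm)
        · obtain rfl : x = b j := hj
          exact absurd (Option.some_injective _ ((hbx j).symm.trans hi)) huw
        · obtain rfl : x = b i := hi
          exact absurd (Option.some_injective _ ((hbx i).symm.trans hj)) huw
        · obtain rfl : x = b i := hi
          exact hb hj
      · intro x
        refine (hbel x).symm.trans ?_
        constructor
        · rintro ⟨hx, hx' | ⟨hx', -⟩⟩
          · obtain ⟨j, rfl⟩ : x ∈ Set.range b := by rw [hbr]; exact hx'
            exact ⟨j, by simp [hx]⟩
          · obtain ⟨j, hj⟩ : T.out u ∈ Set.range b := by rw [hbr]; exact h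
            exact ⟨j, by simpa [hj] using hx'⟩
        · rintro ⟨j, hj⟩
          split_ifs at hj with h1
          · refine ⟨?_, Or.inr ⟨hj, rfl⟩⟩
            rintro rfl
            exact huw (Option.some_injective _ (h.symm.trans hj))
          · obtain rfl : x = b j := hj
            exact ⟨h1, Or.inl (hbx j)⟩
    · refine IsOp.vertex v _ hinj fun x => Iff.trans ?_ (hbel x)
      constructor
      · intro hx
        refine ⟨?_, Or.inl hx⟩
        rintro rfl
        exact hvw (Option.some_injective _ (hx.symm.trans h))
      · rintro ⟨-, hx | ⟨-, hx⟩⟩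
        · exact hx
        · exact absurd hx hvw)

/-- The inclusion of an outer face at a vertex that is not the root vertex. -/
def chopTopMap (T : Tree) (v : T.Vertex) (hl : ∀ u, T.below (T.out u) ≠ some v) :
    T.chopTop v hl ⟶ T :=
  homMk (fun x => x.1) (by
    rintro ⟨y, hy⟩ n a ha hv
    refine IsOp.vertex y _ (Subtype.val_injective.comp ha) fun x => ?_
    constructor
    · intro hx
      obtain ⟨i, hi⟩ := (hv ⟨x, by rw [hx]; simpa using hy⟩).1
        (Option.map_eq_some_iff.2 ⟨⟨y, hx⟩, by simpa using hx, rfl⟩)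
      exact ⟨i, congrArg Subtype.val hi⟩
    · rintro ⟨i, rfl⟩
      obtain ⟨y', -, h2⟩ := Option.map_eq_some_iff.1 ((hv (a i)).2 ⟨i, rfl⟩)
      exact y'.2.trans (congrArg (fun z => some (Subtype.val z)) h2))

/-- The inclusion of an outer face at the root vertex. -/
noncomputable def chopRootMap (T : Tree) (v u : T.Vertex) (hv : T.out v = T.root)
    (hu : T.below (T.out u) = some v) (hl : ∀ u', T.below (T.out u') = some v → u' = u) :
    T.chopRoot v u hv hu hl ⟶ T :=
  homMk (fun x => x.1) (by
    classical
    rintro ⟨y, hy⟩ n a ha hv'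
    refine IsOp.vertex y _ (Subtype.val_injective.comp ha) fun x => ?_
    constructor
    · intro hx
      have hxv : T.below x ≠ some v := by rw [hx]; simpa using hy
      have hxu : x ≠ T.out u := by rintro rfl; exact hxv hu
      have hxr : x ≠ T.root := fun h => by simp [(T.below_eq_none _).2 h] at hx
      obtain ⟨i, hi⟩ := (hv' ⟨x, hxr, fun h => absurd h hxv⟩).1
        ((dif_neg hxu).trans (Option.map_eq_some_iff.2 ⟨⟨y, hx⟩, by simpa using hx, rfl⟩))
      exact ⟨i, congrArg Subtype.val hi⟩
    · rintro ⟨i, rfl⟩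
      have h1 := (hv' (a i)).2 ⟨i, rfl⟩
      dsimp only [chopRoot] at h1
      split_ifs at h1 with h3
      obtain ⟨y', -, h2⟩ := Option.map_eq_some_iff.1 h1
      exact y'.2.trans (congrArg (fun z => some (Subtype.val z)) h2))

/-- The inclusion of an edge of `T`. -/
def edgeMap (T : Tree) (x : T.Edge) : eta ⟶ T :=
  homMk (fun _ => x) (fun v => v.elim)

/-- The faces of a tree `T`: an inner face for every inner edge `out u`; an outer face for every
vertex `v` with exactly one inner edge attached to it, if `T` has at least two vertices (this inner
edge is either `out v`, or an incoming edge `out u` of the root vertex `v`); and, if `T` is a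
corolla, a face for every edge. -/
inductive Face (T : Tree) : Type
  | inner (u w : T.Vertex) (h : T.below (T.out u) = some w)
  | top (v : T.Vertex) (hv : T.out v ≠ T.root) (hl : ∀ u, T.below (T.out u) ≠ some v)
  | bottom (v u : T.Vertex) (hv : T.out v = T.root) (hu : T.below (T.out u) = some v)
      (hl : ∀ u', T.below (T.out u') = some v → u' = u)
  | edge (x : T.Edge) (h : ∃! _ : T.Vertex, True)

namespace Face

variable {T : Tree}

/-- The tree of a face. -/
noncomputable def tree : Face T → Tree
  | inner u w h => T.contract u w h
  | top v _ hl => T.chopTop v hl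
  | bottom v u hv hu hl => T.chopRoot v u hv hu hl
  | edge _ _ => eta

/-- The inclusion of a face. -/
noncomputable def incl : (a : Face T) → (a.tree ⟶ T)
  | inner u w h => T.contractMap u w h
  | top v _ hl => T.chopTopMap v hl
  | bottom v u hv hu hl => T.chopRootMap v u hv hu hl
  | edge x _ => T.edgeMap x

end Face

end Tree

/-! ## Dendroidal sets -/

/-- The category of dendroidal sets, the presheaves on `Ω`. -/
abbrev DSet := Treeᵒᵖ ⥤ Type u

/-- The dendroidal set `Ω[T]` represented by a tree `T`. -/
abbrev rep (T : Tree) : DSet.{u} := uliftYoneda.{u}.obj T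

/-- The horn `Λᵃ[T] ⊆ Ω[T]`, the union of all faces except the face `a`. -/
noncomputable def horn (T : Tree) (a : T.Face) : Subfunctor (rep.{u} T) :=
  ⨆ (b : T.Face) (_ : b ≠ a), Subfunctor.range (uliftYoneda.{u}.map b.incl)

/-- A dendroidal set is fully Kan if it has fillers for all horns. -/
def IsFullyKan (D : DSet.{u}) : Prop :=
  ∀ (T : Tree) (a : T.Face) (f : (horn T a).toFunctor ⟶ D), ∃ g : rep T ⟶ D, (horn T a).ι ≫ g = f

/-- A dendroidal set is strictly fully Kan if it is fully Kan and the fillers of the horns of all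
trees with more than one vertex are unique. -/
def IsStrictlyFullyKan : ObjectProperty DSet.{u} := fun D =>
  IsFullyKan D ∧ ∀ (T : Tree), Nontrivial T.Vertex → ∀ (a : T.Face) (g g' : rep T ⟶ D),
    (horn T a).ι ≫ g = (horn T a).ι ≫ g' → g = g'

/-- The dendroidal nerve of operads, `N_d(P)_T = Hom(Ω(T), P)`. -/
def operadNerve : Operad.{u} ⥤ DSet.{u} where
  obj P :=
    { obj := fun T => Operad.Hom T.unop.operad P
      map := fun φ => ↾fun x => Operad.Hom.trans φ.unop x }
  map F := { app := fun T => ↾fun x => Operad.Hom.trans x F }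

/-! ## Iterated tensor products and their reorderings -/

section Tensor

variable {C : Type u} [Category.{v} C] [MonoidalCategory C]

/-- The iterated tensor product `c i₁ ⊗ (c i₂ ⊗ (⋯ ⊗ (c iₙ ⊗ 𝟙)))` over a list `[i₁, …, iₙ]`. -/
@[reducible] def tens {I : Type w} (c : I → C) : List I → C
  | [] => 𝟙_ C
  | i :: L => c i ⊗ tens c L

/-- The coherence isomorphism `c(L ++ L') ≅ c(L) ⊗ c(L')`. -/
def split {I : Type w} (c : I → C) : (L L' : List I) → (tens c (L ++ L') ⟶ tens c L ⊗ tens c L')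
  | [], L' => (λ_ (tens c L')).inv
  | i :: L, L' => c i ◁ split c L L' ≫ (α_ (c i) (tens c L) (tens c L')).inv

/-- Given `φⱼ : r(Kⱼ) ⟶ bⱼ`, the map `φ_{j₁} ⊗ ⋯ ⊗ φ_{jₙ} : r(K_{j₁} ++ ⋯ ++ K_{jₙ}) ⟶ b(L)` for a
list `L = [j₁, …, jₙ]`. -/
def blockMap {I J : Type w} {r : I → C} {b : J → C} {K : J → List I}
    (φ : (j : J) → (tens r (K j) ⟶ b j)) : (L : List J) → (tens r (L.flatMap K) ⟶ tens b L)
  | [] => 𝟙 (𝟙_ C)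
  | j :: L => split r (K j) (L.flatMap K) ≫ (φ j ⊗ₘ blockMap φ L)

/-- The identification of tensor products under a change of labels. -/
def relabel {I J : Type w} {r : I → C} {a : J → C} (h : J → I) (hr : ∀ j, r (h j) = a j) :
    (L : List J) → (tens r (L.map h) ⟶ tens a L)
  | [] => 𝟙 (𝟙_ C)
  | j :: L => eqToHom (hr j) ⊗ₘ relabel h hr L

variable [SymmetricCategory C]

/-- The symmetry `X ⊗ (Y ⊗ Z) ≅ Y ⊗ (X ⊗ Z)`. -/
def swap (X Y Z : C) : X ⊗ (Y ⊗ Z) ⟶ Y ⊗ (X ⊗ Z) :=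
  (α_ X Y Z).inv ≫ (β_ X Y).hom ▷ Z ≫ (α_ Y X Z).hom

theorem swap_swap (X Y Z : C) : swap X Y Z ≫ swap Y X Z = 𝟙 _ := by
  simp [swap, ← comp_whiskerRight_assoc]

theorem swap_natural {X Y Z X' Y' Z' : C} (f : X ⟶ X') (g : Y ⟶ Y') (h : Z ⟶ Z') :
    (f ⊗ₘ (g ⊗ₘ h)) ≫ swap X' Y' Z' = swap X Y Z ≫ (g ⊗ₘ (f ⊗ₘ h)) := by
  simp only [swap, Category.assoc]
  rw [← associator_naturality, ← tensorHom_id, ← tensorHom_id, tensorHom_comp_tensorHom_assoc,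
    ← BraidedCategory.braiding_naturality, associator_inv_naturality_assoc, tensorHom_comp_tensorHom_assoc]
  simp

theorem swap_whisker (X Y : C) {Z Z' : C} (h : Z ⟶ Z') :
    X ◁ Y ◁ h ≫ swap X Y Z' = swap X Y Z ≫ Y ◁ X ◁ h := by
  simpa using swap_natural (𝟙 X) (𝟙 Y) h

theorem swap_braid (X Y Z W : C) :
    swap X Y (Z ⊗ W) ≫ Y ◁ swap X Z W ≫ swap Y Z (X ⊗ W) =
      X ◁ swap Y Z W ≫ swap X Z (Y ⊗ W) ≫ Z ◁ swap X Y W := by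
  have h := BraidedCategory.yang_baxter X Y Z
  have h2 := congrArg (fun f => X ◁ (α_ Y Z W).inv ≫ (α_ X (Y ⊗ Z) W).inv ≫ f ▷ W ≫
    (α_ Z (Y ⊗ X) W).hom ≫ Z ◁ (α_ Y X W).hom) h
  simp only [swap]
  refine Eq.trans ?_ (h2.trans ?_)
  · monoidal
  · monoidal

theorem swap_hexagon (X Y Z W : C) :
    swap X Y (Z ⊗ W) ≫ Y ◁ swap X Z W ≫ (α_ Y Z (X ⊗ W)).inv =
      X ◁ (α_ Y Z W).inv ≫ swap X (Y ⊗ Z) W := by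
  simp only [swap, BraidedCategory.braiding_tensor_right_hom]
  monoidal

theorem swap_hexagon' (X Y Z W : C) :
    X ◁ swap Y Z W ≫ swap X Z (Y ⊗ W) ≫ Z ◁ (α_ X Y W).inv =
      (α_ X Y (Z ⊗ W)).inv ≫ swap (X ⊗ Y) Z W := by
  simp only [swap, BraidedCategory.braiding_tensor_left_hom]
  monoidal

theorem swap_assoc (X Y Z W : C) :
    swap X Y (Z ⊗ W) ≫ Y ◁ (α_ X Z W).inv ≫ (α_ Y (X ⊗ Z) W).inv =
      X ◁ (α_ Y Z W).inv ≫ (α_ X (Y ⊗ Z) W).inv ≫ swap X Y Z ▷ W := by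
  simp only [swap]
  monoidal

theorem swap_unit_left (X Z : C) : swap (𝟙_ C) X Z = (λ_ _).hom ≫ X ◁ (λ_ _).inv := by
  simp only [swap, braiding_tensorUnit_left]
  monoidal

theorem swap_unit_right (X Z : C) : swap X (𝟙_ C) Z = X ◁ (λ_ _).hom ≫ (λ_ _).inv := by
  simp only [swap, braiding_tensorUnit_right]
  monoidal

/-- The canonical morphisms between reorderings of an iterated tensor product: those that are
composites of symmetries of adjacent factors. -/
inductive Can {I : Type w} (c : I → C) : {L L' : List I} → (tens c L ⟶ tens c L') → Prop
  | id (L : List I) : Can c (𝟙 (tens c L))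
  | cons (i : I) {L L' : List I} {f : tens c L ⟶ tens c L'} (hf : Can c f) :
      Can c (L := i :: L) (L' := i :: L') (c i ◁ f)
  | swap (i j : I) (L : List I) :
      Can c (L := i :: j :: L) (L' := j :: i :: L) (swap (c i) (c j) (tens c L))
  | comp {L L' L'' : List I} {f : tens c L ⟶ tens c L'} {g : tens c L' ⟶ tens c L''}
      (hf : Can c f) (hg : Can c g) : Can c (f ≫ g)

theorem Can.exists_of_perm {I : Type w} (c : I → C) {L L' : List I} (h : L.Perm L') :
    ∃ f : tens c L ⟶ tens c L', Can c f := by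
  induction h with
  | nil => exact ⟨_, Can.id _⟩
  | cons i _ ih => obtain ⟨f, hf⟩ := ih; exact ⟨_, Can.cons i hf⟩
  | swap i j L => exact ⟨_, Can.swap _ _ _⟩
  | trans _ _ ih ih' =>
    obtain ⟨f, hf⟩ := ih
    obtain ⟨g, hg⟩ := ih'
    exact ⟨_, hf.comp hg⟩

theorem Can.perm {I : Type w} {c : I → C} {L L' : List I} {f : tens c L ⟶ tens c L'}
    (h : Can c f) : L.Perm L' := by
  induction h with
  | id L => exact List.Perm.refl _
  | cons i _ ih => exact ih.cons i
  | swap i j L => exact List.Perm.swap _ _ _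
  | comp _ _ ih ih' => exact ih.trans ih'

theorem Can.exists_inv {I : Type w} {c : I → C} {L L' : List I} {f : tens c L ⟶ tens c L'}
    (h : Can c f) : ∃ g : tens c L' ⟶ tens c L, Can c g ∧ g ≫ f = 𝟙 _ ∧ f ≫ g = 𝟙 _ := by
  induction h with
  | id L => exact ⟨_, Can.id _, by simp, by simp⟩
  | cons i _ ih =>
    obtain ⟨g, hg, h1, h2⟩ := ih
    exact ⟨_, hg.cons i, by rw [← whiskerLeft_comp, h1, whiskerLeft_id],
      by rw [← whiskerLeft_comp, h2, whiskerLeft_id]⟩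
  | swap i j L => exact ⟨_, Can.swap _ _ _, swap_swap _ _ _, swap_swap _ _ _⟩
  | comp _ _ ih ih' =>
    obtain ⟨g, hg, h1, h2⟩ := ih
    obtain ⟨g', hg', h1', h2'⟩ := ih'
    exact ⟨_, hg'.comp hg, by simp [reassoc_of% h1, h1'], by simp [reassoc_of% h2', h2]⟩

/-- The canonical morphism that moves a factor to the front. -/
inductive Pull {I : Type w} (c : I → C) (i : I) :
    {L L' : List I} → (tens c L ⟶ c i ⊗ tens c L') → Prop
  | here (L : List I) : Pull c i (L := i :: L) (L' := L) (𝟙 _)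
  | there (k : I) {L L' : List I} {p : tens c L ⟶ c i ⊗ tens c L'} (hp : Pull c i p) :
      Pull c i (L := k :: L) (L' := k :: L') (c k ◁ p ≫ Dendroidal.swap (c k) (c i) (tens c L'))

theorem Pull.mem {I : Type w} {c : I → C} {i : I} {L L' : List I}
    {p : tens c L ⟶ c i ⊗ tens c L'} (h : Pull c i p) : i ∈ L := by
  induction h with
  | here => simp
  | there k _ ih => simp [ih]

theorem Pull.unique {I : Type w} {c : I → C} {i : I} {L L' L'' : List I} (hL : L.Nodup)
    {p : tens c L ⟶ c i ⊗ tens c L'} {q : tens c L ⟶ c i ⊗ tens c L''}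
    (hp : Pull c i p) (hq : Pull c i q) :
    (⟨L', p⟩ : Σ M, tens c L ⟶ c i ⊗ tens c M) = ⟨L'', q⟩ := by
  induction hp generalizing L'' with
  | here L =>
    cases hq with
    | here => rfl
    | there k hq => exact absurd hq.mem (List.nodup_cons.1 hL).1
  | there k hp ih =>
    cases hq with
    | here => exact absurd hp.mem (List.nodup_cons.1 hL).1
    | there k hq =>
      have := ih (List.nodup_cons.1 hL).2 hq
      cases this
      rfl

theorem Can.pull {I : Type w} {c : I → C} {i : I} {L L' M' : List I} {f : tens c L ⟶ tens c L'}
    (hf : Can c f) (hL : L.Nodup) {p' : tens c L' ⟶ c i ⊗ tens c M'} (hp' : Pull c i p') :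
    ∃ (M : List I) (p : tens c L ⟶ c i ⊗ tens c M) (g : tens c M ⟶ tens c M'),
      Pull c i p ∧ Can c g ∧ f ≫ p' = p ≫ c i ◁ g := by
  induction hf generalizing M' with
  | id L => exact ⟨_, _, _, hp', Can.id _, by simp⟩
  | cons k hf ih =>
    cases hp' with
    | here => exact ⟨_, _, _, Pull.here _, hf, by simp⟩
    | there k hp' =>
      obtain ⟨M, p, g, hp, hg, h⟩ := ih (List.nodup_cons.1 hL).2 hp'
      refine ⟨_, _, _, hp.there k, hg.cons k, ?_⟩
      rw [← whiskerLeft_comp_assoc, h, Category.assoc, whiskerLeft_comp_assoc, swap_whisker]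
  | swap j k L =>
    cases hp' with
    | here => 
      refine ⟨_, _, _, (Pull.here _).there j, Can.id _, ?_⟩
      simp
    | there k hp' =>
      cases hp' with
      | here =>
        exact ⟨_, _, _, Pull.here _, Can.id _, by simp [swap_swap]⟩
      | there k hp' =>
        refine ⟨_, _, _, (hp'.there _).there _, Can.swap _ _ _, ?_⟩
        simp only [whiskerLeft_comp, Category.assoc]
        rw [← swap_braid, ← reassoc_of% swap_whisker]
  | comp hf hg ih ih' =>
    obtain ⟨M, p, g, hp, hg, h⟩ := ih' (hf.perm.nodup_iff.1 hL) hp'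
    obtain ⟨M2, p2, g2, hp2, hg2, h2⟩ := ih hL hp
    exact ⟨M2, p2, _, hp2, hg2.comp hg, by simp [h, reassoc_of% h2]⟩

theorem Pull.perm {I : Type w} {c : I → C} {i : I} {L L' : List I}
    {p : tens c L ⟶ c i ⊗ tens c L'} (h : Pull c i p) : L.Perm (i :: L') := by
  induction h with
  | here => exact List.Perm.refl _
  | there k _ ih => exact (ih.cons k).trans (List.Perm.swap _ _ _)

theorem Can.eq_id_of_nil {I : Type w} {c : I → C} {L L' : List I} {f : tens c L ⟶ tens c L'}
    (hf : Can c f) (hL : L = []) : ∃ h : L = L', f = eqToHom (congrArg (tens c) h) := by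
  induction hf with
  | id => exact ⟨rfl, rfl⟩
  | cons => cases hL
  | swap => cases hL
  | comp _ _ ih ih' =>
    obtain ⟨rfl, rfl⟩ := ih hL
    obtain ⟨rfl, rfl⟩ := ih' hL
    exact ⟨rfl, by simp⟩

/-- Coherence: there is at most one canonical morphism between two orderings of a family of
distinct labels. -/
theorem Can.unique {I : Type w} {c : I → C} {L L' : List I} (hL : L.Nodup)
    {f g : tens c L ⟶ tens c L'} (hf : Can c f) (hg : Can c g) : f = g := by
  induction L' generalizing L with
  | nil =>
    have := List.perm_nil.1 hf.perm
    rw [(hf.eq_id_of_nil this).2, (hg.eq_id_of_nil this).2]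
  | cons i L' ih =>
    obtain ⟨M, p, f', hp, hf', h⟩ := hf.pull hL (Pull.here L')
    obtain ⟨M2, q, g', hq, hg', h'⟩ := hg.pull hL (Pull.here L')
    cases Pull.unique hL hp hq
    have hM : M.Nodup := (List.nodup_cons.1 (hp.perm.nodup_iff.1 hL)).2
    rw [ih hM hf' hg', ← h'] at h
    simpa using h

/-- The canonical isomorphism between the tensor products of a family in two different orders; it
is the unique canonical morphism if the labels are distinct. -/
noncomputable def reorder {I : Type w} (c : I → C) {L L' : List I} (h : L.Perm L') :
    tens c L ⟶ tens c L' :=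
  (Can.exists_of_perm c h).choose

theorem reorder_can {I : Type w} (c : I → C) {L L' : List I} (h : L.Perm L') :
    Can c (reorder c h) :=
  (Can.exists_of_perm c h).choose_spec

/-- Two morphisms out of tensor products of a family in two different orders correspond to each
other under a canonical morphism. -/
def Rel {I : Type w} {c : I → C} {L L' : List I} {X : C} (p : tens c L ⟶ X) (q : tens c L' ⟶ X) :
    Prop :=
  ∃ s : tens c L ⟶ tens c L', Can c s ∧ p = s ≫ q

namespace Rel

variable {I J : Type w} {c : I → C} {L L' L'' : List I} {X Y : C}

theorem refl (p : tens c L ⟶ X) : Rel p p := ⟨_, Can.id _, by simp⟩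

theorem of_eq {p q : tens c L ⟶ X} (h : p = q) : Rel p q := h ▸ refl p

theorem trans {p : tens c L ⟶ X} {q : tens c L' ⟶ X} {r : tens c L'' ⟶ X} (h : Rel p q)
    (h' : Rel q r) : Rel p r := by
  obtain ⟨s, hs, rfl⟩ := h
  obtain ⟨t, ht, rfl⟩ := h'
  exact ⟨_, hs.comp ht, by simp⟩

theorem symm {p : tens c L ⟶ X} {q : tens c L' ⟶ X} (h : Rel p q) : Rel q p := by
  obtain ⟨s, hs, rfl⟩ := h
  obtain ⟨t, ht, h1, -⟩ := hs.exists_inv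
  exact ⟨t, ht, by rw [reassoc_of% h1]⟩

theorem eq (hL : L.Nodup) {p q : tens c L ⟶ X} (h : Rel p q) : p = q := by
  obtain ⟨s, hs, rfl⟩ := h
  rw [hs.unique hL (Can.id L), Category.id_comp]

theorem reorder (h : L.Perm L') (q : tens c L' ⟶ X) : Rel (reorder c h ≫ q) q :=
  ⟨_, reorder_can c h, rfl⟩

theorem postcomp {p : tens c L ⟶ X} {q : tens c L' ⟶ X} (h : Rel p q) (f : X ⟶ Y) :
    Rel (p ≫ f) (q ≫ f) := by
  obtain ⟨s, hs, rfl⟩ := h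
  exact ⟨s, hs, by simp⟩

theorem cons (i : I) {p : tens c L ⟶ X} {q : tens c L' ⟶ X} (h : Rel p q) :
    Rel (L := i :: L) (L' := i :: L') (c i ◁ p) (c i ◁ q) := by
  obtain ⟨s, hs, rfl⟩ := h
  exact ⟨_, hs.cons i, by rw [whiskerLeft_comp]⟩

/-- Tensor product of related morphisms. -/
theorem tensor {M M' : List I} {p : tens c L ⟶ X} {p' : tens c L' ⟶ X} {q : tens c M ⟶ Y}
    {q' : tens c M' ⟶ Y} (h : Rel p p') (h' : Rel q q') :
    Rel (split c L M ≫ (p ⊗ₘ q)) (split c L' M' ≫ (p' ⊗ₘ q')) := by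
  obtain ⟨s, hs, rfl⟩ := h
  obtain ⟨t, ht, rfl⟩ := h'
  have h1 : ∃ t' : tens c (L ++ M) ⟶ tens c (L ++ M'), Can c t' ∧
      t' ≫ split c L M' = split c L M ≫ tens c L ◁ t := by
    clear hs s
    induction L with
    | nil => exact ⟨t, ht, by simp [split]⟩
    | cons i L ih =>
      obtain ⟨t', ht', h⟩ := ih
      refine ⟨_, ht'.cons i, ?_⟩
      simp only [split]
      rw [← whiskerLeft_comp_assoc, h]
      simp
  have h2 : ∃ s' : tens c (L ++ M') ⟶ tens c (L' ++ M'), Can c s' ∧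
      s' ≫ split c L' M' = split c L M' ≫ s ▷ tens c M' := by
    clear h1 p'
    induction hs with
    | id => exact ⟨_, Can.id _, by simp⟩
    | cons i hs ih =>
      obtain ⟨s', hs', h⟩ := ih
      refine ⟨_, hs'.cons i, ?_⟩
      simp only [split]
      rw [← whiskerLeft_comp_assoc, h]
      simp
    | swap i j L =>
      refine ⟨_, Can.swap i j (L ++ M'), ?_⟩
      simp only [split, whiskerLeft_comp, Category.assoc]
      rw [← reassoc_of% swap_whisker, swap_assoc]
    | comp _ _ ih ih' =>
      obtain ⟨s, hs, h⟩ := ih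
      obtain ⟨s', hs', h'⟩ := ih'
      exact ⟨_, hs.comp hs', by simp [h', reassoc_of% h]⟩
  obtain ⟨t', ht', h1⟩ := h1
  obtain ⟨s', hs', h2⟩ := h2
  refine ⟨_, ht'.comp hs', ?_⟩
  rw [Category.assoc, reassoc_of% h2, reassoc_of% h1, tensorHom_def']
  simp [tensorHom_def', whisker_exchange_assoc]

theorem split_assoc (A B D : List I) {Z : C} (f : tens c A ⊗ tens c B ⊗ tens c D ⟶ Z) :
    Rel (split c A (B ++ D) ≫ tens c A ◁ split c B D ≫ f)
      (split c (A ++ B) D ≫ split c A B ▷ tens c D ≫ (α_ _ _ _).hom ≫ f) := by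
  suffices h : ∃ s : tens c (A ++ (B ++ D)) ⟶ tens c ((A ++ B) ++ D), Can c s ∧
      s ≫ split c (A ++ B) D ≫ split c A B ▷ tens c D ≫ (α_ _ _ _).hom =
        split c A (B ++ D) ≫ tens c A ◁ split c B D by
    obtain ⟨s, hs, h⟩ := h
    exact ⟨s, hs, by simpa using congrArg (· ≫ f) h.symm⟩
  clear f
  induction A with
  | nil =>
    refine ⟨_, Can.id _, ?_⟩
    simp [split]
  | cons i A ih =>
    obtain ⟨s, hs, h⟩ := ih
    refine ⟨_, hs.cons i, ?_⟩
    have := congrArg (fun x => c i ◁ x ≫ (α_ _ _ _).inv) h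
    simp only [whiskerLeft_comp, Category.assoc] at this
    simp only [split, List.cons_append, comp_whiskerRight, Category.assoc]
    refine Eq.trans ?_ (this.trans ?_)
    · rw [← associator_inv_naturality_middle_assoc]
      simp
    · rw [associator_inv_naturality_right]

theorem split_swap (A B D : List I) {Z : C} (f : tens c B ⊗ tens c A ⊗ tens c D ⟶ Z) :
    Rel (split c A (B ++ D) ≫ tens c A ◁ split c B D ≫ swap _ _ _ ≫ f)
      (split c B (A ++ D) ≫ tens c B ◁ split c A D ≫ f) := by
  have h1 : ∀ (i : I) (D : List I), ∃ s : tens c (i :: (B ++ D)) ⟶ tens c (B ++ i :: D), Can c s ∧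
      s ≫ split c B (i :: D) =
        c i ◁ split c B D ≫ swap (c i) (tens c B) (tens c D) := by
    intro i D
    clear f
    induction B with
    | nil => exact ⟨_, Can.id _, by simp [split, swap_unit_right]⟩
    | cons k B ih =>
      obtain ⟨s, hs, h⟩ := ih
      refine ⟨_, (Can.swap i k (B ++ D)).comp (hs.cons k), ?_⟩
      have := congrArg (fun x => swap (c i) (c k) _ ≫ c k ◁ x ≫ (α_ _ _ _).inv) h
      simp only [whiskerLeft_comp, Category.assoc, ← reassoc_of% swap_whisker, swap_hexagon] at this
      simpa [split] using this
  suffices h : ∃ s : tens c (A ++ (B ++ D)) ⟶ tens c (B ++ (A ++ D)), Can c s ∧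
      s ≫ split c B (A ++ D) ≫ tens c B ◁ split c A D =
        split c A (B ++ D) ≫ tens c A ◁ split c B D ≫ swap _ _ _ by
    obtain ⟨s, hs, h⟩ := h
    exact ⟨s, hs, by simpa using congrArg (· ≫ f) h.symm⟩
  clear f
  induction A with
  | nil =>
    refine ⟨_, Can.id _, ?_⟩
    simp [split, swap_unit_left]
  | cons i A ih =>
    obtain ⟨s, hs, h⟩ := ih
    obtain ⟨t, ht, h'⟩ := h1 i (A ++ D)
    refine ⟨_, (hs.cons i).comp ht, ?_⟩
    have h2 := congrArg (fun x => c i ◁ x ≫ swap _ _ _ ≫ tens c B ◁ (α_ _ _ _).inv) h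
    simp only [whiskerLeft_comp, Category.assoc] at h2
    simp only [split, List.cons_append, whiskerLeft_comp, Category.assoc]
    rw [reassoc_of% h']
    refine Eq.trans ?_ (h2.trans ?_)
    · rw [reassoc_of% swap_whisker]
    · rw [swap_hexagon', associator_inv_naturality_right_assoc]

theorem blocks {K K' : J → List I} {b : J → C} {φ : ∀ j, tens c (K j) ⟶ b j}
    {φ' : ∀ j, tens c (K' j) ⟶ b j} (h : ∀ j, Rel (φ j) (φ' j)) (L : List J) :
    Rel (blockMap φ L) (blockMap φ' L) := by
  induction L with
  | nil => exact refl _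
  | cons j L ih => exact tensor (h j) ih

theorem blockMap_comp {K : J → List I} {b : J → C} (φ : ∀ j, tens c (K j) ⟶ b j) {N N' : List J}
    {p : tens b N ⟶ X} {q : tens b N' ⟶ X} (h : Rel p q) :
    Rel (blockMap φ N ≫ p) (blockMap φ N' ≫ q) := by
  obtain ⟨s, hs, rfl⟩ := h
  rw [← Category.assoc]
  refine postcomp ?_ q
  clear q
  induction hs with
  | id => exact of_eq (Category.comp_id _)
  | @cons j N N' f hf ih =>
    have := tensor (refl (φ j)) ih
    refine (of_eq ?_).trans this
    change (split c (K j) (N.flatMap K) ≫ (φ j ⊗ₘ blockMap φ N)) ≫ b j ◁ f = _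
    simp [MonoidalCategory.tensorHom_def]
  | swap i j N =>
    have := split_swap (K i) (K j) (N.flatMap K) (φ j ⊗ₘ φ i ⊗ₘ blockMap φ N)
    refine (of_eq ?_).trans (this.trans (of_eq ?_))
    · rw [← swap_natural]
      change (split c (K i) (K j ++ N.flatMap K) ≫
        (φ i ⊗ₘ (split c (K j) (N.flatMap K) ≫ (φ j ⊗ₘ blockMap φ N)))) ≫ swap _ _ _ = _
      simp [MonoidalCategory.tensorHom_def']
    · change _ = split c (K j) (K i ++ N.flatMap K) ≫
        (φ j ⊗ₘ (split c (K i) (N.flatMap K) ≫ (φ i ⊗ₘ blockMap φ N)))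
      simp [MonoidalCategory.tensorHom_def']
  | @comp N N' N'' f g hf hg ih ih' =>
    rw [← Category.assoc]
    refine (postcomp ih g).trans ih'

theorem blockMap_append {K : J → List I} {b : J → C} (φ : ∀ j, tens c (K j) ⟶ b j)
    (A N : List J) :
    Rel (split c (A.flatMap K) (N.flatMap K) ≫
        (blockMap φ A ⊗ₘ blockMap φ N))
      (blockMap φ (A ++ N) ≫ split b A N) := by
  induction A with
  | nil => 
    refine of_eq ?_
    change (λ_ _).inv ≫ (𝟙 _ ⊗ₘ blockMap φ N) = blockMap φ N ≫ (λ_ _).inv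
    simp
  | cons j A ih =>
    have h1 := split_assoc (c := c) (K j) (A.flatMap K) (N.flatMap K)
      ((φ j ⊗ₘ blockMap φ A ⊗ₘ blockMap φ N) ≫ (α_ _ _ _).inv)
    have h2 := (tensor (refl (φ j)) ih).postcomp (α_ _ _ _).inv
    refine (of_eq ?_).trans (h1.symm.trans ((of_eq ?_).trans (h2.trans (of_eq ?_))))
    · change split c (K j ++ A.flatMap K) (N.flatMap K) ≫
        ((split c (K j) (A.flatMap K) ≫ (φ j ⊗ₘ blockMap φ A)) ⊗ₘ blockMap φ N) = _
      rw [← associator_naturality_assoc]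
      simp only [MonoidalCategory.tensorHom_def', comp_whiskerRight, Category.assoc]
      rw [whisker_exchange_assoc]
      simp
    · simp [MonoidalCategory.tensorHom_def']
    · change _ = (split c (K j) ((A ++ N).flatMap K) ≫ (φ j ⊗ₘ blockMap φ (A ++ N))) ≫
        b j ◁ split b A N ≫ (α_ _ _ _).inv
      simp [MonoidalCategory.tensorHom_def]

theorem blockMap_blockMap {P : Type w} {a : J → C} {b : P → C} {K : J → List I} {B : P → List J}
    (ψ : ∀ j, tens c (K j) ⟶ a j) (φ : ∀ p, tens a (B p) ⟶ b p) (N : List P) :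
    Rel (blockMap (fun p => blockMap ψ (B p) ≫ φ p) N)
      (blockMap ψ (N.flatMap B) ≫ blockMap φ N) := by
  induction N with
  | nil => exact of_eq (Category.comp_id (𝟙 (𝟙_ C))).symm
  | cons p N ih =>
    have h1 := tensor (refl (blockMap ψ (B p) ≫ φ p)) ih
    have h2 := (blockMap_append ψ (B p) (N.flatMap B)).postcomp (φ p ⊗ₘ blockMap φ N)
    refine h1.trans ((of_eq ?_).trans (h2.trans (of_eq ?_)))
    · simp
    · exact Category.assoc _ _ _

theorem relabels {a : J → C} (h : J → I) (hr : ∀ j, c (h j) = a j) {N N' : List J}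
    {p : tens a N ⟶ X} {q : tens a N' ⟶ X} (hpq : Rel p q) :
    Rel (relabel h hr N ≫ p) (relabel h hr N' ≫ q) := by
  obtain rfl : a = fun j => c (h j) := (funext hr).symm
  obtain ⟨s, hs, rfl⟩ := hpq
  rw [← Category.assoc]
  refine postcomp ?_ q
  clear q
  induction hs with
  | id => exact of_eq (Category.comp_id _)
  | @cons j N N' f hf ih =>
    refine (of_eq ?_).trans ((cons (h j) ih).trans (of_eq ?_)) <;> simp [relabel]
  | swap i j N =>
    refine ⟨_, Can.swap _ _ _, ?_⟩
    simp [relabel, swap_whisker]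
  | @comp N N' N'' f g hf hg ih ih' =>
    rw [← Category.assoc]
    refine (postcomp ih g).trans ih'

theorem relabel_split {a : J → C} (h : J → I) (hr : ∀ j, c (h j) = a j) (A N : List J) :
    Rel (relabel h hr (A ++ N) ≫ split a A N)
      (split c (A.map h) (N.map h) ≫
        (relabel h hr A ⊗ₘ relabel h hr N)) := by
  obtain rfl : a = fun j => c (h j) := (funext hr).symm
  induction A with
  | nil =>
    refine of_eq ?_
    change relabel h hr N ≫ (λ_ _).inv = (λ_ _).inv ≫ (𝟙 _ ⊗ₘ relabel h hr N)
    simp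
  | cons j A ih =>
    have := (cons (h j) ih).postcomp (α_ _ _ _).inv
    refine (of_eq ?_).trans (this.trans (of_eq ?_))
    · simp [relabel, split]
    · change _ = (c (h j) ◁ split c (A.map h) (N.map h) ≫ (α_ _ _ _).inv) ≫
        ((𝟙 _ ⊗ₘ relabel h hr A) ⊗ₘ relabel h hr N)
      rw [Category.assoc, ← associator_inv_naturality]
      simp

/-- Changing the labels of the blocks. -/
theorem relabel_blockMap {P : Type w} {a : J → C} {b : P → C} {K : P → List J} (h : J → I)
    (hr : ∀ j, c (h j) = a j) (φ : ∀ p, tens a (K p) ⟶ b p) (N : List P) :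
    Rel (relabel h hr (N.flatMap K) ≫ blockMap φ N)
      (blockMap (K := fun p => (K p).map h)
        (fun p => relabel h hr (K p) ≫ φ p) N) := by
  induction N with
  | nil => exact of_eq (Category.comp_id (𝟙 (𝟙_ C)))
  | cons p N ih =>
    have h1 := (relabel_split h hr (K p) (N.flatMap K)).postcomp
      (φ p ⊗ₘ blockMap φ N)
    have h2 := tensor (refl (relabel h hr (K p) ≫ φ p)) ih
    refine (of_eq ?_).trans (h1.trans ((of_eq ?_).trans h2))
    · exact (Category.assoc _ _ _).symm
    · simp

/-- Changing the labels of the index list of the blocks. -/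
theorem blockMap_relabel {P : Type w} {a : J → C} {b : P → C} {K : J → List I} (h : P → J)
    (hr : ∀ p, a (h p) = b p) (ψ : ∀ j, tens c (K j) ⟶ a j) (N : List P) :
    Rel (blockMap ψ (N.map h) ≫ relabel h hr N)
      (blockMap (K := fun p => K (h p)) (fun p => ψ (h p) ≫ eqToHom (hr p)) N) := by
  induction N with
  | nil => exact of_eq (Category.comp_id (𝟙 (𝟙_ C)))
  | cons p N ih =>
    have h2 := tensor (refl (ψ (h p) ≫ eqToHom (hr p))) ih
    refine (of_eq ?_).trans h2
    change (split c (K (h p)) ((N.map h).flatMap K) ≫ (ψ (h p) ⊗ₘ blockMap ψ (N.map h))) ≫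
      (eqToHom (hr p) ⊗ₘ relabel h hr N) = _
    simp

theorem relabel_relabel {P : Type w} {a : J → C} {b : P → C} (h : J → I) (h' : P → J) (h'' : P → I)
    (hh : ∀ p, h (h' p) = h'' p) (hr : ∀ j, c (h j) = a j) (hr' : ∀ p, a (h' p) = b p)
    (hr'' : ∀ p, c (h'' p) = b p) (N : List P) :
    Rel (relabel h hr (N.map h') ≫ relabel h' hr' N)
      (relabel h'' hr'' N) := by
  obtain rfl : h'' = fun p => h (h' p) := (funext hh).symm
  induction N with
  | nil => exact of_eq (Category.comp_id (𝟙 (𝟙_ C)))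
  | cons p N ih =>
    refine (of_eq ?_).trans (((cons _ ih).postcomp (eqToHom (hr'' p) ▷ _)).trans (of_eq ?_))
    · change (eqToHom (hr (h' p)) ⊗ₘ relabel h hr (N.map h')) ≫
        (eqToHom (hr' p) ⊗ₘ relabel h' hr' N) = _
      rw [tensorHom_comp_tensorHom, eqToHom_trans, MonoidalCategory.tensorHom_def']
    · simp [relabel, MonoidalCategory.tensorHom_def']

theorem relabel_id {a : I → C} (h : I → I) (hh : ∀ i, h i = i) (hr : ∀ i, c (h i) = a i)
    (hr' : c = a) (N : List I) (p : tens a N ⟶ X) :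
    Rel (relabel h hr N ≫ p) (eqToHom (by rw [hr']) ≫ p) := by
  obtain rfl : h = fun i => i := funext hh
  subst hr'
  refine postcomp ?_ p
  clear p
  induction N with
  | nil => exact of_eq (by simp [relabel])
  | cons i N ih =>
    refine (of_eq ?_).trans ((cons _ ih).trans (of_eq ?_)) <;> simp [relabel]

end Rel

end Tensor

/-! ## The operad of a symmetric monoidal category -/

section SymMon

variable (C : Type u) [Category.{u} C] [MonoidalCategory C] [SymmetricCategory C]

theorem perm_blocks {n m : ℕ} {k : Fin n → ℕ} (e : (Σ j, Fin (k j)) ≃ Fin m) :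
    (List.finRange m).Perm
      ((List.finRange n).flatMap fun j => (List.finRange (k j)).map fun i => e ⟨j, i⟩) := by
  refine (List.perm_ext_iff_of_nodup (List.nodup_finRange m) ?_).2 fun p => ?_
  · rw [List.nodup_flatMap]
    refine ⟨fun j _ => (List.nodup_finRange _).map fun i i' h => ?_, ?_⟩
    · simpa using e.injective h
    · refine (List.nodup_finRange n).pairwise_of_forall_ne fun j _ j' _ hj => ?_
      intro p hp hp'
      simp only [List.mem_map, List.mem_finRange, true_and] at hp hp'
      obtain ⟨i, rfl⟩ := hp
      obtain ⟨i', h⟩ := hp'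
      exact hj (congrArg Sigma.fst (e.injective h)).symm
  · obtain ⟨⟨j, i⟩, rfl⟩ := e.surjective p
    simp

variable {C}

/-- The composition in the operad of a symmetric monoidal category: the composite
`⊗ₚ rₚ ≅ ⊗ⱼ ⊗ᵢ aⱼᵢ ⟶ ⊗ⱼ bⱼ ⟶ d`. -/
noncomputable def opComp {n m : ℕ} {k : Fin n → ℕ} (e : (Σ j, Fin (k j)) ≃ Fin m)
    {b : Fin n → C} {a : (j : Fin n) → Fin (k j) → C} {r : Fin m → C} {d : C}
    (hr : ∀ j i, r (e ⟨j, i⟩) = a j i) (g : tens b (List.finRange n) ⟶ d)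
    (f : (j : Fin n) → (tens (a j) (List.finRange (k j)) ⟶ b j)) :
    tens r (List.finRange m) ⟶ d :=
  reorder r (perm_blocks e) ≫
    blockMap (fun j => relabel (fun i => e ⟨j, i⟩) (hr j) (List.finRange (k j)) ≫ f j)
      (List.finRange n) ≫ g

theorem opComp_rel {n m : ℕ} {k : Fin n → ℕ} (e : (Σ j, Fin (k j)) ≃ Fin m)
    {b : Fin n → C} {a : (j : Fin n) → Fin (k j) → C} {r : Fin m → C} {d : C}
    (hr : ∀ j i, r (e ⟨j, i⟩) = a j i) (g : tens b (List.finRange n) ⟶ d)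
    (f : (j : Fin n) → (tens (a j) (List.finRange (k j)) ⟶ b j)) :
    Rel (opComp e hr g f)
      (blockMap (fun j => relabel (fun i => e ⟨j, i⟩) (hr j) (List.finRange (k j)) ≫ f j)
        (List.finRange n) ≫ g) :=
  Rel.reorder _ _

theorem opComp_assoc {n m M : ℕ} {k : Fin n → ℕ} {l : Fin m → ℕ} {s : Fin n → ℕ}
    (e : (Σ j, Fin (k j)) ≃ Fin m) (e' : (Σ p, Fin (l p)) ≃ Fin M)
    (ε : ∀ j, (Σ i, Fin (l (e ⟨j, i⟩))) ≃ Fin (s j)) (e'' : (Σ j, Fin (s j)) ≃ Fin M)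
    (he : ∀ j i q, e'' ⟨j, ε j ⟨i, q⟩⟩ = e' ⟨e ⟨j, i⟩, q⟩)
    {b : Fin n → C} {a : Fin m → C} {x : (p : Fin m) → Fin (l p) → C} {r : Fin M → C} {d : C}
    (hr : ∀ p q, r (e' ⟨p, q⟩) = x p q) (g : tens b (List.finRange n) ⟶ d)
    (f : ∀ j, tens (fun i => a (e ⟨j, i⟩)) (List.finRange (k j)) ⟶ b j)
    (h : ∀ p, tens (x p) (List.finRange (l p)) ⟶ a p) :
    opComp e' hr (opComp e (fun _ _ => rfl) g f) h =
      opComp e'' (a := fun j t => r (e'' ⟨j, t⟩)) (fun _ _ => rfl) g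
        (fun j => opComp (ε j) (fun i q => (congrArg r (he j i q)).trans (hr (e ⟨j, i⟩) q))
          (f j) (fun i => h (e ⟨j, i⟩))) := by
  refine Rel.eq (List.nodup_finRange M) ?_
  have hL := (opComp_rel e' hr (opComp e (fun _ _ => rfl) g f) h).trans
    (Rel.blockMap_comp _ (opComp_rel e (fun _ _ => rfl) g f))
  rw [← Category.assoc] at hL
  have hL2 := hL.trans ((Rel.blockMap_blockMap _ _ _).symm.postcomp g)
  refine hL2.trans (Rel.symm ((opComp_rel e'' _ g _).trans (Rel.postcomp (Rel.blocks ?_ _) g)))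
  intro j
  refine (Rel.relabels _ _ (opComp_rel _ _ _ _)).trans ?_
  rw [← Category.assoc, ← Category.assoc]
  refine Rel.postcomp ?_ (f j)
  refine (Rel.relabel_blockMap _ _ _ _).trans ((Rel.blockMap_relabel _ _ _ _).trans
    (Rel.blocks (fun i => ?_) _)).symm
  simp only [eqToHom_refl, Category.comp_id]
  rw [← Category.assoc]
  exact ((Rel.relabel_relabel (c := r) (fun t => e'' ⟨j, t⟩) (fun q => ε j ⟨i, q⟩)
    (fun q => e' ⟨e ⟨j, i⟩, q⟩) (he j i) _ _ _ _).postcomp _).symm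

theorem opComp_id_left {n : ℕ} {a : Fin n → C} {d : C} (f : tens a (List.finRange n) ⟶ d)
    (e : (Σ _ : Fin 1, Fin n) ≃ Fin n) (he : ∀ j i, e ⟨j, i⟩ = i) :
    opComp e (b := fun _ : Fin 1 => d) (a := fun _ => a) (fun j i => congrArg a (he j i))
      (ρ_ d).hom (fun _ => f) = f := by
  refine Rel.eq (List.nodup_finRange n) ((opComp_rel _ _ _ _).trans ?_)
  have h1 : ∀ (c : Fin n → C) (L : List (Fin n)) {X : C} (p : tens c L ⟶ X),
      Rel (split c L [] ≫ (p ⊗ₘ 𝟙 (𝟙_ C)) ≫ (ρ_ X).hom) p := by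
    intro c L X p
    rw [tensorHom_id, rightUnitor_naturality, ← Category.assoc]
    suffices h : Rel (split c L [] ≫ (ρ_ (tens c L)).hom) (𝟙 _) by
      simpa using h.postcomp p
    clear p
    induction L with
    | nil =>
      refine Rel.of_eq ?_
      change (λ_ (𝟙_ C)).inv ≫ (ρ_ (𝟙_ C)).hom = 𝟙 _
      rw [← unitors_equal, Iso.inv_hom_id]
    | cons i L ih =>
      refine (Rel.of_eq ?_).trans ((Rel.cons i ih).trans (Rel.of_eq ?_)) <;> simp [split]
  refine ((Rel.of_eq (Category.assoc _ _ _)).trans (h1 _ _ _)).trans ?_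
  exact (Rel.relabel_id _ (he 0) _ rfl _ f).trans (Rel.of_eq (Category.id_comp _))

theorem opComp_id_right {n : ℕ} {a : Fin n → C} {d : C} (f : tens a (List.finRange n) ⟶ d)
    (e : (Σ _ : Fin n, Fin 1) ≃ Fin n) (he : ∀ j i, e ⟨j, i⟩ = j) :
    opComp e (a := fun j _ => a j) (fun j i => congrArg a (he j i)) f (fun j => (ρ_ (a j)).hom) =
      f := by
  refine Rel.eq (List.nodup_finRange n) ((opComp_rel _ _ _ _).trans ?_)
  refine (Rel.postcomp ?_ f).trans (Rel.of_eq (Category.id_comp _))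
  generalize List.finRange n = L
  induction L with
  | nil => exact Rel.refl _
  | cons j L ih =>
    have h : ∀ i, e ⟨j, i⟩ = j := he j
    have h1 : Rel (L := [e ⟨j, 0⟩]) (L' := [j])
        (relabel (fun i => e ⟨j, i⟩) (fun i => congrArg a (h i)) (List.finRange 1) ≫ (ρ_ (a j)).hom)
        (ρ_ (a j)).hom := by
      have key : ∀ (t : Fin 1 → Fin n) (ht : ∀ i, t i = j), Rel (L := [t 0]) (L' := [j])
          (relabel t (fun i => congrArg a (ht i)) (List.finRange 1) ≫ (ρ_ (a j)).hom)
          (ρ_ (a j)).hom := by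
        intro t ht
        obtain rfl : t = fun _ => j := funext ht
        refine Rel.of_eq ?_
        change (𝟙 _ ⊗ₘ 𝟙 _) ≫ _ = _
        simp
      exact key _ h
    have h2 := Rel.tensor h1 ih
    refine h2.trans (Rel.of_eq ?_)
    change (a j ◁ (λ_ _).inv ≫ (α_ _ _ _).inv) ≫ ((ρ_ _).hom ⊗ₘ 𝟙 _) = 𝟙 _
    simp

/-- The coloured operad `O_C` of a symmetric monoidal category `C`: the colours are the objects of
`C`, and `O_C(c₁, …, cₙ; d)` is the set of morphisms `c₁ ⊗ ⋯ ⊗ cₙ ⟶ d`.  Here the bracketing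
`c₁ ⊗ (c₂ ⊗ (⋯ ⊗ (cₙ ⊗ 𝟙)))` is chosen; any other choice gives an isomorphic operad. -/
noncomputable def symOperad (C : Type u) [Category.{u} C] [MonoidalCategory C]
    [SymmetricCategory C] : Operad.{u} where
  Col := C
  Op {n} c d := tens c (List.finRange n) ⟶ d
  id c := (ρ_ c).hom
  comp e _ _ _ _ hr g f := opComp e hr g f
  id_comp := opComp_id_left
  comp_id := opComp_id_right
  assoc := opComp_assoc

end SymMon

/-! ## Lax symmetric monoidal functors -/

section Lax

variable {C D : Type u} [Category.{u} C] [MonoidalCategory C] [SymmetricCategory C]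
  [Category.{u} D] [MonoidalCategory D] [SymmetricCategory D] (F : C ⥤ D) [F.LaxBraided]

open Functor.LaxMonoidal

/-- The structure morphism `F c₁ ⊗ ⋯ ⊗ F cₙ ⟶ F (c₁ ⊗ ⋯ ⊗ cₙ)` of a lax monoidal functor. -/
def lax {I : Type w} (c : I → C) :
    (L : List I) → (tens (fun i => F.obj (c i)) L ⟶ F.obj (tens c L))
  | [] => ε F
  | i :: L => F.obj (c i) ◁ lax c L ≫ μ F (c i) (tens c L)

theorem lax_swap (X Y Z : C) :
    F.obj X ◁ μ F Y Z ≫ μ F X (Y ⊗ Z) ≫ F.map (swap X Y Z) =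
      swap _ _ _ ≫ F.obj Y ◁ μ F X Z ≫ μ F Y (X ⊗ Z) := by
  simp only [swap, Functor.map_comp, Category.assoc]
  rw [associativity_inv_assoc, ← μ_natural_left_assoc, ← comp_whiskerRight_assoc,
    Functor.LaxBraided.braided, comp_whiskerRight_assoc, associativity]

theorem lax_rel {I : Type w} {c : I → C} {L L' : List I} {X : C} {p : tens c L ⟶ X}
    {q : tens c L' ⟶ X} (h : Rel p q) :
    Rel (lax F c L ≫ F.map p) (lax F c L' ≫ F.map q) := by
  obtain ⟨s, hs, rfl⟩ := h
  rw [F.map_comp, ← Category.assoc]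
  refine Rel.postcomp ?_ _
  clear q
  induction hs with
  | id => exact Rel.of_eq (by simp)
  | @cons i L L' f hf ih =>
    refine (Rel.of_eq ?_).trans (((Rel.cons i ih).postcomp (μ F _ _)).trans (Rel.of_eq ?_)) <;>
      simp [lax]
  | swap i j L =>
    refine ⟨_, Can.swap _ _ _, ?_⟩
    simp only [lax, whiskerLeft_comp, Category.assoc]
    rw [lax_swap, reassoc_of% swap_whisker]
  | @comp L L' L'' f g hf hg ih ih' =>
    have := ih.postcomp (F.map g)
    exact ((Rel.of_eq (by simp)).trans this).trans ih'

theorem lax_split {I : Type w} (c : I → C) (A L : List I) :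
    lax F c (A ++ L) ≫ F.map (split c A L) =
      split _ A L ≫ (lax F c A ⊗ₘ lax F c L) ≫ μ F _ _ := by
  induction A with
  | nil =>
    change lax F c L ≫ F.map (λ_ _).inv = (λ_ _).inv ≫ (ε F ⊗ₘ lax F c L) ≫ μ F _ _
    rw [ε_tensorHom_comp_μ]
    simp
  | cons i A ih =>
    have h := congrArg (fun x => F.obj (c i) ◁ x ≫ μ F _ _ ≫ F.map (α_ _ _ _).inv) ih
    simp only [whiskerLeft_comp, Category.assoc, associativity_inv] at h
    simp only [lax, split, List.cons_append, Functor.map_comp, Category.assoc]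
    rw [← μ_natural_right_assoc]
    refine h.trans ?_
    simp [MonoidalCategory.tensorHom_def']

theorem lax_blockMap {I J : Type w} {r : I → C} {b : J → C} {K : J → List I}
    (φ : (j : J) → (tens r (K j) ⟶ b j)) (L : List J) :
    lax F r (L.flatMap K) ≫ F.map (blockMap φ L) =
      blockMap (fun j => lax F r (K j) ≫ F.map (φ j)) L ≫ lax F b L := by
  induction L with
  | nil =>
    change ε F ≫ F.map (𝟙 _) = 𝟙 _ ≫ ε F
    simp
  | cons j L ih =>
    change lax F r (K j ++ L.flatMap K) ≫
      F.map (split r (K j) (L.flatMap K) ≫ (φ j ⊗ₘ blockMap φ L)) =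
      (split _ (K j) (L.flatMap K) ≫ ((lax F r (K j) ≫ F.map (φ j)) ⊗ₘ
        blockMap (fun j => lax F r (K j) ≫ F.map (φ j)) L)) ≫ F.obj (b j) ◁ lax F b L ≫ μ F _ _
    rw [F.map_comp, ← Category.assoc, lax_split, Category.assoc, Category.assoc, ← μ_natural,
      tensorHom_comp_tensorHom_assoc, ih]
    simp [MonoidalCategory.tensorHom_def]

theorem lax_relabel {I J : Type w} {r : I → C} {a : J → C} (h : J → I) (hr : ∀ j, r (h j) = a j)
    (L : List J) :
    lax F r (L.map h) ≫ F.map (relabel h hr L) =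
      relabel h (fun j => congrArg F.obj (hr j)) L ≫ lax F a L := by
  obtain rfl : a = fun j => r (h j) := (funext hr).symm
  induction L with
  | nil =>
    change ε F ≫ F.map (𝟙 _) = 𝟙 _ ≫ ε F
    simp
  | cons j L ih =>
    have h' := congrArg (fun x => F.obj (r (h j)) ◁ x ≫ μ F _ _) ih
    simp only [whiskerLeft_comp, Category.assoc, μ_natural_right] at h'
    change (F.obj (r (h j)) ◁ lax F r (L.map h) ≫ μ F _ _) ≫ F.map (𝟙 _ ⊗ₘ relabel h hr L) =
      (𝟙 _ ⊗ₘ relabel h _ L) ≫ F.obj (r (h j)) ◁ lax F _ L ≫ μ F _ _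
    simpa using h'

/-- The action of a lax symmetric monoidal functor on operations: it sends
`f : c₁ ⊗ ⋯ ⊗ cₙ ⟶ d` to `F c₁ ⊗ ⋯ ⊗ F cₙ ⟶ F (c₁ ⊗ ⋯ ⊗ cₙ) ⟶ F d`. -/
def laxOp {n : ℕ} {c : Fin n → C} {d : C} (f : tens c (List.finRange n) ⟶ d) :
    tens (fun i => F.obj (c i)) (List.finRange n) ⟶ F.obj d :=
  lax F c (List.finRange n) ≫ F.map f

theorem laxOp_id (c : C) :
    laxOp F (c := fun _ : Fin 1 => c) (ρ_ c).hom = (ρ_ (F.obj c)).hom := by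
  change (F.obj c ◁ ε F ≫ μ F c (𝟙_ C)) ≫ F.map (ρ_ c).hom = (ρ_ (F.obj c)).hom
  rw [right_unitality, Category.assoc]

theorem laxOp_opComp {n m : ℕ} {k : Fin n → ℕ} (e : (Σ j, Fin (k j)) ≃ Fin m)
    {b : Fin n → C} {a : (j : Fin n) → Fin (k j) → C} {r : Fin m → C} {d : C}
    (hr : ∀ j i, r (e ⟨j, i⟩) = a j i) (g : tens b (List.finRange n) ⟶ d)
    (f : (j : Fin n) → (tens (a j) (List.finRange (k j)) ⟶ b j)) :
    laxOp F (opComp e hr g f) =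
      opComp e (fun j i => congrArg F.obj (hr j i)) (laxOp F g) (fun j => laxOp F (f j)) := by
  refine Rel.eq (List.nodup_finRange m) ((lax_rel F (opComp_rel e hr g f)).trans ?_)
  refine Rel.trans ?_ (opComp_rel _ _ _ _).symm
  simp only [laxOp]
  rw [F.map_comp, ← Category.assoc, lax_blockMap, Category.assoc]
  refine Rel.postcomp (Rel.blocks (fun j => Rel.of_eq ?_) _) _
  rw [F.map_comp, ← Category.assoc, lax_relabel, Category.assoc]

/-- The map of operads `O_C → O_D` given by a lax symmetric monoidal functor `F : C ⥤ D`. -/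
noncomputable def symOperadMap : Operad.Hom (symOperad C) (symOperad D) where
  col := F.obj
  map f := laxOp F f
  map_id c := laxOp_id F c
  map_comp e _ _ _ _ hr g f := laxOp_opComp F e hr g f

theorem lax_id {I : Type w} (c : I → C) (L : List I) : lax (𝟭 C) c L = 𝟙 (tens c L) := by
  induction L with
  | nil => rfl
  | cons i L ih =>
    change c i ◁ lax (𝟭 C) c L ≫ 𝟙 _ = _
    rw [ih]
    simp

theorem lax_comp {E : Type u} [Category.{u} E] [MonoidalCategory E] [SymmetricCategory E]
    (G : D ⥤ E) [G.LaxBraided] {I : Type w} (c : I → C) (L : List I) :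
    lax (F ⋙ G) c L = lax G (fun i => F.obj (c i)) L ≫ G.map (lax F c L) := by
  induction L with
  | nil => rfl
  | cons i L ih =>
    change G.obj (F.obj (c i)) ◁ lax (F ⋙ G) c L ≫ μ G _ _ ≫ G.map (μ F _ _) =
      (G.obj (F.obj (c i)) ◁ lax G _ L ≫ μ G _ _) ≫ G.map (F.obj (c i) ◁ lax F c L ≫ μ F _ _)
    rw [ih]
    simp

theorem laxOp_functor_id {n : ℕ} {c : Fin n → C} {d : C} (f : tens c (List.finRange n) ⟶ d) :
    laxOp (𝟭 C) f = f := by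
  rw [laxOp, lax_id]
  exact Category.id_comp f

theorem laxOp_functor_comp {E : Type u} [Category.{u} E] [MonoidalCategory E] [SymmetricCategory E]
    (G : D ⥤ E) [G.LaxBraided] {n : ℕ} {c : Fin n → C} {d : C}
    (f : tens c (List.finRange n) ⟶ d) : laxOp (F ⋙ G) f = laxOp G (laxOp F f) := by
  simp only [laxOp, lax_comp, G.map_comp, Category.assoc]
  rfl

end Lax

/-! ## The category of symmetric monoidal categories -/

/-- Small symmetric monoidal categories. -/
structure SymMonCat where
  carrier : Type u
  [category : Category.{u} carrier]
  [monoidal : MonoidalCategory carrier]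
  [symmetric : SymmetricCategory carrier]

attribute [instance] SymMonCat.category SymMonCat.monoidal SymMonCat.symmetric

namespace SymMonCat

/-- Lax symmetric monoidal functors are equal if they are equal as functors, with the same structure
morphisms. -/
theorem hom_ext {C D : SymMonCat.{u}} {F G : LaxBraidedFunctor C.carrier D.carrier}
    (h : F.toFunctor = G.toFunctor)
    (hF : HEq F.laxBraided.toLaxMonoidal G.laxBraided.toLaxMonoidal) : F = G := by
  obtain ⟨F, hF'⟩ := F
  obtain ⟨G, hG'⟩ := G
  obtain rfl : F = G := h
  obtain ⟨_⟩ := hF'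
  obtain ⟨_⟩ := hG'
  cases hF
  rfl

/-- The category of small symmetric monoidal categories and lax symmetric monoidal functors. -/
instance : Category SymMonCat.{u} where
  Hom C D := LaxBraidedFunctor C.carrier D.carrier
  id C := LaxBraidedFunctor.of (𝟭 C.carrier)
  comp F G := LaxBraidedFunctor.of (F.toFunctor ⋙ G.toFunctor)
  id_comp F := hom_ext rfl (heq_of_eq (Functor.LaxMonoidal.ext
    (by change F.laxBraided.ε ≫ F.map (𝟙 _) = F.laxBraided.ε; simp)
    (by ext X Y; change F.laxBraided.μ X Y ≫ F.map (𝟙 _) = F.laxBraided.μ X Y; simp)))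
  comp_id F := hom_ext rfl (heq_of_eq (Functor.LaxMonoidal.ext
    (by change 𝟙 _ ≫ F.laxBraided.ε = F.laxBraided.ε; simp)
    (by ext X Y; change 𝟙 _ ≫ F.laxBraided.μ X Y = F.laxBraided.μ X Y; simp)))
  assoc F G H := hom_ext rfl (heq_of_eq (Functor.LaxMonoidal.ext
    (by
      change H.laxBraided.ε ≫ H.map (G.laxBraided.ε ≫ G.map F.laxBraided.ε) =
        (H.laxBraided.ε ≫ H.map G.laxBraided.ε) ≫ H.map (G.map F.laxBraided.ε)
      simp)
    (by
      ext X Y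
      change H.laxBraided.μ _ _ ≫ H.map (G.laxBraided.μ _ _ ≫ G.map (F.laxBraided.μ X Y)) =
        (H.laxBraided.μ _ _ ≫ H.map (G.laxBraided.μ _ _)) ≫ H.map (G.map (F.laxBraided.μ X Y))
      simp)))

/-- The functor from symmetric monoidal categories to coloured operads, `C ↦ O_C`. -/
noncomputable def toOperad : SymMonCat.{u} ⥤ Operad.{u} where
  obj C := symOperad C.carrier
  map F := symOperadMap F.toFunctor
  map_id C := Operad.Hom.ext rfl (heq_of_eq (by
    funext n c d f
    exact laxOp_functor_id (C := C.carrier) f))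
  map_comp F G := Operad.Hom.ext rfl (heq_of_eq (by
    funext n c d f
    exact laxOp_functor_comp F.toFunctor G.toFunctor f))

/-- The nerve `N_d(C)` of a symmetric monoidal category, the dendroidal nerve of its operad. -/
noncomputable def nerve : SymMonCat.{u} ⥤ DSet.{u} := toOperad ⋙ operadNerve

/-- A Picard groupoid is a symmetric monoidal category whose underlying category is a groupoid and
in which every object has a tensor inverse. -/
def IsPicard : ObjectProperty SymMonCat.{u} := fun C =>
  IsGroupoid C.carrier ∧ ∀ X : C.carrier, ∃ Y : C.carrier, Nonempty (X ⊗ Y ≅ 𝟙_ C.carrier)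

end SymMonCat

end Dendroidal

/-! A subtree of `T` is recorded by its root edge `d` and its set `W` of vertices. It is determined
by its root and its leaves (`lv_unique`), and the operations of the operad of `T` are exactly the
subtrees together with an order of their leaves (`IsOp.isOpSet`, `isOp_of_set`). Everything about
maps of trees and faces is derived from this description.

Two properties of a dendroidal set `D` carry the theorem. The Segal condition says that an element
on `T` is the same as a family of elements on the corollas of its vertices that match along edges.
Division says that in a composite of two operations, the composite and one factor determine the
other factor, and that this factor exists whenever inputs and outputs fit.

From Picard groupoids to Kan conditions: the operad of a tree is free on its vertices
(`Norm.unique`, `freeHom`), so the nerve of every operad is Segal. In a Picard groupoid all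
morphisms are invertible and tensoring with an object is bijective on morphisms, which gives
division (`hasDivision_symOperad`). Consider a horn at a face `a` of a tree with at least two
vertices. If every vertex lies in a face other than `a`, the Segal condition produces the filler.
The only exception is a tree with two vertices and `a` an outer face, and this horn is a division
problem. A horn of a corolla asks for one missing object, which is a tensor product or is found with
a tensor inverse.

Full faithfulness: the nerve factors through operads. A map of nerves is determined by its values on
`eta` and on corollas, and trees with two levels show that it respects composition. A map between
the operads of symmetric monoidal categories is a lax symmetric monoidal functor, because every
operation is built from morphisms and the universal operations of arity 0 and 2; presenting one
operation as a composite in two ways yields each axiom.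

Essential surjectivity: let `D` be strictly fully Kan. It satisfies the Segal condition, by
induction on the number of vertices with horns at inner faces (`IsStrictlyFullyKan.segal`). Objects
are the elements on `eta`, morphisms are the unary operations, and by division two operations with
the same inputs differ by a unique morphism (`ap_existsUnique`). Tensor products and the unit are
chosen fillers of horns of corollas, the structure isomorphisms are quotients of two operations with
the same inputs, and a coherence axiom holds as soon as both sides agree on a single operation
(`app_ext`). Dividing by iterated tensor products identifies morphisms out of them with operations
of `D`, and this identifies `D` with the nerve of the resulting Picard groupoid (`isoNerve`). -/

namespace Dendroidal

/-! ### Subtrees of a tree, and the operations of its operad as subtrees -/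

namespace Tree

attribute [instance] Tree.finite_edge Tree.finite_vertex

/-- The map on edges of a map of trees. -/
def ed {S T : Tree} (f : S ⟶ T) (x : S.Edge) : T.Edge := f.col x

/-- The operations of `T.operad` with given inputs and output form a subsingleton, so the edge map
carries all the data of a map of trees. -/
theorem hom_ext {S T : Tree} {f g : S ⟶ T} (h : ∀ x, ed f x = ed g x) : f = g := by
  obtain ⟨c, m, _, _⟩ := f
  obtain ⟨c', m', _, _⟩ := g
  obtain rfl : c = c' := funext h
  obtain rfl : @m = @m' := by
    funext n a d o
    exact Subsingleton.elim (α := PLift _) _ _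
  rfl

@[simp]
theorem ed_comp {R S T : Tree} (f : R ⟶ S) (g : S ⟶ T) (x : R.Edge) :
    ed (f ≫ g) x = ed g (ed f x) := rfl

@[simp]
theorem ed_id {T : Tree} (x : T.Edge) : ed (𝟙 T) x = x := rfl

variable (T : Tree)

/-- A height function on the edges of a tree. -/
noncomputable def ht : T.Edge → ℕ := T.descending.choose

variable {T}

theorem ht_lt {x : T.Edge} {v : T.Vertex} (h : T.below x = some v) : T.ht (T.out v) < T.ht x :=
  T.descending.choose_spec x v h

theorem below_out_ne (v : T.Vertex) : T.below (T.out v) ≠ some v := fun h =>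
  lt_irrefl _ (ht_lt h)

theorem below_root : T.below T.root = none := (T.below_eq_none _).2 rfl

/-- One step down in a tree. -/
def Step (x y : T.Edge) : Prop := ∃ v, T.below x = some v ∧ T.out v = y

/-- `Le x y` says that the edge `y` lies on the path from `x` to the root. -/
def Le (x y : T.Edge) : Prop := Relation.ReflTransGen Step x y

theorem Le.ht_le {x y : T.Edge} (h : Le x y) : T.ht y ≤ T.ht x := by
  induction h with
  | refl => exact le_rfl
  | tail _ h ih =>
    obtain ⟨v, h1, rfl⟩ := h
    exact (ht_lt h1).le.trans ih

theorem Le.total {x y z : T.Edge} (h : Le x y) (h' : Le x z) : Le y z ∨ Le z y := by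
  refine Relation.ReflTransGen.total_of_right_unique ?_ h h'
  rintro a b c ⟨v, h1, rfl⟩ ⟨v', h2, rfl⟩
  rw [h1] at h2
  cases h2
  rfl

/-- `W` is the set of vertices of a subtree with root `d`. -/
def Cl (W : Set T.Vertex) (d : T.Edge) : Prop :=
  ∀ v ∈ W, T.out v = d ∨ ∃ w ∈ W, T.below (T.out v) = some w

/-- The edges of the subtree with root `d` and vertices `W`. -/
def subE (W : Set T.Vertex) (d : T.Edge) : Set T.Edge :=
  {x | x = d ∨ ∃ w ∈ W, T.below x = some w}

/-- The leaves of the subtree with root `d` and vertices `W`. -/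
def lv (W : Set T.Vertex) (d : T.Edge) : Set T.Edge :=
  {x | x ∈ subE W d ∧ ∀ v ∈ W, T.out v ≠ x}

/-- The incoming edges of a vertex. -/
def inp (v : T.Vertex) : Set T.Edge := {x | T.below x = some v}

theorem Cl.out_mem {W : Set T.Vertex} {d : T.Edge} (h : Cl W d) {v : T.Vertex} (hv : v ∈ W) :
    T.out v ∈ subE W d := h v hv

theorem lv_sub {W : Set T.Vertex} {d : T.Edge} : lv W d ⊆ subE W d := fun _ h => h.1

theorem subE_le {W : Set T.Vertex} {d : T.Edge} (h : Cl W d) {x : T.Edge} (hx : x ∈ subE W d) :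
    Le x d := by
  induction hn : T.ht x using Nat.strong_induction_on generalizing x with
  | _ n ih =>
    rcases hx with rfl | ⟨w, hw, hx⟩
    · exact Relation.ReflTransGen.refl
    · exact Relation.ReflTransGen.head ⟨w, hx, rfl⟩ (ih _ (hn ▸ ht_lt hx) (h.out_mem hw) rfl)

/-- Going down from an edge of the subtree, one stays inside it until its root `d` is passed. A leaf
reached after at least one step would therefore be the output of a vertex of `W` or lie strictly
below `d`, and neither is possible. -/
theorem eq_of_le_lv {W : Set T.Vertex} {d : T.Edge} (h : Cl W d) {x l : T.Edge}
    (hx : x ∈ subE W d) (hl : l ∈ lv W d) (hxl : Le x l) : x = l := by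
  have key : ∀ y, Le x y → y ∈ subE W d ∨ Le d y := by
    intro y hy
    induction hy with
    | refl => exact Or.inl hx
    | tail _ hs ih =>
      rcases ih with (rfl | ⟨w, hw, hy⟩) | ih
      · exact Or.inr (Relation.ReflTransGen.single hs)
      · obtain ⟨v, h1, rfl⟩ := hs
        rw [hy] at h1
        cases h1
        exact Or.inl (h.out_mem hw)
      · exact Or.inr (ih.tail hs)
  rcases Relation.ReflTransGen.cases_tail hxl with h1 | ⟨y, hy, v, h1, rfl⟩
  · exact h1.symm
  · rcases key y hy with (rfl | ⟨w, hw, hy'⟩) | hdy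
    · have := (subE_le h hl.1).ht_le
      have := ht_lt h1
      omega
    · rw [hy'] at h1
      cases h1
      exact absurd rfl (hl.2 _ hw)
    · have h2 := (subE_le h hl.1).ht_le
      have := ht_lt h1
      have := Le.ht_le hdy
      omega

/-- A lowest vertex of `W` outside `W'` would have as output an edge of the second subtree that is
not an output there. This edge would be a leaf of both subtrees, although it is the output of a
vertex of `W`. Later arguments use this to recover the vertices of an operation from its inputs. -/
theorem lv_unique {W W' : Set T.Vertex} {d : T.Edge} (h : Cl W d) (h' : Cl W' d)
    (hl : lv W d = lv W' d) : W = W' := by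
  have key : ∀ {W W' : Set T.Vertex}, Cl W d → Cl W' d → lv W d = lv W' d → W ⊆ W' := by
    intro W W' h h' hl v hv
    induction hn : T.ht (T.out v) using Nat.strong_induction_on generalizing v with
    | _ n ih =>
      by_contra hv'
      have h1 : T.out v ∈ subE W' d := by
        rcases h v hv with h1 | ⟨w, hw, h1⟩
        · exact Or.inl h1
        · exact Or.inr ⟨w, ih _ (hn ▸ ht_lt h1) hw rfl, h1⟩
      have : T.out v ∈ lv W' d := ⟨h1, fun u hu hu' => hv' (T.out_injective hu' ▸ hu)⟩
      rw [← hl] at this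
      exact this.2 v hv rfl
  exact (key h h' hl).antisymm (key h' h hl.symm)

/-- Grafting subtrees on the leaves of a subtree. -/
theorem graft {W : Set T.Vertex} {d : T.Edge} (h : Cl W d) (V : T.Edge → Set T.Vertex)
    (hV : ∀ l ∈ lv W d, Cl (V l) l) :
    Cl (W ∪ ⋃ l ∈ lv W d, V l) d ∧
    lv (W ∪ ⋃ l ∈ lv W d, V l) d = ⋃ l ∈ lv W d, lv (V l) l ∧
    (∀ l ∈ lv W d, ∀ l' ∈ lv W d, ∀ x, x ∈ subE (V l) l → x ∈ subE (V l') l' → l = l') ∧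
    (∀ l ∈ lv W d, ∀ x, x ∈ subE (V l) l → x ∈ subE W d → x = l) := by
  -- Both leaves lie on the path from `x` to the root, so they are comparable; comparable leaves of
  -- one subtree coincide.
  have hdis : ∀ l ∈ lv W d, ∀ l' ∈ lv W d, ∀ x, x ∈ subE (V l) l → x ∈ subE (V l') l' →
      l = l' := by
    intro l hl l' hl' x hx hx'
    rcases (subE_le (hV l hl) hx).total (subE_le (hV l' hl') hx') with h1 | h1
    · exact eq_of_le_lv h hl.1 hl' h1
    · exact (eq_of_le_lv h hl'.1 hl h1).symm
  have hdis' : ∀ l ∈ lv W d, ∀ x, x ∈ subE (V l) l → x ∈ subE W d → x = l := fun l hl x hx hx' =>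
    eq_of_le_lv h hx' hl (subE_le (hV l hl) hx)
  refine ⟨?_, ?_, hdis, hdis'⟩
  · rintro v (hv | hv)
    · rcases h v hv with h1 | ⟨w, hw, h1⟩
      · exact Or.inl h1
      · exact Or.inr ⟨w, Or.inl hw, h1⟩
    · simp only [Set.mem_iUnion] at hv
      obtain ⟨l, hl, hv⟩ := hv
      rcases hV l hl v hv with h1 | ⟨w, hw, h1⟩
      · rcases hl.1 with h2 | ⟨w, hw, h2⟩
        · exact Or.inl (h1.trans h2)
        · exact Or.inr ⟨w, Or.inl hw, h1 ▸ h2⟩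
      · exact Or.inr ⟨w, Or.inr (by simp only [Set.mem_iUnion]; exact ⟨l, hl, hw⟩), h1⟩
  · ext x
    simp only [Set.mem_iUnion]
    constructor
    · rintro ⟨hx, hx'⟩
      by_cases hxW : x ∈ subE W d
      · have hxl : x ∈ lv W d := ⟨hxW, fun v hv => hx' v (Or.inl hv)⟩
        exact ⟨x, hxl, Or.inl rfl, fun v hv =>
          hx' v (Or.inr (by simp only [Set.mem_iUnion]; exact ⟨x, hxl, hv⟩))⟩
      · rcases hx with rfl | ⟨w, hw | hw, h1⟩
        · exact absurd (Or.inl rfl) hxW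
        · exact absurd (Or.inr ⟨w, hw, h1⟩) hxW
        · simp only [Set.mem_iUnion] at hw
          obtain ⟨l, hl, hw⟩ := hw
          exact ⟨l, hl, Or.inr ⟨w, hw, h1⟩, fun v hv =>
            hx' v (Or.inr (by simp only [Set.mem_iUnion]; exact ⟨l, hl, hv⟩))⟩
    · rintro ⟨l, hl, hx, hx'⟩
      refine ⟨?_, ?_⟩
      · rcases hx with rfl | ⟨w, hw, h1⟩
        · rcases hl.1 with h2 | ⟨w, hw, h2⟩
          · exact Or.inl h2
          · exact Or.inr ⟨w, Or.inl hw, h2⟩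
        · exact Or.inr ⟨w, Or.inr (by simp only [Set.mem_iUnion]; exact ⟨l, hl, hw⟩), h1⟩
      · rintro v (hv | hv) rfl
        · have := hdis' l hl _ hx (h.out_mem hv)
          exact hl.2 v hv this
        · simp only [Set.mem_iUnion] at hv
          obtain ⟨l', hl', hv⟩ := hv
          obtain rfl := hdis l hl l' hl' _ hx ((hV l' hl').out_mem hv)
          exact hx' v hv rfl

theorem cl_empty (d : T.Edge) : Cl ∅ d := fun _ h => h.elim

theorem lv_empty (d : T.Edge) : lv ∅ d = {d} := by
  ext x
  simp [lv, subE]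

theorem cl_singleton (v : T.Vertex) : Cl {v} (T.out v) := by
  rintro _ rfl
  exact Or.inl rfl

theorem lv_singleton (v : T.Vertex) : lv {v} (T.out v) = inp v := by
  ext x
  simp only [lv, subE, inp, Set.mem_singleton_iff, exists_eq_left, forall_eq, Set.mem_ofPred_eq]
  constructor
  · rintro ⟨rfl | h, h'⟩
    · exact absurd rfl h'
    · exact h
  · intro h
    refine ⟨Or.inr h, ?_⟩
    rintro rfl
    exact below_out_ne v h

/-- There is an operation with the given set of inputs. -/
def IsOpSet (T : Tree) (L : Set T.Edge) (d : T.Edge) : Prop := ∃ W, Cl W d ∧ lv W d = L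

/-- Identities come from the empty set of vertices, vertices from singletons, and composites from
grafting. Distinctness of the inputs is carried along in the induction because the grafted subtrees
are indexed by edges, that is by the values of `b`. -/
theorem IsOp.isOpSet {n : ℕ} {a : Fin n → T.Edge} {d : T.Edge} (h : T.IsOp a d) :
    Function.Injective a ∧ T.IsOpSet (Set.range a) d := by
  induction h with
  | id x => exact ⟨Function.injective_of_subsingleton _, ∅, cl_empty _, by simp [lv_empty]⟩
  | vertex v a ha hv =>
    exact ⟨ha, {v}, cl_singleton v, by rw [lv_singleton]; ext x; exact hv x⟩
  | @comp n m k e b a r d hr g f ihg ihf =>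
    obtain ⟨hb, W, hW, hWb⟩ := ihg
    choose ha V hV hVa using ihf
    let V' : T.Edge → Set T.Vertex := fun l => ⋃ (j) (_ : b j = l), V j
    have hV' : ∀ j, V' (b j) = V j := by
      intro j
      ext v
      simp only [V', Set.mem_iUnion]
      exact ⟨fun ⟨i, h1, h2⟩ => hb h1 ▸ h2, fun h => ⟨j, rfl, h⟩⟩
    obtain ⟨h1, h2, h3, h4⟩ := graft hW V' (by
      intro l hl
      rw [hWb] at hl
      obtain ⟨j, rfl⟩ := hl
      rw [hV']
      exact hV j)
    refine ⟨?_, _, h1, h2.trans ?_⟩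
    · intro p q hpq
      obtain ⟨⟨j, i⟩, rfl⟩ := e.surjective p
      obtain ⟨⟨j', i'⟩, rfl⟩ := e.surjective q
      rw [hr, hr] at hpq
      have hm : ∀ j i, a j i ∈ subE (V' (b j)) (b j) := by
        intro j i
        rw [hV']
        apply lv_sub
        rw [hVa]
        exact ⟨i, rfl⟩
      obtain rfl := hb (h3 (b j) (by rw [hWb]; exact ⟨j, rfl⟩) (b j') (by rw [hWb]; exact ⟨j', rfl⟩)
        (a j i) (hm j i) (hpq ▸ hm j' i'))
      rw [ha j hpq]
    · ext x
      simp only [Set.mem_iUnion, hWb]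
      constructor
      · rintro ⟨_, ⟨j, rfl⟩, hx⟩
        rw [hV', hVa] at hx
        obtain ⟨i, rfl⟩ := hx
        exact ⟨e ⟨j, i⟩, hr j i⟩
      · rintro ⟨p, rfl⟩
        obtain ⟨⟨j, i⟩, rfl⟩ := e.surjective p
        exact ⟨b j, ⟨j, rfl⟩, by rw [hV', hVa]; exact ⟨i, (hr j i).symm⟩⟩

theorem exists_enum {X : Type*} [Finite X] (s : Set X) :
    ∃ (k : ℕ) (a : Fin k → X), Function.Injective a ∧ Set.range a = s := by
  obtain ⟨k, ⟨e⟩⟩ := Finite.exists_equiv_fin s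
  exact ⟨k, fun i => (e.symm i).1, Subtype.val_injective.comp e.symm.injective, by
    ext x
    exact ⟨by rintro ⟨i, rfl⟩; exact (e.symm i).2, fun hx => ⟨e ⟨x, hx⟩, by simp⟩⟩⟩

/-- A vertex of a subtree without incoming inner edges. -/
theorem exists_top {W : Set T.Vertex} (h : W.Nonempty) :
    ∃ v ∈ W, ∀ u ∈ W, T.below (T.out u) ≠ some v := by
  obtain ⟨v, hv, hm⟩ := Set.exists_max_image W (fun v => T.ht (T.out v)) (Set.toFinite _) h
  refine ⟨v, hv, fun u hu hu' => ?_⟩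
  have := hm u hu
  have := ht_lt hu'
  omega

/-- Induction on subtrees, by removing a top vertex. -/
theorem cl_induction {d : T.Edge} {P : (W : Set T.Vertex) → Cl W d → Prop} (h0 : P ∅ (cl_empty d))
    (h1 : ∀ (W : Set T.Vertex) (v : T.Vertex) (hW : Cl W d) (hW' : Cl (insert v W) d), v ∉ W →
      T.out v ∈ lv W d → P W hW → P (insert v W) hW') (W : Set T.Vertex) (hW : Cl W d) :
    P W hW := by
  induction hn : W.ncard generalizing W with
  | zero =>
    rw [Set.ncard_eq_zero] at hn
    subst hn
    exact h0
  | succ n ih =>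
    obtain ⟨v, hv, hv'⟩ := exists_top (W := W) (by
      rw [← Set.ncard_pos]
      omega)
    have hcl : Cl (W \ {v}) d := by
      rintro u ⟨hu, -⟩
      rcases hW u hu with h | ⟨w, hw, h⟩
      · exact Or.inl h
      · refine Or.inr ⟨w, ⟨hw, ?_⟩, h⟩
        rintro rfl
        exact hv' u hu h
    have hins : insert v (W \ {v}) = W := by
      rw [Set.insert_sdiff_singleton, Set.insert_eq_of_mem hv]
    have := h1 (W \ {v}) v hcl (by rwa [hins]) (by simp) ⟨?_, ?_⟩ (ih _ hcl (by
      rw [Set.ncard_sdiff_singleton_of_mem hv]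
      omega))
    · simpa only [hins] using this
    · rcases hW v hv with h | ⟨w, hw, h⟩
      · exact Or.inl h
      · refine Or.inr ⟨w, ⟨hw, ?_⟩, h⟩
        rintro rfl
        exact below_out_ne _ h
    · rintro u ⟨-, hu⟩ h
      exact hu (T.out_injective h)

/-- Grafting on a single leaf, obtained by grafting the empty subtree on all other leaves. -/
theorem graft_one {W V : Set T.Vertex} {d l : T.Edge} (h : Cl W d) (hl : l ∈ lv W d)
    (hV : Cl V l) : Cl (W ∪ V) d ∧ lv (W ∪ V) d = (lv W d \ {l}) ∪ lv V l ∧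
      (∀ x ∈ subE V l, x ∈ subE W d → x = l) := by
  classical
  obtain ⟨h1, h2, h3, h4⟩ := graft h (fun x => if x = l then V else ∅) (by
    intro x _
    split_ifs with hx
    · exact hx ▸ hV
    · exact cl_empty _)
  have hU : (⋃ x ∈ lv W d, if x = l then V else ∅) = V := by
    ext v
    simp only [Set.mem_iUnion]
    constructor
    · rintro ⟨x, hx, hv⟩
      split_ifs at hv
      · exact hv
      · exact hv.elim
    · intro hv
      exact ⟨l, hl, by rwa [if_pos rfl]⟩
  rw [hU] at h1 h2
  refine ⟨h1, h2.trans ?_, fun x hx hx' => h4 l hl x (by rwa [if_pos rfl]) hx'⟩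
  ext x
  simp only [Set.mem_iUnion, Set.mem_union, Set.mem_sdiff, Set.mem_singleton_iff]
  constructor
  · rintro ⟨y, hy, hx⟩
    split_ifs at hx with hyl
    · subst hyl
      exact Or.inr hx
    · rw [lv_empty, Set.mem_singleton_iff] at hx
      subst hx
      exact Or.inl ⟨hy, hyl⟩
  · rintro (⟨hx, hxl⟩ | hx)
    · exact ⟨x, hx, by rw [if_neg hxl, lv_empty]; rfl⟩
    · exact ⟨l, hl, by rwa [if_pos rfl]⟩

theorem inp_finite_isOp (v : T.Vertex) {n : ℕ} {a : Fin n → T.Edge} (ha : Function.Injective a)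
    (hr : Set.range a = inp v) : T.IsOp a (T.out v) :=
  IsOp.vertex v a ha (fun x => by rw [hr]; rfl)

/-- The subtree is built one top vertex at a time, each new vertex being a substitution into one
leaf. The claim is proved for all enumerations of the leaves at once, since the set of leaves
changes with every vertex. -/
theorem isOp_of_set {n : ℕ} {a : Fin n → T.Edge} {d : T.Edge} (ha : Function.Injective a)
    (h : T.IsOpSet (Set.range a) d) : T.IsOp a d := by
  obtain ⟨W, hW, hl⟩ := h
  suffices H : ∀ {n : ℕ} {a : Fin n → T.Edge}, Function.Injective a → Set.range a = lv W d →
      T.IsOp a d from H ha hl.symm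
  clear hl ha a n
  induction W, hW using cl_induction with
  | h0 =>
    intro n a ha hr
    rw [lv_empty] at hr
    have h1 : ∀ i, a i = d := fun i => by
      have : a i ∈ Set.range a := ⟨i, rfl⟩
      rwa [hr] at this
    obtain ⟨i, hi⟩ : d ∈ Set.range a := by rw [hr]; rfl
    have h2 : ∀ j, j = i := fun j => ha ((h1 j).trans hi.symm)
    obtain rfl : n = 1 := by
      have : Subsingleton (Fin n) := ⟨fun j j' => (h2 j).trans (h2 j').symm⟩
      have := Fin.subsingleton_iff_le_one.1 this
      have := i.2
      omega
    obtain rfl : a = fun _ => d := funext h1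
    exact IsOp.id d
  | h1 W v hW _ hv hvl ih =>
    intro n a ha hr
    obtain ⟨k, b, hb, hbr⟩ := exists_enum (lv W d)
    obtain ⟨h1, h2, h3⟩ := graft_one hW hvl (cl_singleton v)
    rw [Set.union_singleton] at h1 h2
    rw [h2, lv_singleton] at hr
    rw [lv_singleton] at h2
    classical
    -- The corolla of `v` goes into the leaf `T.out v`, identities go into all other leaves.
    refine IsOp.subst (ih hb hbr) (fun j => if b j = T.out v then inp v else {b j}) ?_ ?_ ha ?_
    · intro j
      split_ifs with hj
      · obtain ⟨l, c, hc, hcr⟩ := exists_enum (inp v)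
        exact ⟨l, c, hc, hcr, hj ▸ inp_finite_isOp v hc hcr⟩
      · exact ⟨1, fun _ => b j, Function.injective_of_subsingleton _, by simp, IsOp.id _⟩
    · have hmem : ∀ j, b j ∈ lv W d := fun j => by rw [← hbr]; exact ⟨j, rfl⟩
      have hno : ∀ j, b j ∉ inp v := by
        intro j hj
        have := h3 (b j) (lv_sub (lv_singleton v ▸ hj)) (hmem j).1
        rw [this] at hj
        exact below_out_ne v hj
      intro i j x hi hj
      split_ifs at hi hj with h1 h2 h2
      · exact hb (h1.trans h2.symm)
      · obtain rfl : x = b j := hj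
        exact absurd hi (hno j)
      · obtain rfl : x = b i := hi
        exact absurd hj (hno i)
      · obtain rfl : x = b i := hi
        exact hb hj
    · intro x
      rw [hr]
      constructor
      · rintro (⟨hx, hxv⟩ | hx)
        · rw [← hbr] at hx
          obtain ⟨j, rfl⟩ := hx
          exact ⟨j, by rw [if_neg (by simpa using hxv)]; rfl⟩
        · rw [← hbr] at hvl
          obtain ⟨j, hj⟩ := hvl
          exact ⟨j, by rwa [if_pos hj]⟩
      · rintro ⟨j, hj⟩
        split_ifs at hj with h
        · exact Or.inr hj
        · obtain rfl : x = b j := hj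
          exact Or.inl ⟨by rw [← hbr]; exact ⟨j, rfl⟩, h⟩

/-! ### Maps of trees in terms of sets -/

/-- Constructing a map of trees from the sets of inputs of the vertices. -/
def homOfSet {S T : Tree} (φ : S.Edge → T.Edge) (hi : ∀ v : S.Vertex, Set.InjOn φ (inp v))
    (hφ : ∀ v : S.Vertex, T.IsOpSet (φ '' inp v) (φ (S.out v))) : S ⟶ T :=
  homMk φ fun v n a ha hv => isOp_of_set
    (fun i j h => ha (hi v ((hv _).2 ⟨i, rfl⟩) ((hv _).2 ⟨j, rfl⟩) h)) (by
      have : Set.range (fun i => φ (a i)) = φ '' inp v := by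
        rw [Set.range_comp' φ a]
        congr 1
        ext x
        exact (hv x).symm
      rw [this]
      exact hφ v)

/-- Maps of trees act on operations, and operations are subtrees. Injectivity on the leaves holds
because the inputs of an operation of `T` are distinct. -/
theorem hom_isOpSet {S T : Tree} (f : S ⟶ T) {L : Set S.Edge} {d : S.Edge} (h : S.IsOpSet L d) :
    Set.InjOn (ed f) L ∧ T.IsOpSet (ed f '' L) (ed f d) := by
  obtain ⟨n, a, ha, rfl⟩ := exists_enum L
  have : Function.Injective (fun i => ed f (a i)) ∧
      T.IsOpSet (Set.range fun i => ed f (a i)) (ed f d) :=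
    (f.map ⟨isOp_of_set ha h⟩).down.isOpSet
  refine ⟨?_, by rw [← Set.range_comp' (ed f) a]; exact this.2⟩
  rintro _ ⟨i, rfl⟩ _ ⟨j, rfl⟩ h
  rw [this.1 h]

theorem isOpSet_inp (v : T.Vertex) : T.IsOpSet (inp v) (T.out v) :=
  ⟨{v}, cl_singleton v, lv_singleton v⟩

theorem subE_insert {W : Set T.Vertex} {v : T.Vertex} {d x : T.Edge} (h : x ∈ subE (insert v W) d) :
    x ∈ subE W d ∨ x ∈ inp v := by
  rcases h with h | ⟨w, rfl | hw, h⟩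
  · exact Or.inl (Or.inl h)
  · exact Or.inr h
  · exact Or.inl (Or.inr ⟨w, hw, h⟩)

/-- A map of trees restricts to a map of subtrees. -/
theorem hom_restrict {S T : Tree} (f : S ⟶ T) {W : Set S.Vertex} {d : S.Edge} (hW : Cl W d) :
    ∃ W' : Set T.Vertex, Cl W' (ed f d) ∧ lv W' (ed f d) = ed f '' lv W d ∧
      (∀ x ∈ subE W d, ed f x ∈ subE W' (ed f d)) ∧
      ∀ v ∈ W, ∃ V ⊆ W', Cl V (ed f (S.out v)) ∧ lv V (ed f (S.out v)) = ed f '' inp v := by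
  induction W, hW using cl_induction with
  | h0 =>
    refine ⟨∅, cl_empty _, by simp [lv_empty], ?_, fun v hv => hv.elim⟩
    rintro x (rfl | ⟨w, hw, -⟩)
    · exact Or.inl rfl
    · exact hw.elim
  | h1 W v hW _ hv hvl ih =>
    obtain ⟨W', hW', hl, hs, hq⟩ := ih
    obtain ⟨-, V, hV, hVl⟩ := hom_isOpSet f (isOpSet_inp v)
    -- The image of the enlarged subtree is the image `W'` of the smaller one with the subtree `V`,
    -- the image of the vertex `v`, grafted on the leaf `ed f (S.out v)`.
    obtain ⟨h1, h2, h3⟩ := graft_one hW' (l := ed f (S.out v)) (by rw [hl]; exact ⟨_, hvl, rfl⟩) hV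
    obtain ⟨-, h2', -⟩ := graft_one hW hvl (cl_singleton v)
    rw [Set.union_singleton, lv_singleton] at h2'
    refine ⟨_, h1, ?_, ?_, ?_⟩
    rotate_left 2
    · rintro q (rfl | hq')
      · exact ⟨V, Set.subset_union_right, hV, hVl⟩
      · obtain ⟨V', h4, h5⟩ := hq q hq'
        exact ⟨V', h4.trans Set.subset_union_left, h5⟩
    · rw [h2, h2', Set.image_union, hVl, hl, (hom_isOpSet f ⟨W, hW, rfl⟩).1.image_sdiff_subset
        (by simpa using hvl), Set.image_singleton]
    · intro x hx
      rcases subE_insert hx with hx | hx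
      · rcases hs x hx with h | ⟨w, hw, h⟩
        · exact Or.inl h
        · exact Or.inr ⟨w, Or.inl hw, h⟩
      · have : ed f x ∈ subE V (ed f (S.out v)) := lv_sub (by rw [hVl]; exact ⟨x, hx, rfl⟩)
        rcases this with h | ⟨w, hw, h⟩
        · rw [h]
          rcases hs _ hvl.1 with h | ⟨w, hw, h⟩
          · exact Or.inl h
          · exact Or.inr ⟨w, Or.inl hw, h⟩
        · exact Or.inr ⟨w, Or.inr hw, h⟩

end Tree
end Dendroidal

namespace Dendroidal

namespace Tree

@[simp]
theorem ed_homOfSet {S T : Tree} (φ : S.Edge → T.Edge) (hi hφ) (x : S.Edge) :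
    ed (homOfSet φ hi hφ) x = φ x := rfl

theorem image_val_mk {X Y : Type*} {p : X → Prop} (f : Y → X) (h : ∀ y, p (f y)) (s : Set Y) :
    Subtype.val '' ((fun y => (⟨f y, h y⟩ : Subtype p)) '' s) = f '' s := by
  rw [Set.image_image]

/-! ### Corollas -/

/-- The corolla with leaves `A`. -/
def cor (A : Type) [Finite A] : Tree where
  Edge := Option A
  Vertex := Unit
  finite_edge := inferInstance
  finite_vertex := inferInstance
  root := none
  out _ := none
  out_injective _ _ _ := rfl
  below x := x.map fun _ => ()
  below_eq_none x := by simp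
  descending := ⟨fun x => x.elim 0 fun _ => 1, fun x v h => by
    cases x
    · simp at h
    · simp⟩

section cor

variable {A : Type} [Finite A] {T : Tree}

/-- A leaf of a corolla. -/
def leaf (i : A) : (cor A).Edge := some i

/-- The root of a corolla. -/
def rt : (cor A).Edge := none

theorem cor_cases {P : (cor A).Edge → Prop} (h : P rt) (h' : ∀ i, P (leaf i)) (x) : P x := by
  cases x
  · exact h
  · exact h' _

theorem leaf_injective : Function.Injective (leaf (A := A)) := Option.some_injective A

theorem inp_cor (v : (cor A).Vertex) : inp v = Set.range (leaf (A := A)) := by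
  ext x
  induction x using cor_cases with
  | h =>
    constructor
    · intro h
      cases h
    · rintro ⟨i, hi⟩
      cases hi
  | h' i => exact ⟨fun _ => ⟨i, rfl⟩, fun _ => rfl⟩

theorem cor_hom_ext {f g : cor A ⟶ T} (h : ed f rt = ed g rt) (h' : ∀ i, ed f (leaf i) = ed g (leaf i)) :
    f = g := hom_ext (cor_cases h h')

theorem cor_isOpSet : (cor A).IsOpSet (Set.range leaf) rt := by
  have h : inp (T := cor A) () = _ := inp_cor _
  exact h ▸ isOpSet_inp (T := cor A) ()

/-- The map from a corolla given by an operation. -/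
def corHom (a : A → T.Edge) (d : T.Edge) (ha : Function.Injective a)
    (h : T.IsOpSet (Set.range a) d) : cor A ⟶ T :=
  homOfSet (fun x : Option A => x.elim d a) (by
    intro v
    rw [inp_cor]
    rintro _ ⟨i, rfl⟩ _ ⟨j, rfl⟩ hij
    exact congrArg leaf (ha hij)) (by
    intro v
    have h' : (fun x : Option A => x.elim d a) '' Set.range (some : A → Option A) = Set.range a := by
      rw [← Set.range_comp]
      rfl
    rw [inp_cor]
    rw [← h'] at h
    exact h)

theorem cor_hom_injective (f : cor A ⟶ T) : Function.Injective fun i => ed f (leaf i) :=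
  fun i j h => leaf_injective
    ((hom_isOpSet f cor_isOpSet).1 ⟨i, rfl⟩ ⟨j, rfl⟩ h)

theorem cor_hom_isOpSet (f : cor A ⟶ T) :
    T.IsOpSet (Set.range fun i => ed f (leaf i)) (ed f rt) := by
  have := (hom_isOpSet f cor_isOpSet).2
  rwa [← Set.range_comp] at this

/-- The corolla of a vertex. -/
def vmap (v : T.Vertex) : cor (inp v) ⟶ T :=
  corHom (fun x => x.1) (T.out v) Subtype.val_injective (by
    rw [Subtype.range_val]
    exact isOpSet_inp v)

/-- Maps between corollas given by bijections of their leaves. -/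
def corMap {B : Type} [Finite B] (e : A ≃ B) : cor A ⟶ cor B :=
  corHom (fun i => leaf (e i)) rt (leaf_injective.comp e.injective) (by
    have : Set.range (fun i => leaf (e i)) = Set.range (leaf (A := B)) := e.surjective.range_comp _
    rw [this]
    exact cor_isOpSet)

@[simp]
theorem ed_corMap_leaf {B : Type} [Finite B] (e : A ≃ B) (i : A) :
    ed (corMap e) (leaf i) = leaf (e i) := rfl

/-- A map from a corolla that hits a vertex factors through the corolla of the vertex. -/
theorem exists_corMap_vmap {v : T.Vertex} (f : cor A ⟶ T) (h : ed f rt = T.out v)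
    (h' : (Set.range fun i => ed f (leaf i)) = inp v) : ∃ e : A ≃ inp v, f = corMap e ≫ vmap v := by
  have hm : ∀ i, ed f (leaf i) ∈ inp v := fun i => by rw [← h']; exact ⟨i, rfl⟩
  refine ⟨Equiv.ofBijective (fun i => ⟨ed f (leaf i), hm i⟩) ⟨?_, ?_⟩, cor_hom_ext h fun i => rfl⟩
  · intro i j hij
    exact cor_hom_injective f (congrArg Subtype.val hij)
  · rintro ⟨x, hx⟩
    rw [← h'] at hx
    obtain ⟨i, rfl⟩ := hx
    exact ⟨i, rfl⟩

end cor

/-! ### Subtrees -/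

variable {T : Tree}

/-- All outputs of vertices of `W` lie above `d`, so heights exclude that `d` is an input of one of
them. Cutting off whatever is below `d` thus removes no vertex of the subtree. -/
theorem Cl.below_ne {W : Set T.Vertex} {d : T.Edge} (h : Cl W d) {v : T.Vertex} (hv : v ∈ W) :
    T.below d ≠ some v := by
  intro hd
  have := (subE_le h (h.out_mem hv)).ht_le
  have := ht_lt hd
  omega

/-- The subtree with root `d` and vertices `W`. -/
noncomputable def sub (W : Set T.Vertex) (d : T.Edge) (h : Cl W d) : Tree where
  Edge := subE W d
  Vertex := W
  finite_edge := inferInstance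
  finite_vertex := inferInstance
  root := ⟨d, Or.inl rfl⟩
  out v := ⟨T.out v.1, h.out_mem v.2⟩
  out_injective v v' h' := Subtype.ext (T.out_injective (congrArg Subtype.val h'))
  below x := open Classical in if hx : x.1 = d then none else
    some ⟨(x.2.resolve_left hx).choose, (x.2.resolve_left hx).choose_spec.1⟩
  below_eq_none x := by
    classical
    rw [Subtype.ext_iff, dite_eq_left_iff]
    simp
  descending := by
    refine ⟨fun x => T.ht x.1, fun x v hv => ?_⟩
    classical
    split_ifs at hv with hx
    rw [Option.some.injEq] at hv
    subst hv
    exact ht_lt (x.2.resolve_left hx).choose_spec.2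

section sub

variable {W : Set T.Vertex} {d : T.Edge} (hW : Cl W d)

/-- Vertices below a given edge are unique, so the choice in the definition of `sub` is no choice;
everything else about subtrees is derived from this description. -/
theorem sub_below_iff (x : (sub W d hW).Edge) (v : (sub W d hW).Vertex) :
    (sub W d hW).below x = some v ↔ T.below x.1 = some v.1 := by
  classical
  have hb : (sub W d hW).below x = if hx : x.1 = d then none else
    some ⟨(x.2.resolve_left hx).choose, (x.2.resolve_left hx).choose_spec.1⟩ := rfl
  rw [hb]
  split_ifs with hx
  · rw [hx]
    simp [hW.below_ne v.2]
  · have h1 := (x.2.resolve_left hx).choose_spec.2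
    refine Iff.trans ?_ (iff_of_eq (congrArg (fun t => t = some v.1) h1.symm))
    exact (Option.some.injEq _ _).to_iff.trans
      (Subtype.ext_iff.trans (Option.some.injEq _ _).to_iff.symm)

theorem sub_inp (v : (sub W d hW).Vertex) : Subtype.val '' inp v = inp v.1 := by
  ext x
  constructor
  · rintro ⟨x, hx, rfl⟩
    exact (sub_below_iff hW x v).1 hx
  · intro hx
    exact ⟨⟨x, Or.inr ⟨v.1, v.2, hx⟩⟩, (sub_below_iff hW _ v).2 hx, rfl⟩

theorem sub_cl_iff {V : Set (sub W d hW).Vertex} {x : (sub W d hW).Edge} :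
    Cl V x ↔ Cl (Subtype.val '' V) x.1 := by
  constructor
  · rintro h _ ⟨v, hv, rfl⟩
    rcases h v hv with h1 | ⟨w, hw, h1⟩
    · exact Or.inl (congrArg Subtype.val h1)
    · exact Or.inr ⟨w.1, ⟨w, hw, rfl⟩, (sub_below_iff hW _ w).1 h1⟩
  · intro h v hv
    rcases h v.1 ⟨v, hv, rfl⟩ with h1 | ⟨_, ⟨w, hw, rfl⟩, h1⟩
    · exact Or.inl (Subtype.ext h1)
    · exact Or.inr ⟨w, hw, (sub_below_iff hW _ w).2 h1⟩

theorem sub_lv {V : Set (sub W d hW).Vertex} {x : (sub W d hW).Edge} :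
    Subtype.val '' lv V x = lv (Subtype.val '' V) x.1 := by
  ext y
  constructor
  · rintro ⟨y, ⟨hy, hy'⟩, rfl⟩
    refine ⟨?_, ?_⟩
    · rcases hy with rfl | ⟨w, hw, h⟩
      · exact Or.inl rfl
      · exact Or.inr ⟨w.1, ⟨w, hw, rfl⟩, (sub_below_iff hW _ w).1 h⟩
    · rintro _ ⟨v, hv, rfl⟩ h
      exact hy' v hv (Subtype.ext h)
  · rintro ⟨hy, hy'⟩
    have hm : y ∈ subE W d := by
      rcases hy with rfl | ⟨_, ⟨w, hw, rfl⟩, h⟩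
      · exact x.2
      · exact Or.inr ⟨w.1, w.2, h⟩
    refine ⟨⟨y, hm⟩, ⟨?_, ?_⟩, rfl⟩
    · rcases hy with rfl | ⟨_, ⟨w, hw, rfl⟩, h⟩
      · exact Or.inl rfl
      · exact Or.inr ⟨w, hw, (sub_below_iff hW _ w).2 h⟩
    · intro v hv h
      exact hy' v.1 ⟨v, hv, rfl⟩ (congrArg Subtype.val h)

/-- Passing from a set of vertices of the subtree to its image in `T` changes neither closedness nor
leaves. This is the criterion by which maps into a subtree are constructed. -/
theorem sub_isOpSet_iff {L : Set (sub W d hW).Edge} {x : (sub W d hW).Edge} :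
    (sub W d hW).IsOpSet L x ↔ ∃ V ⊆ W, Cl V x.1 ∧ lv V x.1 = Subtype.val '' L := by
  constructor
  · rintro ⟨V, hV, rfl⟩
    exact ⟨Subtype.val '' V, by rintro _ ⟨v, -, rfl⟩; exact v.2, (sub_cl_iff hW).1 hV,
      (sub_lv hW).symm⟩
  · rintro ⟨V, hVW, hV, hl⟩
    have hV' : V = Subtype.val '' {v : W | v.1 ∈ V} := by
      ext v
      constructor
      · intro hv
        exact ⟨⟨v, hVW hv⟩, hv, rfl⟩
      · rintro ⟨v, hv, rfl⟩
        exact hv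
    rw [hV'] at hV hl
    refine ⟨{v : W | v.1 ∈ V}, (sub_cl_iff hW).2 hV, ?_⟩
    have h := (sub_lv hW (V := {v : W | v.1 ∈ V}) (x := x)).trans hl
    exact Set.image_injective.2 Subtype.val_injective h

/-- The inclusion of a subtree. -/
noncomputable def subι : sub W d hW ⟶ T :=
  homOfSet (fun x : subE W d => x.1) (fun _ => Subtype.val_injective.injOn) (fun v => by
    have h := isOpSet_inp v.1
    rw [← sub_inp hW v] at h
    exact h)

/-- Maps into a subtree. -/
noncomputable def subLift {S : Tree} (f : S ⟶ T) (he : ∀ x, ed f x ∈ subE W d)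
    (hv : ∀ v : S.Vertex, ∃ V ⊆ W, Cl V (ed f (S.out v)) ∧ lv V (ed f (S.out v)) = ed f '' inp v) :
    S ⟶ sub W d hW :=
  homOfSet (fun x => (⟨ed f x, he x⟩ : subE W d))
    (fun v _ hx _ hy h => (hom_isOpSet f (isOpSet_inp v)).1 hx hy (congrArg Subtype.val h)) (by
    intro v
    refine (sub_isOpSet_iff hW).2 ?_
    obtain ⟨V, h1, h2, h3⟩ := hv v
    exact ⟨V, h1, h2, h3.trans (image_val_mk (ed f) he _).symm⟩)

theorem subLift_ι {S : Tree} (f : S ⟶ T) (he hv) : subLift hW f he hv ≫ subι hW = f :=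
  hom_ext fun _ => rfl

theorem subι_mono {S : Tree} {f g : S ⟶ sub W d hW} (h : f ≫ subι hW = g ≫ subι hW) : f = g :=
  hom_ext fun x => Subtype.ext (congrArg (fun k => ed k x) h)

/-- The total operation of a subtree. -/
theorem exists_corLift {A : Type} [Finite A] (f : cor A ⟶ T)
    (hl : lv W d = Set.range fun i => ed f (leaf i)) (hd : ed f rt = d) :
    ∃ g : cor A ⟶ sub W d hW, g ≫ subι hW = f := by
  refine ⟨subLift hW f ?_ ?_, subLift_ι _ _ _ _⟩
  · refine cor_cases (Or.inl hd) fun i => lv_sub ?_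
    rw [hl]
    exact ⟨i, rfl⟩
  · intro v
    refine ⟨W, subset_rfl, ?_⟩
    rw [inp_cor, ← Set.range_comp]
    change Cl W (ed f rt) ∧ lv W (ed f rt) = _
    rw [hd]
    exact ⟨hW, hl⟩

theorem cor_hom_sub {A : Type} [Finite A] (f : cor A ⟶ sub W d hW) :
    ∃ V ⊆ W, Cl V (ed f rt).1 ∧ lv V (ed f rt).1 = Set.range fun i => (ed f (leaf i)).1 := by
  obtain ⟨V, h1, h2, h3⟩ := (sub_isOpSet_iff hW).1 (cor_hom_isOpSet f)
  exact ⟨V, h1, h2, h3.trans (Set.range_comp _ _).symm⟩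

/-- The inclusion of subtrees. -/
noncomputable def subIncl {W' : Set T.Vertex} {d' : T.Edge} (hW' : Cl W' d') (h : W' ⊆ W)
    (hd : d' ∈ subE W d) : sub W' d' hW' ⟶ sub W d hW :=
  subLift hW (subι hW') (by
    rintro ⟨x, rfl | ⟨w, hw, hx⟩⟩
    · exact hd
    · exact Or.inr ⟨w, h hw, hx⟩) (fun v => ⟨{v.1}, by
      rintro _ rfl
      exact h v.2, cl_singleton v.1, (lv_singleton v.1).trans (sub_inp hW' v).symm⟩)

theorem subIncl_ι {W' : Set T.Vertex} {d' : T.Edge} (hW' : Cl W' d') (h : W' ⊆ W)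
    (hd : d' ∈ subE W d) : subIncl hW hW' h hd ≫ subι hW = subι hW' := hom_ext fun _ => rfl

theorem sub_vmap (v : (sub W d hW).Vertex) :
    ∃ e : inp v ≃ inp v.1, vmap v ≫ subι hW = corMap e ≫ vmap v.1 := by
  refine exists_corMap_vmap _ rfl ?_
  rw [← sub_inp hW v]
  ext x
  constructor
  · rintro ⟨i, rfl⟩
    exact ⟨i.1, i.2, rfl⟩
  · rintro ⟨i, hi, rfl⟩
    exact ⟨⟨i, hi⟩, rfl⟩

end sub

/-! ### Outer faces -/

/-- `a` is the outer face at the vertex `y`. -/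
def Face.IsOuter (a : Face T) (y : T.Vertex) : Prop :=
  (∃ hv hl, a = Face.top y hv hl) ∨ ∃ u hv hu hl, a = Face.bottom y u hv hu hl

theorem Face.IsOuter.unique {a : Face T} {y y' : T.Vertex} (h : a.IsOuter y) (h' : a.IsOuter y') :
    y = y' := by
  rcases h with ⟨_, _, rfl⟩ | ⟨_, _, _, _, rfl⟩ <;> rcases h' with ⟨_, _, h⟩ | ⟨_, _, _, _, h⟩ <;>
    cases h <;> rfl

theorem val_inp_chopTop (v : T.Vertex) (hl) (y : (T.chopTop v hl).Vertex) :
    Subtype.val '' inp y = inp y.1 := by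
  ext x
  constructor
  · rintro ⟨x, hx, rfl⟩
    obtain ⟨y', -, h2⟩ := Option.map_eq_some_iff.1 hx
    exact y'.2.trans (congrArg (fun z => some (Subtype.val z)) h2)
  · intro hx
    have hx' : T.below x = some y.1 := hx
    exact ⟨⟨x, by rw [hx']; simpa using y.2⟩,
      Option.map_eq_some_iff.2 ⟨⟨y.1, hx⟩, by simpa using hx', rfl⟩, rfl⟩

theorem val_inp_chopRoot (v u : T.Vertex) (hv hu hl) (y : (T.chopRoot v u hv hu hl).Vertex) :
    Subtype.val '' inp y = inp y.1 := by
  classical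
  ext x
  constructor
  · rintro ⟨x, hx, rfl⟩
    have h1 : (T.chopRoot v u hv hu hl).below x = some y := hx
    dsimp only [chopRoot] at h1
    split_ifs at h1 with h3
    obtain ⟨y', -, h2⟩ := Option.map_eq_some_iff.1 h1
    exact y'.2.trans (congrArg (fun z => some (Subtype.val z)) h2)
  · intro hx
    have hx' : T.below x = some y.1 := hx
    have hxv : T.below x ≠ some v := by rw [hx']; simpa using y.2
    have hxu : x ≠ T.out u := by rintro rfl; exact hxv hu
    have hxr : x ≠ T.root := fun h => by simp [(T.below_eq_none _).2 h] at hx'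
    exact ⟨⟨x, hxr, fun h => absurd h hxv⟩,
      (dif_neg hxu).trans (Option.map_eq_some_iff.2 ⟨⟨y.1, hx⟩, by simpa using hx', rfl⟩), rfl⟩

theorem exists_cl_inp {W : Set T.Vertex} {v : T.Vertex} (hv : v ∈ W) :
    ∃ V ⊆ W, Cl V (T.out v) ∧ lv V (T.out v) = inp v :=
  ⟨{v}, by simpa using hv, cl_singleton v, lv_singleton v⟩

/-- An outer face is isomorphic to the subtree of the remaining vertices. -/
theorem Face.IsOuter.exists_sub {a : Face T} {y : T.Vertex} (h : a.IsOuter y) :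
    ∃ (d : T.Edge) (hd : Cl {y}ᶜ d) (k : a.tree ⟶ sub {y}ᶜ d hd) (k' : sub {y}ᶜ d hd ⟶ a.tree),
      k ≫ subι hd = a.incl ∧ k' ≫ a.incl = subι hd ∧ k ≫ k' = 𝟙 _ ∧ k' ≫ k = 𝟙 _ := by
  rcases h with ⟨hv, hl, rfl⟩ | ⟨u, hv, hu, hl, rfl⟩
  -- Chopping a top vertex keeps the root: no vertex is attached above `y`, so removing `y`
  -- disconnects nothing.
  · have hd : Cl {y}ᶜ T.root := by
      intro z hz
      by_cases h : T.out z = T.root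
      · exact Or.inl h
      · rw [← T.below_eq_none, ← ne_eq, Option.ne_none_iff_exists'] at h
        obtain ⟨w, hw⟩ := h
        exact Or.inr ⟨w, fun h => hl z (hw.trans (congrArg some h)), hw⟩
    have hmem : ∀ x : T.Edge, T.below x ≠ some y ↔ x ∈ subE {y}ᶜ T.root := by
      intro x
      constructor
      · intro hx
        rcases hw : T.below x with _ | w
        · exact Or.inl ((T.below_eq_none _).1 hw)
        · exact Or.inr ⟨w, by rintro rfl; exact hx hw, hw⟩
      · rintro (rfl | ⟨w, hw, h⟩)
        · simp [below_root]
        · rw [h]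
          simpa using hw
    refine ⟨T.root, hd, subLift hd (T.chopTopMap y hl) (fun x => (hmem _).1 x.2) (fun q => ?_),
      homOfSet (S := sub {y}ᶜ T.root hd) (T := T.chopTop y hl)
      (fun x => (⟨x.1, (hmem x.1).2 x.2⟩ : {x // T.below x ≠ some y})) ?_ ?_, rfl, rfl, rfl, rfl⟩
    · have := val_inp_chopTop y hl q
      change ∃ V ⊆ {y}ᶜ, Cl V (T.out q.1) ∧ lv V (T.out q.1) = Subtype.val '' inp q
      exact this ▸ exists_cl_inp q.2
    · intro v x _ z _ hxz
      exact Subtype.ext (congrArg (fun t : {x // T.below x ≠ some y} => t.1) hxz)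
    · intro q
      have := isOpSet_inp (T := T.chopTop y hl) ⟨q.1, q.2⟩
      have h' := (val_inp_chopTop y hl ⟨q.1, q.2⟩).trans (sub_inp hd q).symm
      refine (congrArg (fun t => (T.chopTop y hl).IsOpSet t _)
        (Set.image_injective.2 Subtype.val_injective (h'.trans ?_))).mp this
      exact (image_val_mk (Subtype.val : subE {y}ᶜ _ → T.Edge) (fun x => (hmem x.1).2 x.2) _).symm
  · have hne : ∀ x, T.below (T.out x) = some y → x ≠ y := by
      rintro x hx rfl
      exact below_out_ne _ hx
    -- Without the root vertex `y` the root is `T.out u`, because `u` is the only vertex attached to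
    -- `y`.
    have hd : Cl {y}ᶜ (T.out u) := by
      intro z hz
      have h : T.out z ≠ T.root := fun h => hz (T.out_injective (h.trans hv.symm))
      rw [ne_eq, ← T.below_eq_none, ← ne_eq, Option.ne_none_iff_exists'] at h
      obtain ⟨w, hw⟩ := h
      by_cases hwy : w = y
      · exact Or.inl (by rw [hl z (hw.trans (congrArg some hwy))])
      · exact Or.inr ⟨w, hwy, hw⟩
    have hmem : ∀ x : T.Edge, (x ≠ T.root ∧ (T.below x = some y → x = T.out u)) ↔
        x ∈ subE {y}ᶜ (T.out u) := by
      intro x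
      constructor
      · rintro ⟨hx, hx'⟩
        rw [ne_eq, ← T.below_eq_none, ← ne_eq, Option.ne_none_iff_exists'] at hx
        obtain ⟨w, hw⟩ := hx
        by_cases hwy : w = y
        · exact Or.inl (hx' (hw.trans (congrArg some hwy)))
        · exact Or.inr ⟨w, hwy, hw⟩
      · rintro (rfl | ⟨w, hw, h⟩)
        · exact ⟨fun h => (hd.below_ne (v := u) (hne u hu) (by
            rw [h, below_root] at hu
            cases hu)).elim, fun _ => rfl⟩
        · refine ⟨fun h' => ?_, fun h' => ?_⟩
          · rw [h', below_root] at h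
            cases h
          · rw [h'] at h
            cases h
            exact absurd rfl hw
    refine ⟨T.out u, hd, subLift hd (T.chopRootMap y u hv hu hl) (fun x => (hmem _).1 x.2)
      (fun q => ?_), homOfSet (S := sub {y}ᶜ (T.out u) hd) (T := T.chopRoot y u hv hu hl)
      (fun x => (⟨x.1, (hmem x.1).2 x.2⟩ :
        {x // x ≠ T.root ∧ (T.below x = some y → x = T.out u)})) ?_ ?_, rfl, rfl, rfl, rfl⟩
    · have := val_inp_chopRoot y u hv hu hl q
      change ∃ V ⊆ {y}ᶜ, Cl V (T.out q.1) ∧ lv V (T.out q.1) = Subtype.val '' inp q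
      exact this ▸ exists_cl_inp q.2
    · intro v x _ z _ hxz
      exact Subtype.ext (congrArg
        (fun t : {x // x ≠ T.root ∧ (T.below x = some y → x = T.out u)} => t.1) hxz)
    · intro q
      have := isOpSet_inp (T := T.chopRoot y u hv hu hl) ⟨q.1, q.2⟩
      have h' := (val_inp_chopRoot y u hv hu hl ⟨q.1, q.2⟩).trans (sub_inp hd q).symm
      refine (congrArg (fun t => (T.chopRoot y u hv hu hl).IsOpSet t _)
        (Set.image_injective.2 Subtype.val_injective (h'.trans ?_))).mp this
      exact (image_val_mk (Subtype.val : subE {y}ᶜ _ → T.Edge) (fun x => (hmem x.1).2 x.2) _).symm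

/-! ### Inner faces -/

section contract

variable {u w : T.Vertex} (h : T.below (T.out u) = some w)

theorem ne_of_below_out {u w : T.Vertex} (h : T.below (T.out u) = some w) : w ≠ u := by
  rintro rfl
  exact below_out_ne _ h

theorem contract_below_iff (x : (T.contract u w h).Edge) (v : (T.contract u w h).Vertex) :
    (T.contract u w h).below x = some v ↔
      T.below x.1 = some v.1 ∨ (T.below x.1 = some u ∧ v.1 = w) := by
  classical
  let b : T.Vertex → {v : T.Vertex // v ≠ u} := fun v => if hv : v = u then
    ⟨w, ne_of_below_out h⟩ else ⟨v, hv⟩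
  have hb1 : (b u).1 = w := by simp only [b, dif_pos]
  have hb2 : ∀ v, v ≠ u → (b v).1 = v := fun v hv => by simp only [b, dif_neg hv]
  have hb : (T.contract u w h).below x = (T.below x.1).map b := rfl
  refine Iff.trans (iff_of_eq (congrArg (fun t => t = some v) hb)) ?_
  refine Option.map_eq_some_iff.trans ?_
  constructor
  · rintro ⟨z, hz, hzv⟩
    have hzv' : (b z).1 = v.1 := congrArg Subtype.val hzv
    by_cases hzu : z = u
    · subst hzu
      exact Or.inr ⟨hz, hzv'.symm.trans hb1⟩
    · rw [hb2 z hzu] at hzv'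
      exact Or.inl (hz.trans (congrArg some hzv'))
  · rintro (h1 | ⟨h1, h2⟩)
    · exact ⟨v.1, h1, Subtype.ext (hb2 _ v.2)⟩
    · exact ⟨u, h1, Subtype.ext (hb1.trans h2.symm)⟩

/-- The operations of an inner face are the operations of the tree. -/
theorem contract_isOpSet {L : Set (T.contract u w h).Edge} {d : (T.contract u w h).Edge}
    (hL : T.IsOpSet (Subtype.val '' L) d.1) : (T.contract u w h).IsOpSet L d := by
  obtain ⟨W, hW, hl⟩ := hL
  have huw := ne_of_below_out h
  -- The root and the leaves of the subtree are edges of the contracted tree, hence different from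
  -- `T.out u`. So `W` contains both ends of the contracted edge or neither, and it descends to a
  -- set of vertices of the inner face.
  have h1 : w ∈ W → u ∈ W := by
    intro hw
    by_contra hu
    have : T.out u ∈ lv W d.1 := ⟨Or.inr ⟨w, hw, h⟩, fun v hv hvu => hu (T.out_injective hvu ▸ hv)⟩
    rw [hl] at this
    obtain ⟨x, -, hx⟩ := this
    exact x.2 hx
  have h2 : u ∈ W → w ∈ W := by
    intro hu
    rcases hW u hu with h' | ⟨w', hw', h'⟩
    · exact absurd h'.symm d.2
    · rw [h] at h'
      cases h'
      exact hw'
  refine ⟨{v | v.1 ∈ W}, ?_, ?_⟩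
  · intro v hv
    rcases hW v.1 hv with h' | ⟨w', hw', h'⟩
    · exact Or.inl (Subtype.ext h')
    · by_cases hwu : w' = u
      · subst hwu
        exact Or.inr ⟨⟨w, huw⟩, h2 hw', (contract_below_iff h _ _).2 (Or.inr ⟨h', rfl⟩)⟩
      · exact Or.inr ⟨⟨w', hwu⟩, hw', (contract_below_iff h _ _).2 (Or.inl h')⟩
  · ext x
    have hx : x ∈ L ↔ x.1 ∈ lv W d.1 := by
      rw [hl]
      exact ⟨fun h => ⟨x, h, rfl⟩, fun ⟨y, hy, hyx⟩ => Subtype.ext hyx ▸ hy⟩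
    rw [hx]
    constructor
    · rintro ⟨hx1, hx2⟩
      refine ⟨?_, ?_⟩
      · rcases hx1 with rfl | ⟨v, hv, hxv⟩
        · exact Or.inl rfl
        · rcases (contract_below_iff h _ _).1 hxv with h' | ⟨h', h''⟩
          · exact Or.inr ⟨v.1, hv, h'⟩
          · exact Or.inr ⟨u, h1 (h'' ▸ hv), h'⟩
      · rintro v hv hvx
        by_cases hvu : v = u
        · subst hvu
          exact x.2 hvx.symm
        · exact hx2 ⟨v, hvu⟩ hv (Subtype.ext hvx)
    · rintro ⟨hx1, hx2⟩
      refine ⟨?_, ?_⟩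
      · rcases hx1 with hx | ⟨v, hv, hxv⟩
        · exact Or.inl (Subtype.ext hx)
        · by_cases hvu : v = u
          · subst hvu
            exact Or.inr ⟨⟨w, huw⟩, h2 hv, (contract_below_iff h _ _).2 (Or.inr ⟨hxv, rfl⟩)⟩
          · exact Or.inr ⟨⟨v, hvu⟩, hv, (contract_below_iff h _ _).2 (Or.inl hxv)⟩
      · intro v hv hvx
        exact hx2 v.1 hv (congrArg Subtype.val hvx)

theorem cl_pair {u w : T.Vertex} (h : T.below (T.out u) = some w) : Cl {u, w} (T.out w) := by
  rintro v (rfl | rfl)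
  · exact Or.inr ⟨w, by simp, h⟩
  · exact Or.inl rfl

theorem lv_pair {u w : T.Vertex} (h : T.below (T.out u) = some w) : lv {u, w} (T.out w) = (inp w \ {T.out u}) ∪ inp u := by
  have := graft_one (cl_singleton w) (l := T.out u) (by rw [lv_singleton]; exact h) (cl_singleton u)
  rw [lv_singleton, lv_singleton, Set.union_singleton] at this
  exact this.2.1

theorem contract_inp (y : (T.contract u w h).Vertex) (hy : y.1 ≠ w) :
    Subtype.val '' inp y = inp y.1 := by
  ext x
  constructor
  · rintro ⟨x, hx, rfl⟩
    rcases (contract_below_iff h _ _).1 hx with h' | ⟨-, h'⟩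
    · exact h'
    · exact absurd h' hy
  · intro hx
    refine ⟨⟨x, ?_⟩, (contract_below_iff h _ _).2 (Or.inl hx), rfl⟩
    rintro rfl
    exact hy (Option.some_injective _ (hx.symm.trans h))

theorem contract_inp_merged (y : (T.contract u w h).Vertex) (hy : y.1 = w) :
    Subtype.val '' inp y = lv {u, w} (T.out w) := by
  rw [lv_pair h]
  ext x
  constructor
  · rintro ⟨x, hx, rfl⟩
    rcases (contract_below_iff h _ _).1 hx with h' | ⟨h', -⟩
    · exact Or.inl ⟨hy ▸ h', x.2⟩
    · exact Or.inr h'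
  · rintro (⟨hx, hxu⟩ | hx)
    · exact ⟨⟨x, hxu⟩, (contract_below_iff h _ _).2 (Or.inl (hy ▸ hx)), rfl⟩
    · refine ⟨⟨x, ?_⟩, (contract_below_iff h _ _).2 (Or.inr ⟨hx, hy⟩), rfl⟩
      rintro rfl
      exact below_out_ne u hx

/-- A map of trees that avoids an inner edge factors through the inner face. -/
theorem exists_contractLift {S : Tree} (f : S ⟶ T) (hf : ∀ x, ed f x ≠ T.out u) :
    ∃ g : S ⟶ T.contract u w h, g ≫ T.contractMap u w h = f := by
  refine ⟨homOfSet (T := T.contract u w h) (fun x => (⟨ed f x, hf x⟩ : {x // x ≠ T.out u}))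
    (fun v _ hx _ hy hxy => (hom_isOpSet f (isOpSet_inp v)).1 hx hy (congrArg
      (fun t : {x // x ≠ T.out u} => t.1) hxy)) (fun v => ?_), hom_ext fun _ => rfl⟩
  apply contract_isOpSet
  refine (congrArg (fun t => T.IsOpSet t (ed f (S.out v))) (image_val_mk (ed f) hf _)).mpr ?_
  exact (hom_isOpSet f (isOpSet_inp v)).2

theorem contractMap_mono {S : Tree} {f g : S ⟶ T.contract u w h}
    (hfg : f ≫ T.contractMap u w h = g ≫ T.contractMap u w h) : f = g :=
  hom_ext fun x => Subtype.ext (congrArg (fun k => ed k x) hfg)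

end contract

/-- All these inclusions are injective on edges, and maps of trees are determined by their edges. -/
theorem Face.incl_mono {a : Face T} {S : Tree} {f g : S ⟶ a.tree} (h : f ≫ a.incl = g ≫ a.incl) :
    f = g := by
  cases a with
  | inner u w h' => exact contractMap_mono h' h
  | top v hv hl =>
    exact hom_ext fun x => Subtype.ext (congrArg (fun k => ed k x) h)
  | bottom v u hv hu hl =>
    exact hom_ext fun x => Subtype.ext (congrArg (fun k => ed k x) h)
  | edge x _ => exact hom_ext fun x => rfl

end Tree
end Dendroidal

/-! ### Elements of dendroidal sets, and horns as families on faces -/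

namespace Dendroidal

open Dendroidal.Tree

variable {D : DSet.{u}}

/-- The restriction of an element of a dendroidal set along a map of trees. -/
def res {S T : Tree} (f : S ⟶ T) (x : D.obj (op T)) : D.obj (op S) := D.map f.op x

theorem res_res {R S T : Tree} (f : R ⟶ S) (g : S ⟶ T) (x : D.obj (op T)) :
    res f (res g x) = res (f ≫ g) x := by
  simp [res]

theorem res_id {T : Tree} (x : D.obj (op T)) : res (𝟙 T) x = x := by
  simp [res]

theorem yoneda_app {T : Tree} (g : rep.{u} T ⟶ D) {S : Tree} (f : S ⟶ T) :
    g.app (op S) ⟨f⟩ = res f (g.app (op T) ⟨𝟙 T⟩) := by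
  have := NatTrans.naturality_apply g f.op ⟨𝟙 T⟩
  refine Eq.trans ?_ this
  congr 1

theorem rep_hom_ext {T : Tree} {g g' : rep.{u} T ⟶ D}
    (h : g.app (op T) ⟨𝟙 T⟩ = g'.app (op T) ⟨𝟙 T⟩) : g = g' := by
  ext ⟨S⟩ ⟨f⟩
  exact (yoneda_app g f).trans ((congrArg (res f) h).trans (yoneda_app g' f).symm)

theorem exists_rep_hom {T : Tree} (x : D.obj (op T)) :
    ∃ g : rep.{u} T ⟶ D, ∀ S (f : S ⟶ T), g.app (op S) ⟨f⟩ = res f x := by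
  refine ⟨{ app := fun S => ↾fun f => res f.down x, naturality := ?_ }, fun S f => rfl⟩
  rintro ⟨S⟩ ⟨R⟩ φ
  ext ⟨f⟩
  exact (res_res φ.unop f x).symm

theorem mem_horn {T : Tree} {a : T.Face} {S : Tree} (f : S ⟶ T) :
    (⟨f⟩ : (rep.{u} T).obj (op S)) ∈ (horn.{u} T a).obj (op S) ↔
      ∃ b : T.Face, b ≠ a ∧ ∃ g : S ⟶ b.tree, g ≫ b.incl = f := by
  have h : (horn.{u} T a).obj (op S) = ⋃ (b : T.Face) (_ : b ≠ a),
      (Subfunctor.range (uliftYoneda.{u}.map b.incl)).obj (op S) := by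
    simp only [horn, Subfunctor.iSup_obj]
  rw [h]
  refine Set.mem_iUnion₂.trans ?_
  constructor
  · rintro ⟨b, hb, ⟨g⟩, hg⟩
    exact ⟨b, hb, g, congrArg ULift.down hg⟩
  · rintro ⟨b, hb, g, rfl⟩
    exact ⟨b, hb, ⟨g⟩, rfl⟩

/-- A family of elements on all faces except one. -/
abbrev Fam (D : DSet.{u}) {T : Tree} (a : T.Face) := ∀ b : T.Face, b ≠ a → D.obj (op b.tree)

/-- A family of elements on faces is compatible if the elements agree where the faces intersect. -/
def Fam.Compat {T : Tree} {a : T.Face} (x : Fam D a) : Prop :=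
  ∀ b hb b' hb' (S : Tree) (f : S ⟶ b.tree) (f' : S ⟶ b'.tree), f ≫ b.incl = f' ≫ b'.incl →
    res f (x b hb) = res f' (x b' hb')

/-- Compatibility makes the element assigned to a map into the horn independent of the face through
which it factors. This gives a map out of the horn, and the filler is read off at the identity of
`T`. -/
theorem IsFullyKan.exists_fill (h : IsFullyKan D) {T : Tree} (a : T.Face) (x : Fam D a)
    (hx : x.Compat) : ∃ y : D.obj (op T), ∀ b hb, res b.incl y = x b hb := by
  have key : ∀ (S : Tree) (f : (horn.{u} T a).toFunctor.obj (op S)), ∃ z : D.obj (op S),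
      ∀ b hb (g : S ⟶ b.tree), g ≫ b.incl = f.1.down → res g (x b hb) = z := by
    rintro S ⟨⟨f⟩, hf⟩
    obtain ⟨b, hb, g, rfl⟩ := (mem_horn f).1 hf
    exact ⟨res g (x b hb), fun b' hb' g' h' => hx _ _ _ _ _ _ _ h'⟩
  choose z hz using key
  obtain ⟨g, hg⟩ := h T a
    { app := fun S => ↾fun f => z S.unop f
      naturality := by
        rintro ⟨S⟩ ⟨R⟩ φ
        ext f
        obtain ⟨⟨f⟩, hf⟩ := f
        obtain ⟨b, hb, g, rfl⟩ := (mem_horn f).1 hf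
        change z R _ = res φ.unop (z S _)
        rw [← hz S ⟨⟨g ≫ b.incl⟩, hf⟩ b hb g rfl, res_res]
        exact (hz R _ b hb (φ.unop ≫ g) (Category.assoc _ _ _)).symm }
  refine ⟨g.app (op T) ⟨𝟙 T⟩, fun b hb => ?_⟩
  rw [← yoneda_app]
  have hm := (mem_horn.{u} b.incl).2 ⟨b, hb, 𝟙 _, Category.id_comp _⟩
  have h2 := congrArg (fun k => k.app (op b.tree) ⟨⟨b.incl⟩, hm⟩) hg
  refine Eq.trans h2 ?_
  change z b.tree _ = _
  rw [← hz b.tree ⟨⟨b.incl⟩, hm⟩ b hb (𝟙 _) (Category.id_comp _), res_id]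

theorem IsStrictlyFullyKan.ext (h : IsStrictlyFullyKan D) {T : Tree} (hT : Nontrivial T.Vertex)
    (a : T.Face) {x y : D.obj (op T)} (hxy : ∀ b, b ≠ a → res b.incl x = res b.incl y) : x = y := by
  obtain ⟨g, hg⟩ := exists_rep_hom x
  obtain ⟨g', hg'⟩ := exists_rep_hom y
  have : g = g' := h.2 T hT a g g' (by
    ext ⟨S⟩ ⟨⟨f⟩, hf⟩
    obtain ⟨b, hb, k, rfl⟩ := (mem_horn f).1 hf
    change g.app (op S) ⟨k ≫ b.incl⟩ = g'.app (op S) ⟨k ≫ b.incl⟩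
    rw [hg, hg', ← res_res, ← res_res, hxy b hb])
  rw [← res_id x, ← res_id y, ← hg, ← hg', this]

/-- The same dictionary in the opposite direction: a map out of the horn is determined by its values
on the inclusions of the faces, and these values are compatible by naturality. -/
theorem isStrictlyFullyKan_of
    (h : ∀ (T : Tree) (a : T.Face) (x : Fam D a), x.Compat → ∃ y : D.obj (op T), ∀ b hb,
      res b.incl y = x b hb)
    (h' : ∀ (T : Tree), Nontrivial T.Vertex → ∀ (a : T.Face) (x y : D.obj (op T)),
      (∀ b, b ≠ a → res b.incl x = res b.incl y) → x = y) : IsStrictlyFullyKan D := by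
  refine ⟨fun T a f => ?_, fun T hT a g g' hg => ?_⟩
  · have hm : ∀ b, b ≠ a → (⟨b.incl⟩ : (rep.{u} T).obj (op b.tree)) ∈
        (horn.{u} T a).obj (op b.tree) :=
      fun b hb => (mem_horn.{u} b.incl).2 ⟨b, hb, 𝟙 _, Category.id_comp _⟩
    have hf : ∀ b hb S (g : S ⟶ b.tree) (hg : (⟨g ≫ b.incl⟩ : (rep.{u} T).obj (op S)) ∈
        (horn.{u} T a).obj (op S)), f.app (op S) ⟨⟨g ≫ b.incl⟩, hg⟩ =
        res g (f.app (op b.tree) ⟨⟨b.incl⟩, hm b hb⟩) := by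
      intro b hb S g hg
      exact NatTrans.naturality_apply f g.op ⟨⟨b.incl⟩, hm b hb⟩
    obtain ⟨y, hy⟩ := h T a (fun b hb => f.app (op b.tree) ⟨⟨b.incl⟩, hm b hb⟩) (by
      intro b hb b' hb' S g g' hgg
      rw [← hf b hb S g ((mem_horn _).2 ⟨b, hb, g, rfl⟩),
        ← hf b' hb' S g' ((mem_horn _).2 ⟨b', hb', g', rfl⟩)]
      congr 1
      exact Subtype.ext (congrArg ULift.up hgg))
    obtain ⟨g, hg⟩ := exists_rep_hom y
    refine ⟨g, ?_⟩
    ext ⟨S⟩ ⟨⟨k⟩, hk⟩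
    obtain ⟨b, hb, k, rfl⟩ := (mem_horn k).1 hk
    refine Eq.trans ?_ (hf b hb S k hk).symm
    rw [← hy b hb, res_res]
    exact hg _ _
  · refine rep_hom_ext (h' T hT a _ _ fun b hb => ?_)
    rw [← yoneda_app, ← yoneda_app]
    exact congrArg (fun k => k.app (op b.tree) ⟨⟨b.incl⟩,
      (mem_horn.{u} b.incl).2 ⟨b, hb, 𝟙 _, Category.id_comp _⟩⟩) hg

/-! ### The Segal condition -/

/-- Elements of a dendroidal set are determined by their edges and vertices. -/
def Separated (D : DSet.{u}) : Prop :=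
  ∀ (T : Tree) (x y : D.obj (op T)), (∀ e, res (edgeMap T e) x = res (edgeMap T e) y) →
    (∀ v : T.Vertex, res (vmap v) x = res (vmap v) y) → x = y

/-- Elements of `D` on the vertices of a tree can be put together to an element on the tree. -/
def Fillable (D : DSet.{u}) (T : Tree) : Prop :=
  ∀ (κ : T.Edge → D.obj (op eta)) (s : ∀ v : T.Vertex, D.obj (op (cor (inp v)))),
    (∀ v, res (edgeMap _ rt) (s v) = κ (T.out v)) →
    (∀ v i, res (edgeMap _ (leaf i)) (s v) = κ i.1) →
    ∃ x : D.obj (op T), (∀ e, res (edgeMap T e) x = κ e) ∧ ∀ v, res (vmap v) x = s v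

/-- The Segal condition. -/
def Segal (D : DSet.{u}) : Prop := Separated D ∧ ∀ T, Fillable D T

theorem edgeMap_comp {S T : Tree} (f : S ⟶ T) (e : S.Edge) :
    edgeMap S e ≫ f = edgeMap T (ed f e) := hom_ext fun _ => rfl

theorem res_edge {S T : Tree} (f : S ⟶ T) (e : S.Edge) (x : D.obj (op T)) :
    res (edgeMap S e) (res f x) = res (edgeMap T (ed f e)) x := by
  rw [res_res, edgeMap_comp]

theorem corMap_symm {A B : Type} [Finite A] [Finite B] (e : A ≃ B) :
    corMap e.symm ≫ corMap e = 𝟙 _ :=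
  cor_hom_ext rfl fun i => congrArg leaf (e.apply_symm_apply i)

theorem res_corMap_injective {A B : Type} [Finite A] [Finite B] (e : A ≃ B)
    {x y : D.obj (op (cor B))} (h : res (corMap e) x = res (corMap e) y) : x = y := by
  have := congrArg (res (corMap e.symm)) h
  rwa [res_res, res_res, corMap_symm, res_id, res_id] at this

end Dendroidal

/-! ### Outer vertices, and the faces that contain a given subtree -/

namespace Dendroidal

namespace Tree

variable {T : Tree}

theorem cl_univ : Cl (Set.univ : Set T.Vertex) T.root := by
  intro z _
  rcases h : T.below (T.out z) with _ | w
  · exact Or.inl ((T.below_eq_none _).1 h)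
  · exact Or.inr ⟨w, trivial, rfl⟩

/-- The operation of a tree from all leaves to the root. -/
def total (T : Tree) : cor (lv (Set.univ : Set T.Vertex) T.root) ⟶ T :=
  corHom (fun x => x.1) T.root Subtype.val_injective (by
    rw [Subtype.range_val]
    exact ⟨_, cl_univ, rfl⟩)

theorem exists_corMap_total {A : Type} [Finite A] (f : cor A ⟶ T) (h : ed f rt = T.root)
    (h' : (Set.range fun i => ed f (leaf i)) = lv Set.univ T.root) :
    ∃ e : A ≃ lv (Set.univ : Set T.Vertex) T.root, f = corMap e ≫ total T := by
  have hm : ∀ i, ed f (leaf i) ∈ lv Set.univ T.root := fun i => by rw [← h']; exact ⟨i, rfl⟩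
  refine ⟨Equiv.ofBijective (fun i => ⟨ed f (leaf i), hm i⟩) ⟨?_, ?_⟩, cor_hom_ext h fun i => rfl⟩
  · intro i j hij
    exact cor_hom_injective f (congrArg Subtype.val hij)
  · rintro ⟨x, hx⟩
    rw [← h'] at hx
    obtain ⟨i, rfl⟩ := hx
    exact ⟨i, rfl⟩

theorem exists_root_vertex (v : T.Vertex) : ∃ r : T.Vertex, T.out r = T.root := by
  obtain ⟨r, -, hr⟩ := Set.exists_min_image (Set.univ : Set T.Vertex) (fun v => T.ht (T.out v))
    (Set.toFinite _) ⟨v, trivial⟩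
  refine ⟨r, (T.below_eq_none _).1 ?_⟩
  rcases h : T.below (T.out r) with _ | w
  · rfl
  · have := hr w trivial
    have := ht_lt h
    omega

theorem exists_vertex_of_edge (v : T.Vertex) (e : T.Edge) :
    ∃ v : T.Vertex, e = T.out v ∨ e ∈ inp v := by
  rcases h : T.below e with _ | w
  · obtain ⟨r, hr⟩ := exists_root_vertex v
    exact ⟨r, Or.inl (by rw [hr, ← T.below_eq_none, h])⟩
  · exact ⟨w, Or.inr h⟩

theorem Le.exists_out {v : T.Vertex} {z : T.Edge} (h : Le (T.out v) z) : ∃ q, T.out q = z := by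
  rcases Relation.ReflTransGen.cases_tail h with h | ⟨y, -, q, -, hq⟩
  · exact ⟨v, h.symm⟩
  · exact ⟨q, hq⟩

theorem le_root (x : T.Edge) : Le x T.root := by
  refine subE_le cl_univ ?_
  rcases h : T.below x with _ | w
  · exact Or.inl ((T.below_eq_none _).1 h)
  · exact Or.inr ⟨w, trivial, h⟩

/-- Outside a proper subtree there is a vertex with exactly one inner edge attached to it. -/
theorem exists_outer {W : Set T.Vertex} {m : T.Vertex} (hm : m ∈ W) (hW : Cl W (T.out m))
    (hne : W ≠ Set.univ) : ∃ y ∉ W, ∃ a : T.Face, a.IsOuter y := by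
  by_cases htop : ∃ y ∉ W, ∀ u, T.below (T.out u) ≠ some y
  · obtain ⟨y, hy, htop⟩ := htop
    -- The path from `T.out m` to the root ends with the root vertex. If that were `y`, then either
    -- `y = m` or some vertex is attached above `y`.
    have hyr : T.out y ≠ T.root := by
      intro hyr
      rcases Relation.ReflTransGen.cases_tail (le_root (T.out m)) with h | ⟨z, hz, v, h1, h2⟩
      · exact hy (T.out_injective (hyr.trans h) ▸ hm)
      · obtain rfl : v = y := T.out_injective (h2.trans hyr.symm)
        obtain ⟨q, rfl⟩ := Le.exists_out hz
        exact htop q h1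
    exact ⟨y, hy, Face.top y hyr htop, Or.inl ⟨_, _, rfl⟩⟩
  -- From here on, every vertex outside `W` has a vertex attached above it.
  push Not at htop
  obtain ⟨r, hr⟩ := exists_root_vertex m
  have hcl : ∀ q ∈ W, ∀ y ∉ W, T.below (T.out q) = some y → q = m := by
    intro q hq y hy h
    rcases hW q hq with h' | ⟨w, hw, h'⟩
    · exact T.out_injective h'
    · rw [h] at h'
      cases h'
      exact absurd hw hy
  have hrW : r ∉ W := by
    intro hrW
    obtain ⟨v, hv, hmax⟩ := Set.exists_max_image Wᶜ (fun v => T.ht (T.out v)) (Set.toFinite _)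
      (Set.nonempty_compl.2 hne)
    obtain ⟨u, hu⟩ := htop v hv
    by_cases huW : u ∈ W
    · obtain rfl := hcl u huW v hv hu
      rcases hW r hrW with h' | ⟨w, hw, h'⟩
      · rw [← h', hr, below_root] at hu
        cases hu
      · rw [hr, below_root] at h'
        cases h'
    · have := hmax u huW
      have := ht_lt hu
      omega
  choose! σ hσ using htop
  have hσr : ∀ v ∉ W, σ v ≠ r := by
    intro v hv h
    have := hσ v hv
    rw [h, hr, below_root] at this
    cases this
  have hσi : ∀ v ∉ W, ∀ v' ∉ W, σ v = σ v' → v = v' := by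
    intro v hv v' hv' h
    have h1 := hσ v hv
    rw [h, hσ v' hv'] at h1
    cases h1
    rfl
  classical
  -- A counting argument. The vertex `σ v` above `v` is outside `W` or equal to `m`, and it is never
  -- the root vertex `r`. Replacing the value `m` by `r` gives an injective self-map of a finite
  -- set, hence a bijection. So every vertex attached to the root vertex is `σ r`, and `r` has
  -- exactly one inner edge.
  let τ : {v // v ∉ W} → {v // v ∉ W} := fun v =>
    if h : σ v.1 = m then ⟨r, hrW⟩ else ⟨σ v.1, fun h' => h (hcl _ h' v.1 v.2 (hσ v.1 v.2))⟩
  have hτ1 : ∀ v, σ v.1 = m → (τ v).1 = r := fun v h => by simp only [τ, dif_pos h]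
  have hτ2 : ∀ v, σ v.1 ≠ m → (τ v).1 = σ v.1 := fun v h => by simp only [τ, dif_neg h]
  have hτi : Function.Injective τ := by
    intro v v' h
    have h' := congrArg Subtype.val h
    apply Subtype.ext
    apply hσi _ v.2 _ v'.2
    by_cases h1 : σ v.1 = m <;> by_cases h2 : σ v'.1 = m
    · rw [h1, h2]
    · rw [hτ1 v h1, hτ2 v' h2] at h'
      exact absurd h'.symm (hσr _ v'.2)
    · rw [hτ2 v h1, hτ1 v' h2] at h'
      exact absurd h' (hσr _ v.2)
    · rwa [hτ2 v h1, hτ2 v' h2] at h'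
  have hτs := Finite.surjective_of_injective hτi
  refine ⟨r, hrW, Face.bottom r (σ r) hr (hσ r hrW) ?_, Or.inr ⟨_, _, _, _, rfl⟩⟩
  intro u hu
  have hur : u ≠ r := by
    rintro rfl
    exact below_out_ne _ hu
  by_cases huW : u ∈ W
  · obtain rfl := hcl u huW r hrW hu
    obtain ⟨v, hv⟩ := hτs ⟨r, hrW⟩
    have hv' := congrArg Subtype.val hv
    by_cases h1 : σ v.1 = u
    · have := hσ v.1 v.2
      rw [h1, hu] at this
      cases this
      exact h1.symm
    · rw [hτ2 v h1] at hv'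
      exact absurd hv' (hσr _ v.2)
  · obtain ⟨v, hv⟩ := hτs ⟨u, huW⟩
    have hv' := congrArg Subtype.val hv
    by_cases h1 : σ v.1 = m
    · rw [hτ1 v h1] at hv'
      exact absurd hv'.symm hur
    · rw [hτ2 v h1] at hv'
      have := hσ v.1 v.2
      change σ v.1 = u at hv'
      rw [hv', hu] at this
      cases this
      exact hv'.symm

theorem Face.IsOuter.exists_lift {a : Face T} {x : T.Vertex} (h : a.IsOuter x) {W : Set T.Vertex}
    {m : T.Vertex} (hm : m ∈ W) (hW : Cl W (T.out m)) (hx : x ∉ W) :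
    ∃ g : sub W (T.out m) hW ⟶ a.tree, g ≫ a.incl = subι hW := by
  obtain ⟨d, hd, k, k', h1, h2, -, -⟩ := h.exists_sub
  have hs : W ⊆ {x}ᶜ := by
    rintro v hv rfl
    exact hx hv
  exact ⟨subIncl hd hW hs (hd.out_mem (hs hm)) ≫ k', by rw [Category.assoc, h2, subIncl_ι]⟩

/-- The root of the subtree is the output of a vertex of `W`, and its other edges are inputs of
vertices of `W`. If both ends of an inner edge are outside `W`, this edge is not among them. -/
theorem inner_exists_lift {u w : T.Vertex} (h : T.below (T.out u) = some w) {W : Set T.Vertex}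
    {m : T.Vertex} (hm : m ∈ W) (hW : Cl W (T.out m)) (hu : u ∉ W) (hw : w ∉ W) :
    ∃ g : sub W (T.out m) hW ⟶ (Face.inner u w h).tree, g ≫ (Face.inner u w h).incl = subι hW := by
  refine exists_contractLift h _ ?_
  rintro ⟨x, rfl | ⟨q, hq, hx⟩⟩ hxu
  · exact hu (T.out_injective hxu ▸ hm)
  · obtain rfl : x = T.out u := hxu
    rw [h] at hx
    cases hx
    exact hw hq

theorem Face.IsOuter.ne_inner {a : Face T} {x : T.Vertex} (ha : a.IsOuter x) {u w : T.Vertex} (h) :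
    Face.inner u w h ≠ a := by
  rintro rfl
  rcases ha with ⟨_, _, h⟩ | ⟨_, _, _, _, h⟩ <;> cases h

theorem Face.IsOuter.eq {a b : Face T} {x : T.Vertex} (ha : a.IsOuter x) (hb : b.IsOuter x) :
    a = b := by
  rcases ha with ⟨h1, h2, rfl⟩ | ⟨u, h1, h2, h3, rfl⟩ <;>
    rcases hb with ⟨h1', h2', rfl⟩ | ⟨u', h1', h2', h3', rfl⟩
  · rfl
  · exact absurd h1' h1
  · exact absurd h1 h1'
  · obtain rfl := h3' _ h2
    rfl

/-- The inner edge attached to an outer vertex. -/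
theorem Face.IsOuter.exists_inner {a : Face T} {x : T.Vertex} (ha : a.IsOuter x) :
    ∃ p q, T.below (T.out p) = some q ∧ (x = p ∨ x = q) := by
  rcases ha with ⟨h1, h2, rfl⟩ | ⟨u, h1, h2, h3, rfl⟩
  · rw [ne_eq, ← T.below_eq_none, ← ne_eq, Option.ne_none_iff_exists'] at h1
    obtain ⟨w, hw⟩ := h1
    exact ⟨x, w, hw, Or.inl rfl⟩
  · exact ⟨u, x, h2, Or.inr rfl⟩

/-- A proper subtree is contained in a face different from a given one, except in a special case. -/
theorem exists_face_lift (a : T.Face) {W : Set T.Vertex} {m : T.Vertex} (hm : m ∈ W)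
    (hW : Cl W (T.out m)) (hne : W ≠ Set.univ) :
    (∃ c, c ≠ a ∧ ∃ g : sub W (T.out m) hW ⟶ c.tree, g ≫ c.incl = subι hW) ∨
      ∃ y ∉ W, a.IsOuter y ∧ insert y W = Set.univ := by
  obtain ⟨x, hx, b, hb⟩ := exists_outer hm hW hne
  by_cases hba : b = a
  swap
  · exact Or.inl ⟨b, hba, hb.exists_lift hm hW hx⟩
  subst hba
  by_cases huniv : insert x W = Set.univ
  · exact Or.inr ⟨x, hx, hb, huniv⟩
  -- If adding `x` gives a subtree, which is still proper, then a second outer vertex outside it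
  -- supplies a face different from `b`.
  have hfin : ∀ m' ∈ insert x W, Cl (insert x W) (T.out m') →
      (∃ c, c ≠ b ∧ ∃ g : sub W (T.out m) hW ⟶ c.tree, g ≫ c.incl = subι hW) := by
    intro m' hm' hW'
    obtain ⟨x', hx', b', hb'⟩ := exists_outer hm' hW' huniv
    refine ⟨b', ?_, hb'.exists_lift hm hW fun h => hx' (Or.inr h)⟩
    rintro rfl
    exact hx' (Or.inl (hb'.unique hb))
  left
  -- The inner edge of `x` either joins it to `W`, and then adding `x` gives a subtree, or has both
  -- ends outside `W`, and then the inner face at this edge contains `W`.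
  rcases id hb with ⟨h1, h2, h⟩ | ⟨u, h1, h2, h3, h⟩
  · rw [ne_eq, ← T.below_eq_none, ← ne_eq, Option.ne_none_iff_exists'] at h1
    obtain ⟨w, hw⟩ := h1
    by_cases hwW : w ∈ W
    · refine hfin m (Or.inr hm) ?_
      rintro v (rfl | hv)
      · exact Or.inr ⟨w, Or.inr hwW, hw⟩
      · rcases hW v hv with h' | ⟨w', hw', h'⟩
        · exact Or.inl h'
        · exact Or.inr ⟨w', Or.inr hw', h'⟩
    · exact ⟨_, hb.ne_inner hw, inner_exists_lift hw hm hW hx hwW⟩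
  · by_cases huW : u ∈ W
    · have hum : u = m := by
        rcases hW u huW with h' | ⟨w', hw', h'⟩
        · exact T.out_injective h'
        · rw [h2] at h'
          cases h'
          exact absurd hw' hx
      refine hfin x (Or.inl rfl) ?_
      rintro v (rfl | hv)
      · exact Or.inl rfl
      · rcases hW v hv with h' | ⟨w', hw', h'⟩
        · rw [T.out_injective h', ← hum]
          exact Or.inr ⟨x, Or.inl rfl, h2⟩
        · exact Or.inr ⟨w', Or.inr hw', h'⟩
    · exact ⟨_, hb.ne_inner h2, inner_exists_lift h2 hm hW huW hx⟩

/-- The total operation factors through all inner faces. -/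
theorem exists_total_lift {A : Type} [Finite A] (f : cor A ⟶ T) (h : ed f rt = T.root)
    (h' : (Set.range fun i => ed f (leaf i)) = lv Set.univ T.root) {p q : T.Vertex}
    (hpq : T.below (T.out p) = some q) :
    ∃ g : cor A ⟶ (Face.inner p q hpq).tree, g ≫ (Face.inner p q hpq).incl = f := by
  refine exists_contractLift hpq f (cor_cases ?_ fun i hi => ?_)
  · rw [h]
    intro h
    rw [← h, below_root] at hpq
    cases hpq
  · have : ed f (leaf i) ∈ lv Set.univ T.root := by rw [← h']; exact ⟨i, rfl⟩
    exact this.2 p trivial hi.symm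

theorem contract_total {u w : T.Vertex} (h : T.below (T.out u) = some w) :
    (Set.range fun i => ed (total (T.contract u w h) ≫ T.contractMap u w h) (leaf i)) =
      lv Set.univ T.root := by
  ext x
  constructor
  · rintro ⟨i, rfl⟩
    refine ⟨?_, ?_⟩
    · have := le_root (i.1.1 : T.Edge)
      rcases h : T.below i.1.1 with _ | z
      · exact Or.inl ((T.below_eq_none _).1 h)
      · exact Or.inr ⟨z, trivial, h⟩
    · rintro v - hv
      by_cases hvu : v = u
      · subst hvu
        exact i.1.2 hv.symm
      · exact i.2.2 ⟨v, hvu⟩ trivial (Subtype.ext hv)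
  · rintro ⟨-, hx⟩
    refine ⟨⟨⟨x, fun h => hx u trivial h.symm⟩, ?_, ?_⟩, rfl⟩
    · rcases h' : (T.contract u w h).below ⟨x, fun h => hx u trivial h.symm⟩ with _ | z
      · exact Or.inl (((T.contract u w h).below_eq_none _).1 h')
      · exact Or.inr ⟨z, trivial, h'⟩
    · intro v _ hv
      exact hx v.1 trivial (congrArg Subtype.val hv)

end Tree

/-! ### Division conditions on trees with two vertices -/

open Dendroidal.Tree

variable {D : DSet.{u}}

/-- On trees with two vertices, elements are determined by their total operation and one of the
vertices. -/
def DivUnique (D : DSet.{u}) : Prop :=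
  ∀ (T : Tree) (v v' : T.Vertex), v ≠ v' → (∀ z, z = v ∨ z = v') → ∀ x y : D.obj (op T),
    (∀ e, res (edgeMap T e) x = res (edgeMap T e) y) → res (vmap v) x = res (vmap v) y →
    res (total T) x = res (total T) y → x = y

/-- On trees with two vertices, there are elements with given total operation and one of the
vertices. -/
def DivFill (D : DSet.{u}) : Prop :=
  ∀ (T : Tree) (v v' : T.Vertex), v ≠ v' → (∀ z, z = v ∨ z = v') → ∀ (κ : T.Edge → D.obj (op eta))
    (f : D.obj (op (cor (inp v)))) (t : D.obj (op (cor (lv (Set.univ : Set T.Vertex) T.root)))),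
    res (edgeMap _ rt) f = κ (T.out v) → (∀ i, res (edgeMap _ (leaf i)) f = κ i.1) →
    res (edgeMap _ rt) t = κ T.root → (∀ i, res (edgeMap _ (leaf i)) t = κ i.1) →
    ∃ x : D.obj (op T), (∀ e, res (edgeMap T e) x = κ e) ∧ res (vmap v) x = f ∧
      res (total T) x = t

/-- The horns of corollas have fillers. -/
def CorollaFill (D : DSet.{u}) : Prop :=
  ∀ (T : Tree) (v : T.Vertex), (∀ z, z = v) → ∀ (e : T.Edge) (κ : ∀ e', e' ≠ e → D.obj (op eta)),
    ∃ x : D.obj (op T), ∀ e' (h : e' ≠ e), res (edgeMap T e') x = κ e' h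

theorem exists_vmap_lift {T : Tree} {c : T.Face} {v : T.Vertex}
    (h : ∃ g : sub {v} (T.out v) (cl_singleton v) ⟶ c.tree, g ≫ c.incl = subι _) :
    ∃ g : cor (inp v) ⟶ c.tree, g ≫ c.incl = vmap v := by
  obtain ⟨g, hg⟩ := h
  obtain ⟨k, hk⟩ := exists_corLift (cl_singleton v) (vmap v) (by
    rw [lv_singleton]
    exact Subtype.range_val.symm) rfl
  exact ⟨k ≫ g, by rw [Category.assoc, hg, hk]⟩

/-- The faces different from `a` contain all edges. -/
theorem exists_edge_lift {T : Tree} (a : T.Face) (hT : Nontrivial T.Vertex) (e : T.Edge) :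
    ∃ c, c ≠ a ∧ ∃ e' : c.tree.Edge, ed c.incl e' = e := by
  obtain ⟨v0⟩ := hT.to_nonempty
  obtain ⟨v, hv⟩ := exists_vertex_of_edge v0 e
  have hsub : ∀ v : T.Vertex, e = T.out v ∨ e ∈ inp v →
      ∀ c : T.Face, (∃ g : cor (inp v) ⟶ c.tree, g ≫ c.incl = vmap v) →
      ∃ e' : c.tree.Edge, ed c.incl e' = e := by
    rintro v hv c ⟨g, hg⟩
    rcases hv with rfl | hv
    · exact ⟨ed g rt, by rw [← ed_comp, hg]; rfl⟩
    · exact ⟨ed g (leaf ⟨e, hv⟩), by rw [← ed_comp, hg]; rfl⟩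
  have hne : ∀ v : T.Vertex, ({v} : Set T.Vertex) ≠ Set.univ := by
    intro v h
    obtain ⟨z, hz⟩ := exists_ne v
    have : z ∈ ({v} : Set T.Vertex) := by rw [h]; trivial
    exact hz this
  rcases exists_face_lift a (Set.mem_singleton v) (cl_singleton v) (hne v) with
    ⟨c, hc, h⟩ | ⟨y, hy, hay, huniv⟩
  · exact ⟨c, hc, hsub v hv c (exists_vmap_lift h)⟩
  -- Now `T` has just two vertices and `a` is the outer face at `y`. The inner face contains every
  -- edge but the contracted one, and that edge belongs to the corolla of `y`, which lies in an
  -- outer face at another vertex.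
  · obtain ⟨p, q, hpq, hy'⟩ := hay.exists_inner
    by_cases hep : e = T.out p
    · obtain ⟨v', hv', b, hb⟩ := exists_outer (Set.mem_singleton y) (cl_singleton y) (hne y)
      refine ⟨b, ?_, hsub y ?_ b (exists_vmap_lift (hb.exists_lift (Set.mem_singleton y) _ hv'))⟩
      · rintro rfl
        exact hv' (hb.unique hay)
      · rcases hy' with rfl | rfl
        · exact Or.inl hep
        · exact Or.inr (by rw [hep]; exact hpq)
    · exact ⟨_, hay.ne_inner hpq, ⟨e, hep⟩, rfl⟩

end Dendroidal

/-! ### Filling horns by the Segal condition and division -/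

namespace Dendroidal

open Dendroidal.Tree

variable {D : DSet.{u}}

/-- An outer face is the subtree on the vertices other than `z`, so separatedness has to be tested
only there. The reindexing `k` is needed because the inputs of a vertex in the face and in `T` form
different types. -/
theorem eq_of_outer (hD : Separated D) {T : Tree} {b : T.Face} {z : T.Vertex} (hb : b.IsOuter z)
    {x y : D.obj (op b.tree)}
    (he : ∀ e, res (edgeMap b.tree e) x = res (edgeMap b.tree e) y)
    (hv : ∀ (A : Type) [Finite A] (f : cor A ⟶ b.tree) (v : T.Vertex) (k : A ≃ inp v), v ≠ z →
      f ≫ b.incl = corMap k ≫ vmap v → res f x = res f y) : x = y := by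
  obtain ⟨d, hd, k, k', h1, h2, h3, h4⟩ := hb.exists_sub
  have : res k' x = res k' y := by
    refine hD _ _ _ (fun e => ?_) fun v => ?_
    · rw [res_edge, res_edge, he]
    · obtain ⟨c, hc⟩ := sub_vmap hd v
      rw [res_res, res_res]
      exact hv _ _ v.1 c v.2 (by rw [Category.assoc, h2, hc])
  rw [← res_id x, ← res_id y, ← h3, ← res_res, ← res_res, this]

/-- The vertices of the contracted tree are the vertices of `T` apart from `u` and `w`, handled by
`hv`, and the merged vertex, handled by `hm`, whose corolla is the total operation of the subtree
`{u, w}`. -/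
theorem eq_of_inner (hD : Separated D) {T : Tree} {u w : T.Vertex} (h : T.below (T.out u) = some w)
    {x y : D.obj (op (T.contract u w h))}
    (he : ∀ e, res (edgeMap _ e) x = res (edgeMap _ e) y)
    (hv : ∀ (A : Type) [Finite A] (f : cor A ⟶ T.contract u w h) (v : T.Vertex) (k : A ≃ inp v),
      v ≠ u → v ≠ w → f ≫ T.contractMap u w h = corMap k ≫ vmap v → res f x = res f y)
    (hm : ∀ (A : Type) [Finite A] (f : cor A ⟶ T.contract u w h)
      (g : cor A ⟶ sub {u, w} (T.out w) (cl_pair h)),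
      f ≫ T.contractMap u w h = g ≫ subι (cl_pair h) →
      (Set.range fun i => ed (f ≫ T.contractMap u w h) (leaf i)) = lv {u, w} (T.out w) →
      ed (f ≫ T.contractMap u w h) rt = T.out w → res f x = res f y) : x = y := by
  refine hD _ _ _ he fun v => ?_
  have hr : (Set.range fun i => ed (vmap v ≫ T.contractMap u w h) (leaf i)) =
      Subtype.val '' inp v := by
    ext z
    exact ⟨fun ⟨i, hi⟩ => ⟨i.1, i.2, hi⟩, fun ⟨i, hi, hz⟩ => ⟨⟨i, hi⟩, hz⟩⟩
  by_cases hvw : v.1 = w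
  · have hr' := hr.trans (contract_inp_merged h v hvw)
    obtain ⟨g, hg⟩ := exists_corLift (cl_pair h) (vmap v ≫ T.contractMap u w h) hr'.symm
      (congrArg T.out hvw)
    exact hm _ _ g hg.symm hr' (congrArg T.out hvw)
  · obtain ⟨k, hk⟩ := exists_corMap_vmap (v := v.1) (vmap v ≫ T.contractMap u w h) rfl
      (hr.trans (contract_inp h v hvw))
    exact hv _ _ v.1 k v.2 hvw hk

/-- `y` agrees with the given elements on the faces on all edges and vertices. -/
structure Fam.Agree {T : Tree} {a : T.Face} (x : Fam D a) (y : D.obj (op T)) : Prop where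
  edge : ∀ b hb e, res (edgeMap b.tree e) (res b.incl y) = res (edgeMap b.tree e) (x b hb)
  vertex : ∀ b hb (A : Type) [Finite A] (f : cor A ⟶ b.tree) (v : T.Vertex) (k : A ≃ inp v),
    f ≫ b.incl = corMap k ≫ vmap v → res f (res b.incl y) = res f (x b hb)

/-- Only the merged vertex needs an argument. If the subtree `{u, w}` lies in another face `c` of
the horn, the two elements agree on it by separatedness, and compatibility of the family transfers
this to the merged operation. -/
theorem Fam.Agree.inner_eq (hD : Separated D) {T : Tree} {a : T.Face} {x : Fam D a}
    (hx : x.Compat) {y : D.obj (op T)} (hy : x.Agree y)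
    {u w : T.Vertex} (h : T.below (T.out u) = some w) (hb : Face.inner u w h ≠ a)
    (hc : ∃ c, c ≠ a ∧ ∃ g : sub {u, w} (T.out w) (cl_pair h) ⟶ c.tree, g ≫ c.incl = subι _) :
    res (Face.inner u w h).incl y = x _ hb := by
  refine eq_of_inner hD h (hy.edge _ hb) (fun A _ f v k _ _ hf => hy.vertex _ hb A f v k hf) ?_
  intro A _ f g hfg _ _
  obtain ⟨c, hca, k, hk⟩ := hc
  have h1 : res k (res c.incl y) = res k (x c hca) := by
    refine hD _ _ _ (fun e => ?_) fun v => ?_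
    · exact (res_edge k e _).trans ((hy.edge c hca _).trans (res_edge k e _).symm)
    · obtain ⟨e, he⟩ := sub_vmap (cl_pair h) v
      refine (res_res (vmap v) k _).trans (Eq.trans ?_ (res_res (vmap v) k _).symm)
      exact hy.vertex _ _ _ _ v.1 e (by rw [Category.assoc, hk, he])
  have h3 : f ≫ (Face.inner u w h).incl = (g ≫ k) ≫ c.incl := by
    rw [Category.assoc, hk]
    exact hfg
  have h2 : res f (x _ hb) = res (g ≫ k) (x c hca) := hx _ _ _ _ _ _ _ h3
  refine (res_res _ _ _).trans (Eq.trans ?_ h2.symm)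
  rw [h3, ← res_res (g ≫ k), ← res_res g k, ← res_res g k, h1]

theorem Fam.Agree.outer_eq (hD : Separated D) {T : Tree} {a : T.Face} {x : Fam D a}
    {y : D.obj (op T)} (hy : x.Agree y) {b : T.Face} (hb : b ≠ a) {z : T.Vertex}
    (hz : b.IsOuter z) : res b.incl y = x b hb :=
  eq_of_outer hD hz (hy.edge b hb) fun A _ f v k _ hf => hy.vertex b hb A f v k hf

theorem Face.edge_absurd {T : Tree} (hT : Nontrivial T.Vertex) (h : ∃! _ : T.Vertex, True) :
    False := by
  obtain ⟨v, -, hv⟩ := h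
  obtain ⟨z, hz⟩ := exists_ne v
  exact hz (hv z trivial)

theorem two_cover {X : Type*} {p q y v : X} (h : p ≠ q) (hz : ∀ z, z = y ∨ z = v) (z : X) :
    z = p ∨ z = q := by
  have := hz z
  have := hz p
  have := hz q
  grind

/-- Heights decrease along an inner edge, so a tree with two vertices has only one inner edge. -/
theorem out_eq_root_of_two {T : Tree} {p q p' q' : T.Vertex} (h : T.below (T.out p) = some q)
    (h' : T.below (T.out p') = some q') (h2 : ∀ z, z = p ∨ z = q) : p' = p ∧ q' = q := by
  have h3 := ht_lt h
  have h4 := ht_lt h'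
  rcases h2 p' with rfl | rfl <;> rcases h2 q' with rfl | rfl
  · omega
  · exact ⟨rfl, rfl⟩
  · omega
  · omega

theorem out_root_of_two {T : Tree} {p q : T.Vertex} (h : T.below (T.out p) = some q)
    (h2 : ∀ z, z = p ∨ z = q) : T.out q = T.root := by
  obtain ⟨r, hr⟩ := exists_root_vertex p
  rcases h2 r with rfl | rfl
  · rw [hr, below_root] at h
    cases h
  · exact hr

/-- A vertex of a tree with at least two vertices is contained in a face different from a given
one, unless the tree has two vertices and the given face is the face opposite to the other one. -/
theorem vertex_cover {T : Tree} (a : T.Face) (hT : Nontrivial T.Vertex) (v : T.Vertex) :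
    (∃ c, c ≠ a ∧ ∃ g : cor (inp v) ⟶ c.tree, g ≫ c.incl = vmap v) ∨
      ∃ y, y ≠ v ∧ a.IsOuter y ∧ ∀ z, z = y ∨ z = v := by
  rcases exists_face_lift a (Set.mem_singleton v) (cl_singleton v) (by
    intro h
    obtain ⟨z, hz⟩ := exists_ne v
    have : z ∈ ({v} : Set T.Vertex) := by rw [h]; trivial
    exact hz this) with ⟨c, hc, h⟩ | ⟨y, hy, hay, hu⟩
  · exact Or.inl ⟨c, hc, exists_vmap_lift h⟩
  · exact Or.inr ⟨y, hy, hay, fun z => by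
      have : z ∈ insert y ({v} : Set T.Vertex) := by rw [hu]; trivial
      exact this⟩

/-- Outside the one-vertex subtree `{y}` there is a further outer vertex; the face at it contains
`y` and differs from `a`. -/
theorem outer_vertex_cover {T : Tree} {a : T.Face} {y v : T.Vertex} (hyv : y ≠ v)
    (hay : a.IsOuter y) : ∃ c, c ≠ a ∧ ∃ g : cor (inp y) ⟶ c.tree, g ≫ c.incl = vmap y := by
  obtain ⟨v', hv', b, hb⟩ := exists_outer (Set.mem_singleton y) (cl_singleton y) (by
    intro h
    have : v ∈ ({y} : Set T.Vertex) := by rw [h]; trivial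
    exact hyv this.symm)
  refine ⟨b, ?_, exists_vmap_lift (hb.exists_lift (Set.mem_singleton y) _ hv')⟩
  rintro rfl
  exact hv' (hb.unique hay)

/-- With at most one vertex every face is an edge, so a horn is just a colour for every edge but
one. -/
theorem exists_fill_of_subsingleton (h3 : CorollaFill D) {T : Tree} (hT : ¬ Nontrivial T.Vertex)
    (a : T.Face) (x : Fam D a) : ∃ y : D.obj (op T), ∀ b hb, res b.incl y = x b hb := by
  have hs : ∀ v v' : T.Vertex, v = v' := by
    rw [not_nontrivial_iff_subsingleton] at hT
    exact fun v v' => Subsingleton.elim _ _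
  have hno : ∀ u w : T.Vertex, T.below (T.out u) ≠ some w := fun u w h =>
    below_out_ne w (hs u w ▸ h)
  have hedge : ∀ b : T.Face, ∃ e h, b = Face.edge e h := by
    intro b
    cases b with
    | inner u w h => exact absurd h (hno u w)
    | top v hv hl =>
      rw [ne_eq, ← T.below_eq_none, ← ne_eq, Option.ne_none_iff_exists'] at hv
      obtain ⟨w, hw⟩ := hv
      exact absurd hw (hno v w)
    | bottom v u hv hu hl => exact absurd hu (hno u v)
    | edge e h => exact ⟨e, h, rfl⟩
  obtain ⟨e, h, rfl⟩ := hedge a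
  obtain ⟨v, -, -⟩ := id h
  obtain ⟨y, hy⟩ := h3 T v (fun z => hs z v) e fun e' he' => x (Face.edge e' h) (by
    intro h
    cases h
    exact he' rfl)
  refine ⟨y, fun b hb => ?_⟩
  obtain ⟨e', h', rfl⟩ := hedge b
  exact hy e' (by
    rintro rfl
    exact hb rfl)

/-- Filling of the outer horns of trees with two vertices. -/
theorem exists_fill_of_two (hD : Separated D) (h2 : DivFill D) {T : Tree}
    (hT : Nontrivial T.Vertex) (a : T.Face) (x : Fam D a) (hx : x.Compat) {y v : T.Vertex}
    (hyv : y ≠ v) (hay : a.IsOuter y) (hz : ∀ z, z = y ∨ z = v)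
    (κ : T.Edge → D.obj (op eta))
    (hκ : ∀ b hb (e : b.tree.Edge), κ (ed b.incl e) = res (edgeMap b.tree e) (x b hb)) :
    ∃ y : D.obj (op T), ∀ b hb, res b.incl y = x b hb := by
  obtain ⟨c, hca, g, hg⟩ := outer_vertex_cover hyv hay
  obtain ⟨p, q, hpq, -⟩ := hay.exists_inner
  have hpq' := two_cover (ne_of_below_out hpq).symm hz
  obtain ⟨t, ht⟩ := exists_total_lift (total T) rfl Subtype.range_val hpq
  have hia := hay.ne_inner hpq
  have hκ2 : ∀ (S : Tree) (k : S ⟶ T) b hb (l : S ⟶ b.tree), l ≫ b.incl = k → ∀ e,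
      res (edgeMap S e) (res l (x b hb)) = κ (ed k e) := by
    rintro S k b hb l rfl e
    rw [ed_comp, hκ b hb, res_edge]
  -- The horn contains the total operation, through the inner face, and the corolla of `y`, through
  -- the outer face at `v`. The corolla of `v` has to come from division.
  obtain ⟨z, hz1, hz2, hz3⟩ := h2 T y v hyv hz κ (res g (x c hca))
    (res t (x _ hia)) (hκ2 _ _ _ _ _ hg _) (fun i => hκ2 _ _ _ _ _ hg _)
    (hκ2 _ _ _ _ _ ht _) (fun i => hκ2 _ _ _ _ _ ht _)
  have hE : ∀ b hb e, res (edgeMap b.tree e) (res b.incl z) =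
      res (edgeMap b.tree e) (x b hb) := by
    intro b hb e
    rw [res_edge, hz1]
    exact hκ b hb e
  have houter : ∀ b hb z', b.IsOuter z' → res b.incl z = x b hb := by
    intro b hb z' hbz
    refine eq_of_outer hD hbz (hE b hb) fun A _ f v' k hv' hf => ?_
    have hz'y : z' ≠ y := by
      rintro rfl
      exact hb (hbz.eq hay)
    obtain rfl : v' = y := (two_cover hz'y hz v').resolve_left hv'
    refine (res_res _ _ _).trans ?_
    rw [hf, ← res_res, hz2, res_res]
    exact (hx _ _ _ _ _ _ _ (by rw [hf, Category.assoc, hg])).symm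
  refine ⟨z, fun b hb => ?_⟩
  cases b with
  | inner u w h =>
    obtain ⟨rfl, rfl⟩ := out_eq_root_of_two hpq h hpq'
    refine eq_of_inner hD h (hE _ hb) ?_ ?_
    · intro A _ f p' k hpu hpw
      rcases hpq' p' with rfl | rfl
      · exact absurd rfl hpu
      · exact absurd rfl hpw
    · intro A _ f k hfk hr hrt
      have huw : ({u, w} : Set T.Vertex) = Set.univ := Set.eq_univ_of_forall hpq'
      have hw := out_root_of_two hpq hpq'
      rw [hw, huw] at hr
      obtain ⟨e, he⟩ := exists_corMap_total _ (hrt.trans hw) hr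
      refine (res_res _ _ _).trans ?_
      refine (congrArg (fun k => res k z) he).trans ?_
      rw [← res_res, hz3, res_res]
      exact (hx _ hb _ hia _ f (corMap e ≫ t) (he.trans (by rw [Category.assoc, ht]))).symm
  | top z' hv hl => exact houter _ hb z' (Or.inl ⟨_, _, rfl⟩)
  | bottom z' u hv hu hl => exact houter _ hb z' (Or.inr ⟨_, _, _, _, rfl⟩)
  | edge e h => exact (Face.edge_absurd hT h).elim

/-- If all edges and vertices are in faces different from `a`, then horns are filled using the
Segal condition. -/
theorem Fam.Agree.eq (hD : Separated D) (h1 : DivUnique D) {T : Tree} (hT : Nontrivial T.Vertex)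
    {a : T.Face} {x : Fam D a} (hx : x.Compat) {z : D.obj (op T)} (hz : x.Agree z)
    (hB : ¬ ∃ y v : T.Vertex, y ≠ v ∧ a.IsOuter y ∧ ∀ z, z = y ∨ z = v) (b : T.Face) (hb : b ≠ a) :
    res b.incl z = x b hb := by
  -- If `u` and `w` were all vertices, the faces would be one inner face and outer faces at `u` and
  -- `w`. The first is excluded for `a` because `a` differs from it, the others by `hB`.
  have hpair : ∀ u w (h : T.below (T.out u) = some w), Face.inner u w h ≠ a →
      ({u, w} : Set T.Vertex) ≠ Set.univ := by
    intro u w h hb huniv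
    have h2 : ∀ z, z = u ∨ z = w := fun z => by
      have : z ∈ ({u, w} : Set T.Vertex) := by rw [huniv]; trivial
      exact this
    have hne := ne_of_below_out h
    have houter : ∀ z, ¬ a.IsOuter z := by
      intro z hz
      rcases h2 z with rfl | rfl
      · exact hB ⟨z, w, hne.symm, hz, h2⟩
      · exact hB ⟨z, u, hne, hz, fun z => (h2 z).symm⟩
    cases a with
    | inner u' w' h' =>
      obtain ⟨rfl, rfl⟩ := out_eq_root_of_two h h' h2
      exact hb rfl
    | top z' hv hl => exact houter z' (Or.inl ⟨_, _, rfl⟩)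
    | bottom z' u hv hu hl => exact houter z' (Or.inr ⟨_, _, _, _, rfl⟩)
    | edge e h => exact Face.edge_absurd hT h
  cases b with
  | inner u w h =>
    rcases exists_face_lift a (m := w) (by simp) (cl_pair h) (hpair u w h hb) with
      hc | ⟨y, hy, hay, huniv⟩
    · exact hz.inner_eq hD hx h hb hc
    -- The remaining case: `T` has the three vertices `y`, `u`, `w`, and `a` is the outer face at
    -- `y`. The contracted tree has two vertices, so by `h1` it is enough to compare the vertex `y`
    -- and the total operation. The total operation also factors through the inner face at the edge
    -- attached to `y`, where agreement follows as before because the subtree `{p, q}` contains `y`.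
    have h3 : ∀ z, z = y ∨ z = u ∨ z = w := fun z => by
      have : z ∈ (insert y {u, w} : Set T.Vertex) := by rw [huniv]; trivial
      exact this
    have hyu : y ≠ u := fun h => hy (Or.inl h)
    have hyw : y ≠ w := fun h => hy (Or.inr h)
    refine h1 (T.contract u w h) ⟨y, hyu⟩ ⟨w, ne_of_below_out h⟩
      (fun h => hyw (congrArg Subtype.val h)) (fun z => ?_) _ _ (hz.edge _ hb) ?_ ?_
    · rcases h3 z.1 with h | h | h
      · exact Or.inl (Subtype.ext h)
      · exact absurd h z.2
      · exact Or.inr (Subtype.ext h)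
    · obtain ⟨k, hk⟩ := exists_corMap_vmap (v := y)
        (vmap (T := T.contract u w h) ⟨y, hyu⟩ ≫ T.contractMap u w h) rfl (by
          refine Eq.trans ?_ (contract_inp h ⟨y, hyu⟩ hyw)
          ext z
          exact ⟨fun ⟨i, hi⟩ => ⟨i.1, i.2, hi⟩, fun ⟨i, hi, hz⟩ => ⟨⟨i, hi⟩, hz⟩⟩)
      exact hz.vertex _ hb _ _ y k hk
    · obtain ⟨p, q, hpq, hypq⟩ := hay.exists_inner
      have hia := hay.ne_inner hpq
      obtain ⟨g, hg⟩ := exists_total_lift (total (T.contract u w h) ≫ T.contractMap u w h) rfl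
        (contract_total h) hpq
      have hc : res (Face.inner p q hpq).incl z = x _ hia := by
        rcases exists_face_lift a (m := q) (by simp) (cl_pair hpq) (hpair p q hpq hia) with
          hc | ⟨y', hy', hay', -⟩
        · exact hz.inner_eq hD hx hpq hia hc
        · obtain rfl := hay'.unique hay
          exact absurd hypq hy'
      refine (res_res _ _ _).trans ?_
      refine (congrArg (fun k => res k z) hg.symm).trans ?_
      rw [← res_res, hc]
      exact hx _ hia _ hb _ g (total _) hg
  | top z' hv hl => exact hz.outer_eq hD hb (z := z') (Or.inl ⟨_, _, rfl⟩)
  | bottom z' u hv hu hl => exact hz.outer_eq hD hb (z := z') (Or.inr ⟨_, _, _, _, rfl⟩)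
  | edge e h => exact (Face.edge_absurd hT h).elim

/-- The Segal condition reduces the filling of horns to small trees. -/
theorem isStrictlyFullyKan_of_segal (hD : Segal D) (h1 : DivUnique D) (h2 : DivFill D)
    (h3 : CorollaFill D) : IsStrictlyFullyKan D := by
  refine isStrictlyFullyKan_of (fun T a x hx => ?_) (fun T hT a x y hxy => ?_)
  · by_cases hT : Nontrivial T.Vertex
    swap
    · exact exists_fill_of_subsingleton h3 hT a x
    choose ce hce e' he' using fun e => exists_edge_lift a hT e
    have hκ : ∀ b hb (e : b.tree.Edge), res (edgeMap _ (e' (ed b.incl e))) (x (ce _) (hce _)) =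
        res (edgeMap b.tree e) (x b hb) := by
      intro b hb e
      apply hx
      rw [edgeMap_comp, edgeMap_comp, he']
    -- The exceptional horns are those of trees with two vertices at an outer face. In all other
    -- cases each vertex lies in a face of the horn, and the Segal condition applies.
    by_cases hB : ∃ y v : T.Vertex, y ≠ v ∧ a.IsOuter y ∧ ∀ z, z = y ∨ z = v
    · obtain ⟨y, v, hyv, hay, hz⟩ := hB
      exact exists_fill_of_two hD.1 h2 hT a x hx hyv hay hz
        (fun e => res (edgeMap _ (e' e)) (x (ce e) (hce e))) hκ
    choose cv hcv g hg using fun v => (vertex_cover a hT v).resolve_right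
      fun ⟨y, hy, hay, hz⟩ => hB ⟨y, v, hy, hay, hz⟩
    obtain ⟨z, hz1, hz2⟩ := hD.2 T (fun e => res (edgeMap _ (e' e)) (x (ce e) (hce e)))
      (fun v => res (g v) (x (cv v) (hcv v)))
      (fun v => by
        rw [res_edge]
        refine (hκ _ (hcv v) _).symm.trans ?_
        rw [← ed_comp, hg]
        rfl)
      (fun v i => by
        rw [res_edge]
        refine (hκ _ (hcv v) _).symm.trans ?_
        rw [← ed_comp, hg]
        rfl)
    have hA : Fam.Agree x z := by
      refine ⟨fun b hb e => ?_, fun b hb A _ f v k hf => ?_⟩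
      · rw [res_edge, hz1]
        exact hκ b hb e
      · refine (res_res _ _ _).trans ?_
        rw [hf, ← res_res, hz2, res_res]
        exact (hx _ _ _ _ _ _ _ (by rw [hf, Category.assoc, hg])).symm
    exact ⟨z, hA.eq hD.1 h1 hT hx hB⟩
  · have hE : ∀ e, res (edgeMap T e) x = res (edgeMap T e) y := by
      intro e
      obtain ⟨c, hc, e', rfl⟩ := exists_edge_lift a hT e
      rw [← res_edge, hxy c hc, res_edge]
    have hF : ∀ (S : Tree) (f : S ⟶ T) (c : T.Face), c ≠ a → (∃ g : S ⟶ c.tree, g ≫ c.incl = f) →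
        res f x = res f y := by
      rintro S f c hc ⟨g, rfl⟩
      rw [← res_res, hxy c hc, res_res]
    by_cases hB : ∃ y v : T.Vertex, y ≠ v ∧ a.IsOuter y ∧ ∀ z, z = y ∨ z = v
    · obtain ⟨z, v, hzv, haz, hz⟩ := hB
      obtain ⟨c, hc, hg⟩ := outer_vertex_cover hzv haz
      obtain ⟨p, q, hpq, -⟩ := haz.exists_inner
      exact h1 T z v hzv hz x y hE (hF _ _ c hc hg)
        (hF _ _ _ (haz.ne_inner hpq) (exists_total_lift (total T) rfl Subtype.range_val hpq))
    · refine hD.1 T x y hE fun v => ?_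
      obtain ⟨c, hc, hg⟩ := (vertex_cover a hT v).resolve_right
        fun ⟨y, hy, hay, hz⟩ => hB ⟨y, v, hy, hay, hz⟩
      exact hF _ _ c hc hg

end Dendroidal

/-! ### The operad of a tree is free on its vertices -/

namespace Dendroidal

/-- Pairs with first entry in a one-element type. -/
def oneSigma (n : ℕ) : (Σ _ : Fin 1, Fin n) ≃ Fin n where
  toFun p := p.2
  invFun i := ⟨0, i⟩
  left_inv p := by
    obtain ⟨j, i⟩ := p
    obtain rfl : j = 0 := Subsingleton.elim _ _
    rfl
  right_inv _ := rfl

/-- Pairs with second entry in a one-element type. -/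
def sigmaOne (n : ℕ) : (Σ _ : Fin n, Fin 1) ≃ Fin n where
  toFun p := p.1
  invFun i := ⟨i, 0⟩
  left_inv p := by
    obtain ⟨j, i⟩ := p
    obtain rfl : i = 0 := Subsingleton.elim _ _
    rfl
  right_inv _ := rfl

theorem exists_fiber_equiv {X : Type*} {Y Z : X → Type*} (E : (Σ x, Y x) ≃ Σ x, Z x)
    (hE : ∀ p, (E p).1 = p.1) : ∃ τ : ∀ x, Y x ≃ Z x, ∀ x y, E ⟨x, y⟩ = ⟨x, τ x y⟩ := by
  have h : ∀ x y, ∃ z, E ⟨x, y⟩ = ⟨x, z⟩ := by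
    intro x y
    have := hE ⟨x, y⟩
    generalize E ⟨x, y⟩ = p at this
    obtain ⟨x', z⟩ := p
    obtain rfl : x' = x := this
    exact ⟨z, rfl⟩
  choose t ht using h
  refine ⟨fun x => Equiv.ofBijective (t x) ⟨fun y y' hy => ?_, fun z => ?_⟩, ht⟩
  · have : E ⟨x, y⟩ = E ⟨x, y'⟩ := by rw [ht, ht, hy]
    exact eq_of_heq (Sigma.mk.inj (E.injective this)).2
  · obtain ⟨⟨x', y⟩, hy⟩ := E.surjective ⟨x, z⟩
    have h1 := hy
    rw [ht] at h1
    obtain rfl : x' = x := (Sigma.mk.inj h1).1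
    exact ⟨y, eq_of_heq (Sigma.mk.inj h1).2⟩

/-- Ordering each inner block lexicographically supplies the data that the associativity law asks
for. -/
theorem exists_assoc_equiv {n m M : ℕ} {k : Fin n → ℕ} {l : Fin m → ℕ}
    (e : (Σ j, Fin (k j)) ≃ Fin m) (e' : (Σ p, Fin (l p)) ≃ Fin M) :
    ∃ (s : Fin n → ℕ) (ε : ∀ j, (Σ i, Fin (l (e ⟨j, i⟩))) ≃ Fin (s j))
      (e'' : (Σ j, Fin (s j)) ≃ Fin M), ∀ j i q, e'' ⟨j, ε j ⟨i, q⟩⟩ = e' ⟨e ⟨j, i⟩, q⟩ := by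
  refine ⟨fun j => ∑ i, l (e ⟨j, i⟩), fun j => finSigmaFinEquiv,
    (Equiv.sigmaCongrRight fun j => finSigmaFinEquiv.symm).trans
      (((Equiv.sigmaAssoc fun j i => Fin (l (e ⟨j, i⟩))).symm.trans
        (Equiv.sigmaCongrLeft (β := fun p => Fin (l p)) e)).trans e'), fun j i q => ?_⟩
  simp [Equiv.sigmaCongrRight, Equiv.sigmaAssoc, Equiv.sigmaCongrLeft]

namespace Operad

variable {P : Operad.{u}}

/-- Reordering of the inputs of an operation. -/
def reidx {m m' : ℕ} {r : Fin m → P.Col} {r' : Fin m' → P.Col} {d : P.Col} (σ : Fin m ≃ Fin m')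
    (h : ∀ i, r' (σ i) = r i) (f : P.Op r d) : P.Op r' d :=
  P.comp (k := fun _ : Fin 1 => m) ((oneSigma m).trans σ) (a := fun _ => r) (fun _ i => h i)
    (P.id d) (fun _ => f)

theorem reidx_refl {m : ℕ} {r : Fin m → P.Col} {d : P.Col} (f : P.Op r d) :
    P.reidx (Equiv.refl _) (fun _ => rfl) f = f :=
  P.id_comp f ((oneSigma m).trans (Equiv.refl _)) fun _ _ => rfl

/-- Reordering is composition under an outer identity, so associativity and the left unit law absorb
it into the bijection of the composite. -/
theorem reidx_comp {n m m' : ℕ} {k : Fin n → ℕ} (e : (Σ j, Fin (k j)) ≃ Fin m)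
    {b : Fin n → P.Col} {a : (j : Fin n) → Fin (k j) → P.Col} {r : Fin m → P.Col}
    {r' : Fin m' → P.Col} {d : P.Col} (hr : ∀ j i, r (e ⟨j, i⟩) = a j i) (g : P.Op b d)
    (f : (j : Fin n) → P.Op (a j) (b j)) (σ : Fin m ≃ Fin m') (h : ∀ i, r' (σ i) = r i) :
    P.reidx σ h (P.comp e hr g f) =
      P.comp (e.trans σ) (fun j i => (h _).trans (hr j i)) g f := by
  obtain rfl : r = fun i => r' (σ i) := funext fun i => (h i).symm
  have := P.assoc (n := 1) (k := fun _ => n) (oneSigma n) (e.trans σ) (s := fun _ => m) (fun _ => e)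
    ((oneSigma m).trans σ) (fun _ _ _ => rfl) (b := fun _ => d) (a := b) (x := a) (r := r')
    (fun p q => hr p q) (P.id d) (fun _ => g) f
  refine Eq.trans this.symm ?_
  congr 1
  exact P.id_comp g (oneSigma n) fun _ _ => rfl

/-- Associativity is applied with identities inserted between `g` and the `f j`; the right unit law
removes them again. -/
theorem comp_reidx {n m : ℕ} {k k' : Fin n → ℕ} (e : (Σ j, Fin (k' j)) ≃ Fin m)
    (e' : (Σ j, Fin (k j)) ≃ Fin m)
    {b : Fin n → P.Col} {a : (j : Fin n) → Fin (k j) → P.Col}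
    {a' : (j : Fin n) → Fin (k' j) → P.Col} {r : Fin m → P.Col} {d : P.Col}
    (hr : ∀ j i, r (e ⟨j, i⟩) = a' j i) (g : P.Op b d)
    (f : (j : Fin n) → P.Op (a j) (b j)) (σ : ∀ j, Fin (k j) ≃ Fin (k' j))
    (h : ∀ j i, a' j (σ j i) = a j i) (he : ∀ j i, e ⟨j, σ j i⟩ = e' ⟨j, i⟩) :
    P.comp e hr g (fun j => P.reidx (σ j) (h j) (f j)) =
      P.comp e' (fun j i => (congrArg r (he j i).symm).trans ((hr _ _).trans (h j i))) g f := by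
  obtain rfl : a' = fun j t => r (e ⟨j, t⟩) := by
    funext j t
    exact (hr j t).symm
  have := P.assoc (n := n) (k := fun _ => 1) (sigmaOne n) e' (s := k')
    (fun j => (oneSigma (k j)).trans (σ j)) e (fun j i q => he j q) (b := b) (a := b) (x := a)
    (r := r) (fun j i => (congrArg r (he j i).symm).trans (h j i)) g (fun j => P.id (b j)) f
  refine Eq.trans this.symm ?_
  congr 1
  exact P.comp_id g (sigmaOne n) fun _ _ => rfl

/-- Families over `Fin 1` are constant, but only propositionally; making them constant brings the
composite into the form of `reidx`. -/
theorem comp_id_left {m : ℕ} {k : Fin 1 → ℕ} (e : (Σ j, Fin (k j)) ≃ Fin m) {d : P.Col}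
    {a : (j : Fin 1) → Fin (k j) → P.Col} {r : Fin m → P.Col} (hr : ∀ j i, r (e ⟨j, i⟩) = a j i)
    (f : (j : Fin 1) → P.Op (a j) d) :
    ∃ (σ : Fin (k 0) ≃ Fin m) (hσ : ∀ i, σ i = e ⟨0, i⟩),
      P.comp e hr (P.id d) f = P.reidx σ (fun i => (congrArg r (hσ i)).trans (hr 0 i)) (f 0) := by
  obtain ⟨k0, rfl⟩ : ∃ k0, k = fun _ => k0 :=
    ⟨k 0, funext fun j => congrArg k (Subsingleton.elim j 0)⟩
  obtain ⟨a0, rfl⟩ : ∃ a0, a = fun _ => a0 :=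
    ⟨a 0, funext fun j => congrArg a (Subsingleton.elim j 0)⟩
  obtain ⟨f0, rfl⟩ : ∃ f0, f = fun _ => f0 :=
    ⟨f 0, funext fun j => congrArg f (Subsingleton.elim j 0)⟩
  refine ⟨(oneSigma k0).symm.trans e, fun _ => rfl, ?_⟩
  obtain ⟨σ, rfl⟩ : ∃ σ, e = (oneSigma k0).trans σ :=
    ⟨(oneSigma k0).symm.trans e, by rw [← Equiv.trans_assoc, Equiv.self_trans_symm]; rfl⟩
  rfl

theorem Hom.map_reidx {Q : Operad.{v}} (F : Hom P Q) {m m' : ℕ} {r : Fin m → P.Col}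
    {r' : Fin m' → P.Col} {d : P.Col} (σ : Fin m ≃ Fin m') (h : ∀ i, r' (σ i) = r i)
    (f : P.Op r d) : F.map (P.reidx σ h f) = Q.reidx σ (fun i => congrArg F.col (h i)) (F.map f) := by
  refine (F.map_comp _ _ _ _).trans ?_
  rw [F.map_id]
  rfl

end Operad

namespace Tree

/-- Two siblings are not comparable. -/
theorem eq_of_le_siblings {T : Tree} {v : T.Vertex} {x y z : T.Edge} (hy : y ∈ inp v)
    (hz : z ∈ inp v) (h1 : Le x y) (h2 : Le x z) : y = z := by
  have key : ∀ {y z : T.Edge}, y ∈ inp v → z ∈ inp v → Le y z → y = z := by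
    intro y z hy hz h
    rcases Relation.ReflTransGen.cases_head h with h | ⟨w, ⟨v', h3, rfl⟩, h4⟩
    · exact h
    · have hy' : T.below y = some v := hy
      rw [hy'] at h3
      cases h3
      have := ht_lt hz
      have := Le.ht_le h4
      omega
  rcases h1.total h2 with h | h
  · exact key hy hz h
  · exact (key hz hy h).symm

theorem IsOp.le {T : Tree} {n : ℕ} {a : Fin n → T.Edge} {d : T.Edge} (h : T.IsOp a d) (i : Fin n) :
    Le (a i) d := by
  obtain ⟨-, W, hW, hl⟩ := h.isOpSet
  exact subE_le hW (lv_sub (hl ▸ ⟨i, rfl⟩))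

/-- The number of incoming edges of a vertex. -/
noncomputable def arity {T : Tree} (v : T.Vertex) : ℕ := (exists_enum (inp v)).choose

/-- A chosen enumeration of the incoming edges of a vertex. -/
noncomputable def enum {T : Tree} (v : T.Vertex) : Fin (arity v) → T.Edge :=
  (exists_enum (inp v)).choose_spec.choose

theorem enum_injective {T : Tree} (v : T.Vertex) : Function.Injective (enum v) :=
  (exists_enum (inp v)).choose_spec.choose_spec.1

theorem range_enum {T : Tree} (v : T.Vertex) : Set.range (enum v) = inp v :=
  (exists_enum (inp v)).choose_spec.choose_spec.2

theorem enum_mem {T : Tree} (v : T.Vertex) (i) : enum v i ∈ inp v := by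
  rw [← range_enum]
  exact ⟨i, rfl⟩

theorem enum_isOp {T : Tree} (v : T.Vertex) : T.IsOp (enum v) (T.out v) :=
  inp_finite_isOp v (enum_injective v) (range_enum v)

/-- The operations of `P` that are composites of given operations on the vertices of a tree, in
normal form. -/
inductive Norm {P : Operad.{u}} {T : Tree} (col : T.Edge → P.Col)
    (V : ∀ v : T.Vertex, P.Op (fun i => col (enum v i)) (col (T.out v))) :
    {n : ℕ} → (a : Fin n → T.Edge) → (d : T.Edge) → P.Op (fun i => col (a i)) (col d) → Prop
  | id (x : T.Edge) : Norm col V (fun _ : Fin 1 => x) x (P.id (col x))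
  | node (v : T.Vertex) {m : ℕ} {l : Fin (arity v) → ℕ} (e : (Σ j, Fin (l j)) ≃ Fin m)
      {a : ∀ j, Fin (l j) → T.Edge} {r : Fin m → T.Edge} (hr : ∀ j i, r (e ⟨j, i⟩) = a j i)
      (f : ∀ j, P.Op (fun i => col (a j i)) (col (enum v j)))
      (hf : ∀ j, Norm col V (a j) (enum v j) (f j)) :
      Norm col V r (T.out v) (P.comp e (fun j i => congrArg col (hr j i)) (V v) f)

section

variable {P : Operad.{u}} {T : Tree} {col : T.Edge → P.Col}
  {V : ∀ v : T.Vertex, P.Op (fun i => col (enum v i)) (col (T.out v))}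

theorem Norm.isOp {n : ℕ} {a : Fin n → T.Edge} {d : T.Edge}
    {f : P.Op (fun i => col (a i)) (col d)} (h : Norm col V a d f) : T.IsOp a d := by
  induction h with
  | id x => exact IsOp.id x
  | node v e hr f hf ih => exact IsOp.comp e hr (enum_isOp v) ih

/-- The heart of freeness. The outermost vertex of a normal form is determined by the output edge,
and each input is assigned to the unique input of this vertex below it. Two normal forms with the
same inputs therefore have the same blocks, and induction applies to each block. The output edges
`d` and `d'` are kept as separate variables for the case analysis, whence the heterogeneous
equality. -/
theorem Norm.unique {n n' : ℕ} {a : Fin n → T.Edge} {d : T.Edge}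
    {f : P.Op (fun i => col (a i)) (col d)} (h : Norm col V a d f) {a' : Fin n' → T.Edge}
    {d' : T.Edge} {f' : P.Op (fun i => col (a' i)) (col d')} (h' : Norm col V a' d' f')
    (hd : d = d') (σ : Fin n ≃ Fin n') (hσ : ∀ i, a' (σ i) = a i) :
    HEq f' (P.reidx (r' := fun i => col (a' i)) σ (fun i => congrArg col (hσ i)) f) := by
  -- The inputs of an operation with an outermost vertex have greater height than its output, so it
  -- cannot be confused with an identity.
  have hid : ∀ {v : T.Vertex} {m : ℕ} {r : Fin m → T.Edge} {l : Fin (arity v) → ℕ}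
      (e : (Σ j, Fin (l j)) ≃ Fin m) {a : ∀ j, Fin (l j) → T.Edge}
      (_ : ∀ j i, r (e ⟨j, i⟩) = a j i) (_ : ∀ j, T.IsOp (a j) (enum v j)) (i : Fin m),
      r i ≠ T.out v := by
    intro v m r l e a hr ha i hi
    obtain ⟨⟨j, i⟩, rfl⟩ := e.surjective i
    rw [hr] at hi
    have h1 := ((ha j).le i).ht_le
    have h2 := ht_lt (enum_mem v j)
    rw [hi] at h1
    omega
  induction h generalizing n' d' with
  | id x =>
    cases h' with
    | id x' =>
      subst hd
      obtain rfl : σ = Equiv.refl _ := Subsingleton.elim _ _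
      exact heq_of_eq (P.reidx_refl _).symm
    | node v e hr f hf => exact absurd ((hσ 0).trans hd) (hid e hr (fun j => (hf j).isOp) _)
  | @node v m l e a r hr f hf ih =>
    cases h' with
    | id x' =>
      have h0 := hσ (σ.symm 0)
      rw [Equiv.apply_symm_apply] at h0
      exact absurd (h0.symm.trans hd.symm) (hid e hr (fun j => (hf j).isOp) _)
    | @node v' _ l' e' b _ hr' f' hf' =>
      obtain rfl : v = v' := T.out_injective hd
      clear hd
      -- Different inputs of `v` are not comparable, so an edge lies above at most one of them. The
      -- reordering thus respects the blocks and splits into bijections `τ j`.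
      obtain ⟨τ, hτ⟩ := exists_fiber_equiv ((e.trans σ).trans e'.symm) (by
        rintro ⟨j, i⟩
        obtain ⟨⟨j', i'⟩, h1⟩ := e'.surjective (σ (e ⟨j, i⟩))
        rw [Equiv.trans_apply, Equiv.trans_apply, ← h1, Equiv.symm_apply_apply]
        have h2 := hσ (e ⟨j, i⟩)
        rw [← h1, hr', hr] at h2
        have h3 := (hf j).isOp.le i
        have h4 := (hf' j').isOp.le i'
        rw [h2] at h4
        exact enum_injective v (eq_of_le_siblings (enum_mem v _) (enum_mem v _) h4 h3))
      have hτ' : ∀ j i, e' ⟨j, τ j i⟩ = σ (e ⟨j, i⟩) := by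
        intro j i
        rw [← hτ]
        simp
      have hb : ∀ j i, b j (τ j i) = a j i := by
        intro j i
        rw [← hr', hτ', hσ, hr]
      obtain rfl : f' = fun j => P.reidx (τ j) (fun i => congrArg col (hb j i)) (f j) := by
        funext j
        exact eq_of_heq (ih j (hf' j) rfl (τ j) (hb j))
      refine heq_of_eq ?_
      rw [P.reidx_comp]
      exact P.comp_reidx e' (e.trans σ) _ _ _ _ _ hτ'

theorem Norm.reidx {n n' : ℕ} {a : Fin n → T.Edge} {d : T.Edge}
    {f : P.Op (fun i => col (a i)) (col d)} (h : Norm col V a d f) {a' : Fin n' → T.Edge}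
    (σ : Fin n ≃ Fin n') (hσ : ∀ i, a' (σ i) = a i) :
    Norm col V a' d (P.reidx (r' := fun i => col (a' i)) σ (fun i => congrArg col (hσ i)) f) := by
  cases h with
  | id x =>
    obtain rfl : n' = 1 := by simpa using (Fintype.card_congr σ).symm
    obtain rfl : σ = Equiv.refl _ := Subsingleton.elim _ _
    obtain rfl : a' = fun _ => d := funext hσ
    have := P.reidx_refl (P.id (col d))
    rw [this]
    exact Norm.id d
  | node v e hr f hf =>
    rw [P.reidx_comp]
    exact Norm.node v (e.trans σ) (fun j i => (hσ _).trans (hr j i)) f hf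

/-- Induction on the outer operation: associativity moves the inner operations into the branches
over its outermost vertex. -/
theorem Norm.comp {n : ℕ} {b : Fin n → T.Edge} {d : T.Edge}
    {g : P.Op (fun i => col (b i)) (col d)} (hg : Norm col V b d g) {m : ℕ} {k : Fin n → ℕ}
    (e : (Σ j, Fin (k j)) ≃ Fin m) {a : ∀ j, Fin (k j) → T.Edge} {r : Fin m → T.Edge}
    (hr : ∀ j i, r (e ⟨j, i⟩) = a j i) {f : ∀ j, P.Op (fun i => col (a j i)) (col (b j))}
    (hf : ∀ j, Norm col V (a j) (b j) (f j)) :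
    Norm col V r d (P.comp e (fun j i => congrArg col (hr j i)) g f) := by
  induction hg generalizing m with
  | id x =>
    obtain ⟨σ, hσ, h⟩ := P.comp_id_left (d := col x) e (r := fun i => col (r i)) (fun j i => congrArg col (hr j i)) f
    refine Eq.mpr (congrArg (Norm col V r x) h) ?_
    exact (hf 0).reidx σ fun i => by rw [hσ, hr]
  | @node v m' l e' b r' hr' g hg ih =>
    obtain rfl : b = fun j i => r' (e' ⟨j, i⟩) := by
      funext j i
      exact (hr' j i).symm
    obtain ⟨s, ε, e'', he⟩ := exists_assoc_equiv e' e
    have h := P.assoc e' e ε e'' he (r := fun i => col (r i)) (fun j i => congrArg col (hr j i)) (V v) g f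
    refine Eq.mpr (congrArg (Norm col V r (T.out v)) h) ?_
    exact Norm.node v e'' (fun _ _ => rfl) _ fun j =>
      ih j (ε j) (fun i q => (congrArg r (he j i q)).trans (hr _ q)) fun i => hf _

theorem Norm.exists {n : ℕ} {a : Fin n → T.Edge} {d : T.Edge} (h : T.IsOp a d) :
    ∃ f, Norm col V a d f := by
  induction h with
  | id x => exact ⟨_, Norm.id x⟩
  | vertex v a ha hv =>
    have hr : Set.range a = inp v := by
      ext x
      exact (hv x).symm
    have hmem : ∀ j, ∃ i, a i = enum v j := fun j => by
      have := enum_mem v j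
      rwa [← hr] at this
    choose σ hσ using hmem
    have hbij : Function.Bijective σ := by
      refine ⟨fun i j hij => enum_injective v ?_, fun i => ?_⟩
      · rw [← hσ, ← hσ, hij]
      · have : a i ∈ Set.range (enum v) := by rw [range_enum, ← hr]; exact ⟨i, rfl⟩
        obtain ⟨j, hj⟩ := this
        exact ⟨j, ha (by rw [hσ, hj])⟩
    exact ⟨_, Norm.node v ((sigmaOne _).trans (Equiv.ofBijective σ hbij)) (fun j _ => hσ j) _
      fun j => Norm.id _⟩
  | comp e hr g f ihg ihf =>
    obtain ⟨g, hg⟩ := ihg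
    choose f hf using ihf
    exact ⟨_, hg.comp e hr hf⟩

theorem Norm.eq {n : ℕ} {a : Fin n → T.Edge} {d : T.Edge} {f f' : P.Op (fun i => col (a i)) (col d)}
    (h : Norm col V a d f) (h' : Norm col V a d f') : f = f' := by
  have := h.unique h' rfl (Equiv.refl _) fun _ => rfl
  rw [← P.reidx_refl f]
  exact (eq_of_heq this).symm

variable (col V) in
/-- The operad generated by a tree is free: operations for the vertices give a map of operads. -/
noncomputable def freeHom : Operad.Hom T.operad P where
  col := col
  map f := (Norm.exists (V := V) f.down).choose
  map_id x := ((Norm.exists (IsOp.id x)).choose_spec).eq (Norm.id x)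
  map_comp e _ _ _ _ hr g f := (Norm.exists (IsOp.comp e hr g.down fun j => (f j).down)).choose_spec.eq
    ((Norm.exists g.down).choose_spec.comp e hr fun j => (Norm.exists (f j).down).choose_spec)

theorem freeHom_enum (v : T.Vertex) : HEq ((freeHom col V).map ⟨enum_isOp v⟩) (V v) := by
  refine heq_of_eq ?_
  refine (Norm.exists (V := V) (enum_isOp v)).choose_spec.eq ?_
  have := Norm.node (V := V) v (sigmaOne _) (a := fun j _ => enum v j) (r := enum v) (fun j _ => rfl) _ fun j => Norm.id _
  have h := P.comp_id (V v) (sigmaOne _) fun _ _ => rfl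
  exact Eq.mp (congrArg (Norm col V _ _) h) this

/-- Every operation has a normal form over the values on the vertices, and any map of operads with
these values sends the operation to it. Heterogeneous equality is needed since the colours of the
two values are only propositionally equal. -/
theorem IsOp.hom_ext {F G : Operad.Hom T.operad P} (hc : F.col = G.col)
    (h : ∀ v : T.Vertex, HEq (F.map ⟨enum_isOp v⟩) (G.map ⟨enum_isOp v⟩)) : F = G := by
  obtain ⟨c, F, F1, F2⟩ := F
  obtain ⟨c', G, G1, G2⟩ := G
  obtain rfl : c = c' := hc
  suffices H : ∀ {n : ℕ} {a : Fin n → T.Edge} {d : T.Edge} (h : T.IsOp a d),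
      F ⟨h⟩ = G ⟨h⟩ by
    obtain rfl : @F = @G := by
      funext n a d f
      exact H f.down
    rfl
  intro n a d h'
  obtain ⟨f, hf⟩ := Norm.exists (col := c) (V := fun v => F ⟨enum_isOp v⟩) h'
  have key : ∀ (F : {n : ℕ} → {a : Fin n → T.Edge} → {d : T.Edge} → T.operad.Op a d →
      P.Op (fun i => c (a i)) (c d)) (F1 : ∀ x : T.Edge, F (T.operad.id x) = P.id (c x))
      (F2 : ∀ {n m : ℕ} {k : Fin n → ℕ} (e : (Σ j, Fin (k j)) ≃ Fin m) {b : Fin n → T.Edge}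
        {a : (j : Fin n) → Fin (k j) → T.Edge} {r : Fin m → T.Edge} {d : T.Edge}
        (hr : ∀ j i, r (e ⟨j, i⟩) = a j i) (g : T.operad.Op b d)
        (f : ∀ j, T.operad.Op (a j) (b j)), F (T.operad.comp e hr g f) =
        P.comp e (fun j i => congrArg c (hr j i)) (F g) fun j => F (f j))
      {V : ∀ v : T.Vertex, P.Op (fun i => c (enum v i)) (c (T.out v))}
      (hV : ∀ v, F ⟨enum_isOp v⟩ = V v)
      {n : ℕ} {a : Fin n → T.Edge} {d : T.Edge} {f} (hf : Norm c V a d f),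
      F ⟨hf.isOp⟩ = f := by
    intro F F1 F2 V hV n a d f hf
    induction hf with
    | id x => exact F1 x
    | node v e hr f hf ih =>
      refine (F2 e hr ⟨enum_isOp v⟩ fun j => ⟨(hf j).isOp⟩).trans ?_
      rw [hV]
      congr 1
      exact funext ih
  exact (key F F1 F2 (fun _ => rfl) hf).trans
    (key G G1 G2 (fun v => (eq_of_heq (h v)).symm) hf).symm

end

end Tree

end Dendroidal

/-! ### The nerve of an operad satisfies the Segal condition -/

namespace Dendroidal

open Dendroidal.Tree

theorem exists_equiv_of_range_eq {X Y Z : Type*} {a : X → Z} {b : Y → Z}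
    (ha : Function.Injective a) (hb : Function.Injective b) (h : Set.range a = Set.range b) :
    ∃ σ : X ≃ Y, ∀ i, b (σ i) = a i := by
  have hmem : ∀ i, ∃ j, b j = a i := fun i => by
    have : a i ∈ Set.range a := ⟨i, rfl⟩
    rwa [h] at this
  choose σ hσ using hmem
  refine ⟨Equiv.ofBijective σ ⟨fun i j hij => ha ?_, fun j => ?_⟩, hσ⟩
  · rw [← hσ, ← hσ, hij]
  · have : b j ∈ Set.range a := by rw [h]; exact ⟨j, rfl⟩
    obtain ⟨i, hi⟩ := this
    exact ⟨i, hb (by rw [hσ, hi])⟩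

theorem Operad.Hom.reidx_heq {P : Operad.{u}} {Q : Operad.{v}} {F G : Operad.Hom P Q}
    (hc : F.col = G.col) {m m' : ℕ} {r : Fin m → P.Col} {r' : Fin m' → P.Col} {d : P.Col}
    (σ : Fin m ≃ Fin m') (h : ∀ i, r' (σ i) = r i) (f : P.Op r d)
    (hf : HEq (F.map f) (G.map f)) : HEq (F.map (P.reidx σ h f)) (G.map (P.reidx σ h f)) := by
  rw [F.map_reidx, G.map_reidx]
  obtain ⟨c, F, _, _⟩ := F
  obtain ⟨c', G, _, _⟩ := G
  obtain rfl : c = c' := hc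
  have : F f = G f := eq_of_heq hf
  change HEq (Q.reidx _ _ (F f)) (Q.reidx _ _ (G f))
  rw [this]

/-- Maps of operads commute with reorderings, so the chosen enumeration of the inputs of a vertex
can be replaced by any other. -/
theorem Tree.IsOp.hom_ext' {P : Operad.{u}} {T : Tree} {F G : Operad.Hom T.operad P}
    (hc : F.col = G.col)
    (h : ∀ v : T.Vertex, ∃ (n : ℕ) (a : Fin n → T.Edge) (o : T.IsOp a (T.out v)),
      Set.range a = inp v ∧ HEq (F.map ⟨o⟩) (G.map ⟨o⟩)) : F = G := by
  refine IsOp.hom_ext hc fun v => ?_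
  obtain ⟨n, a, o, ha, ho⟩ := h v
  obtain ⟨σ, hσ⟩ := exists_equiv_of_range_eq o.isOpSet.1 (enum_injective v)
    (ha.trans (range_enum v).symm)
  exact Operad.Hom.reidx_heq hc (P := T.operad) σ hσ ⟨o⟩ ho

/-- The enumeration of the leaves of the corolla of a vertex. -/
noncomputable def enumLeaf {T : Tree} (v : T.Vertex) (i : Fin (arity v)) : (cor (inp v)).Edge :=
  leaf ⟨enum v i, enum_mem v i⟩

theorem range_enumLeaf {T : Tree} (v : T.Vertex) :
    Set.range (enumLeaf v) = Set.range (leaf (A := inp v)) := by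
  ext x
  constructor
  · rintro ⟨i, rfl⟩
    exact ⟨_, rfl⟩
  · rintro ⟨⟨x, hx⟩, rfl⟩
    rw [← range_enum] at hx
    obtain ⟨i, rfl⟩ := hx
    exact ⟨i, rfl⟩

theorem enumLeaf_isOp {T : Tree} (v : T.Vertex) : (cor (inp v)).IsOp (enumLeaf v) rt := by
  refine isOp_of_set (fun i j h => enum_injective v (congrArg Subtype.val (leaf_injective h))) ?_
  rw [range_enumLeaf]
  exact cor_isOpSet

theorem op_heq {P : Operad.{u}} {n : ℕ} {a b : Fin n → P.Col} {d d' : P.Col} (h : ∀ i, a i = b i)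
    (hd : d = d') (f : P.Op a d) : ∃ g : P.Op b d', HEq g f := by
  obtain rfl : a = b := funext h
  subst hd
  exact ⟨f, HEq.rfl⟩

/-- The nerve of an operad satisfies the Segal condition. -/
theorem segal_operadNerve (P : Operad.{u}) : Segal (operadNerve.obj P) := by
  refine ⟨fun T x y he hv => ?_, fun T κ s h1 h2 => ?_⟩
  · refine IsOp.hom_ext (P := P) (T := T) (F := x) (G := y) ?_ fun v => ?_
    · funext e
      exact congrArg (fun h : Operad.Hom eta.operad P => h.col ()) (he e)
    · exact congr_arg_heq (fun h : Operad.Hom (cor (inp v)).operad P => h.map ⟨enumLeaf_isOp v⟩)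
        (hv v)
  · let col : T.Edge → P.Col := fun e => Operad.Hom.col (P := eta.operad) (κ e) ()
    let s' : ∀ v : T.Vertex, Operad.Hom (cor (inp v)).operad P := s
    have hrt : ∀ v, (s' v).col rt = col (T.out v) := fun v =>
      congrArg (fun h : Operad.Hom eta.operad P => h.col ()) (h1 v)
    have hlf : ∀ v i, (s' v).col (leaf i) = col i.1 := fun v i =>
      congrArg (fun h : Operad.Hom eta.operad P => h.col ()) (h2 v i)
    have hV : ∀ v, ∃ g : P.Op (fun i => col (enum v i)) (col (T.out v)),
        HEq g ((s' v).map ⟨enumLeaf_isOp v⟩) := fun v =>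
      op_heq (fun i => hlf v ⟨enum v i, enum_mem v i⟩) (hrt v) _
    choose V hV using hV
    refine ⟨freeHom col V, fun e => ?_, fun v => ?_⟩
    · refine IsOp.hom_ext (P := P) (T := eta) (F := Operad.Hom.trans (edgeMap T e) (freeHom col V))
        (G := κ e) rfl fun v => v.elim
    · refine IsOp.hom_ext' (P := P) (T := cor (inp v))
        (F := Operad.Hom.trans (vmap v) (freeHom col V)) (G := s' v) ?_ fun v' => ?_
      · exact funext (cor_cases (hrt v).symm fun i => (hlf v i).symm)
      · refine ⟨_, enumLeaf v, enumLeaf_isOp v, ?_, (freeHom_enum v).trans (hV v)⟩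
        rw [range_enumLeaf, inp_cor]

end Dendroidal

/-! ### Division in the operad of a Picard groupoid -/

namespace Dendroidal

section Invertible

variable {C : Type u} [Category.{v} C] [MonoidalCategory C]

/-- Whisker once more by `Z'`; exchange along `i` replaces `Z ⊗ Z'` by the unit, and whiskering by
the unit is faithful. -/
theorem whiskerRight_injective {Z Z' : C} (i : Z ⊗ Z' ≅ 𝟙_ C) {X Y : C} {f g : X ⟶ Y}
    (h : f ▷ Z = g ▷ Z) : f = g := by
  have h1 : f ▷ Z ▷ Z' = g ▷ Z ▷ Z' := by rw [h]
  have h2 : f ▷ (Z ⊗ Z') = g ▷ (Z ⊗ Z') := by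
    rw [whiskerRight_tensor, whiskerRight_tensor, h1]
  have h3 : f ▷ 𝟙_ C = g ▷ 𝟙_ C := by
    rw [← cancel_epi (X ◁ i.hom), whisker_exchange, whisker_exchange, h2]
  simpa using h3

/-- The preimage is `h ▷ Z'` conjugated with `i`. By injectivity, with `i'` as the witness, it may
be tested after whiskering by `Z'`; in this way no relation between `i` and `i'` is needed. -/
theorem whiskerRight_surjective {Z Z' : C} (i : Z ⊗ Z' ≅ 𝟙_ C) (i' : Z' ⊗ Z ≅ 𝟙_ C) {X Y : C}
    (h : X ⊗ Z ⟶ Y ⊗ Z) : ∃ f : X ⟶ Y, f ▷ Z = h := by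
  let f : X ⟶ Y := (ρ_ X).inv ≫ X ◁ i.inv ≫ (α_ _ _ _).inv ≫ h ▷ Z' ≫ (α_ _ _ _).hom ≫
    Y ◁ i.hom ≫ (ρ_ Y).hom
  refine ⟨f, whiskerRight_injective i' ?_⟩
  have h1 : f ▷ Z ▷ Z' = (α_ _ _ _).hom ≫ f ▷ (Z ⊗ Z') ≫ (α_ _ _ _).inv := by
    rw [whiskerRight_tensor]
    simp
  have h2 : f ▷ (Z ⊗ Z') = X ◁ i.hom ≫ f ▷ 𝟙_ C ≫ Y ◁ i.inv := by
    rw [← Category.assoc, whisker_exchange, Category.assoc, ← whiskerLeft_comp, i.hom_inv_id]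
    simp
  have h3 : f ▷ 𝟙_ C = (ρ_ X).hom ≫ f ≫ (ρ_ Y).inv := by simp
  rw [h1, h2, h3]
  simp only [f, Category.assoc, Iso.hom_inv_id, Iso.hom_inv_id_assoc, Category.comp_id,
    ← whiskerLeft_comp_assoc, whiskerLeft_id, Category.id_comp,
    ← whiskerLeft_comp]

end Invertible

theorem tens_congr {C : Type u} [Category.{v} C] [MonoidalCategory C] {I : Type w} {c c' : I → C}
    {L : List I} (h : ∀ i ∈ L, c i = c' i) : tens c L = tens c' L := by
  induction L with
  | nil => rfl
  | cons i L ih =>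
    change c i ⊗ tens c L = c' i ⊗ tens c' L
    rw [h i (by simp), ih fun j hj => h j (by simp [hj])]

theorem precomp_bijective {C : Type u} [Category.{v} C] {X Y Z : C} (f : X ⟶ Y) [IsIso f] :
    Function.Bijective fun g : Y ⟶ Z => f ≫ g :=
  ⟨fun _ _ h => (cancel_epi f).1 h, fun h => ⟨inv f ≫ h, by simp⟩⟩

theorem postcomp_bijective {C : Type u} [Category.{v} C] {X Y Z : C} (g : Y ⟶ Z) [IsIso g] :
    Function.Bijective fun f : X ⟶ Y => f ≫ g :=
  ⟨fun _ _ h => (cancel_mono g).1 h, fun h => ⟨h ≫ inv g, by simp⟩⟩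

/-- The numbers of inputs of operations that are the identities except for the first one. -/
def firstArity (k n : ℕ) : Fin (n + 1) → ℕ := Fin.cases k fun _ => 1

/-- The inputs of operations that are identities except for the first one. -/
def firstInputs {X : Type*} {k n : ℕ} (a : Fin k → X) (b : Fin n → X) :
    (j : Fin (n + 1)) → Fin (firstArity k n j) → X :=
  Fin.cases a fun i _ => b i

/-- Operations that are identities except for the first one. -/
def firstOps {P : Operad.{u}} {k n : ℕ} {a : Fin k → P.Col} {b : Fin (n + 1) → P.Col}
    (f : P.Op a (b 0)) (j : Fin (n + 1)) : P.Op (firstInputs a (fun i => b i.succ) j) (b j) :=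
  Fin.cases (motive := fun j => P.Op (firstInputs a (fun i => b i.succ) j) (b j)) f
    (fun i => P.id (b i.succ)) j

/-- Composition with an operation at the first input. -/
def Operad.circ (P : Operad.{u}) {k n m : ℕ} (e : (Σ j, Fin (firstArity k n j)) ≃ Fin m)
    {a : Fin k → P.Col} {b : Fin (n + 1) → P.Col} {r : Fin m → P.Col} {d : P.Col}
    (hr : ∀ j i, r (e ⟨j, i⟩) = firstInputs a (fun i => b i.succ) j i) (g : P.Op b d)
    (f : P.Op a (b 0)) : P.Op r d :=
  P.comp e hr g (firstOps f)

/-- Left and right division by operations. -/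
structure Operad.HasDivision (P : Operad.{u}) : Prop where
  left : ∀ {k n m : ℕ} (e : (Σ j, Fin (firstArity k n j)) ≃ Fin m)
    {a : Fin k → P.Col} {b : Fin (n + 1) → P.Col} {r : Fin m → P.Col} {d : P.Col}
    (hr : ∀ j i, r (e ⟨j, i⟩) = firstInputs a (fun i => b i.succ) j i) (f : P.Op a (b 0)),
    Function.Bijective fun g : P.Op b d => P.circ e hr g f
  right : ∀ {k n m : ℕ} (e : (Σ j, Fin (firstArity k n j)) ≃ Fin m)
    {a : Fin k → P.Col} {b : Fin (n + 1) → P.Col} {r : Fin m → P.Col} {d : P.Col}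
    (hr : ∀ j i, r (e ⟨j, i⟩) = firstInputs a (fun i => b i.succ) j i) (g : P.Op b d),
    Function.Bijective fun f : P.Op a (b 0) => P.circ e hr g f

section

variable {C : Type u} [Category.{u} C] [MonoidalCategory C] [SymmetricCategory C]

/-- The blocks of a composition at the first input. -/
noncomputable def firstBlock {k n m : ℕ} (e : (Σ j, Fin (firstArity k n j)) ≃ Fin m)
    {a : Fin k → C} {b : Fin (n + 1) → C} {r : Fin m → C}
    (hr : ∀ j i, r (e ⟨j, i⟩) = firstInputs a (fun i => b i.succ) j i)
    (f : tens a (List.finRange k) ⟶ b 0) (j : Fin (n + 1)) :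
    tens r ((List.finRange (firstArity k n j)).map fun i => e ⟨j, i⟩) ⟶ b j :=
  relabel (fun i => e ⟨j, i⟩) (hr j) (List.finRange _) ≫ firstOps (P := symOperad C) f j

/-- Only the first block depends on `f`; the identities at the other inputs contribute a fixed
factor. -/
theorem exists_blockMap_firstBlock {k n m : ℕ} (e : (Σ j, Fin (firstArity k n j)) ≃ Fin m)
    {a : Fin k → C} {b : Fin (n + 1) → C} {r : Fin m → C}
    (hr : ∀ j i, r (e ⟨j, i⟩) = firstInputs a (fun i => b i.succ) j i) (L : List (Fin n)) :
    ∃ Ψ : tens r ((L.map Fin.succ).flatMap fun j =>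
        (List.finRange (firstArity k n j)).map fun i => e ⟨j, i⟩) ⟶ tens b (L.map Fin.succ),
      ∀ f, blockMap (firstBlock e hr f) (L.map Fin.succ) = Ψ := by
  induction L with
  | nil => exact ⟨𝟙 _, fun _ => rfl⟩
  | cons i L ih =>
    obtain ⟨Ψ, h⟩ := ih
    refine ⟨split r _ _ ≫ ((relabel (fun t => e ⟨i.succ, t⟩) (hr i.succ) (List.finRange _) ≫
      (symOperad C).id (b i.succ)) ⊗ₘ Ψ), fun f => ?_⟩
    rw [← h f]
    rfl

/-- Up to precomposition with an isomorphism, the map is `f ↦ f ▷ Z`, where `Z` is the tensor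
product of the inputs of index at least 1, which is an invertible object. -/
theorem bijective_blockMap_firstBlock [IsGroupoid C]
    (hC : ∀ X : C, ∃ Y : C, Nonempty (X ⊗ Y ≅ 𝟙_ C)) {k n m : ℕ}
    (e : (Σ j, Fin (firstArity k n j)) ≃ Fin m) {a : Fin k → C} {b : Fin (n + 1) → C}
    {r : Fin m → C} (hr : ∀ j i, r (e ⟨j, i⟩) = firstInputs a (fun i => b i.succ) j i) :
    Function.Bijective fun f => blockMap (firstBlock e hr f) (List.finRange (n + 1)) := by
  rw [List.finRange_succ]
  obtain ⟨Ψ, hΨ⟩ := exists_blockMap_firstBlock e hr (List.finRange n)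
  let Z := tens b ((List.finRange n).map Fin.succ)
  obtain ⟨Z', ⟨i⟩⟩ := hC Z
  have h3 : ∀ f, blockMap (firstBlock e hr f) (0 :: (List.finRange n).map Fin.succ) =
      (split r _ _ ≫ (relabel (fun i => e ⟨0, i⟩) (hr 0) (List.finRange _) ⊗ₘ Ψ)) ≫ f ▷ Z := by
    intro f
    rw [← hΨ f]
    have key : ∀ {W X Y Y' X' Q : C} (s : W ⟶ X ⊗ Q) (p : X ⟶ Y) (f : Y ⟶ Y') (g : Q ⟶ X'),
        s ≫ ((p ≫ f) ⊗ₘ g) = (s ≫ (p ⊗ₘ g)) ≫ f ▷ X' := by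
      intro W X Y Y' X' Q s p f g
      rw [Category.assoc, ← tensorHom_id, tensorHom_comp_tensorHom, Category.comp_id]
    exact key _ _ _ _
  rw [funext h3]
  exact (precomp_bijective _).comp (⟨fun f g h => whiskerRight_injective i h, fun h =>
    whiskerRight_surjective i (β_ _ _ ≪≫ i) h⟩ : Function.Bijective fun f => f ▷ Z)

/-- Dividing by `f` on one side is cancelling an isomorphism of the groupoid. On the other side one
cancels `g` and the reordering, and then the invertible object by which `f` is whiskered. -/
theorem hasDivision_symOperad [IsGroupoid C] (hC : ∀ X : C, ∃ Y : C, Nonempty (X ⊗ Y ≅ 𝟙_ C)) :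
    (symOperad C).HasDivision where
  left {k n m} e a b r d hr f := by
    have : ∀ g : tens (C := C) b (List.finRange _) ⟶ d, (symOperad C).circ e hr g f =
      (reorder (C := C) r (perm_blocks e) ≫ blockMap (firstBlock (C := C) e hr f) (List.finRange _)) ≫ g :=
      fun g => (Category.assoc _ _ _).symm
    refine Eq.mpr (congrArg Function.Bijective (funext this)) ?_
    exact precomp_bijective (C := C) _
  right {k n m} e a b r d hr g :=
    (precomp_bijective (C := C) (Z := d) (reorder (C := C) r (perm_blocks e))).comp
      ((@postcomp_bijective C _ _ _ _ g (IsGroupoid.all_isIso (C := C) g)).comp (bijective_blockMap_firstBlock (C := C) hC e hr))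

theorem exists_first_input (hC : ∀ X : C, ∃ Y : C, Nonempty (X ⊗ Y ≅ 𝟙_ C)) {n : ℕ}
    (c : Fin n → C) (d : C) : ∃ y : C, ∀ c' : Fin (n + 1) → C, c' 0 = y → (∀ i, c' i.succ = c i) →
      Nonempty (tens c' (List.finRange (n + 1)) ⟶ d) := by
  -- `Fin.cons d c` serves only to index the remaining inputs by successors; its value at 0 does not
  -- enter. With an inverse `Z'` of their tensor product, the input `d ⊗ Z'` gives a total
  -- isomorphic to `d`.
  obtain ⟨Z', ⟨i⟩⟩ := hC (tens (fun j => (Fin.cons d c : Fin (n + 1) → C) j)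
    ((List.finRange n).map Fin.succ))
  refine ⟨d ⊗ Z', fun c' h0 hc => ?_⟩
  rw [List.finRange_succ]
  have h := tens_congr (c := c') (c' := fun j => (Fin.cons d c : Fin (n + 1) → C) j)
    (L := (List.finRange n).map Fin.succ) (by
      intro j hj
      obtain ⟨i, -, rfl⟩ := List.mem_map.1 hj
      exact hc i)
  change Nonempty (c' 0 ⊗ tens c' _ ⟶ d)
  rw [h, h0]
  exact ⟨(α_ _ _ _).hom ≫ d ◁ ((β_ _ _).hom ≫ i.hom) ≫ (ρ_ d).hom⟩

end

end Dendroidal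

/-! ### From division in an operad to division in its nerve -/

namespace Dendroidal

open Dendroidal.Tree

theorem Operad.comp_congr {P : Operad.{u}} {n m : ℕ} {k : Fin n → ℕ}
    (e : (Σ j, Fin (k j)) ≃ Fin m) {b : Fin n → P.Col} {a a' : (j : Fin n) → Fin (k j) → P.Col}
    {r : Fin m → P.Col} {d : P.Col} (hr : ∀ j i, r (e ⟨j, i⟩) = a j i)
    (hr' : ∀ j i, r (e ⟨j, i⟩) = a' j i) (g : P.Op b d) {f : ∀ j, P.Op (a j) (b j)}
    {f' : ∀ j, P.Op (a' j) (b j)} (hf : ∀ j, HEq (f j) (f' j)) :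
    P.comp e hr g f = P.comp e hr' g f' := by
  obtain rfl : a = a' := by
    funext j i
    rw [← hr, hr']
  obtain rfl : f = f' := funext fun j => eq_of_heq (hf j)
  rfl

theorem map_firstInputs {X Y : Type*} (φ : X → Y) {k n : ℕ} (a : Fin k → X) (b : Fin n → X) (j i) :
    φ (firstInputs a b j i) = firstInputs (fun i => φ (a i)) (fun i => φ (b i)) j i := by
  induction j using Fin.cases with
  | zero => rfl
  | succ j => rfl

theorem Operad.Hom.map_circ {P : Operad.{u}} {Q : Operad.{v}} (F : Hom P Q) {k n m : ℕ}
    (e : (Σ j, Fin (firstArity k n j)) ≃ Fin m) {a : Fin k → P.Col} {b : Fin (n + 1) → P.Col}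
    {r : Fin m → P.Col} {d : P.Col}
    (hr : ∀ j i, r (e ⟨j, i⟩) = firstInputs a (fun i => b i.succ) j i) (g : P.Op b d)
    (f : P.Op a (b 0)) :
    F.map (P.circ e hr g f) =
      Q.circ e (fun j i => (congrArg F.col (hr j i)).trans (map_firstInputs F.col _ _ j i))
        (F.map g) (F.map f) := by
  refine (F.map_comp _ _ _ _).trans (Operad.comp_congr _ _ _ _ fun j => ?_)
  induction j using Fin.cases with
  | zero => exact HEq.rfl
  | succ j => exact heq_of_eq (F.map_id _)

theorem Operad.reidx_reidx {P : Operad.{u}} {m m' m'' : ℕ} {r : Fin m → P.Col}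
    {r' : Fin m' → P.Col} {r'' : Fin m'' → P.Col} {d : P.Col} (σ : Fin m ≃ Fin m')
    (h : ∀ i, r' (σ i) = r i) (τ : Fin m' ≃ Fin m'') (h' : ∀ i, r'' (τ i) = r' i) (f : P.Op r d) :
    P.reidx τ h' (P.reidx σ h f) = P.reidx (σ.trans τ) (fun i => (h' _).trans (h i)) f :=
  P.reidx_comp _ _ _ _ _ _

section

variable {P : Operad.{u}} {A : Type} [Finite A]

theorem cor_enum_isOp {n : ℕ} {α : Fin n → A} (hα : Function.Bijective α) :
    (cor A).IsOp (fun i => leaf (α i)) rt := by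
  refine isOp_of_set (leaf_injective.comp hα.1) ?_
  have : Set.range (fun i => leaf (α i)) = Set.range (leaf (A := A)) := hα.2.range_comp _
  rw [this]
  exact cor_isOpSet

theorem range_cor_enum {n : ℕ} {α : Fin n → A} (hα : Function.Bijective α) (v : (cor A).Vertex) :
    (Set.range fun i => leaf (α i)) = inp v := by
  have : Set.range (fun i => leaf (α i)) = Set.range (leaf (A := A)) := hα.2.range_comp _
  rw [this, inp_cor]

/-- Operations give elements of the nerve on corollas. -/
theorem exists_hom_cor (col : (cor A).Edge → P.Col) {n : ℕ} {α : Fin n → A}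
    (hα : Function.Bijective α) (o : P.Op (fun i => col (leaf (α i))) (col rt)) :
    ∃ x : Operad.Hom (cor A).operad P, x.col = col ∧ HEq (x.map ⟨cor_enum_isOp hα⟩) o := by
  have h1 : ∀ v : (cor A).Vertex, ∃ σ : Fin n ≃ Fin (arity v), ∀ i, enum v (σ i) = leaf (α i) :=
    fun v => exists_equiv_of_range_eq (leaf_injective.comp hα.1) (enum_injective v)
      ((range_cor_enum hα v).trans (range_enum v).symm)
  choose σ hσ using h1
  obtain ⟨V, hV⟩ : ∃ V : ∀ v : (cor A).Vertex, P.Op (fun i => col (enum v i))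
      (col ((cor A).out v)), ∀ v, V v = P.reidx (r' := fun i => col (enum v i)) (σ v)
        (fun i => congrArg col (hσ v i)) o := ⟨_, fun v => rfl⟩
  refine ⟨freeHom col V, rfl, ?_⟩
  let v0 : (cor A).Vertex := ()
  have h2 : (freeHom col V).map ⟨cor_enum_isOp hα⟩ =
      (freeHom col V).map ((cor A).operad.reidx (r := enum v0) (r' := fun i => leaf (α i))
        (σ v0).symm (fun i => by
          have := hσ v0 ((σ v0).symm i)
          rw [Equiv.apply_symm_apply] at this
          exact this.symm) ⟨enum_isOp v0⟩) := rfl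
  have h5 : (freeHom col V).map ⟨enum_isOp v0⟩ = P.reidx (r' := fun i => col (enum v0 i)) (σ v0)
      (fun i => congrArg col (hσ v0 i)) o := (eq_of_heq (freeHom_enum v0)).trans (hV v0)
  refine heq_of_eq (h2.trans ((Operad.Hom.map_reidx _ _ _ _).trans ?_))
  refine (congrArg (fun t => P.reidx _ _ t) h5).trans ?_
  refine (P.reidx_reidx _ _ _ _ _).trans ?_
  have h3 := P.reidx_refl o
  have h4 : (σ v0).trans (σ v0).symm = Equiv.refl _ := Equiv.self_trans_symm _
  refine Eq.trans ?_ h3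
  congr 1

theorem hom_cor_ext {x y : Operad.Hom (cor A).operad P} (hc : x.col = y.col) {n : ℕ}
    {α : Fin n → A} (hα : Function.Bijective α)
    (h : HEq (x.map ⟨cor_enum_isOp hα⟩) (y.map ⟨cor_enum_isOp hα⟩)) : x = y :=
  IsOp.hom_ext' hc fun v => ⟨n, _, cor_enum_isOp hα, range_cor_enum hα v, h⟩

end

theorem exists_pair {T : Tree} {v v' : T.Vertex} (hv : v ≠ v') (h : ∀ z, z = v ∨ z = v') :
    ∃ u w : T.Vertex, T.below (T.out u) = some w ∧ T.out w = T.root ∧ (v = u ∨ v = w) ∧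
      ∀ z, z = u ∨ z = w := by
  obtain ⟨w, hw⟩ := exists_root_vertex v
  obtain ⟨u, hu⟩ : ∃ u, u ≠ w := by
    rcases h w with rfl | rfl
    · exact ⟨v', hv.symm⟩
    · exact ⟨v, hv⟩
  have h2 := two_cover hu h
  refine ⟨u, w, ?_, hw, h2 v, h2⟩
  rcases hz : T.below (T.out u) with _ | z
  · exact absurd (T.out_injective (((T.below_eq_none _).1 hz).trans hw.symm)) hu
  · rcases h2 z with rfl | rfl
    · exact absurd hz (below_out_ne _)
    · rfl

/-- Enumerations for the composite of the two vertices of a tree. -/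
theorem exists_enum_pair {T : Tree} {u w : T.Vertex} (huw : T.below (T.out u) = some w)
    (hw : T.out w = T.root) (h : ∀ z, z = u ∨ z = w) :
    ∃ (k n m : ℕ) (a : Fin k → T.Edge) (b : Fin (n + 1) → T.Edge) (r : Fin m → T.Edge)
      (e : (Σ j, Fin (firstArity k n j)) ≃ Fin m),
      Function.Injective a ∧ Set.range a = inp u ∧ Function.Injective b ∧ Set.range b = inp w ∧
      b 0 = T.out u ∧ (∀ j i, r (e ⟨j, i⟩) = firstInputs a (fun i => b i.succ) j i) ∧
      Function.Injective r ∧ Set.range r = lv Set.univ T.root := by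
  obtain ⟨k, a, ha, har⟩ := exists_enum (inp u)
  obtain ⟨n, b, hb, hbr⟩ := exists_enum (inp w \ {T.out u})
  -- The inner edge is made input number 0 of the lower vertex, the position at which `Operad.circ`
  -- composes.
  let b' : Fin (n + 1) → T.Edge := Fin.cons (T.out u) b
  have hb' : Function.Injective b' := Fin.cons_injective_iff.2 ⟨fun h => by
    rw [hbr] at h
    exact h.2 rfl, hb⟩
  have hbr' : Set.range b' = inp w := by
    rw [Fin.range_cons, hbr, Set.insert_sdiff_singleton, Set.insert_eq_of_mem]
    exact huw
  let e := finSigmaFinEquiv (n := firstArity k n)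
  let r : _ → T.Edge := fun t => firstInputs a (fun i => b' i.succ) (e.symm t).1 (e.symm t).2
  have hr : ∀ j i, r (e ⟨j, i⟩) = firstInputs a (fun i => b' i.succ) j i := by
    intro j i
    exact congrArg (fun p : Σ j, Fin (firstArity k n j) => firstInputs a (fun i => b' i.succ) p.1 p.2)
      (e.symm_apply_apply ⟨j, i⟩)
  have hop : T.IsOp r (T.out w) := by
    refine IsOp.comp e hr (inp_finite_isOp w hb' hbr') fun j => ?_
    induction j using Fin.cases with
    | zero => exact inp_finite_isOp u ha har
    | succ j => exact IsOp.id _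
  refine ⟨k, n, _, a, b', r, e, ha, har, hb', hbr', rfl, hr, hop.isOpSet.1, ?_⟩
  have h1 : ({u, w} : Set T.Vertex) = Set.univ := Set.eq_univ_of_forall h
  rw [← h1, ← hw, lv_pair huw, ← hbr, ← har]
  ext x
  constructor
  · rintro ⟨t, rfl⟩
    obtain ⟨⟨j, i⟩, rfl⟩ := e.surjective t
    rw [hr]
    induction j using Fin.cases with
    | zero => exact Or.inr ⟨i, rfl⟩
    | succ j => exact Or.inl ⟨j, rfl⟩
  · rintro (⟨i, rfl⟩ | ⟨i, rfl⟩)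
    · exact ⟨e ⟨i.succ, (0 : Fin 1)⟩, hr _ _⟩
    · exact ⟨e ⟨0, i⟩, hr 0 i⟩

section

variable {P : Operad.{u}} {T : Tree}

/-- An enumeration of the inputs of an operation lifts to the leaves of the corolla. -/
theorem exists_lift_enum {A : Type} [Finite A] (f : cor A ⟶ T) {n : ℕ} {a : Fin n → T.Edge}
    (ha : Function.Injective a) (hr : Set.range a = Set.range fun i => ed f (leaf i)) :
    ∃ α : Fin n → A, Function.Bijective α ∧ ∀ i, ed f (leaf (α i)) = a i := by
  obtain ⟨σ, hσ⟩ := exists_equiv_of_range_eq ha (cor_hom_injective f) hr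
  exact ⟨σ, σ.bijective, hσ⟩

theorem heq_map_of_res {A : Type} [Finite A] (f : cor A ⟶ T) {n : ℕ} {a : Fin n → T.Edge}
    {d : T.Edge} (o : T.IsOp a d) (hr : Set.range a = Set.range fun i => ed f (leaf i))
    (hd : ed f rt = d) {α : Fin n → A} (hα : Function.Bijective α)
    (h : ∀ i, ed f (leaf (α i)) = a i) (x : Operad.Hom T.operad P) :
    HEq (x.map ⟨o⟩) ((Operad.Hom.trans f x).map ⟨cor_enum_isOp hα⟩) := by
  subst hd
  obtain rfl : a = fun i => ed f (leaf (α i)) := funext fun i => (h i).symm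
  rfl

theorem heq_of_res_eq {A : Type} [Finite A] (f : cor A ⟶ T) {n : ℕ} {a : Fin n → T.Edge}
    {d : T.Edge} (o : T.IsOp a d) (hr : Set.range a = Set.range fun i => ed f (leaf i))
    (hd : ed f rt = d) {x y : Operad.Hom T.operad P}
    (h : Operad.Hom.trans f x = Operad.Hom.trans f y) : HEq (x.map ⟨o⟩) (y.map ⟨o⟩) := by
  obtain ⟨α, hα, hα'⟩ := exists_lift_enum f o.isOpSet.1 hr
  refine (heq_map_of_res f o hr hd hα hα' x).trans (HEq.trans ?_
    (heq_map_of_res f o hr hd hα hα' y).symm)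
  rw [h]

theorem heq_map_of_eq {x y : Operad.Hom T.operad P} {n : ℕ} {a : Fin n → T.Edge} {d d' : T.Edge}
    (hd : d = d') (o : T.IsOp a d) (o' : T.IsOp a d') (h : HEq (x.map ⟨o⟩) (y.map ⟨o⟩)) :
    HEq (x.map ⟨o'⟩) (y.map ⟨o'⟩) := by
  subst hd
  exact h

theorem firstOps_isOp {k n m : ℕ} {a : Fin k → T.Edge} {b : Fin (n + 1) → T.Edge}
    {r : Fin m → T.Edge} (e : (Σ j, Fin (firstArity k n j)) ≃ Fin m) {d : T.Edge}
    (hr : ∀ j i, r (e ⟨j, i⟩) = firstInputs a (fun i => b i.succ) j i) (hb : T.IsOp b d)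
    (ha : T.IsOp a (b 0)) : T.IsOp r d :=
  (T.operad.circ e hr ⟨hb⟩ ⟨ha⟩).down

/-- The total operation is the composite `circ` of the lower and the upper vertex. Agreement on it
and on one factor gives agreement on the other by cancellation, and freeness then gives equality. -/
theorem HasDivision.divUnique (hP : P.HasDivision) : DivUnique (operadNerve.obj P) := by
  intro T v v' hv hz x y hE hV ht
  change Operad.Hom T.operad P at x y
  obtain ⟨u, w, huw, hw, hvuw, h2⟩ := exists_pair hv hz
  obtain ⟨k, n, m, a, b, r, e, ha, har, hb, hbr, hb0, hr, hri, hrr⟩ := exists_enum_pair huw hw h2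
  have hc : x.col = y.col :=
    funext fun e => congrArg (fun h : Operad.Hom eta.operad P => h.col ()) (hE e)
  have hbo := inp_finite_isOp w hb hbr
  have hao := inp_finite_isOp u ha har
  have hao' : T.IsOp a (b 0) := hb0 ▸ hao
  have hro := firstOps_isOp e hr hbo hao'
  have hR : HEq (x.map ⟨hro⟩) (y.map ⟨hro⟩) :=
    heq_of_res_eq (total T) hro (hrr.trans Subtype.range_val.symm) hw.symm ht
  have hcirc : ∀ x : Operad.Hom T.operad P, x.map ⟨hro⟩ = _ := fun x =>
    x.map_circ e hr ⟨hbo⟩ ⟨hao'⟩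
  have key : HEq (x.map ⟨hbo⟩) (y.map ⟨hbo⟩) ∧ HEq (x.map ⟨hao'⟩) (y.map ⟨hao'⟩) := by
    have h3 : HEq (x.map ⟨hbo⟩) (y.map ⟨hbo⟩) ∨ HEq (x.map ⟨hao'⟩) (y.map ⟨hao'⟩) := by
      rcases hvuw with rfl | rfl
      · exact Or.inr (heq_of_res_eq (vmap v) hao' (har.trans Subtype.range_val.symm) hb0.symm hV)
      · exact Or.inl (heq_of_res_eq (vmap v) hbo (hbr.trans Subtype.range_val.symm) rfl hV)
    rw [hcirc, hcirc] at hR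
    obtain ⟨c, x, _, _⟩ := x
    obtain ⟨c', y, _, _⟩ := y
    obtain rfl : c = c' := hc
    have hR := eq_of_heq hR
    rcases h3 with h3 | h3
    · have h4 : x ⟨hbo⟩ = y ⟨hbo⟩ := eq_of_heq h3
      refine ⟨h3, heq_of_eq ?_⟩
      refine (hP.right e _ _).1 (Eq.trans hR ?_)
      exact congrArg (fun g => P.circ e _ g (y ⟨hao'⟩)) h4.symm
    · have h4 : x ⟨hao'⟩ = y ⟨hao'⟩ := eq_of_heq h3
      refine ⟨heq_of_eq ?_, h3⟩
      refine (hP.left e _ _).1 (Eq.trans hR ?_)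
      exact congrArg (fun f => P.circ e _ (y ⟨hbo⟩) f) h4.symm
  refine IsOp.hom_ext' hc fun z => ?_
  rcases h2 z with rfl | rfl
  · refine ⟨k, a, hao, har, ?_⟩
    exact heq_map_of_eq hb0 hao' hao key.2
  · exact ⟨_, b, hbo, hbr, key.1⟩

theorem heq_map_circ {k n m : ℕ} {a : Fin k → T.Edge} {b : Fin (n + 1) → T.Edge}
    {r : Fin m → T.Edge} {e : (Σ j, Fin (firstArity k n j)) ≃ Fin m} {d : T.Edge}
    {hr : ∀ j i, r (e ⟨j, i⟩) = firstInputs a (fun i => b i.succ) j i} {hb : T.IsOp b d}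
    {ha : T.IsOp a (b 0)} {x : Operad.Hom T.operad P} {col : T.Edge → P.Col} (hc : x.col = col)
    {G : P.Op (fun i => col (b i)) (col d)} {φ : P.Op (fun i => col (a i)) (col (b 0))}
    (hG : HEq (x.map ⟨hb⟩) G) (hφ : HEq (x.map ⟨ha⟩) φ) :
    HEq (x.map (T.operad.circ e hr ⟨hb⟩ ⟨ha⟩))
      (P.circ e (r := fun i => col (r i)) (fun j i => (congrArg col (hr j i)).trans (map_firstInputs col _ _ j i)) G φ) := by
  subst hc
  obtain rfl := eq_of_heq hG
  obtain rfl := eq_of_heq hφ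
  exact heq_of_eq (x.map_circ e hr ⟨hb⟩ ⟨ha⟩)

/-- Elements of the nerve on corollas mapping to a tree, with a given operation. -/
theorem exists_hom_cor_map {A : Type} [Finite A] (f : cor A ⟶ T) {n : ℕ} {a : Fin n → T.Edge}
    {d : T.Edge} (ha : Function.Injective a)
    (hr : Set.range a = Set.range fun i => ed f (leaf i)) (hd : ed f rt = d)
    (col : T.Edge → P.Col) (o : P.Op (fun i => col (a i)) (col d)) :
    ∃ s : Operad.Hom (cor A).operad P, (∀ e, s.col e = col (ed f e)) ∧
      ∀ (α : Fin n → A) (hα : Function.Bijective α), (∀ i, ed f (leaf (α i)) = a i) →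
        HEq (s.map ⟨cor_enum_isOp hα⟩) o := by
  obtain ⟨α, hα, h⟩ := exists_lift_enum f ha hr
  subst hd
  obtain rfl : a = fun i => ed f (leaf (α i)) := funext fun i => (h i).symm
  obtain ⟨s, hs, hs'⟩ := exists_hom_cor (fun e => col (ed f e)) hα o
  refine ⟨s, congrFun hs, fun α' hα' h' => ?_⟩
  obtain rfl : α' = α := funext fun i => cor_hom_injective f (h' i)
  exact hs'

theorem HasDivision.divFill (hP : P.HasDivision) : DivFill (operadNerve.obj P) := by
  intro T v v' hv hz κ f t hf1 hf2 ht1 ht2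
  change Operad.Hom (cor _).operad P at f t
  obtain ⟨u, w, huw, hw, hvuw, h2⟩ := exists_pair hv hz
  obtain ⟨k, n, m, a, b, r, e, ha, har, hb, hbr, hb0, hr, hri, hrr⟩ := exists_enum_pair huw hw h2
  have hbo := inp_finite_isOp w hb hbr
  have hao := inp_finite_isOp u ha har
  have hao' : T.IsOp a (b 0) := hb0 ▸ hao
  have hro := firstOps_isOp e hr hbo hao'
  have har' : Set.range a = Set.range fun i => ed (vmap u) (leaf i) :=
    har.trans Subtype.range_val.symm
  have hbr' : Set.range b = Set.range fun i => ed (vmap w) (leaf i) :=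
    hbr.trans Subtype.range_val.symm
  have hrr' : Set.range r = Set.range fun i => ed (total T) (leaf i) :=
    hrr.trans Subtype.range_val.symm
  let col : T.Edge → P.Col := fun e => Operad.Hom.col (P := eta.operad) (κ e) ()
  have hcol : ∀ {A : Type} [Finite A] (g : cor A ⟶ T) (y : Operad.Hom (cor A).operad P),
      res (D := operadNerve.obj P) (edgeMap _ rt) y = κ (ed g rt) →
      (∀ i, res (D := operadNerve.obj P) (edgeMap _ (leaf i)) y = κ (ed g (leaf i))) →
      ∀ e, y.col e = col (ed g e) := by
    intro A _ g y h1 h2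
    refine cor_cases ?_ fun i => ?_
    · exact congrArg (fun h : Operad.Hom eta.operad P => h.col ()) h1
    · exact congrArg (fun h : Operad.Hom eta.operad P => h.col ()) (h2 i)
  have hft : ∀ {A : Type} [Finite A] (g : cor A ⟶ T) (y : Operad.Hom (cor A).operad P),
      (∀ e, y.col e = col (ed g e)) → ∀ {n : ℕ} {a : Fin n → T.Edge} {d : T.Edge}
      (_ : Function.Injective a) (_ : Set.range a = Set.range fun i => ed g (leaf i))
      (_ : ed g rt = d), ∃ o : P.Op (fun i => col (a i)) (col d),
      ∀ (α : Fin n → A) (hα : Function.Bijective α), (∀ i, ed g (leaf (α i)) = a i) →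
        HEq (y.map ⟨cor_enum_isOp hα⟩) o := by
    intro A _ g y hy n a d ha hr hd
    obtain ⟨α, hα, h⟩ := exists_lift_enum g ha hr
    subst hd
    obtain rfl : a = fun i => ed g (leaf (α i)) := funext fun i => (h i).symm
    obtain ⟨o, ho⟩ := op_heq (fun i => hy (leaf (α i))) (hy rt) (y.map ⟨cor_enum_isOp hα⟩)
    refine ⟨o, fun α' hα' h' => ?_⟩
    obtain rfl : α' = α := funext fun i => cor_hom_injective g (h' i)
    exact ho.symm
  have hfc := hcol (vmap v) f hf1 hf2
  have htc := hcol (total T) t ht1 ht2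
  obtain ⟨R, hR⟩ := hft (total T) t htc hri hrr' hw.symm
  -- `G` is to be the lower operation and `φ` the upper one, with composite the given total `R`. The
  -- given one is taken over, and the other is the quotient of `R` by it.
  obtain ⟨G, φ, hGφ, hGf, hφf⟩ : ∃ (G : P.Op (fun i => col (b i)) (col (T.out w)))
      (φ : P.Op (fun i => col (a i)) (col (b 0))),
      P.circ e (r := fun i => col (r i)) (fun j i => (congrArg col (hr j i)).trans (map_firstInputs col _ _ j i)) G φ = R ∧
      (∀ h : v = w, ∀ (α : Fin (n + 1) → inp v) (hα : Function.Bijective α),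
        (∀ i, (α i).1 = b i) → HEq (f.map ⟨cor_enum_isOp hα⟩) G) ∧
      (∀ h : v = u, ∀ (α : Fin k → inp v) (hα : Function.Bijective α),
        (∀ i, (α i).1 = a i) → HEq (f.map ⟨cor_enum_isOp hα⟩) φ) := by
    rcases hvuw with rfl | rfl
    · obtain ⟨φ, hφ⟩ := hft (vmap v) f hfc ha har' hb0.symm
      obtain ⟨G, hG⟩ := (hP.left e (r := fun i => col (r i)) (b := fun i => col (b i)) (fun j i => (congrArg col (hr j i)).trans
        (map_firstInputs col _ _ j i)) φ).2 R
      exact ⟨G, φ, hG, fun h => absurd (h ▸ huw) (below_out_ne _), fun _ => hφ⟩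
    · obtain ⟨G, hG⟩ := hft (vmap v) f hfc hb hbr' rfl
      obtain ⟨φ, hφ⟩ := (hP.right e (r := fun i => col (r i)) (b := fun i => col (b i)) (fun j i => (congrArg col (hr j i)).trans
        (map_firstInputs col _ _ j i)) G).2 R
      exact ⟨G, φ, hφ, fun _ => hG, fun h => absurd (h ▸ huw) (below_out_ne _)⟩
  have hs : ∀ z : T.Vertex, ∃ s : Operad.Hom (cor (inp z)).operad P,
      (∀ e, s.col e = col (ed (vmap z) e)) ∧
      (∀ h : z = w, ∀ (α : Fin (n + 1) → inp z) (hα : Function.Bijective α),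
        (∀ i, (α i).1 = b i) → HEq (s.map ⟨cor_enum_isOp hα⟩) G) ∧
      (∀ h : z = u, ∀ (α : Fin k → inp z) (hα : Function.Bijective α),
        (∀ i, (α i).1 = a i) → HEq (s.map ⟨cor_enum_isOp hα⟩) φ) := by
    intro z
    rcases h2 z with rfl | rfl
    · obtain ⟨s, hs, hs'⟩ := exists_hom_cor_map (vmap z) ha har' hb0.symm col φ
      exact ⟨s, hs, fun h => absurd (h ▸ huw) (below_out_ne _), fun _ => hs'⟩
    · obtain ⟨s, hs, hs'⟩ := exists_hom_cor_map (vmap z) hb hbr' rfl col G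
      exact ⟨s, hs, fun _ => hs', fun h => absurd (h ▸ huw) (below_out_ne _)⟩
  choose s hs1 hs2 hs3 using hs
  have hsedge : ∀ z e, res (D := operadNerve.obj P) (edgeMap _ e) (s z) = κ (ed (vmap z) e) := by
    intro z e
    exact IsOp.hom_ext (P := P) (T := eta) (F := Operad.Hom.trans (edgeMap _ e) (s z))
      (G := κ (ed (vmap z) e)) (funext fun _ => hs1 z e) fun v => v.elim
  obtain ⟨x, hx1, hx2⟩ := (segal_operadNerve P).2 T κ s (fun z => hsedge z _) fun z i => hsedge z _
  change Operad.Hom T.operad P at x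
  have hxc : x.col = col :=
    funext fun e => congrArg (fun h : Operad.Hom eta.operad P => h.col ()) (hx1 e)
  refine ⟨x, hx1, ?_, ?_⟩
  · rw [hx2]
    refine Eq.trans (b := (s v : Operad.Hom (cor (inp v)).operad P)) rfl ?_
    have hc : (s v).col = f.col := funext fun e => (hs1 v e).trans (hfc e).symm
    rcases hvuw with rfl | rfl
    · obtain ⟨α, hα, h⟩ := exists_lift_enum (vmap v) ha har'
      exact hom_cor_ext hc hα ((hs3 v rfl α hα h).trans (hφf rfl α hα h).symm)
    · obtain ⟨α, hα, h⟩ := exists_lift_enum (vmap v) hb hbr'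
      exact hom_cor_ext hc hα ((hs2 v rfl α hα h).trans (hGf rfl α hα h).symm)
  · obtain ⟨α, hα, h⟩ := exists_lift_enum (total T) hri hrr'
    obtain ⟨α1, hα1, h1⟩ := exists_lift_enum (vmap w) hb hbr'
    obtain ⟨α2, hα2, h2⟩ := exists_lift_enum (vmap u) ha har'
    refine hom_cor_ext (x := Operad.Hom.trans (total T) x) (y := t)
      (funext fun e => (congrFun hxc _).trans (htc e).symm) hα ?_
    refine (heq_map_of_res (total T) hro hrr' hw.symm hα h x).symm.trans
      (HEq.trans ?_ (hR α hα h).symm)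
    rw [← hGφ]
    refine heq_map_circ (hr := hr) (hb := hbo) (ha := hao') hxc ?_ ?_
    · refine (heq_map_of_res (vmap w) hbo hbr' rfl hα1 h1 x).trans ?_
      have : Operad.Hom.trans (vmap w) x = s w := hx2 w
      rw [this]
      exact hs2 w rfl α1 hα1 h1
    · refine (heq_map_of_res (vmap u) hao' har' hb0.symm hα2 h2 x).trans ?_
      have : Operad.Hom.trans (vmap u) x = s u := hx2 u
      rw [this]
      exact hs3 u rfl α2 hα2 h2

end

end Dendroidal

/-! ### Horns of corollas, and the nerve of a Picard groupoid -/

namespace Dendroidal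

open Dendroidal.Tree

theorem exists_hom_of_vertex {P : Operad.{u}} {T : Tree} {v : T.Vertex} (hv : ∀ z, z = v)
    (col : T.Edge → P.Col) {n : ℕ} {b : Fin n → T.Edge} (hb : Function.Injective b)
    (hbr : Set.range b = inp v) (o : P.Op (fun i => col (b i)) (col (T.out v))) :
    ∃ x : Operad.Hom T.operad P, x.col = col := by
  have hs : ∀ z : T.Vertex, ∃ s : Operad.Hom (cor (inp z)).operad P,
      ∀ e, s.col e = col (ed (vmap z) e) := by
    intro z
    obtain rfl := hv z
    obtain ⟨s, hs, -⟩ := exists_hom_cor_map (vmap z) hb (hbr.trans Subtype.range_val.symm) rfl col o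
    exact ⟨s, hs⟩
  choose s hs using hs
  let κ : T.Edge → Operad.Hom eta.operad P := fun e => freeHom (fun _ => col e) fun v => v.elim
  have hsedge : ∀ z e, res (D := operadNerve.obj P) (edgeMap _ e) (s z) = κ (ed (vmap z) e) := by
    intro z e
    exact IsOp.hom_ext (P := P) (T := eta) (F := Operad.Hom.trans (edgeMap _ e) (s z))
      (G := κ (ed (vmap z) e)) (funext fun _ => hs z e) fun v => v.elim
  obtain ⟨x, hx, -⟩ := (segal_operadNerve P).2 T κ s (fun z => hsedge z _) fun z i => hsedge z _
  exact ⟨x, funext fun e => congrArg (fun h : Operad.Hom eta.operad P => h.col ()) (hx e)⟩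

section

variable {C : Type u} [Category.{u} C] [MonoidalCategory C] [SymmetricCategory C]

theorem corollaFill_symOperad (hC : ∀ X : C, ∃ Y : C, Nonempty (X ⊗ Y ≅ 𝟙_ C)) :
    CorollaFill (operadNerve.obj (symOperad C)) := by
  intro T v hv e κ
  classical
  let col0 : T.Edge → C := fun e' => if h : e' = e then 𝟙_ C else
    Operad.Hom.col (P := eta.operad) (Q := symOperad C) (κ e' h) ()
  suffices h : ∃ (y : C) (n : ℕ) (b : Fin n → T.Edge), Function.Injective b ∧
      Set.range b = inp v ∧ Nonempty (tens (fun i => Function.update col0 e y (b i))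
        (List.finRange n) ⟶ Function.update col0 e y (T.out v)) by
    obtain ⟨y, n, b, hb, hbr, ⟨o⟩⟩ := h
    obtain ⟨x, hx⟩ := exists_hom_of_vertex (P := symOperad C) hv (Function.update col0 e y) hb hbr o
    refine ⟨x, fun e' h => ?_⟩
    refine IsOp.hom_ext (P := symOperad C) (T := eta) (F := Operad.Hom.trans (edgeMap _ e') x)
      (G := κ e' h) (funext fun _ => ?_) fun v => v.elim
    refine (congrFun hx e').trans ?_
    exact (Function.update_of_ne h y col0).trans (dif_neg h)
  -- If the root is missing, the tensor product of the inputs serves, with an identity as operation.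
  -- If a leaf is missing, it is made the first input, and `exists_first_input` solves for it with a
  -- tensor inverse.
  by_cases he : e = T.out v
  · obtain ⟨n, b, hb, hbr⟩ := exists_enum (inp v)
    refine ⟨tens (fun i => col0 (b i)) (List.finRange n), n, b, hb, hbr, ⟨eqToHom ?_⟩⟩
    subst he
    rw [Function.update_self]
    refine tens_congr fun i _ => Function.update_of_ne ?_ _ _
    intro h
    have : b i ∈ inp v := hbr ▸ ⟨i, rfl⟩
    rw [h] at this
    exact below_out_ne v this
  · have hev : e ∈ inp v := by
      rcases h : T.below e with _ | z
      · obtain ⟨r, hr⟩ := exists_root_vertex v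
        obtain rfl := hv r
        exact absurd (((T.below_eq_none _).1 h).trans hr.symm) he
      · rw [hv z] at h
        exact h
    obtain ⟨n, b, hb, hbr⟩ := exists_enum (inp v \ {e})
    have hbe : ∀ i, b i ≠ e := fun i h => by
      have : b i ∈ inp v \ {e} := hbr ▸ ⟨i, rfl⟩
      exact this.2 h
    obtain ⟨y, hy⟩ := exists_first_input hC (fun i => col0 (b i)) (col0 (T.out v))
    refine ⟨y, n + 1, Fin.cons e b, Fin.cons_injective_iff.2 ⟨fun ⟨i, h⟩ => hbe i h, hb⟩, ?_, ?_⟩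
    · rw [Fin.range_cons, hbr, Set.insert_sdiff_singleton, Set.insert_eq_of_mem hev]
    · rw [Function.update_of_ne (Ne.symm he)]
      exact hy _ (Function.update_self _ _ _) fun i => Function.update_of_ne (hbe i) _ _

end

theorem isStrictlyFullyKan_nerve (C : SymMonCat.{u}) (hC : SymMonCat.IsPicard C) :
    IsStrictlyFullyKan (SymMonCat.nerve.obj C) := by
  have := hC.1
  have hd : (symOperad C.carrier).HasDivision := hasDivision_symOperad hC.2
  exact isStrictlyFullyKan_of_segal (segal_operadNerve _) (HasDivision.divUnique hd)
    (HasDivision.divFill hd) (corollaFill_symOperad hC.2)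

end Dendroidal

/-! ### Trees with two levels -/

namespace Dendroidal

namespace Tree

variable {J : Type} (K : J → Type) [Finite J] [∀ j, Finite (K j)]

/-- The tree with two levels of vertices. -/
def tree2 : Tree where
  Edge := Option (J ⊕ Σ j, K j)
  Vertex := Option J
  finite_edge := inferInstance
  finite_vertex := inferInstance
  root := none
  out v := v.map Sum.inl
  out_injective := Option.map_injective Sum.inl_injective
  below x := x.map (Sum.elim (fun _ => none) fun p => some p.1)
  below_eq_none x := by cases x <;> simp
  descending := by
    refine ⟨fun x => x.elim 0 (Sum.elim (fun _ => 1) fun _ => 2), ?_⟩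
    rintro (_ | _ | ⟨j, i⟩) v h
    · cases h
    · cases h
      exact Nat.zero_lt_one
    · cases h
      exact Nat.one_lt_two

variable {K}

/-- The root of a tree with two levels. -/
def root2 : (tree2 K).Edge := none

/-- The inner edges of a tree with two levels. -/
def mid2 (j : J) : (tree2 K).Edge := some (Sum.inl j)

/-- The leaves of a tree with two levels. -/
def top2 (p : Σ j, K j) : (tree2 K).Edge := some (Sum.inr p)

theorem tree2_edge_cases {P : (tree2 K).Edge → Prop} (h1 : P root2) (h2 : ∀ j, P (mid2 j))
    (h3 : ∀ p, P (top2 p)) (x) : P x := by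
  rcases x with _ | j | p
  · exact h1
  · exact h2 j
  · exact h3 p

/-- The root vertex of a tree with two levels. -/
def low2 : (tree2 K).Vertex := none

/-- The other vertices of a tree with two levels. -/
def up2 (j : J) : (tree2 K).Vertex := some j

theorem tree2_vertex_cases {P : (tree2 K).Vertex → Prop} (h1 : P low2) (h2 : ∀ j, P (up2 j)) (x) :
    P x := by
  rcases x with _ | j
  · exact h1
  · exact h2 j

theorem inp_low2 : inp (low2 (K := K)) = Set.range mid2 := by
  ext x
  induction x using tree2_edge_cases with
  | h1 => exact ⟨fun h => (nomatch h), fun h => (nomatch h)⟩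
  | h2 j => exact ⟨fun _ => ⟨j, rfl⟩, fun _ => rfl⟩
  | h3 p => exact ⟨fun h => (nomatch h), fun h => (nomatch h)⟩

theorem inp_up2 (j : J) : inp (up2 (K := K) j) = Set.range fun i => top2 ⟨j, i⟩ := by
  ext x
  induction x using tree2_edge_cases with
  | h1 => exact ⟨fun h => (nomatch h), fun h => (nomatch h)⟩
  | h2 j => exact ⟨fun h => (nomatch h), fun h => (nomatch h)⟩
  | h3 p =>
    constructor
    · obtain ⟨j', i⟩ := p
      intro h
      cases h
      exact ⟨i, rfl⟩
    · rintro ⟨i, h⟩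
      cases h
      rfl

theorem mid2_injective : Function.Injective (mid2 (K := K)) := fun i j h => by
  cases h
  rfl

theorem top2_injective : Function.Injective (top2 (K := K)) := fun i j h => by
  cases h
  rfl

/-- The root vertex of a tree with two levels as a map. -/
def lowMap : cor J ⟶ tree2 K :=
  corHom mid2 root2 mid2_injective (by
    rw [← inp_low2]
    exact isOpSet_inp _)

/-- The other vertices of a tree with two levels as maps. -/
def upMap (j : J) : cor (K j) ⟶ tree2 K :=
  corHom (fun i => top2 ⟨j, i⟩) (mid2 j) (top2_injective.comp sigma_mk_injective) (by
    rw [← inp_up2]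
    exact isOpSet_inp (up2 j))

variable {T : Tree}

/-- Grafting once more, with the subtrees indexed through the injection `b` instead of by the leaves
themselves. -/
theorem IsOpSet.subst {X : Type*} {b : X → T.Edge} (hb : Function.Injective b) {d : T.Edge}
    (h : T.IsOpSet (Set.range b) d)
    {S : X → Set T.Edge} (hS : ∀ j, T.IsOpSet (S j) (b j)) :
    T.IsOpSet (⋃ j, S j) d ∧ ∀ j j' x, x ∈ S j → x ∈ S j' → j = j' := by
  obtain ⟨W, hW, hl⟩ := h
  choose V hV hVl using hS
  have hmem : ∀ l ∈ lv W d, ∃ j, b j = l := fun l hl' => by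
    rwa [hl] at hl'
  have hj : ∀ j, b j ∈ lv W d := fun j => by
    rw [hl]
    exact ⟨j, rfl⟩
  classical
  let V' : T.Edge → Set T.Vertex := fun l => if h : ∃ j, b j = l then V h.choose else ∅
  have hV' : ∀ j, V' (b j) = V j := by
    intro j
    have h : ∃ j', b j' = b j := ⟨j, rfl⟩
    simp only [V', dif_pos h]
    rw [hb h.choose_spec]
  obtain ⟨h1, h2, h3, -⟩ := graft hW V' (by
    intro l hl'
    obtain ⟨j, rfl⟩ := hmem l hl'
    rw [hV']
    exact hV j)
  refine ⟨⟨_, h1, h2.trans ?_⟩, fun j j' x hx hx' => hb ?_⟩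
  · ext x
    simp only [Set.mem_iUnion]
    constructor
    · rintro ⟨l, hl', hx⟩
      obtain ⟨j, rfl⟩ := hmem l hl'
      rw [hV', hVl] at hx
      exact ⟨j, hx⟩
    · rintro ⟨j, hx⟩
      exact ⟨b j, hj j, by rwa [hV', hVl]⟩
  · refine h3 _ (hj j) _ (hj j') x ?_ ?_
    · rw [hV']
      exact lv_sub (hVl j ▸ hx)
    · rw [hV']
      exact lv_sub (hVl j' ▸ hx')

theorem top2_isOpSet : (tree2 K).IsOpSet (Set.range top2) root2 := by
  have h := (cor_hom_isOpSet (lowMap (K := K)))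
  have h2 := (IsOpSet.subst mid2_injective h fun j => cor_hom_isOpSet (upMap j)).1
  have : (⋃ j, Set.range fun i => ed (upMap (K := K) j) (leaf i)) = Set.range top2 := by
    ext x
    simp only [Set.mem_iUnion, Set.mem_range]
    exact ⟨fun ⟨j, i, h⟩ => ⟨⟨j, i⟩, h⟩, fun ⟨⟨j, i⟩, h⟩ => ⟨j, i, h⟩⟩
  rwa [this] at h2

/-- The total operation of a tree with two levels. -/
def totMap {A : Type} [Finite A] (e : (Σ j, K j) ≃ A) : cor A ⟶ tree2 K :=
  corHom (fun a => top2 (e.symm a)) root2 (top2_injective.comp e.symm.injective) (by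
    have : Set.range (fun a => top2 (e.symm a)) = Set.range (top2 (K := K)) :=
      e.symm.surjective.range_comp top2
    rw [this]
    exact top2_isOpSet)

/-- Maps out of a tree with two levels. -/
theorem exists_tree2_hom (γ : cor J ⟶ T) (φ : ∀ j, cor (K j) ⟶ T)
    (h : ∀ j, ed (φ j) rt = ed γ (leaf j)) :
    ∃ m : tree2 K ⟶ T, lowMap ≫ m = γ ∧ ∀ j, upMap j ≫ m = φ j := by
  let ψ : (tree2 K).Edge → T.Edge := fun x => Option.elim x (ed γ rt)
    (Sum.elim (fun j => ed γ (leaf j)) fun p => ed (φ p.1) (leaf p.2))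
  refine ⟨homOfSet ψ (fun v => ?_) (fun v => ?_), cor_hom_ext rfl fun _ => rfl,
    fun j => cor_hom_ext (h j).symm fun _ => rfl⟩
  · induction v using tree2_vertex_cases with
    | h1 =>
      rw [inp_low2]
      rintro _ ⟨i, rfl⟩ _ ⟨j, rfl⟩ hij
      exact congrArg mid2 (cor_hom_injective γ hij)
    | h2 j =>
      rw [inp_up2]
      rintro _ ⟨i, rfl⟩ _ ⟨i', rfl⟩ hij
      exact congrArg (fun i => top2 ⟨j, i⟩) (cor_hom_injective (φ j) hij)
  · induction v using tree2_vertex_cases with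
    | h1 =>
      rw [inp_low2, ← Set.range_comp]
      exact cor_hom_isOpSet γ
    | h2 j =>
      rw [inp_up2, ← Set.range_comp]
      have := cor_hom_isOpSet (φ j)
      rw [h] at this
      exact this

end Tree

open Dendroidal.Tree

variable {D : DSet.{u}}

/-- The Segal condition for other indexings of the incoming edges of the vertices. -/
theorem Segal.exists_fill (hD : Segal D) {T : Tree} {B : T.Vertex → Type} [∀ v, Finite (B v)]
    (c : ∀ v, cor (B v) ⟶ T) (h1 : ∀ v, ed (c v) rt = T.out v)
    (h2 : ∀ v, (Set.range fun i => ed (c v) (leaf i)) = inp v) (κ : T.Edge → D.obj (op eta))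
    (s : ∀ v, D.obj (op (cor (B v)))) (hs : ∀ v, res (edgeMap _ rt) (s v) = κ (T.out v))
    (hs' : ∀ v i, res (edgeMap _ (leaf i)) (s v) = κ (ed (c v) (leaf i))) :
    ∃ x : D.obj (op T), (∀ e, res (edgeMap T e) x = κ e) ∧ ∀ v, res (c v) x = s v := by
  choose e he using fun v => exists_corMap_vmap (c v) (h1 v) (h2 v)
  obtain ⟨x, hx, hx'⟩ := hD.2 T κ (fun v => res (corMap (e v).symm) (s v)) (fun v => by
    rw [res_edge]
    exact hs v) (fun v i => by
    rw [res_edge, ed_corMap_leaf, hs', he v]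
    congr 1
    change ((e v) ((e v).symm i)).1 = i.1
    rw [Equiv.apply_symm_apply])
  refine ⟨x, hx, fun v => ?_⟩
  have := corMap_symm (e v).symm
  rw [Equiv.symm_symm] at this
  rw [he, ← res_res, hx', res_res, this, res_id]

theorem Separated.ext' (hD : Separated D) {T : Tree} {B : T.Vertex → Type} [∀ v, Finite (B v)]
    (c : ∀ v, cor (B v) ⟶ T) (h1 : ∀ v, ed (c v) rt = T.out v)
    (h2 : ∀ v, (Set.range fun i => ed (c v) (leaf i)) = inp v) {x y : D.obj (op T)}
    (he : ∀ e, res (edgeMap T e) x = res (edgeMap T e) y) (h : ∀ v, res (c v) x = res (c v) y) :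
    x = y := by
  refine hD _ _ _ he fun v => ?_
  obtain ⟨e, he⟩ := exists_corMap_vmap (c v) (h1 v) (h2 v)
  have := h v
  rw [he, ← res_res, ← res_res] at this
  exact res_corMap_injective e this

section

variable {J : Type} {K : J → Type} [Finite J] [∀ j, Finite (K j)]

variable (K) in
/-- The types of inputs of the vertices of a tree with two levels. -/
def Inp2 (v : (tree2 K).Vertex) : Type := Option.elim v J K

instance (v : (tree2 K).Vertex) : Finite (Inp2 K v) := by
  induction v using tree2_vertex_cases with
  | h1 => exact inferInstanceAs (Finite J)
  | h2 j => exact inferInstanceAs (Finite (K j))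

/-- The vertices of a tree with two levels as maps. -/
def vert2 (v : (tree2 K).Vertex) : cor (Inp2 K v) ⟶ tree2 K := by
  rcases v with _ | j
  · exact @lowMap J K _ _
  · exact @upMap J K _ _ j

/-- A family on the vertices of a tree with two levels. -/
def fam2 (g : D.obj (op (cor J))) (f : ∀ j, D.obj (op (cor (K j)))) (v : (tree2 K).Vertex) :
    D.obj (op (cor (Inp2 K v))) := by
  rcases v with _ | j
  · exact g
  · exact f j

theorem vert2_rt (v : (tree2 K).Vertex) : ed (vert2 v) rt = (tree2 K).out v := by
  induction v using tree2_vertex_cases with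
  | h1 => rfl
  | h2 j => rfl

theorem range_vert2 (v : (tree2 K).Vertex) :
    (Set.range fun i => ed (vert2 v) (leaf i)) = inp v := by
  induction v using tree2_vertex_cases with
  | h1 => exact (inp_low2 (K := K)).symm
  | h2 j => exact (inp_up2 (K := K) j).symm

/-- Trees with two levels encode simultaneous composition: a family of composable operations is an
element on such a tree, whose edge colours are forced by the operations. -/
theorem Segal.exists_tree2 (hD : Segal D) (g : D.obj (op (cor J)))
    (f : ∀ j, D.obj (op (cor (K j))))
    (h : ∀ j, res (edgeMap _ rt) (f j) = res (edgeMap _ (leaf j)) g) :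
    ∃ x : D.obj (op (tree2 K)), res lowMap x = g ∧ ∀ j, res (upMap j) x = f j := by
  obtain ⟨x, -, hx⟩ := hD.exists_fill (T := tree2 K) vert2 vert2_rt range_vert2
    (fun x => Option.elim x (res (edgeMap _ rt) g) (Sum.elim (fun j => res (edgeMap _ (leaf j)) g)
      fun p => res (edgeMap _ (leaf p.2)) (f p.1))) (fam2 g f)
    (tree2_vertex_cases rfl fun j => h j) (fun v => by
      induction v using tree2_vertex_cases with
      | h1 => exact fun _ => rfl
      | h2 j => exact fun _ => rfl)
  exact ⟨x, hx none, fun j => hx (some j)⟩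

/-- Every edge belongs to the corolla of some vertex, so the edges take care of themselves. -/
theorem Separated.tree2_ext (hD : Separated D) {x y : D.obj (op (tree2 K))}
    (hl : res lowMap x = res lowMap y) (hu : ∀ j, res (upMap j) x = res (upMap j) y) : x = y := by
  have hle : ∀ e, res (edgeMap _ (ed lowMap e)) x = res (edgeMap _ (ed lowMap e)) y := fun e => by
    rw [← res_edge, ← res_edge, hl]
  have hue : ∀ j e, res (edgeMap _ (ed (upMap j) e)) x = res (edgeMap _ (ed (upMap j) e)) y :=
    fun j e => by rw [← res_edge, ← res_edge, hu]
  exact hD.ext' vert2 vert2_rt range_vert2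
    (tree2_edge_cases (hle rt) (fun j => hle (leaf j)) fun p => hue p.1 (leaf p.2)) (fun v => by
      induction v using tree2_vertex_cases with
      | h1 => exact hl
      | h2 j => exact hu j)

end

end Dendroidal

/-! ### The nerve of operads is fully faithful -/

namespace Dendroidal

open Dendroidal.Tree

section

variable {P : Operad.{u}}

theorem Operad.comp_heq {n m : ℕ} {k : Fin n → ℕ} (e : (Σ j, Fin (k j)) ≃ Fin m)
    {b b' : Fin n → P.Col} {a a' : (j : Fin n) → Fin (k j) → P.Col} {r r' : Fin m → P.Col}
    {d d' : P.Col} {hr : ∀ j i, r (e ⟨j, i⟩) = a j i} {hr' : ∀ j i, r' (e ⟨j, i⟩) = a' j i}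
    {g : P.Op b d} {g' : P.Op b' d'} {f : ∀ j, P.Op (a j) (b j)} {f' : ∀ j, P.Op (a' j) (b' j)}
    (hb : ∀ j, b j = b' j) (ha : ∀ j i, a j i = a' j i) (hd : d = d') (hg : HEq g g')
    (hf : ∀ j, HEq (f j) (f' j)) : HEq (P.comp e hr g f) (P.comp e hr' g' f') := by
  obtain rfl : b = b' := funext hb
  obtain rfl : a = a' := funext fun j => funext (ha j)
  obtain rfl : r = r' := by
    funext t
    obtain ⟨⟨j, i⟩, rfl⟩ := e.surjective t
    rw [hr, hr']
  subst hd
  obtain rfl := eq_of_heq hg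
  obtain rfl : f = f' := funext fun j => eq_of_heq (hf j)
  rfl

theorem exists_elt {n : ℕ} {c : Fin n → P.Col} {d : P.Col} (p : P.Op c d) :
    ∃ x : Operad.Hom (cor (Fin n)).operad P, x.col rt = d ∧ (∀ i, x.col (leaf i) = c i) ∧
      HEq (x.map ⟨cor_enum_isOp Function.bijective_id⟩) p := by
  obtain ⟨x, hx, hx'⟩ := exists_hom_cor (A := Fin n) (fun e => Option.elim e d c)
    Function.bijective_id p
  exact ⟨x, congrFun hx _, fun i => congrFun hx _, hx'⟩

/-- The element of the nerve given by an operation. -/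
noncomputable def elt {n : ℕ} {c : Fin n → P.Col} {d : P.Col} (p : P.Op c d) :
    Operad.Hom (cor (Fin n)).operad P := (exists_elt p).choose

variable {n : ℕ} {c : Fin n → P.Col} {d : P.Col}

theorem elt_rt (p : P.Op c d) : (elt p).col rt = d := (exists_elt p).choose_spec.1

theorem elt_leaf (p : P.Op c d) (i : Fin n) : (elt p).col (leaf i) = c i :=
  (exists_elt p).choose_spec.2.1 i

theorem elt_map (p : P.Op c d) : HEq ((elt p).map ⟨cor_enum_isOp Function.bijective_id⟩) p :=
  (exists_elt p).choose_spec.2.2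

theorem eq_elt {p : P.Op c d} {x : Operad.Hom (cor (Fin n)).operad P} (h1 : x.col rt = d)
    (h2 : ∀ i, x.col (leaf i) = c i)
    (h : HEq (x.map ⟨cor_enum_isOp Function.bijective_id⟩) p) : x = elt p :=
  hom_cor_ext (funext (cor_cases (h1.trans (elt_rt p).symm) fun i =>
    (h2 i).trans (elt_leaf p i).symm)) Function.bijective_id (h.trans (elt_map p).symm)

/-- The element of the nerve given by a colour. -/
noncomputable def pt (c : P.Col) : Operad.Hom eta.operad P := freeHom (fun _ => c) fun v => v.elim

theorem eta_hom_ext {x y : Operad.Hom eta.operad P} (h : x.col () = y.col ()) : x = y :=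
  IsOp.hom_ext (funext fun _ => h) fun v => v.elim

theorem Operad.Hom.map_heq {Q : Operad.{v}} (F : Operad.Hom P Q) {c' : Fin n → P.Col} {d' : P.Col}
    {p : P.Op c d} {p' : P.Op c' d'} (hc : ∀ i, c i = c' i) (hd : d = d') (h : HEq p p') :
    HEq (F.map p) (F.map p') := by
  obtain rfl : c = c' := funext hc
  subst hd
  rw [eq_of_heq h]

end

/-- Colours are elements on `eta` and operations are elements on corollas, so `pt` and `elt` detect
all values of a map of operads. -/
instance : operadNerve.{u}.Faithful where
  map_injective {P Q F G} h := by
    have hT : ∀ (T : Tree) (x : Operad.Hom T.operad P), Operad.Hom.trans x F = Operad.Hom.trans x G :=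
      fun T x => congrArg (fun α : operadNerve.obj P ⟶ operadNerve.obj Q => α.app (op T) x) h
    have hc : F.col = G.col := funext fun c =>
      congrArg (fun y : Operad.Hom eta.operad Q => y.col ()) (hT eta (pt c))
    have hm : ∀ {n : ℕ} {c : Fin n → P.Col} {d : P.Col} (p : P.Op c d),
        HEq (F.map p) (G.map p) := by
      intro n c d p
      have h1 := congr_arg_heq (fun y : Operad.Hom (cor (Fin n)).operad Q =>
        y.map ⟨cor_enum_isOp Function.bijective_id⟩) (hT _ (elt p))
      exact (F.map_heq (elt_leaf p) (elt_rt p) (elt_map p)).symm.trans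
        (h1.trans (G.map_heq (elt_leaf p) (elt_rt p) (elt_map p)))
    obtain ⟨c, F, _, _⟩ := F
    obtain ⟨c', G, _, _⟩ := G
    obtain rfl : c = c' := hc
    obtain rfl : @F = @G := by
      funext n c d p
      exact eq_of_heq (hm p)
    rfl

section

variable {P Q : Operad.{u}} (α : operadNerve.obj P ⟶ operadNerve.obj Q)

/-- A map of nerves on elements. -/
def nerveApp {T : Tree} (x : Operad.Hom T.operad P) : Operad.Hom T.operad Q := α.app (op T) x

theorem nerveApp_trans {S T : Tree} (f : S ⟶ T) (x : Operad.Hom T.operad P) :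
    nerveApp α (Operad.Hom.trans f x) = Operad.Hom.trans f (nerveApp α x) :=
  NatTrans.naturality_apply α f.op x

/-- The map on colours of a map of nerves. -/
noncomputable def nerveCol (c : P.Col) : Q.Col := (nerveApp α (pt c)).col ()

theorem nerveApp_col {T : Tree} (x : Operad.Hom T.operad P) (e : T.Edge) :
    (nerveApp α x).col e = nerveCol α (x.col e) := by
  have h : Operad.Hom.trans (edgeMap T e) x = pt (x.col e) := eta_hom_ext rfl
  exact (congrArg (fun y : Operad.Hom eta.operad Q => y.col ()) (nerveApp_trans α (edgeMap T e) x)).symm.trans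
    (congrArg (fun y : Operad.Hom eta.operad P => (nerveApp α y).col ()) h)

theorem exists_nerveMap {n : ℕ} {c : Fin n → P.Col} {d : P.Col} (p : P.Op c d) :
    ∃ q : Q.Op (fun i => nerveCol α (c i)) (nerveCol α d),
      HEq q ((nerveApp α (elt p)).map ⟨cor_enum_isOp Function.bijective_id⟩) :=
  op_heq (fun i => (nerveApp_col α _ _).trans (congrArg _ (elt_leaf p i)))
    ((nerveApp_col α _ _).trans (congrArg _ (elt_rt p))) _

/-- The map on operations of a map of nerves. -/
noncomputable def nerveMap {n : ℕ} {c : Fin n → P.Col} {d : P.Col} (p : P.Op c d) :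
    Q.Op (fun i => nerveCol α (c i)) (nerveCol α d) := (exists_nerveMap α p).choose

theorem nerveMap_heq {n : ℕ} {c c' : Fin n → P.Col} {d d' : P.Col} {p : P.Op c d} {p' : P.Op c' d'}
    (hc : ∀ i, c i = c' i) (hd : d = d') (h : HEq p p') :
    HEq (nerveMap α p) (nerveMap α p') := by
  obtain rfl : c = c' := funext hc
  subst hd
  rw [eq_of_heq h]

/-- An operation of `T` is a map from a corolla to `T`, so naturality reduces the claim to the
definition of `nerveMap` on `elt`. -/
theorem nerveApp_map {T : Tree} (x : Operad.Hom T.operad P) {n : ℕ} {a : Fin n → T.Edge}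
    {d : T.Edge} (o : T.IsOp a d) : HEq ((nerveApp α x).map ⟨o⟩) (nerveMap α (x.map ⟨o⟩)) := by
  let f : cor (Fin n) ⟶ T := corHom a d o.isOpSet.1 o.isOpSet.2
  have h : Operad.Hom.trans f x = elt (x.map ⟨o⟩) := eq_elt rfl (fun _ => rfl) HEq.rfl
  refine HEq.trans ?_ (exists_nerveMap α (x.map ⟨o⟩)).choose_spec.symm
  have h1 := congr_arg_heq (fun y : Operad.Hom (cor (Fin n)).operad Q =>
    y.map ⟨cor_enum_isOp Function.bijective_id⟩) (nerveApp_trans α f x)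
  have h2 := congr_arg_heq (fun y => (nerveApp α y).map
    ⟨cor_enum_isOp (α := id) Function.bijective_id⟩) h
  exact h1.symm.trans h2

/-- The map of operads of a map of nerves. -/
noncomputable def nerveHom : Operad.Hom P Q where
  col := nerveCol α
  map p := nerveMap α p
  map_id c := by
    have h := nerveApp_map α (pt c) (IsOp.id (T := eta) ())
    have h1 : (pt c).map ⟨IsOp.id (T := eta) ()⟩ = P.id c := (pt c).map_id ()
    have h2 : (nerveApp α (pt c)).map ⟨IsOp.id (T := eta) ()⟩ = Q.id (nerveCol α c) :=
      (nerveApp α (pt c)).map_id ()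
    rw [h1] at h
    exact eq_of_heq (h.symm.trans (heq_of_eq h2))
  map_comp {n m k} e b a r d hr g f := by
    -- The operations `g` and `f j` form one element on a tree with two levels, and their composite
    -- is its total operation. Comparing the map of nerves on this operation and on the vertices
    -- shows that composition is preserved.
    obtain ⟨x, hx, hx'⟩ := (segal_operadNerve P).exists_tree2 (elt g) (fun j => elt (f j))
      fun j => eta_hom_ext (P := P) (x := Operad.Hom.trans (edgeMap _ rt) (elt (f j)))
        (y := Operad.Hom.trans (edgeMap _ (leaf j)) (elt g)) ((elt_rt _).trans (elt_leaf g j).symm)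
    change Operad.Hom (tree2 _).operad P at x
    have hr' : ∀ j i, top2 (e.symm (e ⟨j, i⟩)) = top2 ⟨j, i⟩ := by simp
    have og : (tree2 fun j => Fin (k j)).IsOp mid2 root2 := isOp_of_set mid2_injective
      (by rw [← inp_low2]; exact isOpSet_inp _)
    have of : ∀ j, (tree2 fun j => Fin (k j)).IsOp (fun i => top2 ⟨j, i⟩) (mid2 j) := fun j =>
      isOp_of_set (top2_injective.comp sigma_mk_injective)
        (by
          have := isOpSet_inp (up2 (K := fun j => Fin (k j)) j)
          rw [inp_up2] at this
          exact this)
    have hg : HEq (x.map ⟨og⟩) g := by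
      have := congr_arg_heq (fun y : Operad.Hom (cor (Fin n)).operad P =>
        y.map ⟨cor_enum_isOp Function.bijective_id⟩) hx
      exact this.trans (elt_map g)
    have hf : ∀ j, HEq (x.map ⟨of j⟩) (f j) := fun j => by
      have := congr_arg_heq (fun y : Operad.Hom (cor (Fin (k j))).operad P =>
        y.map ⟨cor_enum_isOp Function.bijective_id⟩) (hx' j)
      exact this.trans (elt_map (f j))
    have hcr : x.col root2 = d := (congrArg (fun y : Operad.Hom (cor (Fin n)).operad P =>
      y.col rt) hx).trans (elt_rt g)
    have hcm : ∀ j, x.col (mid2 j) = b j := fun j =>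
      (congrArg (fun y : Operad.Hom (cor (Fin n)).operad P => y.col (leaf j)) hx).trans
        (elt_leaf g j)
    have hct : ∀ j i, x.col (top2 ⟨j, i⟩) = a j i := fun j i =>
      (congrArg (fun y : Operad.Hom (cor (Fin (k j))).operad P => y.col (leaf i)) (hx' j)).trans
        (elt_leaf (f j) i)
    have hct' : ∀ t, x.col (top2 (e.symm t)) = r t := fun t => by
      obtain ⟨⟨j, i⟩, rfl⟩ := e.surjective t
      exact (congrArg (fun p => x.col (top2 p)) (e.symm_apply_apply _)).trans
        ((hct j i).trans (hr j i).symm)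
    have h1 : HEq (x.map ⟨IsOp.comp e (r := fun t => top2 (e.symm t)) hr' og of⟩) (P.comp e hr g f) :=
      (heq_of_eq (x.map_comp e (r := fun t => top2 (e.symm t)) hr' ⟨og⟩ fun j => ⟨of j⟩)).trans
        (Operad.comp_heq e hcm hct hcr hg hf)
    have h2 := nerveApp_map α x (IsOp.comp e (r := fun t => top2 (e.symm t)) hr' og of)
    have h3 := (nerveMap_heq α hct' hcr h1).symm.trans h2.symm
    refine eq_of_heq (h3.trans ((heq_of_eq ((nerveApp α x).map_comp e (r := fun t => top2 (e.symm t)) hr' ⟨og⟩ fun j =>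
      ⟨of j⟩)).trans (Operad.comp_heq e (fun j => ?_) (fun j i => ?_) ?_ ?_ fun j => ?_)))
    · exact (nerveApp_col α x _).trans (congrArg _ (hcm j))
    · exact (nerveApp_col α x _).trans (congrArg _ (hct j i))
    · exact (nerveApp_col α x _).trans (congrArg _ hcr)
    · exact (nerveApp_map α x og).trans (nerveMap_heq α hcm hcr hg)
    · exact (nerveApp_map α x (of j)).trans (nerveMap_heq α (hct j) (hcm j) (hf j))

end

/-- The map of operads `nerveHom` and the given map of nerves agree on edges and on the operation of
each vertex, hence on every element of the nerve. -/
instance : operadNerve.{u}.Full where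
  map_surjective {P Q} α := by
    refine ⟨nerveHom α, ?_⟩
    ext ⟨T⟩ x
    change Operad.Hom T.operad P at x
    change Operad.Hom.trans x (nerveHom α) = nerveApp α x
    refine IsOp.hom_ext (funext fun e => (nerveApp_col α x e).symm) fun v => ?_
    exact (nerveApp_map α x (enum_isOp v)).symm

end Dendroidal

/-! ### Composites of operations of small arity in the operad of a symmetric monoidal category -/

namespace Dendroidal

section

variable {C : Type u} [Category.{u} C] [MonoidalCategory C]

/-- The binary operation of a morphism out of a tensor product. -/
def bi (b : Fin 2 → C) {Z : C} (g : b 0 ⊗ b 1 ⟶ Z) : tens b (List.finRange 2) ⟶ Z :=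
  b 0 ◁ (ρ_ (b 1)).hom ≫ g

theorem bi_comp (b : Fin 2 → C) {Z W : C} (g : b 0 ⊗ b 1 ⟶ Z) (h : Z ⟶ W) :
    bi b g ≫ h = bi b (g ≫ h) := Category.assoc _ _ _

theorem bi_injective {b : Fin 2 → C} {Z : C} {g g' : b 0 ⊗ b 1 ⟶ Z} (h : bi b g = bi b g') :
    g = g' := (cancel_epi (b 0 ◁ (ρ_ (b 1)).hom)).1 h

/-- The ternary operation of a morphism out of a tensor product. -/
def tri (r : Fin 3 → C) {Z : C} (g : r 0 ⊗ r 1 ⊗ r 2 ⟶ Z) : tens r (List.finRange 3) ⟶ Z :=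
  r 0 ◁ r 1 ◁ (ρ_ (r 2)).hom ≫ g

theorem tri_injective {b : Fin 3 → C} {Z : C} {g g' : b 0 ⊗ b 1 ⊗ b 2 ⟶ Z}
    (h : tri b g = tri b g') : g = g' := (cancel_epi (b 0 ◁ b 1 ◁ (ρ_ (b 2)).hom)).1 h

variable [SymmetricCategory C]

theorem Rel.split_unit {I : Type w} (c : I → C) (L : List I) {X : C} (p : tens c L ⟶ X) :
    Rel (split c L [] ≫ (p ⊗ₘ 𝟙 (𝟙_ C)) ≫ (ρ_ X).hom) p := by
  rw [tensorHom_id, rightUnitor_naturality, ← Category.assoc]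
  suffices h : Rel (split c L [] ≫ (ρ_ (tens c L)).hom) (𝟙 _) by
    simpa using h.postcomp p
  clear p
  induction L with
  | nil =>
    refine Rel.of_eq ?_
    change (λ_ (𝟙_ C)).inv ≫ (ρ_ (𝟙_ C)).hom = 𝟙 _
    rw [← unitors_equal, Iso.inv_hom_id]
  | cons i L ih =>
    refine (Rel.of_eq ?_).trans ((Rel.cons i ih).trans (Rel.of_eq ?_)) <;> simp [split]

/-- The chosen bracketing ends with a factor `𝟙_ C`, which adds an empty block to every composite
with a binary operation; `Rel.split_unit` removes it. -/
theorem opComp_bi_rel {m : ℕ} {k : Fin 2 → ℕ} (e : (Σ j, Fin (k j)) ≃ Fin m)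
    {b : Fin 2 → C} {a : (j : Fin 2) → Fin (k j) → C} {r : Fin m → C} {d : C}
    (hr : ∀ j i, r (e ⟨j, i⟩) = a j i) (g : b 0 ⊗ b 1 ⟶ d)
    (f : (j : Fin 2) → (tens (a j) (List.finRange (k j)) ⟶ b j)) :
    Rel (opComp e hr (bi b g) f)
      (split r ((List.finRange (k 0)).map fun i => e ⟨0, i⟩)
          ((List.finRange (k 1)).map fun i => e ⟨1, i⟩) ≫
        ((relabel (fun i => e ⟨0, i⟩) (hr 0) (List.finRange (k 0)) ≫ f 0) ⊗ₘ
          (relabel (fun i => e ⟨1, i⟩) (hr 1) (List.finRange (k 1)) ≫ f 1)) ≫ g) := by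
  refine (opComp_rel e hr _ f).trans ?_
  set p := relabel (fun i => e ⟨0, i⟩) (hr 0) (List.finRange (k 0)) ≫ f 0
  set q := relabel (fun i => e ⟨1, i⟩) (hr 1) (List.finRange (k 1)) ≫ f 1 with hq
  have h := (Rel.tensor (Rel.refl p) (Rel.split_unit r _ q)).postcomp g
  refine (Rel.of_eq ?_).trans (h.trans (Rel.of_eq (Category.assoc _ _ _)))
  change (split r _ _ ≫ (p ⊗ₘ split r _ [] ≫ (q ⊗ₘ 𝟙 (𝟙_ C)))) ≫ b 0 ◁ (ρ_ (b 1)).hom ≫ g = _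
  simp [MonoidalCategory.tensorHom_def]

theorem opComp_unit {n : ℕ} {c : Fin n → C} {X Y : C} (p : tens c (List.finRange n) ⟶ X)
    (f : X ⟶ Y) : opComp (Equiv.uniqueSigma fun _ : Fin 1 => Fin n) (b := fun _ : Fin 1 => X)
      (a := fun _ => c) (r := c) (fun j _ => by obtain rfl := Subsingleton.elim j default; rfl)
      ((ρ_ X).hom ≫ f) (fun _ => p) = p ≫ f := by
  conv_rhs => rw [← opComp_id_left p (Equiv.uniqueSigma fun _ : Fin 1 => Fin n)
    (fun j _ => by obtain rfl := Subsingleton.elim j default; rfl)]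
  exact (congrArg _ (Category.assoc _ _ _).symm).trans (Category.assoc _ _ _).symm

/-- The order of the inputs of a composite with a binary operation, with `s` inputs of the first
argument. -/
noncomputable def pairEquiv (k : Fin 2 → ℕ) (m : ℕ) (s : ℕ)
    (h : ∀ p : Σ j, Fin (k j), s * p.1 + p.2 < m)
    (hb : Function.Bijective fun p : Σ j, Fin (k j) => (⟨s * p.1 + p.2, h p⟩ : Fin m)) :
    (Σ j, Fin (k j)) ≃ Fin m := Equiv.ofBijective _ hb

/-- A family indexed by `Fin 2`. -/
def pairFun {β : Fin 2 → Sort w} (x : β 0) (y : β 1) : (j : Fin 2) → β j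
  | 0 => x
  | 1 => y

/-- In this and the next definitions the two digits are the arities of the arguments of a binary
operation. Taking for `s` the arity of the first argument makes `s * j + i` the lexicographic order.
-/
noncomputable def e21 : (Σ j, Fin ((![2, 1] : Fin 2 → ℕ) j)) ≃ Fin 3 :=
  pairEquiv ![2, 1] 3 2 (by decide) (by decide)

noncomputable def e12 : (Σ j, Fin ((![1, 2] : Fin 2 → ℕ) j)) ≃ Fin 3 :=
  pairEquiv ![1, 2] 3 1 (by decide) (by decide)

noncomputable def e11 : (Σ _ : Fin 2, Fin 1) ≃ Fin 2 :=
  pairEquiv (fun _ => 1) 2 1 (by decide) (by decide)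

noncomputable def e01 : (Σ j, Fin ((![0, 1] : Fin 2 → ℕ) j)) ≃ Fin 1 :=
  pairEquiv ![0, 1] 1 0 (by decide) (by decide)

noncomputable def e10 : (Σ j, Fin ((![1, 0] : Fin 2 → ℕ) j)) ≃ Fin 1 :=
  pairEquiv ![1, 0] 1 0 (by decide) (by decide)

noncomputable def eSwap : (Σ _ : Fin 2, Fin 1) ≃ Fin 2 := e11.trans (Equiv.swap 0 1)

variable {b : Fin 2 → C} {d : C} (g : b 0 ⊗ b 1 ⟶ d)

/-- This formula and the following ones evaluate the operadic composites from which associativity,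
naturality, the unit laws and the symmetry of a lax functor will be read off. Since the input labels
are distinct, comparison up to canonical morphisms gives equality. -/
theorem opComp_21 (r : Fin 3 → C) (f : r 0 ⊗ r 1 ⟶ b 0) (h : r 2 ⟶ b 1) :
    opComp e21 (r := r) (a := fun j i => r (e21 ⟨j, i⟩)) (fun _ _ => rfl) (bi b g)
      (pairFun (bi (fun i : Fin 2 => r (e21 ⟨0, i⟩)) f) ((ρ_ (r 2)).hom ≫ h)) =
      tri r ((α_ _ _ _).inv ≫ (f ⊗ₘ h) ≫ g) := by
  refine Rel.eq (List.nodup_finRange 3) ((opComp_bi_rel e21 _ g _).trans (Rel.of_eq ?_))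
  change (r 0 ◁ (r 1 ◁ (λ_ _).inv ≫ (α_ _ _ _).inv) ≫ (α_ _ _ _).inv) ≫ 
    (((𝟙 (r 0) ⊗ₘ (𝟙 (r 1) ⊗ₘ 𝟙 _)) ≫ r 0 ◁ (ρ_ (r 1)).hom ≫ f) ⊗ₘ
      ((𝟙 (r 2) ⊗ₘ 𝟙 _) ≫ (ρ_ (r 2)).hom ≫ h)) ≫ g = r 0 ◁ r 1 ◁ (ρ_ (r 2)).hom ≫ _
  simp only [MonoidalCategory.tensorHom_def]
  monoidal

theorem opComp_12 (r : Fin 3 → C) (f : r 0 ⟶ b 0) (h : r 1 ⊗ r 2 ⟶ b 1) :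
    opComp e12 (r := r) (a := fun j i => r (e12 ⟨j, i⟩)) (fun _ _ => rfl) (bi b g)
      (pairFun ((ρ_ (r 0)).hom ≫ f) (bi (fun i : Fin 2 => r (e12 ⟨1, i⟩)) h)) =
      tri r ((f ⊗ₘ h) ≫ g) := by
  refine Rel.eq (List.nodup_finRange 3) ((opComp_bi_rel e12 _ g _).trans (Rel.of_eq ?_))
  change (r 0 ◁ (λ_ _).inv ≫ (α_ _ _ _).inv) ≫
    (((𝟙 (r 0) ⊗ₘ 𝟙 _) ≫ (ρ_ (r 0)).hom ≫ f) ⊗ₘ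
      ((𝟙 (r 1) ⊗ₘ 𝟙 (r 2) ⊗ₘ 𝟙 _) ≫ r 1 ◁ (ρ_ (r 2)).hom ≫ h)) ≫ g =
      r 0 ◁ r 1 ◁ (ρ_ (r 2)).hom ≫ _
  simp only [MonoidalCategory.tensorHom_def]
  monoidal

theorem opComp_11 (r : Fin 2 → C) (f : r 0 ⟶ b 0) (h : r 1 ⟶ b 1) :
    opComp e11 (r := r) (a := fun j i => r (e11 ⟨j, i⟩)) (fun _ _ => rfl) (bi b g)
      (pairFun ((ρ_ (r 0)).hom ≫ f) ((ρ_ (r 1)).hom ≫ h)) =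
      bi r ((f ⊗ₘ h) ≫ g) := by
  refine Rel.eq (List.nodup_finRange 2) ((opComp_bi_rel e11 _ g _).trans (Rel.of_eq ?_))
  change (r 0 ◁ (λ_ _).inv ≫ (α_ _ _ _).inv) ≫
    (((𝟙 (r 0) ⊗ₘ 𝟙 _) ≫ (ρ_ (r 0)).hom ≫ f) ⊗ₘ
      ((𝟙 (r 1) ⊗ₘ 𝟙 _) ≫ (ρ_ (r 1)).hom ≫ h)) ≫ g =
      r 0 ◁ (ρ_ (r 1)).hom ≫ _
  simp [MonoidalCategory.tensorHom_def]

theorem opComp_01 (r : Fin 1 → C) (f : 𝟙_ C ⟶ b 0) (h : r 0 ⟶ b 1) :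
    opComp e01 (r := r) (a := fun j i => r (e01 ⟨j, i⟩)) (fun _ _ => rfl) (bi b g)
      (pairFun f ((ρ_ (r 0)).hom ≫ h)) =
      (ρ_ (r 0)).hom ≫ (λ_ (r 0)).inv ≫ (f ⊗ₘ h) ≫ g := by
  refine Rel.eq (List.nodup_finRange 1) ((opComp_bi_rel e01 _ g _).trans (Rel.of_eq ?_))
  change (λ_ _).inv ≫ ((𝟙 _ ≫ f) ⊗ₘ ((𝟙 (r 0) ⊗ₘ 𝟙 _) ≫ (ρ_ (r 0)).hom ≫ h)) ≫ g = _
  simp only [MonoidalCategory.tensorHom_def']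
  monoidal

theorem opComp_10 (r : Fin 1 → C) (f : r 0 ⟶ b 0) (h : 𝟙_ C ⟶ b 1) :
    opComp e10 (r := r) (a := fun j i => r (e10 ⟨j, i⟩)) (fun _ _ => rfl) (bi b g)
      (pairFun ((ρ_ (r 0)).hom ≫ f) h) =
      (ρ_ (r 0)).hom ≫ (ρ_ (r 0)).inv ≫ (f ⊗ₘ h) ≫ g := by
  refine Rel.eq (List.nodup_finRange 1) ((opComp_bi_rel e10 _ g _).trans (Rel.of_eq ?_))
  change (r 0 ◁ (λ_ _).inv ≫ (α_ _ _ _).inv) ≫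
    (((𝟙 (r 0) ⊗ₘ 𝟙 _) ≫ (ρ_ (r 0)).hom ≫ f) ⊗ₘ (𝟙 _ ≫ h)) ≫ g = _
  simp [MonoidalCategory.tensorHom_def]

theorem opComp_swap (r : Fin 2 → C) (f : r 1 ⟶ b 0) (h : r 0 ⟶ b 1) :
    opComp eSwap (r := r) (a := fun j i => r (eSwap ⟨j, i⟩)) (fun _ _ => rfl) (bi b g)
      (pairFun ((ρ_ (r 1)).hom ≫ f) ((ρ_ (r 0)).hom ≫ h)) =
      bi r ((β_ _ _).hom ≫ (f ⊗ₘ h) ≫ g) := by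
  -- The symmetry enters as the canonical exchange of the two labels.
  have hs : Rel (c := r) (L := [1, 0]) (L' := [0, 1])
      (r 1 ◁ (ρ_ (r 0)).hom ≫ (f ⊗ₘ h) ≫ g)
      (r 0 ◁ (ρ_ (r 1)).hom ≫ (β_ _ _).hom ≫ (f ⊗ₘ h) ≫ g) := by
    refine ⟨_, Can.swap 1 0 [], ?_⟩
    simp [Dendroidal.swap]
  refine Rel.eq (List.nodup_finRange 2) ((opComp_bi_rel eSwap _ g _).trans
    ((Rel.of_eq ?_).trans hs))
  change (r 1 ◁ (λ_ _).inv ≫ (α_ _ _ _).inv) ≫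
    (((𝟙 (r 1) ⊗ₘ 𝟙 _) ≫ (ρ_ (r 1)).hom ≫ f) ⊗ₘ
      ((𝟙 (r 0) ⊗ₘ 𝟙 _) ≫ (ρ_ (r 0)).hom ≫ h)) ≫ g = _
  simp [MonoidalCategory.tensorHom_def]

end
end Dendroidal

/-! ### From maps of operads to lax symmetric monoidal functors -/

namespace Dendroidal

section

variable {C D : Type u} [Category.{u} C] [MonoidalCategory C] [SymmetricCategory C]
  [Category.{u} D] [MonoidalCategory D] [SymmetricCategory D]

/-- The map on objects of a map of operads. -/
def colMap (φ : Operad.Hom (symOperad C) (symOperad D)) : C → D := φ.col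

/-- The map on operations of a map of operads. -/
def opMap (φ : Operad.Hom (symOperad C) (symOperad D)) {n : ℕ} {c : Fin n → C} {d : C}
    (p : tens c (List.finRange n) ⟶ d) :
    tens (fun i => colMap φ (c i)) (List.finRange n) ⟶ colMap φ d :=
  φ.map (c := c) (d := d) p

variable (φ : Operad.Hom (symOperad C) (symOperad D))

theorem opMap_id (X : C) :
    opMap φ (c := fun _ : Fin 1 => X) (ρ_ X).hom = (ρ_ (colMap φ X)).hom := φ.map_id X

theorem opMap_comp {n m : ℕ} {k : Fin n → ℕ} (e : (Σ j, Fin (k j)) ≃ Fin m)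
    {b : Fin n → C} {a : (j : Fin n) → Fin (k j) → C} {r : Fin m → C} {d : C}
    (hr : ∀ j i, r (e ⟨j, i⟩) = a j i) (g : tens b (List.finRange n) ⟶ d)
    (f : (j : Fin n) → (tens (a j) (List.finRange (k j)) ⟶ b j)) :
    opMap φ (opComp e hr g f) =
      opComp e (fun j i => congrArg (colMap φ) (hr j i)) (opMap φ g) (fun j => opMap φ (f j)) :=
  φ.map_comp e (b := b) (a := a) (r := r) (d := d) hr g f

/-- The map on morphisms of a map of operads. -/
def unMap {X Y : C} (f : X ⟶ Y) : colMap φ X ⟶ colMap φ Y :=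
  (ρ_ _).inv ≫ opMap φ (c := fun _ : Fin 1 => X) ((ρ_ X).hom ≫ f)

theorem opMap_un {X Y : C} (f : X ⟶ Y) :
    opMap φ (c := fun _ : Fin 1 => X) ((ρ_ X).hom ≫ f) = (ρ_ (colMap φ X)).hom ≫ unMap φ f :=
  ((ρ_ (colMap φ X)).hom_inv_id_assoc _).symm

theorem opMap_unary {c : Fin 1 → C} {Y : C} (f : c 0 ⟶ Y) :
    opMap φ (c := c) ((ρ_ (c 0)).hom ≫ f) = (ρ_ (colMap φ (c 0))).hom ≫ unMap φ f := by
  have key : ∀ (X : C) (f : X ⟶ Y), opMap φ (c := fun _ : Fin 1 => X) ((ρ_ X).hom ≫ f) =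
    (ρ_ (colMap φ X)).hom ≫ unMap φ f := fun X f => opMap_un φ f
  obtain ⟨X, rfl⟩ : ∃ X, c = fun _ => X := ⟨c 0, funext fun i => congrArg c (Subsingleton.elim _ _)⟩
  exact key X f

/-- Postcomposition with a morphism is operadic composition with a unary operation, by
`opComp_unit`. -/
theorem opMap_postcomp {n : ℕ} {c : Fin n → C} {X Y : C} (p : tens c (List.finRange n) ⟶ X)
    (f : X ⟶ Y) : opMap φ (p ≫ f) = opMap φ p ≫ unMap φ f := by
  rw [← opComp_unit p f, opMap_comp, opMap_un]
  exact opComp_unit (opMap φ p) (unMap φ f)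

theorem unMap_id (X : C) : unMap φ (𝟙 X) = 𝟙 (colMap φ X) := by
  have h : opMap φ (c := fun _ : Fin 1 => X) ((ρ_ X).hom ≫ 𝟙 X) = (ρ_ (colMap φ X)).hom :=
    (congrArg (opMap φ (c := fun _ : Fin 1 => X)) (Category.comp_id _)).trans (opMap_id φ X)
  exact (congrArg ((ρ_ _).inv ≫ ·) h).trans (Iso.inv_hom_id _)

theorem unMap_comp {X Y Z : C} (f : X ⟶ Y) (g : Y ⟶ Z) :
    unMap φ (f ≫ g) = unMap φ f ≫ unMap φ g := by
  have h : opMap φ (c := fun _ : Fin 1 => X) ((ρ_ X).hom ≫ f ≫ g) =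
      opMap φ (c := fun _ : Fin 1 => X) ((ρ_ X).hom ≫ f) ≫ unMap φ g :=
    (congrArg (opMap φ (c := fun _ : Fin 1 => X)) (Category.assoc _ _ _).symm).trans
      (opMap_postcomp φ _ _)
  exact (congrArg ((ρ_ _).inv ≫ ·) h).trans (Category.assoc _ _ _).symm

/-- The functor of a map of operads. -/
def opFunctor : C ⥤ D where
  obj := colMap φ
  map f := unMap φ f
  map_id := unMap_id φ
  map_comp := unMap_comp φ

/-- The unit of the lax monoidal functor of a map of operads. -/
def opEps : 𝟙_ D ⟶ colMap φ (𝟙_ C) := opMap φ (c := fun i : Fin 0 => i.elim0) (𝟙 (𝟙_ C))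

/-- The tensorator of the lax monoidal functor of a map of operads. -/
def opMu (X Y : C) : colMap φ X ⊗ colMap φ Y ⟶ colMap φ (X ⊗ Y) :=
  colMap φ X ◁ (ρ_ (colMap φ Y)).inv ≫ opMap φ (bi ![X, Y] (𝟙 (X ⊗ Y)))

theorem opMap_nullary {c : Fin 0 → C} {X : C} (f : 𝟙_ C ⟶ X) :
    opMap φ (c := c) f = opEps φ ≫ unMap φ f := by
  obtain rfl : c = fun i => i.elim0 := Subsingleton.elim _ _
  exact (congrArg (opMap φ (c := fun i : Fin 0 => i.elim0)) (Category.id_comp f).symm).trans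
    (opMap_postcomp φ (c := fun i : Fin 0 => i.elim0) (𝟙 (𝟙_ C)) f)

/-- A binary operation is the universal one, the identity of `b 0 ⊗ b 1`, followed by a morphism,
and `opMu` is by definition the image of the universal one. -/
theorem opMap_bi (b : Fin 2 → C) {Z : C} (g : b 0 ⊗ b 1 ⟶ Z) :
    opMap φ (bi b g) = bi (fun i => colMap φ (b i)) (opMu φ (b 0) (b 1) ≫ unMap φ g) := by
  have key : ∀ (X Y : C) (g : X ⊗ Y ⟶ Z), opMap φ (bi ![X, Y] g) =
      colMap φ X ◁ (ρ_ (colMap φ Y)).hom ≫ opMu φ X Y ≫ unMap φ g := fun X Y g => by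
    refine (congrArg (opMap φ) ((congrArg (bi ![X, Y]) (Category.id_comp g).symm).trans
      (bi_comp ![X, Y] (𝟙 (X ⊗ Y)) g).symm)).trans ((opMap_postcomp φ _ g).trans ?_)
    rw [← Category.assoc]
    refine congrArg (· ≫ unMap φ g) ?_
    have h : ∀ {A B W : D} (p : A ⊗ B ⊗ 𝟙_ D ⟶ W), p = A ◁ (ρ_ B).hom ≫ A ◁ (ρ_ B).inv ≫ p := by
      simp
    exact h _
  obtain ⟨X, Y, rfl⟩ : ∃ X Y, b = ![X, Y] := ⟨b 0, b 1, by ext j; fin_cases j <;> rfl⟩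
  exact key X Y g

theorem opMap_pairFun {k : Fin 2 → ℕ} {a : (j : Fin 2) → Fin (k j) → C} {b : Fin 2 → C}
    (f : tens (a 0) (List.finRange (k 0)) ⟶ b 0) (h : tens (a 1) (List.finRange (k 1)) ⟶ b 1) :
    (fun j => opMap φ
      (pairFun (β := fun j => (tens (a j) (List.finRange (k j)) ⟶ b j)) f h j)) =
      pairFun (opMap φ f) (opMap φ h) :=
  funext fun j => match j with
    | 0 => rfl
    | 1 => rfl

variable {b : Fin 2 → C} {d : C} (g : b 0 ⊗ b 1 ⟶ d)

theorem opMap_comp_pair {m : ℕ} {k : Fin 2 → ℕ} (e : (Σ j, Fin (k j)) ≃ Fin m) {r : Fin m → C}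
    (f : tens (fun i => r (e ⟨0, i⟩)) (List.finRange (k 0)) ⟶ b 0)
    (h : tens (fun i => r (e ⟨1, i⟩)) (List.finRange (k 1)) ⟶ b 1) :
    opMap φ (opComp e (r := r) (a := fun j i => r (e ⟨j, i⟩)) (fun _ _ => rfl) (bi b g)
      (pairFun f h)) =
    opComp e (r := fun i => colMap φ (r i)) (a := fun j i => colMap φ (r (e ⟨j, i⟩)))
      (fun _ _ => rfl) (bi (fun i => colMap φ (b i)) (opMu φ (b 0) (b 1) ≫ unMap φ g))
      (pairFun (opMap φ f) (opMap φ h)) := by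
  rw [opMap_comp, opMap_bi]
  exact congrArg _ (opMap_pairFun φ (k := k) (a := fun j i => r (e ⟨j, i⟩)) (b := b) f h)

/-- A map of operads preserves each composite of small arity, and the same formula evaluates it in
the target with `opMu` and `opEps`. An axiom of lax functors arises whenever two such composites
describe the same operation. -/
theorem opMap_21 (r : Fin 3 → C) (f : r 0 ⊗ r 1 ⟶ b 0) (h : r 2 ⟶ b 1) :
    opMap φ (tri r ((α_ _ _ _).inv ≫ (f ⊗ₘ h) ≫ g)) =
      tri (fun i => colMap φ (r i)) ((α_ _ _ _).inv ≫
        ((opMu φ (r 0) (r 1) ≫ unMap φ f) ⊗ₘ unMap φ h) ≫ opMu φ (b 0) (b 1) ≫ unMap φ g) := by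
  refine (congrArg (opMap φ) (opComp_21 g r f h).symm).trans ((opMap_comp_pair φ g e21 _ _).trans ?_)
  refine Eq.trans ?_ (opComp_21 (b := fun i => colMap φ (b i)) _ (fun i => colMap φ (r i)) _ _)
  refine congrArg _ (congrArg₂ pairFun ?_ ?_)
  · exact opMap_bi φ (fun i : Fin 2 => r (e21 ⟨0, i⟩)) f
  · exact opMap_unary φ (c := fun i : Fin 1 => r (e21 ⟨1, i⟩)) h

theorem opMap_12 (r : Fin 3 → C) (f : r 0 ⟶ b 0) (h : r 1 ⊗ r 2 ⟶ b 1) :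
    opMap φ (tri r ((f ⊗ₘ h) ≫ g)) =
      tri (fun i => colMap φ (r i)) ((unMap φ f ⊗ₘ (opMu φ (r 1) (r 2) ≫ unMap φ h)) ≫
        opMu φ (b 0) (b 1) ≫ unMap φ g) := by
  refine (congrArg (opMap φ) (opComp_12 g r f h).symm).trans ((opMap_comp_pair φ g e12 _ _).trans ?_)
  refine Eq.trans ?_ (opComp_12 (b := fun i => colMap φ (b i)) _ (fun i => colMap φ (r i)) _ _)
  refine congrArg _ (congrArg₂ pairFun ?_ ?_)
  · exact opMap_unary φ (c := fun i : Fin 1 => r (e12 ⟨0, i⟩)) f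
  · exact opMap_bi φ (fun i : Fin 2 => r (e12 ⟨1, i⟩)) h

theorem opMap_11 (r : Fin 2 → C) (f : r 0 ⟶ b 0) (h : r 1 ⟶ b 1) :
    opMap φ (bi r ((f ⊗ₘ h) ≫ g)) =
      bi (fun i => colMap φ (r i)) ((unMap φ f ⊗ₘ unMap φ h) ≫
        opMu φ (b 0) (b 1) ≫ unMap φ g) := by
  refine (congrArg (opMap φ) (opComp_11 g r f h).symm).trans ((opMap_comp_pair φ g e11 _ _).trans ?_)
  refine Eq.trans ?_ (opComp_11 (b := fun i => colMap φ (b i)) _ (fun i => colMap φ (r i)) _ _)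
  refine congrArg _ (congrArg₂ pairFun ?_ ?_)
  · exact opMap_unary φ (c := fun i : Fin 1 => r (e11 ⟨0, i⟩)) f
  · exact opMap_unary φ (c := fun i : Fin 1 => r (e11 ⟨1, i⟩)) h

theorem opMap_swap (r : Fin 2 → C) (f : r 1 ⟶ b 0) (h : r 0 ⟶ b 1) :
    opMap φ (bi r ((β_ _ _).hom ≫ (f ⊗ₘ h) ≫ g)) =
      bi (fun i => colMap φ (r i)) ((β_ _ _).hom ≫ (unMap φ f ⊗ₘ unMap φ h) ≫
        opMu φ (b 0) (b 1) ≫ unMap φ g) := by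
  refine (congrArg (opMap φ) (opComp_swap g r f h).symm).trans
    ((opMap_comp_pair φ g eSwap _ _).trans ?_)
  refine Eq.trans ?_ (opComp_swap (b := fun i => colMap φ (b i)) _ (fun i => colMap φ (r i)) _ _)
  refine congrArg _ (congrArg₂ pairFun ?_ ?_)
  · exact opMap_unary φ (c := fun i : Fin 1 => r (eSwap ⟨0, i⟩)) f
  · exact opMap_unary φ (c := fun i : Fin 1 => r (eSwap ⟨1, i⟩)) h

theorem opMap_01 (r : Fin 1 → C) (f : 𝟙_ C ⟶ b 0) (h : r 0 ⟶ b 1) :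
    opMap φ (c := r) ((ρ_ (r 0)).hom ≫ (λ_ (r 0)).inv ≫ (f ⊗ₘ h) ≫ g) =
      (ρ_ (colMap φ (r 0))).hom ≫ (λ_ (colMap φ (r 0))).inv ≫
        ((opEps φ ≫ unMap φ f) ⊗ₘ unMap φ h) ≫ opMu φ (b 0) (b 1) ≫ unMap φ g := by
  refine (congrArg (opMap φ) (opComp_01 g r f h).symm).trans
    ((opMap_comp_pair φ g e01 _ _).trans ?_)
  refine Eq.trans ?_ (opComp_01 (b := fun i => colMap φ (b i)) _ (fun i => colMap φ (r i)) _ _)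
  refine congrArg _ (congrArg₂ pairFun ?_ ?_)
  · exact opMap_nullary φ f
  · exact opMap_unary φ (c := fun i : Fin 1 => r (e01 ⟨1, i⟩)) h

theorem opMap_10 (r : Fin 1 → C) (f : r 0 ⟶ b 0) (h : 𝟙_ C ⟶ b 1) :
    opMap φ (c := r) ((ρ_ (r 0)).hom ≫ (ρ_ (r 0)).inv ≫ (f ⊗ₘ h) ≫ g) =
      (ρ_ (colMap φ (r 0))).hom ≫ (ρ_ (colMap φ (r 0))).inv ≫
        (unMap φ f ⊗ₘ (opEps φ ≫ unMap φ h)) ≫ opMu φ (b 0) (b 1) ≫ unMap φ g := by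
  refine (congrArg (opMap φ) (opComp_10 g r f h).symm).trans
    ((opMap_comp_pair φ g e10 _ _).trans ?_)
  refine Eq.trans ?_ (opComp_10 (b := fun i => colMap φ (b i)) _ (fun i => colMap φ (r i)) _ _)
  refine congrArg _ (congrArg₂ pairFun ?_ ?_)
  · exact opMap_unary φ (c := fun i : Fin 1 => r (e10 ⟨0, i⟩)) f
  · exact opMap_nullary φ h

/-- The operation `f ⊗ₘ h` is the universal binary operation precomposed with two unary ones, and
also the universal binary operation followed by a morphism. -/
theorem opMu_natural {X X' Y Y' : C} (f : X ⟶ X') (h : Y ⟶ Y') :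
    (unMap φ f ⊗ₘ unMap φ h) ≫ opMu φ X' Y' = opMu φ X Y ≫ unMap φ (f ⊗ₘ h) := by
  have h1 := opMap_11 φ (b := ![X', Y']) (𝟙 _) ![X, Y] f h
  rw [Category.comp_id, opMap_bi, unMap_id, Category.comp_id] at h1
  exact (bi_injective h1).symm

/-- One ternary operation is written as a composite of shape `(2, 1)` followed by the associator,
and as a composite of shape `(1, 2)`. -/
theorem op_associativity (X Y Z : C) :
    opMu φ X Y ▷ colMap φ Z ≫ opMu φ (X ⊗ Y) Z ≫ unMap φ (α_ X Y Z).hom =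
      (α_ (colMap φ X) (colMap φ Y) (colMap φ Z)).hom ≫ colMap φ X ◁ opMu φ Y Z ≫
        opMu φ X (Y ⊗ Z) := by
  have h1 := opMap_21 φ (b := ![X ⊗ Y, Z]) (α_ X Y Z).hom ![X, Y, Z] (𝟙 _) (𝟙 _)
  have h2 := opMap_12 φ (b := ![X, Y ⊗ Z]) (𝟙 _) ![X, Y, Z] (𝟙 _) (𝟙 _)
  have h3 : tri ![X, Y, Z] ((α_ X Y Z).inv ≫ (𝟙 (X ⊗ Y) ⊗ₘ 𝟙 Z) ≫ (α_ X Y Z).hom) =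
      tri ![X, Y, Z] ((𝟙 X ⊗ₘ 𝟙 (Y ⊗ Z)) ≫ 𝟙 (X ⊗ Y ⊗ Z)) := by simp
  have h4 := tri_injective (h1.symm.trans ((congrArg (opMap φ) h3).trans h2))
  have h5 : (α_ (colMap φ X) (colMap φ Y) (colMap φ Z)).inv ≫
      (opMu φ X Y ≫ unMap φ (𝟙 _) ⊗ₘ unMap φ (𝟙 _)) ≫ opMu φ (X ⊗ Y) Z ≫ unMap φ (α_ X Y Z).hom =
      (unMap φ (𝟙 _) ⊗ₘ opMu φ Y Z ≫ unMap φ (𝟙 _)) ≫ opMu φ X (Y ⊗ Z) ≫ unMap φ (𝟙 _) := h4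
  simp only [unMap_id, Category.comp_id] at h5
  rw [Iso.inv_comp_eq] at h5
  simpa using h5

/-- Inserting the universal nullary operation into the first argument and applying the left unitor
gives the identity operation. -/
theorem op_left_unitality (X : C) : (λ_ (colMap φ X)).hom =
    opEps φ ▷ colMap φ X ≫ opMu φ (𝟙_ C) X ≫ unMap φ (λ_ X).hom := by
  have h1 := opMap_01 φ (b := ![𝟙_ C, X]) (λ_ X).hom (fun _ => X) (𝟙 _) (𝟙 _)
  have h3 : (ρ_ X).hom ≫ (λ_ X).inv ≫ (𝟙 (𝟙_ C) ⊗ₘ 𝟙 X) ≫ (λ_ X).hom = (ρ_ X).hom := by simp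
  have h4 := h1.symm.trans ((congrArg (opMap φ (c := fun _ : Fin 1 => X)) h3).trans (opMap_id φ X))
  have h5 : (ρ_ (colMap φ X)).hom ≫ (λ_ (colMap φ X)).inv ≫
      (opEps φ ≫ unMap φ (𝟙 _) ⊗ₘ unMap φ (𝟙 _)) ≫ opMu φ (𝟙_ C) X ≫ unMap φ (λ_ X).hom = (ρ_ (colMap φ X)).hom := h4
  simp only [unMap_id, Category.comp_id] at h5
  have h6 := (cancel_epi (ρ_ (colMap φ X)).hom).1 (h5.trans (Category.comp_id _).symm)
  rw [Iso.inv_comp_eq, Category.comp_id] at h6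
  simpa using h6.symm

theorem op_right_unitality (X : C) : (ρ_ (colMap φ X)).hom =
    colMap φ X ◁ opEps φ ≫ opMu φ X (𝟙_ C) ≫ unMap φ (ρ_ X).hom := by
  have h1 := opMap_10 φ (b := ![X, 𝟙_ C]) (ρ_ X).hom (fun _ => X) (𝟙 _) (𝟙 _)
  have h3 : (ρ_ X).hom ≫ (ρ_ X).inv ≫ (𝟙 X ⊗ₘ 𝟙 (𝟙_ C)) ≫ (ρ_ X).hom = (ρ_ X).hom := by simp
  have h4 := h1.symm.trans ((congrArg (opMap φ (c := fun _ : Fin 1 => X)) h3).trans (opMap_id φ X))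
  have h5 : (ρ_ (colMap φ X)).hom ≫ (ρ_ (colMap φ X)).inv ≫
      (unMap φ (𝟙 _) ⊗ₘ opEps φ ≫ unMap φ (𝟙 _)) ≫ opMu φ X (𝟙_ C) ≫ unMap φ (ρ_ X).hom = (ρ_ (colMap φ X)).hom := h4
  simp only [unMap_id, Category.comp_id] at h5
  have h6 := (cancel_epi (ρ_ (colMap φ X)).hom).1 (h5.trans (Category.comp_id _).symm)
  rw [Iso.inv_comp_eq, Category.comp_id] at h6
  simpa using h6.symm

/-- The symmetry as a binary operation is the universal one followed by a morphism, and also the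
universal one with its inputs exchanged. -/
theorem op_braided (X Y : C) : opMu φ X Y ≫ unMap φ (β_ X Y).hom =
    (β_ (colMap φ X) (colMap φ Y)).hom ≫ opMu φ Y X := by
  have h1 := opMap_swap φ (b := ![Y, X]) (𝟙 _) ![X, Y] (𝟙 _) (𝟙 _)
  have h2 := opMap_bi φ ![X, Y] (β_ X Y).hom
  have h3 : bi ![X, Y] ((β_ X Y).hom ≫ (𝟙 Y ⊗ₘ 𝟙 X) ≫ 𝟙 (Y ⊗ X)) = bi ![X, Y] (β_ X Y).hom := by
    simp
  have h4 := bi_injective (h2.symm.trans ((congrArg (opMap φ) h3).symm.trans h1))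
  refine Eq.trans h4 ?_
  change (β_ (colMap φ X) (colMap φ Y)).hom ≫ (unMap φ (𝟙 _) ⊗ₘ unMap φ (𝟙 _)) ≫ opMu φ Y X ≫
    unMap φ (𝟙 _) = _
  simp [unMap_id]

instance : (opFunctor φ).LaxBraided where
  ε := opEps φ
  μ := opMu φ
  μ_natural_left f X' := by
    have := opMu_natural φ f (𝟙 X')
    rw [unMap_id, tensorHom_id, tensorHom_id] at this
    exact this
  μ_natural_right X' f := by
    have := opMu_natural φ (𝟙 X') f
    rw [unMap_id, id_tensorHom, id_tensorHom] at this
    exact this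
  associativity := op_associativity φ
  left_unitality := op_left_unitality φ
  right_unitality := op_right_unitality φ
  braided := op_braided φ

end

end Dendroidal

/-! ### Lax symmetric monoidal functors as maps of operads -/

namespace Dendroidal

section

variable {C D : Type u} [Category.{u} C] [MonoidalCategory C] [SymmetricCategory C]
  [Category.{u} D] [MonoidalCategory D] [SymmetricCategory D]

theorem Can.isIso {I : Type w} {c : I → C} {L L' : List I} {f : tens c L ⟶ tens c L'}
    (h : Can c f) : IsIso f := by
  obtain ⟨g, -, h1, h2⟩ := h.exists_inv
  exact ⟨g, h2, h1⟩

instance split_isIso {I : Type w} (c : I → C) (L L' : List I) : IsIso (split c L L') := by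
  induction L with
  | nil => exact inferInstanceAs (IsIso (λ_ (tens c L')).inv)
  | cons i L ih => exact inferInstanceAs (IsIso (c i ◁ split c L L' ≫ (α_ _ _ _).inv))

instance relabel_isIso {I J : Type w} {r : I → C} {a : J → C} (h : J → I) (hr : ∀ j, r (h j) = a j)
    (L : List J) : IsIso (relabel h hr L) := by
  induction L with
  | nil => exact inferInstanceAs (IsIso (𝟙 (𝟙_ C)))
  | cons j L ih => exact inferInstanceAs (IsIso (eqToHom (hr j) ⊗ₘ relabel h hr L))

/-- The order `0, 1, …, n` of the inputs. -/
def consEquiv (n : ℕ) : (Σ j, Fin ((![1, n] : Fin 2 → ℕ) j)) ≃ Fin (n + 1) where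
  toFun p := match p with
    | ⟨0, _⟩ => 0
    | ⟨1, i⟩ => Fin.succ i
  invFun := Fin.cases ⟨0, (0 : Fin 1)⟩ fun i => ⟨1, i⟩
  left_inv p := match p with
    | ⟨0, _⟩ => congrArg (Sigma.mk 0) (Subsingleton.elim (α := Fin 1) _ _)
    | ⟨1, _⟩ => rfl
  right_inv := Fin.cases rfl fun _ => rfl

/-- The composite of the universal binary operation with universal operations. -/
noncomputable def consOp {n : ℕ} (c : Fin (n + 1) → C) :
    tens c (List.finRange (n + 1)) ⟶ c 0 ⊗ tens (fun i : Fin n => c i.succ) (List.finRange n) :=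
  opComp (consEquiv n) (r := c) (a := fun j i => c (consEquiv n ⟨j, i⟩)) (fun _ _ => rfl)
    (bi ![c 0, tens (fun i : Fin n => c i.succ) (List.finRange n)] (𝟙 _))
    (pairFun (β := fun j => (tens (fun i => c (consEquiv n ⟨j, i⟩))
        (List.finRange ((![1, n] : Fin 2 → ℕ) j)) ⟶
          ![c 0, tens (fun i : Fin n => c i.succ) (List.finRange n)] j)) (ρ_ (c 0)).hom (𝟙 _))

theorem opComp_bi_isIso {m : ℕ} {k : Fin 2 → ℕ} (e : (Σ j, Fin (k j)) ≃ Fin m)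
    {b : Fin 2 → C} {a : (j : Fin 2) → Fin (k j) → C} {r : Fin m → C} {d : C}
    (hr : ∀ j i, r (e ⟨j, i⟩) = a j i) (g : b 0 ⊗ b 1 ⟶ d) [IsIso g]
    (f : (j : Fin 2) → (tens (a j) (List.finRange (k j)) ⟶ b j)) (h0 : IsIso (f 0))
    (h1 : IsIso (f 1)) : IsIso (opComp e hr (bi b g) f) := by
  obtain ⟨s, hs, h⟩ := opComp_bi_rel e hr g f
  have := hs.isIso
  rw [h]
  infer_instance

/-- Invertibility lets every operation of arity `n + 1` factor through a composite of the universal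
binary operation with the universal operation of arity `n`. -/
instance {n : ℕ} (c : Fin (n + 1) → C) : IsIso (consOp c) :=
  opComp_bi_isIso (consEquiv n) (b := ![c 0, tens (fun i : Fin n => c i.succ) (List.finRange n)])
    _ (𝟙 _) _ (inferInstanceAs (IsIso (ρ_ (c 0)).hom))
    (inferInstanceAs (IsIso (𝟙 (tens (fun i : Fin n => c i.succ) (List.finRange n)))))

/-- Maps out of the operad of a symmetric monoidal category are determined by their values on
morphisms and on the universal operations of arity 0 and 2. -/
theorem symOperad_hom_ext {φ ψ : Operad.Hom (symOperad C) (symOperad D)}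
    (hc : φ.col = ψ.col) (h1 : ∀ {X Y : C} (f : X ⟶ Y), HEq (unMap φ f) (unMap ψ f))
    (h0 : HEq (opEps φ) (opEps ψ)) (h2 : ∀ X Y : C, HEq (opMu φ X Y) (opMu ψ X Y)) : φ = ψ := by
  obtain ⟨c, φ, hφ, hφ'⟩ := φ
  obtain ⟨c', ψ, hψ, hψ'⟩ := ψ
  obtain rfl : c = c' := hc
  set Φ : Operad.Hom (symOperad C) (symOperad D) := ⟨c, φ, hφ, hφ'⟩ with hΦ
  set Ψ : Operad.Hom (symOperad C) (symOperad D) := ⟨c, ψ, hψ, hψ'⟩ with hΨ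
  have h1' : ∀ {X Y : C} (f : X ⟶ Y), unMap Φ f = unMap Ψ f := fun f => eq_of_heq (h1 f)
  have h0' : opEps Φ = opEps Ψ := eq_of_heq h0
  have h2' : ∀ X Y, opMu Φ X Y = opMu Ψ X Y := fun X Y => eq_of_heq (h2 X Y)
  have key : ∀ (n : ℕ) (c : Fin n → C) (d : C) (p : tens c (List.finRange n) ⟶ d),
      opMap Φ p = opMap Ψ p := by
    intro n
    induction n with
    | zero =>
      intro c d p
      refine (opMap_nullary Φ (c := c) p).trans (Eq.trans ?_ (opMap_nullary Ψ (c := c) p).symm)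
      exact congrArg₂ (· ≫ ·) h0' (h1' p)
    | succ n ih =>
      intro c d p
      -- Induction on the arity: both maps agree on `consOp c`, by the hypothesis on `opMu` and the
      -- case of arity `n`, and on the morphism that follows.
      have h : p = consOp c ≫ inv (consOp c) ≫ p := by simp
      have h3 : opMap Φ (consOp c) = opMap Ψ (consOp c) := by
        refine (opMap_comp_pair Φ _ (consEquiv n) _ _).trans
          (Eq.trans ?_ (opMap_comp_pair Ψ _ (consEquiv n) _ _).symm)
        refine congr (congrArg (opComp _ _) (congrArg _ ?_)) (congrArg₂ pairFun ?_ ?_)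
        · exact congrArg₂ (· ≫ ·) (h2' _ _) (h1' _)
        · have h4 : (ρ_ (c 0)).hom = (ρ_ (c 0)).hom ≫ 𝟙 _ := (Category.comp_id _).symm
          have h5 := opMap_unary Φ (c := fun i : Fin 1 => c (consEquiv n ⟨0, i⟩)) (𝟙 (c 0))
          have h6 := opMap_unary Ψ (c := fun i : Fin 1 => c (consEquiv n ⟨0, i⟩)) (𝟙 (c 0))
          rw [← Category.comp_id (ρ_ (c 0)).hom]
          exact h5.trans ((congrArg _ (h1' _)).trans h6.symm)
        · exact ih (fun i => c i.succ) _ (𝟙 _)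
      rw [h, opMap_postcomp, opMap_postcomp, h3, h1']
      rfl
  refine Operad.Hom.ext rfl (heq_of_eq ?_)
  funext n c d p
  exact key n c d p

section

variable (F : C ⥤ D) [F.LaxBraided]

theorem unMap_symOperadMap {X Y : C} (f : X ⟶ Y) : unMap (symOperadMap F) f = F.map f := by
  have h1 := laxOp_id F X
  have h : laxOp F (c := fun _ : Fin 1 => X) ((ρ_ X).hom ≫ f) = (ρ_ (F.obj X)).hom ≫ F.map f := by
    rw [← h1]
    exact (congrArg _ (F.map_comp _ _)).trans (Category.assoc _ _ _).symm
  exact (congrArg ((ρ_ (F.obj X)).inv ≫ ·) h).trans ((ρ_ (F.obj X)).inv_hom_id_assoc _)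

theorem opEps_symOperadMap : opEps (symOperadMap F) = Functor.LaxMonoidal.ε F :=
  (congrArg (Functor.LaxMonoidal.ε F ≫ ·) (F.map_id _)).trans (Category.comp_id _)

theorem opMu_symOperadMap (X Y : C) : opMu (symOperadMap F) X Y = Functor.LaxMonoidal.μ F X Y := by
  have h : laxOp F (bi ![X, Y] (𝟙 (X ⊗ Y))) =
      F.obj X ◁ (ρ_ (F.obj Y)).hom ≫ Functor.LaxMonoidal.μ F X Y := by
    change (F.obj X ◁ (F.obj Y ◁ Functor.LaxMonoidal.ε F ≫ Functor.LaxMonoidal.μ F Y (𝟙_ C)) ≫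
      Functor.LaxMonoidal.μ F X (Y ⊗ 𝟙_ C)) ≫ F.map (X ◁ (ρ_ Y).hom ≫ 𝟙 (X ⊗ Y)) = _
    rw [Functor.LaxMonoidal.right_unitality]
    simp
  exact (congrArg (F.obj X ◁ (ρ_ (F.obj Y)).inv ≫ ·) h).trans (by
    rw [← whiskerLeft_comp_assoc, Iso.inv_hom_id, whiskerLeft_id, Category.id_comp])

end

end

/-- The action on morphisms and the structure maps `ε` and `μ` are recovered from the map of operads
as `unMap`, `opEps` and `opMu`. -/
instance : SymMonCat.toOperad.{u}.Faithful where
  map_injective {C D F G} h := by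
    change LaxBraidedFunctor C.carrier D.carrier at F
    change LaxBraidedFunctor C.carrier D.carrier at G
    have hφ : symOperadMap F.toFunctor = symOperadMap G.toFunctor := h
    have hu : ∀ {X Y : C.carrier} (f : X ⟶ Y), HEq (F.map f) (G.map f) := fun f =>
      (heq_of_eq (unMap_symOperadMap F.toFunctor f)).symm.trans
        ((congr_arg_heq (fun φ => unMap φ f) hφ).trans
          (heq_of_eq (unMap_symOperadMap G.toFunctor f)))
    have h0 : HEq (Functor.LaxMonoidal.ε F.toFunctor) (Functor.LaxMonoidal.ε G.toFunctor) :=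
      (heq_of_eq (opEps_symOperadMap F.toFunctor)).symm.trans
        ((congr_arg_heq (fun φ => opEps φ) hφ).trans (heq_of_eq (opEps_symOperadMap G.toFunctor)))
    have h2 : ∀ X Y, HEq (Functor.LaxMonoidal.μ F.toFunctor X Y)
        (Functor.LaxMonoidal.μ G.toFunctor X Y) := fun X Y =>
      (heq_of_eq (opMu_symOperadMap F.toFunctor X Y)).symm.trans
        ((congr_arg_heq (fun φ => opMu φ X Y) hφ).trans
          (heq_of_eq (opMu_symOperadMap G.toFunctor X Y)))
    have hF : F.toFunctor = G.toFunctor :=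
      Functor.hext (fun X => congrFun (congrArg Operad.Hom.col hφ) X) fun X Y f => hu f
    refine SymMonCat.hom_ext hF ?_
    obtain ⟨F, hF'⟩ := F
    obtain ⟨G, hG'⟩ := G
    obtain rfl : F = G := hF
    refine heq_of_eq (Functor.LaxMonoidal.ext (eq_of_heq h0) ?_)
    funext X Y
    exact eq_of_heq (h2 X Y)

/-- The lax functor `opFunctor φ` induces a map of operads with the same values as `φ` on morphisms
and on the universal operations of arity 0 and 2, and these determine it. -/
instance : SymMonCat.toOperad.{u}.Full where
  map_surjective {C D} φ := by
    change Operad.Hom (symOperad C.carrier) (symOperad D.carrier) at φ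
    refine ⟨LaxBraidedFunctor.of (opFunctor φ), ?_⟩
    refine symOperad_hom_ext (φ := symOperadMap (opFunctor φ)) (ψ := φ) rfl
      (fun f => heq_of_eq (unMap_symOperadMap (opFunctor φ) f))
      (heq_of_eq (opEps_symOperadMap (opFunctor φ)))
      (fun X Y => heq_of_eq (opMu_symOperadMap (opFunctor φ) X Y))

instance : SymMonCat.nerve.{u}.Faithful :=
  inferInstanceAs (SymMonCat.toOperad.{u} ⋙ operadNerve.{u}).Faithful

instance : SymMonCat.nerve.{u}.Full :=
  inferInstanceAs (SymMonCat.toOperad.{u} ⋙ operadNerve.{u}).Full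

end Dendroidal

/-! ### Strictly fully Kan dendroidal sets: separatedness, and elements on proper subtrees -/

namespace Dendroidal

open Dendroidal.Tree

section

variable {T : Tree}

theorem exists_retract_eta (hT : IsEmpty T.Vertex) :
    ∃ g : T ⟶ eta, g ≫ edgeMap T T.root = 𝟙 T := by
  refine ⟨homMk (fun _ => ()) fun v => hT.elim v, hom_ext fun x => ?_⟩
  change T.root = x
  rcases h : T.below x with _ | v
  · exact ((T.below_eq_none x).1 h).symm
  · exact hT.elim v

theorem exists_retract_cor {v : T.Vertex} (hT : ∀ z, z = v) :
    ∃ g : T ⟶ cor (inp v), g ≫ vmap v = 𝟙 T := by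
  classical
  let φ : T.Edge → (cor (inp v)).Edge := fun e => if h : e ∈ inp v then leaf ⟨e, h⟩ else rt
  have hin : ∀ (e) (h : e ∈ inp v), φ e = leaf ⟨e, h⟩ := fun e h => dif_pos h
  have hout : φ (T.out v) = rt := dif_neg (below_out_ne v)
  have him : φ '' inp v = Set.range leaf := by
    ext x
    constructor
    · rintro ⟨e, he, rfl⟩
      exact ⟨_, (hin e he).symm⟩
    · rintro ⟨⟨e, he⟩, rfl⟩
      exact ⟨e, he, hin e he⟩
  refine ⟨homOfSet φ (fun z => ?_) (fun z => ?_), hom_ext fun x => ?_⟩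
  · obtain rfl := hT z
    intro e he e' he' hee
    rw [hin e he, hin e' he'] at hee
    exact congrArg Subtype.val (leaf_injective hee)
  · obtain rfl := hT z
    rw [him, hout]
    exact cor_isOpSet
  · rw [ed_comp, ed_homOfSet, ed_id]
    obtain ⟨z, hz⟩ := exists_vertex_of_edge v x
    obtain rfl := hT z
    rcases hz with rfl | hz
    · rw [hout]
      rfl
    · rw [hin x hz]
      rfl

theorem face_card_lt (hT : Nontrivial T.Vertex) (b : T.Face) :
    Nat.card b.tree.Vertex < Nat.card T.Vertex := by
  have := T.finite_vertex
  cases b with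
  | inner u w h => exact Finite.card_subtype_lt (p := fun v => v ≠ u) (x := u) (fun h => h rfl)
  | top v hv hl => exact Finite.card_subtype_lt (p := fun y => y ≠ v) (x := v) (fun h => h rfl)
  | bottom v u hv hu hl =>
    exact Finite.card_subtype_lt (p := fun y => y ≠ v) (x := v) (fun h => h rfl)
  | edge x h => exact (Face.edge_absurd hT h).elim

theorem sub_card_lt {W : Set T.Vertex} {d : T.Edge} (hW : Cl W d) (hne : W ≠ Set.univ) :
    Nat.card (sub W d hW).Vertex < Nat.card T.Vertex := by
  have := T.finite_vertex
  obtain ⟨x, hx⟩ := (Set.ne_univ_iff_exists_notMem W).1 hne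
  exact Finite.card_subtype_lt (p := fun y => y ∈ W) hx

theorem exists_top_vertex (hT : Nontrivial T.Vertex) :
    ∃ v w : T.Vertex, T.below (T.out v) = some w ∧ ∀ u, T.below (T.out u) ≠ some v := by
  obtain ⟨v0, v1, h01⟩ := hT
  obtain ⟨r, hr⟩ := exists_root_vertex v0
  obtain ⟨v, hv, htop⟩ := exists_top (W := {r}ᶜ) (T := T) (by
    by_cases h : v0 = r
    · exact ⟨v1, fun h' => h01 (h.trans h'.symm)⟩
    · exact ⟨v0, h⟩)
  rcases h : T.below (T.out v) with _ | w
  · exact absurd (T.out_injective (((T.below_eq_none _).1 h).trans hr.symm)) hv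
  · refine ⟨v, w, h, fun u => ?_⟩
    by_cases hu : u = r
    · rw [hu, hr, below_root]
      simp
    · exact htop u hu

/-- A vertex of an outer face lives in the complement of a vertex. A vertex of an inner face is a
vertex of `T` or the merged pair `{p, q}`; this pair is proper, since otherwise `T` has only one
inner edge and `b` would be the excluded face. -/
theorem exists_proper_lift (hT : Nontrivial T.Vertex) {v w : T.Vertex}
    (h : T.below (T.out v) = some w) (b : T.Face) (hb : b ≠ Face.inner v w h)
    (y : b.tree.Vertex) : ∃ (W : Set T.Vertex) (d : T.Edge) (hW : Cl W d) (_ : W ≠ Set.univ)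
      (g : cor (inp y) ⟶ sub W d hW), vmap y ≫ b.incl = g ≫ subι hW := by
  have houter : ∀ z, b.IsOuter z → ∃ (W : Set T.Vertex) (d : T.Edge) (hW : Cl W d)
      (_ : W ≠ Set.univ) (g : cor (inp y) ⟶ sub W d hW), vmap y ≫ b.incl = g ≫ subι hW := by
    intro z hz
    obtain ⟨d, hd, k, -, h1, -⟩ := hz.exists_sub
    exact ⟨_, d, hd, (Set.ne_univ_iff_exists_notMem _).2 ⟨z, fun h => h rfl⟩, vmap y ≫ k,
      by rw [Category.assoc, h1]⟩
  cases b with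
  | inner p q hpq =>
    have hr : (Set.range fun i => ed (vmap y ≫ T.contractMap p q hpq) (leaf i)) =
        Subtype.val '' inp y := by
      ext z
      exact ⟨fun ⟨i, hi⟩ => ⟨i.1, i.2, hi⟩, fun ⟨i, hi, hz⟩ => ⟨⟨i, hi⟩, hz⟩⟩
    by_cases hy : y.1 = q
    · obtain ⟨g, hg⟩ := exists_corLift (cl_pair hpq) (vmap y ≫ T.contractMap p q hpq)
        (hr.trans (contract_inp_merged hpq y hy)).symm (congrArg T.out hy)
      refine ⟨_, _, cl_pair hpq, fun hu => hb ?_, g, hg.symm⟩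
      have h2 : ∀ z, z = p ∨ z = q := fun z => by
        have : z ∈ ({p, q} : Set T.Vertex) := by rw [hu]; trivial
        exact this
      obtain ⟨rfl, rfl⟩ := out_eq_root_of_two hpq h h2
      rfl
    · obtain ⟨g, hg⟩ := exists_corLift (cl_singleton y.1) (vmap y ≫ T.contractMap p q hpq)
        ((hr.trans (contract_inp hpq y hy)).trans (lv_singleton y.1).symm).symm rfl
      refine ⟨_, _, cl_singleton y.1, fun hu => ?_, g, hg.symm⟩
      have : q ∈ ({y.1} : Set T.Vertex) := by rw [hu]; trivial
      exact hy this.symm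
  | top x hx hl => exact houter x (Or.inl ⟨hx, hl, rfl⟩)
  | bottom x u hx hu hl => exact houter x (Or.inr ⟨u, hx, hu, hl, rfl⟩)
  | edge x hx => exact (Face.edge_absurd hT hx).elim

end

variable {D : DSet.{u}}

/-- Induction on the number of vertices, using uniqueness of fillers at an inner face. The other
faces have fewer vertices, and each of their vertices lies in a proper subtree of `T`, on which the
induction hypothesis applies once more. -/
theorem IsStrictlyFullyKan.separated (hD : IsStrictlyFullyKan D) : Separated D := by
  suffices h : ∀ (N : ℕ) (T : Tree), Nat.card T.Vertex = N → ∀ x y : D.obj (op T),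
      (∀ e, res (edgeMap T e) x = res (edgeMap T e) y) →
      (∀ v : T.Vertex, res (vmap v) x = res (vmap v) y) → x = y from fun T => h _ T rfl
  intro N
  induction N using Nat.strong_induction_on with
  | _ N ih =>
  rintro T rfl x y he hv
  rcases subsingleton_or_nontrivial T.Vertex with hT | hT
  · rcases isEmpty_or_nonempty T.Vertex with hT' | ⟨⟨v⟩⟩
    · obtain ⟨g, hg⟩ := exists_retract_eta hT'
      rw [← res_id x, ← res_id y, ← hg, ← res_res, ← res_res, he]
    · obtain ⟨g, hg⟩ := exists_retract_cor (v := v) fun z => Subsingleton.elim _ _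
      rw [← res_id x, ← res_id y, ← hg, ← res_res, ← res_res, hv]
  · obtain ⟨v, w, h, -⟩ := exists_top_vertex hT
    refine hD.ext hT (Face.inner v w h) fun b hb => ?_
    refine ih _ (face_card_lt hT b) b.tree rfl _ _ (fun e => ?_) fun z => ?_
    · rw [res_edge, res_edge, he]
    · obtain ⟨W, d, hW, hne, g, hg⟩ := exists_proper_lift hT h b hb z
      rw [res_res, res_res, hg, ← res_res, ← res_res]
      refine congrArg (res g) (ih _ (sub_card_lt hW hne) _ rfl _ _ (fun e => ?_) fun z => ?_)
      · rw [res_edge, res_edge, he]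
      · obtain ⟨k, hk⟩ := sub_vmap hW z
        rw [res_res, res_res, hk, ← res_res, ← res_res, hv]

section

variable {T : Tree} (κ : T.Edge → D.obj (op eta)) (s : ∀ v : T.Vertex, D.obj (op (cor (inp v))))

/-- `x` has the given edges and vertices, where `ψ` sends vertices to vertices. -/
structure Realizes {S : Tree} (ψ : S ⟶ T) (x : D.obj (op S)) : Prop where
  edge : ∀ e, res (edgeMap S e) x = κ (ed ψ e)
  vertex : ∀ (A : Type) [Finite A] (f : cor A ⟶ S) (v : T.Vertex) (k : A ≃ inp v),
    f ≫ ψ = corMap k ≫ vmap v → res f x = res (corMap k) (s v)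

variable {κ s}

theorem Realizes.res {R S : Tree} {ψ : S ⟶ T} {x : D.obj (op S)} (h : Realizes κ s ψ x)
    (g : R ⟶ S) : Realizes κ s (g ≫ ψ) (res g x) where
  edge e := by rw [res_edge, h.edge, ed_comp]
  vertex A _ f v k hf := by
    rw [res_res]
    exact h.vertex A _ v k (by rw [Category.assoc, hf])

theorem Realizes.sub_eq (hD : Separated D) {W : Set T.Vertex} {d : T.Edge} {hW : Cl W d}
    {x y : D.obj (op (sub W d hW))} (hx : Realizes κ s (subι hW) x)
    (hy : Realizes κ s (subι hW) y) : x = y := by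
  refine hD _ _ _ (fun e => (hx.edge e).trans (hy.edge e).symm) fun v => ?_
  obtain ⟨k, hk⟩ := sub_vmap hW v
  exact (hx.vertex _ _ _ k hk).trans (hy.vertex _ _ _ k hk).symm

/-- A common operation of two subtrees has a vertex set `V` contained in both. Both elements
restrict to a realization on the subtree `V`, and realizations are unique. -/
theorem Realizes.cor_eq (hD : Separated D) {W W' : Set T.Vertex} {d d' : T.Edge} {hW : Cl W d}
    {hW' : Cl W' d'} {x : D.obj (op (sub W d hW))} {x' : D.obj (op (sub W' d' hW'))}
    (hx : Realizes κ s (subι hW) x) (hx' : Realizes κ s (subι hW') x') {A : Type} [Finite A]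
    (f : cor A ⟶ sub W d hW) (f' : cor A ⟶ sub W' d' hW') (hf : f ≫ subι hW = f' ≫ subι hW') :
    Dendroidal.res f x = Dendroidal.res f' x' := by
  obtain ⟨V, hVW, hV, hl⟩ := cor_hom_sub hW f
  obtain ⟨V', hVW', hV', hl'⟩ := cor_hom_sub hW' f'
  have hed : ∀ i, (ed f i).1 = (ed f' i).1 := fun i => congrArg (fun k => ed k i) hf
  rw [← hed] at hV' hl'
  obtain rfl : V = V' := lv_unique hV hV' (by
    rw [hl, hl']
    exact congrArg Set.range (funext fun i => hed (leaf i)))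
  obtain ⟨g, hg⟩ := exists_corLift hV (f ≫ subι hW) hl rfl
  have hd' : (ed f rt).1 ∈ subE W' d' := (hed rt).symm ▸ (ed f' rt).2
  have h1 : f = g ≫ subIncl hW hV hVW (ed f rt).2 := subι_mono hW (by
    rw [Category.assoc, subIncl_ι, hg])
  have h2 : f' = g ≫ subIncl hW' hV hVW' hd' := subι_mono hW' (by
    rw [Category.assoc, subIncl_ι, hg, hf])
  have r1 := hx.res (subIncl hW hV hVW (ed f rt).2)
  have r2 := hx'.res (subIncl hW' hV hVW' hd')
  rw [subIncl_ι] at r1 r2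
  rw [h1, h2, ← res_res, ← res_res, Realizes.sub_eq hD r1 r2]

variable (κ s) in
/-- The operations of `z` agree with those on subtrees of `T`. -/
def Extends {B : Tree} (ψ : B ⟶ T) (z : D.obj (op B)) : Prop :=
  ∀ (A : Type) [Finite A] (f : cor A ⟶ B) (W : Set T.Vertex) (d : T.Edge) (hW : Cl W d)
    (g : cor A ⟶ sub W d hW) (x : D.obj (op (sub W d hW))), Realizes κ s (subι hW) x →
    f ≫ ψ = g ≫ subι hW → Dendroidal.res f z = Dendroidal.res g x

/-- The vertices suffice: an operation of `B` has a set `V` of vertices, and the map to `T`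
restricts to a map from the subtree `V` to a subtree inside `W`. On the subtree `V` the two elements
agree at edges and vertices, hence they are equal. -/
theorem extends_of (hD : Separated D) {B : Tree} {ψ : B ⟶ T} {z : D.obj (op B)}
    (he : ∀ e, Dendroidal.res (edgeMap B e) z = κ (ed ψ e))
    (hv : ∀ y : B.Vertex, ∃ (W : Set T.Vertex) (d : T.Edge) (hW : Cl W d)
      (g : cor (inp y) ⟶ sub W d hW) (x : D.obj (op (sub W d hW))), Realizes κ s (subι hW) x ∧
      vmap y ≫ ψ = g ≫ subι hW ∧ Dendroidal.res (vmap y) z = Dendroidal.res g x) :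
    Extends κ s ψ z := by
  intro A _ f W d hW g x hx hfg
  obtain ⟨V, hV, hVl⟩ := cor_hom_isOpSet f
  obtain ⟨W', hW', hl', hE, hO⟩ := hom_restrict ψ hV
  have hed : ∀ i, ed ψ (ed f i) = (ed g i).1 := fun i => congrArg (fun k => ed k i) hfg
  obtain ⟨V1, hV1, hc1, hl1⟩ := cor_hom_sub hW g
  rw [← hed] at hc1 hl1
  obtain rfl : W' = V1 := lv_unique hW' hc1 (by
    rw [hl', hl1, hVl, ← Set.range_comp]
    exact congrArg Set.range (funext fun i => hed (leaf i)))
  have hd : ed ψ (ed f rt) ∈ subE W d := (hed rt).symm ▸ (ed g rt).2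
  have hx' := hx.res (subIncl hW hW' hV1 hd)
  rw [subIncl_ι] at hx'
  have hm : ∃ m : sub V (ed f rt) hV ⟶ sub W' _ hW', m ≫ subι hW' = subι hV ≫ ψ := by
    refine ⟨subLift hW' (subι hV ≫ ψ) (fun e => hE _ e.2) (fun y => ?_), subLift_ι _ _ _ _⟩
    obtain ⟨V2, h1, h2, h3⟩ := hO y.1 y.2
    refine ⟨V2, h1, h2, h3.trans ?_⟩
    rw [← sub_inp hV y]
    exact Set.image_image (ed ψ) Subtype.val (inp y)
  obtain ⟨m, hm⟩ := hm
  have key : Dendroidal.res (subι hV) z = Dendroidal.res m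
      (Dendroidal.res (subIncl hW hW' hV1 hd) x) := by
    refine hD _ _ _ (fun e => ?_) fun y => ?_
    · rw [res_edge, res_edge, he, hx'.edge, ← ed_comp, ← ed_comp, hm]
    · obtain ⟨k, hk⟩ := sub_vmap hV y
      obtain ⟨W2, d2, hW2, g2, x2, hx2, hg2, hz2⟩ := hv y.1
      rw [res_res, hk, ← res_res, hz2, res_res, res_res]
      refine Realizes.cor_eq hD hx2 hx' _ _ ?_
      rw [Category.assoc, ← hg2, Category.assoc, hm, ← Category.assoc, ← Category.assoc, hk]
  obtain ⟨f0, hf0⟩ := exists_corLift hV f hVl rfl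
  rw [← hf0, ← res_res, key, res_res, res_res]
  refine congrArg (fun k => Dendroidal.res k x) (subι_mono hW ?_)
  rw [Category.assoc, Category.assoc, subIncl_ι, hm, ← Category.assoc, hf0, hfg]

end

end Dendroidal

/-! ### Strictly fully Kan dendroidal sets satisfy the Segal condition -/

namespace Dendroidal

open Dendroidal.Tree

section

variable {T : Tree}

theorem eq_root_of_cl_univ {d : T.Edge} (h : Cl (Set.univ : Set T.Vertex) d) : d = T.root := by
  rcases hb : T.below d with _ | q
  · exact (T.below_eq_none _).1 hb
  · exact absurd hb (h.below_ne trivial)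

/-- The total operation of a tree as a composite of two operations, one of them a top vertex. -/
theorem exists_coarse {v w : T.Vertex} (h : T.below (T.out v) = some w)
    (hv : ∀ u, T.below (T.out u) ≠ some v) {A : Type} [Finite A] (f : cor A ⟶ T)
    (hf : ed f rt = T.root) (hf' : (Set.range fun i => ed f (leaf i)) = lv Set.univ T.root) :
    ∃ (J : Type) (_ : Finite J) (K : J → Type) (_ : ∀ j, Finite (K j)) (c : tree2 K ⟶ T)
      (t : cor A ⟶ tree2 K), t ≫ c = f ∧ (∀ p, p ≠ v → ∀ q, T.below (T.out p) = some q →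
        ∀ x, ed c x ≠ T.out p) ∧
      (∃ (W : Set T.Vertex) (d : T.Edge) (hW : Cl W d) (_ : W ≠ Set.univ)
        (g : cor J ⟶ sub W d hW), lowMap ≫ c = g ≫ subι hW) ∧
      ∀ j, ∃ (W : Set T.Vertex) (d : T.Edge) (hW : Cl W d) (_ : W ≠ Set.univ)
        (g : cor (K j) ⟶ sub W d hW), upMap j ≫ c = g ≫ subι hW := by
  have hvw := ne_of_below_out h
  have hc0 : Cl {v}ᶜ T.root := by
    intro z _
    rcases hz : T.below (T.out z) with _ | q
    · exact Or.inl ((T.below_eq_none _).1 hz)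
    · exact Or.inr ⟨q, fun hq => hv z (hz.trans (congrArg some hq)), rfl⟩
  -- The lower level is the complement of `v`. Over its leaf `T.out v` the vertex `v` is grafted,
  -- over every other leaf the empty subtree, which appears as a vertex with one input that is
  -- mapped to an identity. The resulting map from a tree with two levels meets no inner edge except
  -- `T.out v`.
  let V : T.Edge → Set T.Vertex := fun j => {u | u = v ∧ T.out u = j}
  have hcV : ∀ j, Cl (V j) j := fun j u hu => Or.inl hu.2
  have hov : T.out v ∈ lv {v}ᶜ T.root := by
    refine ⟨Or.inr ⟨w, hvw, h⟩, fun u hu huv => hu (T.out_injective huv)⟩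
  obtain ⟨-, hg2, hg3, -⟩ := graft hc0 V fun l _ => hcV l
  have huniv : ({v}ᶜ ∪ ⋃ l ∈ lv {v}ᶜ T.root, V l) = Set.univ := by
    refine Set.eq_univ_of_forall fun u => ?_
    by_cases hu : u = v
    · refine Or.inr (Set.mem_iUnion₂.2 ⟨T.out v, hov, hu, congrArg T.out hu⟩)
    · exact Or.inl hu
  rw [huniv] at hg2
  have := T.finite_edge
  let J : Type := lv ({v}ᶜ : Set T.Vertex) T.root
  let K : J → Type := fun j => lv (V j.1) j.1
  let γ : cor J ⟶ T := corHom (fun x => x.1) T.root Subtype.val_injective (by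
    rw [Subtype.range_val]
    exact ⟨_, hc0, rfl⟩)
  let φ : ∀ j, cor (K j) ⟶ T := fun j => corHom (fun x => x.1) j.1 Subtype.val_injective (by
    rw [Subtype.range_val]
    exact ⟨_, hcV j.1, rfl⟩)
  obtain ⟨c, hc1, hc2⟩ := exists_tree2_hom γ φ fun j => rfl
  have hmid : ∀ j : J, ed c (mid2 j) = j.1 := fun j => congrArg (fun k => ed k (leaf j)) hc1
  have hroot : ed c root2 = T.root := congrArg (fun k => ed k rt) hc1
  have htop : ∀ p : Σ j, K j, ed c (top2 p) = p.2.1 := fun p =>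
    congrArg (fun k => ed k (leaf p.2)) (hc2 p.1)
  have hinj : Function.Injective fun p : Σ j, K j => p.2.1 := by
    rintro ⟨j, i⟩ ⟨j', i'⟩ hij
    have hj : j.1 = j'.1 := hg3 _ j.2 _ j'.2 i.1 i.2.1 (by
      have hij' : i.1 = i'.1 := hij
      rw [hij']
      exact i'.2.1)
    obtain rfl : j = j' := Subtype.ext hj
    obtain rfl : i = i' := Subtype.ext hij
    rfl
  obtain ⟨σ, hσ⟩ := exists_equiv_of_range_eq hinj (cor_hom_injective f) (by
    rw [hf', hg2]
    ext x
    simp only [Set.mem_range, Set.mem_iUnion]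
    constructor
    · rintro ⟨p, rfl⟩
      exact ⟨p.1.1, p.1.2, p.2.2⟩
    · rintro ⟨l, hl, hx⟩
      exact ⟨⟨⟨l, hl⟩, ⟨x, hx⟩⟩, rfl⟩)
  refine ⟨J, inferInstance, K, inferInstance, c, totMap σ, ?_, ?_, ?_, fun j => ?_⟩
  · refine cor_hom_ext (hroot.trans hf.symm) fun i => ?_
    obtain ⟨p, rfl⟩ := σ.surjective i
    refine Eq.trans ?_ (hσ p).symm
    refine Eq.trans ?_ (htop p)
    exact congrArg (fun q => ed c (top2 q)) (σ.symm_apply_apply p)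
  · intro p hp q hq x
    induction x using tree2_edge_cases with
    | h1 =>
      rw [hroot]
      intro h'
      rw [← h', below_root] at hq
      exact nomatch hq
    | h2 j =>
      rw [hmid]
      exact fun h' => j.2.2 p hp h'.symm
    | h3 p' =>
      rw [htop]
      have hx : p'.2.1 ∈ lv Set.univ T.root := by
        rw [hg2]
        exact Set.mem_iUnion₂.2 ⟨_, p'.1.2, p'.2.2⟩
      exact fun h' => hx.2 p trivial h'.symm
  · obtain ⟨g, hg⟩ := exists_corLift hc0 γ (by
      change _ = Set.range fun x : J => x.1
      rw [Subtype.range_val]) rfl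
    exact ⟨_, _, hc0, fun hu => absurd (hu.symm ▸ trivial : v ∈ ({v}ᶜ : Set T.Vertex))
      (fun h => h rfl), g, hc1.trans hg.symm⟩
  · obtain ⟨g, hg⟩ := exists_corLift (hcV j.1) (φ j) (by
      change _ = Set.range fun x : K j => x.1
      rw [Subtype.range_val]) rfl
    refine ⟨_, _, hcV j.1, fun hu => ?_, g, (hc2 j).trans hg.symm⟩
    have : w ∈ V j.1 := by rw [hu]; trivial
    exact hvw this.1

variable {D : DSet.{u}} {κ : T.Edge → D.obj (op eta)} {s : ∀ v : T.Vertex, D.obj (op (cor (inp v)))}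

/-- By separatedness it is enough to compare on operations. If the subtree of the operation is
proper, both sides are compared with its realization. If it is all of `T`, both faces are inner,
since an outer face misses a vertex. The total operation then factors through the tree with two
levels of `exists_coarse`, which lifts to both faces because neither contracts `T.out v`; its
vertices come from proper subtrees, where the first case applies. -/
theorem compat_of_extends (hD : Separated D) {v w : T.Vertex} (h : T.below (T.out v) = some w)
    (hv : ∀ u, T.below (T.out u) ≠ some v)
    (hx : ∀ (W : Set T.Vertex) (d : T.Edge) (hW : Cl W d), W ≠ Set.univ →
      ∃ x, Realizes κ s (subι hW) x)
    (z : Fam D (Face.inner v w h))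
    (he : ∀ b hb e, res (edgeMap b.tree e) (z b hb) = κ (ed b.incl e))
    (hz : ∀ b hb, Extends κ s b.incl (z b hb)) : z.Compat := by
  have hT : Nontrivial T.Vertex := ⟨w, v, ne_of_below_out h⟩
  have hcor : ∀ b hb b' hb' (A : Type) [Finite A] (f : cor A ⟶ b.tree) (f' : cor A ⟶ b'.tree),
      f ≫ b.incl = f' ≫ b'.incl → res f (z b hb) = res f' (z b' hb') := by
    intro b hb b' hb' A _ f f' hff
    obtain ⟨W, hW, hl⟩ := cor_hom_isOpSet (f ≫ b.incl)
    by_cases hne : W = Set.univ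
    · subst hne
      have hroot := eq_root_of_cl_univ hW
      rw [hroot] at hl
      have hinner : ∀ (b1 : T.Face) (f1 : cor A ⟶ b1.tree), f1 ≫ b1.incl = f ≫ b.incl →
          ∃ p q hpq, b1 = Face.inner p q hpq := by
        intro b1 f1 hf1
        have houter : ∀ x, ¬ b1.IsOuter x := by
          intro x hx
          obtain ⟨d, hd, k, -, h1, -⟩ := hx.exists_sub
          have h2 : (f1 ≫ k) ≫ subι hd = f ≫ b.incl := by rw [Category.assoc, h1, hf1]
          have hed : ∀ i, (ed (f1 ≫ k) i).1 = ed (f ≫ b.incl) i := fun i =>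
            congrArg (fun k => ed k i) h2
          obtain ⟨V, hVx, hV, hVl⟩ := cor_hom_sub hd (f1 ≫ k)
          rw [hed, hroot] at hV hVl
          have : V = Set.univ := lv_unique hV cl_univ (by
            rw [hVl, hl]
            exact congrArg Set.range (funext fun i => hed (leaf i)))
          exact hVx (this.symm ▸ trivial : x ∈ V) rfl
        cases b1 with
        | inner p q hpq => exact ⟨p, q, hpq, rfl⟩
        | top x hx hl => exact (houter x (Or.inl ⟨hx, hl, rfl⟩)).elim
        | bottom x u hx hu hl => exact (houter x (Or.inr ⟨u, hx, hu, hl, rfl⟩)).elim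
        | edge x hx => exact (Face.edge_absurd hT hx).elim
      obtain ⟨p, q, hpq, rfl⟩ := hinner b f rfl
      obtain ⟨p', q', hpq', rfl⟩ := hinner b' f' hff.symm
      obtain ⟨J, _, K, _, c, t, ht, hc, ⟨W0, d0, hW0, hn0, g0, hg0⟩, hup⟩ :=
        exists_coarse h hv (f ≫ (Face.inner p q hpq).incl) hroot hl.symm
      have lift : ∀ p q hpq, Face.inner p q hpq ≠ Face.inner v w h →
          ∀ f1 : cor A ⟶ (Face.inner p q hpq).tree, f1 ≫ (Face.inner p q hpq).incl = t ≫ c →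
          ∃ g : tree2 K ⟶ (Face.inner p q hpq).tree, g ≫ (Face.inner p q hpq).incl = c ∧
            f1 = t ≫ g := by
        intro p q hpq hb f1 hf1
        have hpv : p ≠ v := by
          rintro rfl
          obtain rfl : q = w := Option.some_injective _ (hpq.symm.trans h)
          exact hb rfl
        obtain ⟨g, hg⟩ : ∃ g : tree2 K ⟶ (Face.inner p q hpq).tree,
          g ≫ (Face.inner p q hpq).incl = c := exists_contractLift hpq c (hc p hpv q hpq)
        refine ⟨g, hg, Face.incl_mono (a := Face.inner p q hpq) ?_⟩
        rw [hf1, Category.assoc, hg]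
      obtain ⟨g1, hg1, rfl⟩ := lift p q hpq hb f ht.symm
      obtain ⟨g2, hg2, rfl⟩ := lift p' q' hpq' hb' f' (hff.symm.trans ht.symm)
      rw [← res_res, ← res_res]
      refine congrArg (res t) (hD.tree2_ext ?_ fun j => ?_)
      · obtain ⟨x, hx⟩ := hx W0 d0 hW0 hn0
        rw [res_res, res_res]
        exact (hz _ hb J _ W0 _ hW0 g0 x hx (by rw [Category.assoc, hg1, hg0])).trans
          (hz _ hb' J _ W0 _ hW0 g0 x hx (by rw [Category.assoc, hg2, hg0])).symm
      · obtain ⟨W1, d1, hW1, hn1, k, hk⟩ := hup j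
        obtain ⟨x, hx⟩ := hx W1 d1 hW1 hn1
        rw [res_res, res_res]
        exact (hz _ hb (K j) _ W1 _ hW1 k x hx (by rw [Category.assoc, hg1, hk])).trans
          (hz _ hb' (K j) _ W1 _ hW1 k x hx (by rw [Category.assoc, hg2, hk])).symm
    · obtain ⟨g, hg⟩ := exists_corLift hW (f ≫ b.incl) hl rfl
      obtain ⟨x, hx⟩ := hx W _ hW hne
      exact (hz b hb A f W _ hW g x hx hg.symm).trans
        (hz b' hb' A f' W _ hW g x hx (hg.trans hff).symm).symm
  intro b hb b' hb' S f f' hff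
  refine hD _ _ _ (fun e => ?_) fun y => ?_
  · rw [res_edge, res_edge, he, he, ← ed_comp, ← ed_comp, hff]
  · rw [res_res, res_res]
    exact hcor _ _ _ _ _ _ _ (by rw [Category.assoc, hff, Category.assoc])

end

/-- Induction on the number of vertices; trees with at most one vertex are isomorphic to `eta` or to
a corolla. Otherwise choose a top vertex `v` and fill the horn at the inner face of its outgoing
edge. The induction hypothesis provides the elements on proper subtrees, and from these the elements
on the other faces. -/
theorem IsStrictlyFullyKan.segal {D : DSet.{u}} (hD : IsStrictlyFullyKan D) : Segal D := by
  have hS := hD.separated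
  refine ⟨hS, ?_⟩
  suffices h : ∀ (N : ℕ) (T : Tree), Nat.card T.Vertex = N → Fillable D T from fun T => h _ T rfl
  intro N
  induction N using Nat.strong_induction_on with
  | _ N ih =>
  rintro T rfl κ s h1 h2
  rcases subsingleton_or_nontrivial T.Vertex with hT | hT
  · rcases isEmpty_or_nonempty T.Vertex with hT' | ⟨⟨v⟩⟩
    · obtain ⟨g, hg⟩ := exists_retract_eta hT'
      refine ⟨res g (κ T.root), fun e => ?_, fun v => (hT'.false v).elim⟩
      have he : e = T.root := by
        rcases h : T.below e with _ | v
        · exact (T.below_eq_none e).1 h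
        · exact (hT'.false v).elim
      rw [res_res, he]
      have hone : edgeMap T T.root ≫ g = 𝟙 eta := hom_ext fun _ => rfl
      rw [hone, res_id]
    · obtain ⟨g, hg⟩ := exists_retract_cor (v := v) fun z => Subsingleton.elim _ _
      have hg' : vmap v ≫ g = 𝟙 _ := by
        have hm : ∀ e, ed (vmap v) (ed (vmap v ≫ g) e) = ed (vmap v) e := fun e => by
          rw [← ed_comp, Category.assoc, hg, Category.comp_id]
        have hinj : Function.Injective (ed (vmap v)) := by
          intro e e'
          have hne : ∀ i : inp v, T.out v ≠ i.1 := fun i hh =>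
            below_out_ne v ((congrArg T.below hh).trans i.2)
          rcases e with _ | i <;> rcases e' with _ | i'
          · exact fun _ => rfl
          · exact fun hh => (hne i' hh).elim
          · exact fun hh => (hne i hh.symm).elim
          · exact fun hh => congrArg leaf (Subtype.ext hh)
        exact hom_ext fun e => hinj (hm e)
      have hv : ∀ z : T.Vertex, res (vmap z) (res g (s v)) = s z := fun z => by
        obtain rfl : z = v := Subsingleton.elim _ _
        rw [res_res, hg', res_id]
      refine ⟨res g (s v), fun e => ?_, hv⟩
      obtain ⟨z, hz⟩ := exists_vertex_of_edge v e
      rcases hz with rfl | hz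
      · rw [← h1, ← hv z]
        exact (res_edge (vmap z) rt _).symm
      · rw [← h2 z ⟨e, hz⟩, ← hv z]
        exact (res_edge (vmap z) (leaf ⟨e, hz⟩) _).symm
  · obtain ⟨v, w, h, hv⟩ := exists_top_vertex hT
    -- The induction hypothesis gives an element with the prescribed corollas in one indexing of the
    -- inputs; the rest is the change to an arbitrary indexing, as `Realizes` demands.
    have hsub : ∀ (W : Set T.Vertex) (d : T.Edge) (hW : Cl W d), W ≠ Set.univ →
        ∃ x, Realizes κ s (subι hW) x := by
      intro W d hW hne
      choose k hk using fun y => sub_vmap hW y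
      obtain ⟨x, hx, hx'⟩ := ih _ (sub_card_lt hW hne) _ rfl (fun e => κ e.1)
        (fun y => res (corMap (k y)) (s y.1))
        (fun y => (res_edge (corMap (k y)) rt _).trans (h1 y.1))
        (fun y i => (res_edge (corMap (k y)) (leaf i) _).trans ((h2 y.1 (k y i)).trans
          (congrArg κ (congrArg (fun m => ed m (leaf i)) (hk y)).symm)))
      · refine ⟨x, hx, fun A _ f y l hf => ?_⟩
        obtain ⟨V, hVW, hV, hVl⟩ := cor_hom_sub hW f
        have hed : ∀ i, (ed f i).1 = ed (vmap y) (ed (corMap l) i) := fun i =>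
          congrArg (fun k => ed k i) hf
        have hrl : (Set.range fun i => (ed f (leaf i)).1) = inp y := by
          ext e
          constructor
          · rintro ⟨i, rfl⟩
            change (ed f (leaf i)).1 ∈ inp y
            rw [hed]
            exact (l i).2
          · intro he
            exact ⟨l.symm ⟨e, he⟩, (hed _).trans
              (congrArg Subtype.val (l.apply_symm_apply ⟨e, he⟩))⟩
        have hroot : (ed f rt).1 = T.out y := hed rt
        have hVy : V = {y} := by
          rw [hroot] at hV hVl
          exact lv_unique hV (cl_singleton y) (hVl.trans (hrl.trans (lv_singleton y).symm))
        have hy : y ∈ W := hVW (hVy.symm ▸ rfl)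
        let y' : (sub W d hW).Vertex := (⟨y, hy⟩ : W)
        have hf2 : f = corMap (l.trans (k y').symm) ≫ vmap y' := subι_mono hW (by
          rw [hf, Category.assoc, hk, ← Category.assoc]
          refine congrArg (· ≫ vmap y) (cor_hom_ext rfl fun i => ?_)
          exact congrArg leaf ((k y').apply_symm_apply (l i)).symm)
        rw [hf2, ← res_res, hx', res_res]
        refine congrArg (fun m => res m (s y)) (cor_hom_ext rfl fun i => ?_)
        exact congrArg leaf ((k y').apply_symm_apply (l i))
    have hface : ∀ b, b ≠ Face.inner v w h → ∃ z : D.obj (op b.tree),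
        (∀ e, res (edgeMap b.tree e) z = κ (ed b.incl e)) ∧ Extends κ s b.incl z := by
      intro b hb
      -- A vertex of the face `b` may be a merged one. Its prescribed value is the corresponding
      -- operation of the realization on a proper subtree that contains it.
      choose W d hW hne g hg using exists_proper_lift hT h b hb
      choose x hx using fun y => hsub (W y) (d y) (hW y) (hne y)
      have hed : ∀ y e, (ed (g y) e).1 = ed b.incl (ed (vmap y) e) := fun y e =>
        congrArg (fun m => ed m e) (hg y).symm
      obtain ⟨z, hz, hz'⟩ := ih _ (face_card_lt hT b) _ rfl (fun e => κ (ed b.incl e))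
        (fun y => res (g y) (x y))
        (fun y => (res_edge (g y) rt _).trans (((hx y).edge _).trans (congrArg κ (hed y rt))))
        fun y i => (res_edge (g y) (leaf i) _).trans (((hx y).edge _).trans
          (congrArg κ (hed y _)))
      · exact ⟨z, hz, extends_of hS hz fun y => ⟨_, _, hW y, g y, x y, hx y, hg y, hz' y⟩⟩
    choose z hz hz' using hface
    obtain ⟨x, hx⟩ := hD.1.exists_fill (Face.inner v w h) z
      (compat_of_extends hS h hv hsub z hz hz')
    refine ⟨x, fun e => ?_, fun y => ?_⟩
    · obtain ⟨c, hc, e', rfl⟩ := exists_edge_lift (Face.inner v w h) hT e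
      rw [← res_edge, hx c hc, hz]
    · rcases vertex_cover (Face.inner v w h) hT y with ⟨c, hc, g, hg⟩ | ⟨q, -, hq, -⟩
      · obtain ⟨x', hx'⟩ := hsub {y} (T.out y) (cl_singleton y) fun hu => by
          obtain ⟨y', hy'⟩ := exists_ne y
          have : y' ∈ ({y} : Set T.Vertex) := by rw [hu]; trivial
          exact hy' this
        obtain ⟨k, hk⟩ := exists_corLift (cl_singleton y) (vmap y)
          ((lv_singleton y).trans (by
            change _ = Set.range fun i : inp y => i.1
            rw [Subtype.range_val])) rfl
        have hone : corMap (Equiv.refl (inp y)) = 𝟙 _ := cor_hom_ext rfl fun _ => rfl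
        rw [← hg, ← res_res, hx c hc, hz' c hc _ g _ _ _ k x' hx' (hg.trans hk.symm),
          hx'.vertex _ k y (Equiv.refl _) (by rw [hk, hone, Category.id_comp]), hone, res_id]
      · exact absurd rfl (hq.ne_inner h)

end Dendroidal

/-! ### Trees with three levels -/

namespace Dendroidal

open Dendroidal.Tree

namespace Tree

section

variable {J S R : Type} [hJ : Finite J] [hS : Finite S] [hR : Finite R] (π : S → J) (ρ : R → S)

/-- The tree with three levels: a root vertex with inputs `J`, a vertex for every `j : J` with inputs
`π ⁻¹ {j}`, and a vertex for every `s : S` with inputs `ρ ⁻¹ {s}`. -/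
def tree3 : Tree where
  Edge := Option (J ⊕ S ⊕ R)
  Vertex := Option (J ⊕ S)
  finite_edge := inferInstance
  finite_vertex := inferInstance
  root := none
  out
    | none => none
    | some (Sum.inl j) => some (Sum.inl j)
    | some (Sum.inr s) => some (Sum.inr (Sum.inl s))
  out_injective := by
    rintro (_ | j | s) (_ | j' | s') h <;> cases h <;> rfl
  below
    | none => none
    | some (Sum.inl _) => some none
    | some (Sum.inr (Sum.inl s)) => some (some (Sum.inl (π s)))
    | some (Sum.inr (Sum.inr r)) => some (some (Sum.inr (ρ r)))
  below_eq_none := by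
    rintro (_ | j | s | r)
    · exact ⟨fun _ => rfl, fun _ => rfl⟩
    all_goals exact ⟨fun h => (nomatch h), fun h => (nomatch h)⟩
  descending := by
    refine ⟨fun
      | none => 0
      | some (Sum.inl _) => 1
      | some (Sum.inr (Sum.inl _)) => 2
      | some (Sum.inr (Sum.inr _)) => 3, ?_⟩
    rintro (_ | j | s | r) v h <;> cases h
    · exact Nat.zero_lt_one
    · exact Nat.one_lt_two
    · exact Nat.lt_succ_self 2

variable {π ρ}

def root3 : (tree3 π ρ).Edge := none
def mid3 (j : J) : (tree3 π ρ).Edge := some (Sum.inl j)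
def sec3 (s : S) : (tree3 π ρ).Edge := some (Sum.inr (Sum.inl s))
def top3 (r : R) : (tree3 π ρ).Edge := some (Sum.inr (Sum.inr r))

theorem mid3_injective : Function.Injective (mid3 (π := π) (ρ := ρ)) := fun i j h => by
  cases h
  rfl

theorem sec3_injective : Function.Injective (sec3 (π := π) (ρ := ρ)) := fun i j h => by
  cases h
  rfl

theorem top3_injective : Function.Injective (top3 (π := π) (ρ := ρ)) := fun i j h => by
  cases h
  rfl

theorem inp3_low : inp (T := tree3 π ρ) none = Set.range mid3 := by
  ext x
  rcases x with _ | j | s | r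
  · exact ⟨fun h => (nomatch h), fun ⟨i, h⟩ => (nomatch h)⟩
  · exact ⟨fun _ => ⟨j, rfl⟩, fun _ => rfl⟩
  · exact ⟨fun h => (nomatch h), fun ⟨i, h⟩ => (nomatch h)⟩
  · exact ⟨fun h => (nomatch h), fun ⟨i, h⟩ => (nomatch h)⟩

theorem inp3_mid (j : J) : inp (T := tree3 π ρ) (some (Sum.inl j)) = sec3 '' (π ⁻¹' {j}) := by
  ext x
  rcases x with _ | i | s | r
  · exact ⟨fun h => (nomatch h), fun ⟨_, _, h⟩ => (nomatch h)⟩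
  · exact ⟨fun h => (nomatch h), fun ⟨_, _, h⟩ => (nomatch h)⟩
  · refine ⟨fun h => ⟨s, ?_, rfl⟩, ?_⟩
    · exact Sum.inl_injective (Option.some_injective _ (Option.some_injective _ h))
    · rintro ⟨s', rfl, h⟩
      obtain rfl := sec3_injective (π := π) (ρ := ρ) h
      rfl
  · exact ⟨fun h => (nomatch h), fun ⟨_, _, h⟩ => (nomatch h)⟩

theorem inp3_sec (s : S) : inp (T := tree3 π ρ) (some (Sum.inr s)) = top3 '' (ρ ⁻¹' {s}) := by
  ext x
  rcases x with _ | i | s' | r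
  · exact ⟨fun h => (nomatch h), fun ⟨_, _, h⟩ => (nomatch h)⟩
  · exact ⟨fun h => (nomatch h), fun ⟨_, _, h⟩ => (nomatch h)⟩
  · exact ⟨fun h => (nomatch h), fun ⟨_, _, h⟩ => (nomatch h)⟩
  · refine ⟨fun h => ⟨r, ?_, rfl⟩, ?_⟩
    · exact Sum.inr_injective (Option.some_injective _ (Option.some_injective _ h))
    · rintro ⟨s', rfl, h⟩
      obtain rfl := top3_injective (π := π) (ρ := ρ) h
      rfl

theorem opSet3_low : (tree3 π ρ).IsOpSet (Set.range mid3) root3 := by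
  rw [← inp3_low]
  exact isOpSet_inp (T := tree3 π ρ) none

theorem opSet3_mid (j : J) : (tree3 π ρ).IsOpSet (sec3 '' (π ⁻¹' {j})) (mid3 j) := by
  rw [← inp3_mid]
  exact isOpSet_inp (T := tree3 π ρ) (some (Sum.inl j))

theorem opSet3_sec (s : S) : (tree3 π ρ).IsOpSet (top3 '' (ρ ⁻¹' {s})) (sec3 s) := by
  rw [← inp3_sec]
  exact isOpSet_inp (T := tree3 π ρ) (some (Sum.inr s))

theorem opSet3_low_mid : (tree3 π ρ).IsOpSet (Set.range sec3) root3 := by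
  have h := (IsOpSet.subst mid3_injective opSet3_low (opSet3_mid (π := π) (ρ := ρ))).1
  convert h
  ext x
  simp only [Set.mem_range, Set.mem_iUnion]
  exact ⟨fun ⟨s, hs⟩ => ⟨π s, s, rfl, hs⟩, fun ⟨_, s, _, hs⟩ => ⟨s, hs⟩⟩

theorem opSet3_total : (tree3 π ρ).IsOpSet (Set.range top3) root3 := by
  have h := (IsOpSet.subst sec3_injective opSet3_low_mid (opSet3_sec (π := π) (ρ := ρ))).1
  convert h
  ext x
  simp only [Set.mem_range, Set.mem_iUnion]
  exact ⟨fun ⟨s, hs⟩ => ⟨ρ s, s, rfl, hs⟩, fun ⟨_, s, _, hs⟩ => ⟨s, hs⟩⟩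

theorem opSet3_mid_sec (j : J) :
    (tree3 π ρ).IsOpSet (top3 '' ((fun r => π (ρ r)) ⁻¹' {j})) (mid3 j) := by
  have h0 : (tree3 π ρ).IsOpSet (Set.range fun s : π ⁻¹' {j} => sec3 s.1) (mid3 j) := by
    convert opSet3_mid (ρ := ρ) j
    ext x
    exact ⟨fun ⟨s, hs⟩ => ⟨s.1, s.2, hs⟩, fun ⟨s, h, hs⟩ => ⟨⟨s, h⟩, hs⟩⟩
  have h := (IsOpSet.subst (sec3_injective.comp Subtype.val_injective) h0
    fun s => opSet3_sec (π := π) (ρ := ρ) s.1).1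
  convert h
  ext x
  simp only [Set.mem_image, Set.mem_iUnion]
  exact ⟨fun ⟨r, hr, hx⟩ => ⟨⟨ρ r, hr⟩, r, rfl, hx⟩, fun ⟨s, r, hr, hx⟩ =>
    ⟨r, (congrArg π hr).trans s.2, hx⟩⟩

end

end Tree

/-- The objects of the symmetric monoidal category of a dendroidal set. -/
def Obj (D : DSet.{u}) : Type u := D.obj (op eta)

variable {D : DSet.{u}}

/-- The operations of a dendroidal set with given inputs and output. -/
def Cell {A : Type} [Finite A] (a : A → Obj D) (d : Obj D) : Type u :=
  {x : D.obj (op (cor A)) // res (edgeMap _ rt) x = d ∧ ∀ i, res (edgeMap _ (leaf i)) x = a i}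

section

variable {J S R : Type} [Finite J] [Finite S] [Finite R] {π : S → J} {ρ : R → S}

/-- Trees with three levels encode two successive substitutions and are used for associativity. The
inputs of the vertices are indexed by arbitrary injections onto the fibres of `π` and `ρ`, and the
conclusion holds for all corolla maps with the right edges, so no identification of index types is
needed later. -/
theorem Segal.exists_tree3 (hD : Segal D) {Y : Obj D} {b : J → Obj D} {c : S → Obj D}
    {e : R → Obj D} (g : Cell b Y) {B : J → Type} [∀ j, Finite (B j)] {l : ∀ j, B j → S}
    (hl : ∀ j, Function.Injective (l j)) (hl' : ∀ j, Set.range (l j) = π ⁻¹' {j})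
    (f : ∀ j, Cell (fun i => c (l j i)) (b j)) {B' : S → Type} [∀ s, Finite (B' s)]
    {l' : ∀ s, B' s → R} (hm : ∀ s, Function.Injective (l' s))
    (hm' : ∀ s, Set.range (l' s) = ρ ⁻¹' {s}) (h : ∀ s, Cell (fun i => e (l' s i)) (c s)) :
    ∃ z : D.obj (op (tree3 π ρ)),
      res (corHom mid3 root3 mid3_injective opSet3_low) z = g.1 ∧
      (∀ (j : J) (k : cor (B j) ⟶ tree3 π ρ), ed k rt = mid3 j →
        (∀ i, ed k (leaf i) = sec3 (l j i)) → res k z = (f j).1) ∧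
      ∀ (s : S) (k : cor (B' s) ⟶ tree3 π ρ), ed k rt = sec3 s →
        (∀ i, ed k (leaf i) = top3 (l' s i)) → res k z = (h s).1 := by
  have ho : ∀ j, (tree3 π ρ).IsOpSet (Set.range fun i => sec3 (l j i)) (mid3 j) := fun j => by
    have := opSet3_mid (π := π) (ρ := ρ) j
    rwa [← hl' j, ← Set.range_comp] at this
  have ho' : ∀ s, (tree3 π ρ).IsOpSet (Set.range fun i => top3 (l' s i)) (sec3 s) := fun s => by
    have := opSet3_sec (π := π) (ρ := ρ) s
    rwa [← hm' s, ← Set.range_comp] at this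
  let B'' : (tree3 π ρ).Vertex → Type := fun v => Option.elim v J (Sum.elim B B')
  have hB : ∀ v, Finite (B'' v) := by
    rintro (_ | j | s)
    · exact inferInstanceAs (Finite J)
    · exact inferInstanceAs (Finite (B j))
    · exact inferInstanceAs (Finite (B' s))
  let k₀ : cor J ⟶ tree3 π ρ := corHom mid3 root3 mid3_injective opSet3_low
  let k₁ : ∀ j, cor (B j) ⟶ tree3 π ρ := fun j =>
    corHom _ (mid3 j) (sec3_injective.comp (hl j)) (ho j)
  let k₂ : ∀ s, cor (B' s) ⟶ tree3 π ρ := fun s =>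
    corHom _ (sec3 s) (top3_injective.comp (hm s)) (ho' s)
  let g₀ : D.obj (op (cor J)) := g.1
  let f₀ : ∀ j, D.obj (op (cor (B j))) := fun j => (f j).1
  let h₀ : ∀ s, D.obj (op (cor (B' s))) := fun s => (h s).1
  let k : ∀ v, @cor (B'' v) (hB v) ⟶ tree3 π ρ := fun v => match v with
    | none => k₀
    | some (Sum.inl j) => k₁ j
    | some (Sum.inr s) => k₂ s
  let F : ∀ v, D.obj (op (@cor (B'' v) (hB v))) := fun v => match v with
    | none => g₀
    | some (Sum.inl j) => f₀ j
    | some (Sum.inr s) => h₀ s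
  let κ : (tree3 π ρ).Edge → D.obj (op eta) := fun x => match x with
    | none => Y
    | some (Sum.inl j) => b j
    | some (Sum.inr (Sum.inl s)) => c s
    | some (Sum.inr (Sum.inr r)) => e r
  obtain ⟨z, -, hz⟩ := hD.exists_fill (B := B'') k (by rintro (_ | j | s) <;> rfl) (by
    rintro (_ | j | s)
    · exact (inp3_low (π := π) (ρ := ρ)).symm
    · exact (Set.range_comp sec3 (l j)).trans ((congrArg (sec3 '' ·) (hl' j)).trans
        (inp3_mid j).symm)
    · exact (Set.range_comp top3 (l' s)).trans ((congrArg (top3 '' ·) (hm' s)).trans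
        (inp3_sec s).symm)) κ F (by
    rintro (_ | j | s)
    · exact g.2.1
    · exact (f j).2.1
    · exact (h s).2.1) (by
    rintro (_ | j | s)
    · exact g.2.2
    · exact (f j).2.2
    · exact (h s).2.2)
  refine ⟨z, hz none, fun j k' h1 h2 => ?_, fun s k' h1 h2 => ?_⟩
  · refine (congrArg (fun k => res k z) ?_).trans (hz (some (Sum.inl j)))
    exact cor_hom_ext h1 h2
  · refine (congrArg (fun k => res k z) ?_).trans (hz (some (Sum.inr s)))
    exact cor_hom_ext h1 h2

end

end Dendroidal

/-! ### Horns of corollas and division in a strictly fully Kan dendroidal set -/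

namespace Dendroidal

open Dendroidal.Tree

namespace Tree

section

variable {A : Type} [Finite A]

theorem cl_leaf {W : Set (cor A).Vertex} {i : A} (h : Cl W (leaf i)) : W = ∅ := by
  refine Set.eq_empty_of_forall_notMem fun v hv => ?_
  rcases h v hv with h | ⟨w, -, h⟩
  · exact nomatch h
  · exact nomatch h

/-- A map to a corolla whose image is a leaf is degenerate. -/
theorem exists_eta_lift {S : Tree} (k : S ⟶ cor A) (i : A) (h : ∀ e, ed k e = leaf i) :
    ∃ q : S ⟶ eta, q ≫ edgeMap (cor A) (leaf i) = k := by
  refine ⟨homOfSet (fun _ => ()) (fun v e he e' he' _ => ?_) (fun v => ?_),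
    hom_ext fun e => (h e).symm⟩
  · exact (hom_isOpSet k (isOpSet_inp v)).1 he he' ((h e).trans (h e').symm)
  · obtain ⟨W, hW, hl⟩ := (hom_isOpSet k (isOpSet_inp v)).2
    have hd := h (S.out v)
    rw [hd] at hW hl
    rw [cl_leaf hW, lv_empty] at hl
    refine ⟨∅, cl_empty _, (lv_empty (T := eta) ()).trans ?_⟩
    obtain ⟨e, he, -⟩ : leaf i ∈ ed k '' inp v := by rw [← hl]; rfl
    exact Set.eq_of_subset_of_subset (fun _ _ => ⟨e, he, rfl⟩) fun _ _ => rfl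

/-- The map from a corolla with one leaf to the tree without vertices. -/
def degen (A : Type) [Finite A] [Subsingleton A] [Nonempty A] : cor A ⟶ eta :=
  corHom (fun _ => ()) () (Function.injective_of_subsingleton _) ⟨∅, cl_empty _,
    (lv_empty (T := eta) ()).trans <| Set.eq_of_subset_of_subset (fun _ _ => ⟨Classical.arbitrary A, rfl⟩) fun _ _ => rfl⟩

end

end Tree

variable {D : DSet.{u}}

section

variable {A : Type} [Finite A]

/-- Over a leaf of a corolla there is only the empty subtree, so every vertex of `S` is sent to a
degenerate operation, and its value depends only on the colour of a leaf. -/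
theorem res_eq_of_leaf (hD : Separated D) {x y : D.obj (op (cor A))}
    (h : ∀ i, res (edgeMap _ (leaf i)) x = res (edgeMap _ (leaf i)) y) {S : Tree} (q : S ⟶ cor A)
    (hq : ∀ e, ∃ i, ed q e = leaf i) : res q x = res q y := by
  refine hD _ _ _ (fun e => ?_) fun v => ?_
  · obtain ⟨i, hi⟩ := hq e
    rw [res_edge, res_edge, hi, h]
  · obtain ⟨i, hi⟩ := hq (S.out v)
    obtain ⟨W, hW, hl⟩ := (hom_isOpSet q (isOpSet_inp v)).2
    rw [hi] at hW hl
    rw [cl_leaf hW, lv_empty] at hl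
    obtain ⟨k, hk⟩ := exists_eta_lift (vmap v ≫ q) i (cor_cases hi fun e => by
      have : ed q e.1 ∈ ({leaf i} : Set _) := by
        rw [hl]
        exact ⟨_, e.2, rfl⟩
      exact this)
    rw [res_res, res_res, ← hk, ← res_res, ← res_res, h]

/-- The faces of a corolla are its edges. Two maps that agree after inclusion go through the same
edge, because every tree has a root, so any family of colours is compatible. -/
theorem IsStrictlyFullyKan.exists_corolla (hD : IsStrictlyFullyKan D) (e : (cor A).Edge)
    (κ : ∀ e' : (cor A).Edge, e' ≠ e → Obj D) :
    ∃ x : D.obj (op (cor A)), ∀ e' (h : e' ≠ e), res (edgeMap _ e') x = κ e' h := by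
  have hu : ∃! _ : (cor A).Vertex, True := ⟨(), trivial, fun _ _ => rfl⟩
  have hface : ∀ b : (cor A).Face, ∃ e', b = Face.edge e' hu := by
    intro b
    cases b with
    | inner u w h => exact (below_out_ne (T := cor A) u h).elim
    | top v hv hl => exact (hv rfl).elim
    | bottom v u hv hu hl => exact (below_out_ne (T := cor A) u hu).elim
    | edge e h => exact ⟨e, rfl⟩
  have hne : ∀ e', e' ≠ e → Face.edge e' hu ≠ Face.edge e hu := fun e' he' h => he' (by injection h)
  have hb : ∀ b : (cor A).Face, b ≠ Face.edge e hu → ∃ z : D.obj (op b.tree), ∀ e' h,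
      b = Face.edge e' hu → ∀ f : eta ⟶ b.tree, res f z = κ e' h := by
    intro b hb
    obtain ⟨e', rfl⟩ := hface b
    refine ⟨κ e' fun h => hb (h ▸ rfl), fun e'' _ h f => ?_⟩
    obtain rfl : e' = e'' := by injection h
    have : f = 𝟙 eta := hom_ext fun _ => rfl
    rw [this]
    exact res_id _
  choose z hz using hb
  obtain ⟨x, hx⟩ := hD.1.exists_fill _ z (by
    intro b _ b' _ S f f' hff
    obtain ⟨e', rfl⟩ := hface b
    obtain ⟨e'', rfl⟩ := hface b'
    obtain rfl : e' = e'' := congrArg (fun k => ed k S.root) hff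
    obtain rfl : f = f' := hom_ext fun _ => rfl
    rfl)
  exact ⟨x, fun e' he' => (hx _ (hne e' he')).trans
    ((res_id _).symm.trans (hz _ (hne e' he') e' he' rfl (𝟙 eta)))⟩

end

section

variable {A J : Type} [Finite A] [Unique J]

theorem cor_hom_mono {T : Tree} (k : cor A ⟶ T) (h : ∀ i, ed k (leaf i) ≠ ed k rt) {S : Tree}
    {q q' : S ⟶ cor A} (hq : q ≫ k = q' ≫ k) : q = q' := by
  have hinj : ∀ x x', ed k x = ed k x' → x = x' := by
    refine cor_cases (cor_cases (fun _ => rfl) fun i hi => (h i hi.symm).elim) fun i =>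
      cor_cases (fun hi => (h i hi).elim) fun j hij => congrArg leaf (cor_hom_injective k hij)
  exact hom_ext fun x => hinj _ _ (congrArg (fun f => ed f x) hq)

theorem exists_cor_inverse {T : Tree} {y : T.Vertex} (hT : ∀ z, z = y) (k : cor A ⟶ T)
    (h : ed k rt = T.out y) (h' : (Set.range fun i => ed k (leaf i)) = inp y) :
    ∃ r : T ⟶ cor A, r ≫ k = 𝟙 T ∧ k ≫ r = 𝟙 _ := by
  obtain ⟨g, hg⟩ := exists_retract_cor hT
  obtain ⟨e, rfl⟩ := exists_corMap_vmap k h h'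
  have h1 : (g ≫ corMap e.symm) ≫ corMap e ≫ vmap y = 𝟙 T := by
    rw [Category.assoc, ← Category.assoc (corMap e.symm), corMap_symm, Category.id_comp, hg]
  refine ⟨g ≫ corMap e.symm, h1, cor_hom_mono (corMap e ≫ vmap y) (fun i hi => ?_) ?_⟩
  · have h2 : (e i).1 = T.out y := hi
    exact below_out_ne y ((congrArg T.below h2.symm).trans (e i).2)
  · rw [Category.assoc, h1, Category.comp_id, Category.id_comp]

theorem tree2_unique_cases {P : (tree2 fun _ : J => A).Vertex → Prop} (h1 : P low2)
    (h2 : P (up2 default)) (v) : P v :=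
  tree2_vertex_cases h1 (fun j => Unique.eq_default j ▸ h2) v

theorem below_up2 (j : J) : (tree2 fun _ : J => A).below ((tree2 _).out (up2 j)) = some low2 := rfl

theorem up2_ne_low2 {j : J} : (up2 j : (tree2 fun _ : J => A).Vertex) ≠ low2 := fun h => nomatch h

/-- When the root vertex has one input, the tree has two vertices. Contracting the inner edge leaves
the corolla of the total operation, and removing the root vertex leaves the corolla of the upper
vertex. These two faces form the horn at the remaining face, so filling this horn is dividing a
total operation by an upper operation. -/
theorem tree2_inner (e : (Σ _ : J, A) ≃ A) :
    ∃ (k : cor A ⟶ (Face.inner _ _ (below_up2 (A := A) (default : J))).tree) (r : _ ⟶ cor A),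
      r ≫ k = 𝟙 _ ∧ k ≫ r = 𝟙 _ ∧ k ≫ (Face.inner _ _ (below_up2 default)).incl = totMap e := by
  obtain ⟨k, hk⟩ := exists_contractLift (below_up2 (A := A) (default : J)) (totMap e)
    (cor_cases (fun h => nomatch h) fun i h => nomatch h)
  have hk' : ∀ x, (ed k x).1 = ed (totMap e) x := fun x => congrArg (fun f => ed f x) hk
  obtain ⟨r, h1, h2⟩ := exists_cor_inverse
    (T := (tree2 fun _ : J => A).contract _ _ (below_up2 default)) (y := ⟨low2, up2_ne_low2.symm⟩)
    (fun ⟨z, hz⟩ => Subtype.ext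
      (tree2_unique_cases (P := fun z => z ≠ up2 default → z = low2) (fun _ => rfl)
        (fun h => (h rfl).elim) z hz)) k
    (Subtype.ext (hk' rt)) (by
      ext x
      refine Iff.trans ?_ (contract_below_iff _ x _).symm
      constructor
      · rintro ⟨i, rfl⟩
        refine Or.inr ⟨?_, rfl⟩
        dsimp only
        rw [hk', ← Unique.eq_default (e.symm i).1]
        rfl
      · obtain ⟨x, hx⟩ := x
        rintro (h | ⟨h, -⟩)
        · have : x ∈ inp low2 := h
          rw [inp_low2] at this
          obtain ⟨j, rfl⟩ := this
          exact (hx (congrArg mid2 (Unique.eq_default j))).elim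
        · have : x ∈ inp (up2 default) := h
          rw [inp_up2] at this
          obtain ⟨i, rfl⟩ := this
          refine ⟨e ⟨default, i⟩, Subtype.ext ((hk' _).trans ?_)⟩
          exact congrArg top2 (e.symm_apply_apply _))
  exact ⟨k, r, h1, h2, hk⟩

theorem tree2_bottom (hv hu hl) :
    ∃ (k : cor A ⟶ (Face.bottom (T := tree2 fun _ : J => A) low2 (up2 default) hv hu hl).tree)
      (r : _ ⟶ cor A), r ≫ k = 𝟙 _ ∧ k ≫ r = 𝟙 _ ∧
      k ≫ (Face.bottom (T := tree2 fun _ : J => A) low2 (up2 default) hv hu hl).incl =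
        upMap (K := fun _ : J => A) default := by
  have ho : (Face.bottom (T := tree2 fun _ : J => A) low2 (up2 default) hv hu hl).IsOuter low2 :=
    Or.inr ⟨_, hv, hu, hl, rfl⟩
  obtain ⟨g, hg⟩ := exists_vmap_lift (v := up2 default) (ho.exists_lift (m := up2 default)
    (W := {up2 default}) rfl (cl_singleton (T := tree2 fun _ : J => A) _)
    fun h => up2_ne_low2 (J := J) (A := A) (j := default) h.symm)
  obtain ⟨e, he⟩ := exists_corMap_vmap (upMap (K := fun _ : J => A) default) rfl (inp_up2 _).symm
  have hk : (corMap e ≫ g) ≫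
      (Face.bottom (T := tree2 fun _ : J => A) low2 (up2 default) hv hu hl).incl =
      upMap (K := fun _ : J => A) default := by
    rw [Category.assoc, hg, he]
  obtain ⟨k, hk'⟩ : ∃ k, corMap e ≫ g = k := ⟨_, rfl⟩
  rw [hk'] at hk
  have hk1 : ∀ x, (ed k x).1 = ed (upMap (K := fun _ : J => A) default) x := fun x =>
    congrArg (fun f => ed f x) hk
  obtain ⟨r, h1, h2⟩ := exists_cor_inverse
    (T := (tree2 fun _ : J => A).chopRoot low2 (up2 default) hv hu hl)
    (y := ⟨up2 default, up2_ne_low2⟩)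
    (fun ⟨z, hz⟩ => Subtype.ext
      (tree2_unique_cases (P := fun z => z ≠ low2 → z = up2 default) (fun h => (h rfl).elim)
        (fun _ => rfl) z hz)) k
    (Subtype.ext (hk1 rt)) (by
      refine Subtype.val_injective.image_injective ?_
      refine Eq.trans ?_ (val_inp_chopRoot _ _ hv hu hl _).symm
      refine Eq.trans ?_ (inp_up2 _).symm
      refine (Set.range_comp _ _).symm.trans ?_
      exact congrArg Set.range (funext fun i => hk1 _))
  exact ⟨k, r, h1, h2, hk⟩

theorem tree2_face (hv hl hv' hu' hl') (b : (tree2 fun _ : J => A).Face)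
    (hb : b ≠ Face.top (up2 default) hv hl) : b = Face.inner _ _ (below_up2 default) ∨
      b = Face.bottom low2 (up2 default) hv' hu' hl' := by
  have hlow : ∀ u w, (tree2 fun _ : J => A).below ((tree2 _).out u) = some w →
      u = up2 default ∧ w = low2 := by
    intro u w h
    induction u using tree2_unique_cases with
    | h1 => exact nomatch h
    | h2 => exact ⟨rfl, (Option.some_injective _ h).symm⟩
  cases b with
  | inner u w h =>
    obtain ⟨rfl, rfl⟩ := hlow u w h
    exact Or.inl rfl
  | top v hv hl =>
    induction v using tree2_unique_cases with
    | h1 => exact (hv rfl).elim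
    | h2 => exact (hb rfl).elim
  | bottom v u hv hu hl =>
    obtain ⟨rfl, rfl⟩ := hlow u v hu
    exact Or.inr rfl
  | edge x h => exact (up2_ne_low2 (h.unique (y₁ := up2 default) (y₂ := low2) trivial trivial)).elim

theorem up2_not_root : (tree2 fun _ : J => A).out (up2 default) ≠ (tree2 _).root :=
  fun h => nomatch h

theorem up2_top (u) : (tree2 fun _ : J => A).below ((tree2 _).out u) ≠ some (up2 default) := by
  induction u using tree2_unique_cases with
  | h1 => exact fun h => nomatch h
  | h2 => exact fun h => nomatch h

theorem below_low2 (u) (h : (tree2 fun _ : J => A).below ((tree2 _).out u) = some low2) :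
    u = up2 default := by
  induction u using tree2_unique_cases with
  | h1 => exact nomatch h
  | h2 => rfl

theorem IsStrictlyFullyKan.div_unique (hD : IsStrictlyFullyKan D) (e : (Σ _ : J, A) ≃ A)
    {z z' : D.obj (op (tree2 fun _ : J => A))}
    (h : res (upMap (K := fun _ : J => A) default) z = res (upMap (K := fun _ : J => A) default) z')
    (h' : res (totMap e) z = res (totMap e) z') : z = z' := by
  have hT : Nontrivial (tree2 fun _ : J => A).Vertex := ⟨_, _, up2_ne_low2 (j := default)⟩
  refine hD.ext hT (Face.top (up2 default) up2_not_root up2_top) fun b hb => ?_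
  rcases tree2_face _ _ rfl (below_up2 default) below_low2 b hb with rfl | rfl
  · obtain ⟨k, r, h1, -, h3⟩ := tree2_inner (J := J) e
    rw [← h3, ← res_res, ← res_res] at h'
    have := congrArg (res r) h'
    rwa [res_res, res_res r, h1, res_id, res_id] at this
  · obtain ⟨k, r, h1, -, h3⟩ := tree2_bottom (A := A) (J := J) rfl (below_up2 default) below_low2
    rw [← h3, ← res_res, ← res_res] at h
    have := congrArg (res r) h
    rwa [res_res, res_res r, h1, res_id, res_id] at this

/-- Division: operations with the same inputs differ by an operation with one input. -/
theorem IsStrictlyFullyKan.exists_div (hD : IsStrictlyFullyKan D) (e : (Σ _ : J, A) ≃ A)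
    (he : ∀ i, e ⟨default, i⟩ = i) (x t : D.obj (op (cor A)))
    (h : ∀ i, res (edgeMap _ (leaf i)) x = res (edgeMap _ (leaf i)) t) :
    ∃ z : D.obj (op (tree2 fun _ : J => A)), res (upMap (K := fun _ : J => A) default) z = x ∧
      res (totMap e) z = t := by
  have hsep := hD.separated
  -- The root of the total operation is not an edge of the upper corolla, and conversely, so the two
  -- faces meet only in leaves. There `x` and `t` agree by hypothesis; the order `e` is needed to
  -- match the leaves.
  have hmixed : ∀ (S : Tree) (q q' : S ⟶ cor A),
      q ≫ totMap e = q' ≫ upMap (K := fun _ : J => A) default → res q t = res q' x := by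
    intro S q q' hq
    have hcase : ∀ a b : (cor A).Edge, ed (totMap e) a =
        ed (upMap (K := fun _ : J => A) default) b → ∃ i, a = leaf i ∧ b = leaf i := by
      refine cor_cases (cor_cases (fun h => nomatch h) fun i h => nomatch h) fun i =>
        cor_cases (fun h => nomatch h) fun i' hi => ⟨i, rfl, ?_⟩
      have h2 : e.symm i = ⟨default, i'⟩ := top2_injective hi
      rw [e.symm_apply_eq.1 h2, he]
    have hqq : ∀ x, ∃ i, ed q x = leaf i ∧ ed q' x = leaf i := fun x =>
      hcase _ _ (congrArg (fun k => ed k x) hq)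
    obtain rfl : q = q' := hom_ext fun x => by
      obtain ⟨i, h1, h2⟩ := hqq x
      rw [h1, h2]
    exact res_eq_of_leaf hsep (fun i => (h i).symm) q fun x => (hqq x).imp fun _ h => h.1
  obtain ⟨k, r, h1, h2, h3⟩ := tree2_inner (J := J) e
  obtain ⟨k', r', h1', h2', h3'⟩ :=
    tree2_bottom (A := A) (J := J) rfl (below_up2 default) below_low2
  have hmt : ∀ (S : Tree) (q q' : S ⟶ cor A), q ≫ totMap e = q' ≫ totMap e → q = q' :=
    fun S q q' => cor_hom_mono (totMap e) fun i h => nomatch h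
  have hmx : ∀ (S : Tree) (q q' : S ⟶ cor A), q ≫ upMap (K := fun _ : J => A) default =
      q' ≫ upMap (K := fun _ : J => A) default → q = q' :=
    fun S q q' => cor_hom_mono (upMap (K := fun _ : J => A) default) fun i h => nomatch h
  have hfam : ∀ b, b ≠ Face.top (T := tree2 fun _ : J => A) (up2 default) up2_not_root up2_top →
      ∃ z : D.obj (op b.tree), ∃ (f : b.tree ⟶ cor A), f ≫ totMap e = b.incl ∧ z = res f t ∨
        f ≫ upMap (K := fun _ : J => A) default = b.incl ∧ z = res f x := by
    intro b hb
    rcases tree2_face _ _ rfl (below_up2 default) below_low2 b hb with rfl | rfl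
    · refine ⟨res r t, r, Or.inl ⟨?_, rfl⟩⟩
      rw [← h3, ← Category.assoc, h1, Category.id_comp]
    · refine ⟨res r' x, r', Or.inr ⟨?_, rfl⟩⟩
      rw [← h3', ← Category.assoc, h1', Category.id_comp]
  choose z f hz using hfam
  obtain ⟨y, hy⟩ := hD.1.exists_fill _ z (by
    intro b hb b' hb' S g g' hg
    rcases hz b hb with ⟨ha, hb⟩ | ⟨ha, hb⟩ <;> rcases hz b' hb' with ⟨hc, hd⟩ | ⟨hc, hd⟩ <;>
      rw [hb, hd, res_res, res_res] <;>
      rw [← ha, ← hc, ← Category.assoc, ← Category.assoc] at hg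
    · rw [hmt _ _ _ hg]
    · exact hmixed _ _ _ hg
    · exact (hmixed _ _ _ hg.symm).symm
    · rw [hmx _ _ _ hg])
  have hn : Face.inner _ _ (below_up2 default) ≠
      Face.top (T := tree2 fun _ : J => A) (up2 default) up2_not_root up2_top := by
    intro h
    cases h
  have hn' : Face.bottom low2 (up2 default) rfl (below_up2 default) below_low2 ≠
      Face.top (T := tree2 fun _ : J => A) (up2 default) up2_not_root up2_top := by
    intro h
    cases h
  refine ⟨y, ?_, ?_⟩
  · rw [← h3', ← res_res]
    refine (congrArg (res k') (hy _ hn')).trans ?_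
    rcases hz _ hn' with ⟨ha, hb⟩ | ⟨ha, hb⟩
    · refine (congrArg (res k') hb).trans ((res_res _ _ _).trans ?_)
      refine (hmixed _ (k' ≫ f _ hn') (𝟙 _) ?_).trans (res_id x)
      rw [Category.assoc, ha, h3', Category.id_comp]
    · refine (congrArg (res k') hb).trans ((res_res _ _ _).trans ?_)
      rw [hmx _ (k' ≫ f _ hn') (𝟙 _) (by rw [Category.assoc, ha, h3', Category.id_comp]), res_id]
  · rw [← h3, ← res_res]
    refine (congrArg (res k) (hy _ hn)).trans ?_
    rcases hz _ hn with ⟨ha, hb⟩ | ⟨ha, hb⟩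
    · refine (congrArg (res k) hb).trans ((res_res _ _ _).trans ?_)
      rw [hmt _ (k ≫ f _ hn) (𝟙 _) (by rw [Category.assoc, ha, h3, Category.id_comp]), res_id]
    · refine (congrArg (res k) hb).trans ((res_res _ _ _).trans ?_)
      refine (hmixed _ (𝟙 _) (k ≫ f _ hn) ?_).symm.trans (res_id t)
      rw [Category.assoc, ha, h3, Category.id_comp]

end

end Dendroidal

namespace Dendroidal

open Dendroidal.Tree

/-! ### Finite sets of variables -/

/-- The set `R` is the disjoint union of the sets `K j`, for `j` in `S`. -/
def IsPart {J I : Type} (S : Finset J) (K : J → Finset I) (R : Finset I) : Prop :=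
  (∀ i, i ∈ R ↔ ∃ j ∈ S, i ∈ K j) ∧ ∀ j ∈ S, ∀ j' ∈ S, ∀ i, i ∈ K j → i ∈ K j' → j = j'

instance {J I : Type} [Fintype I] [Fintype J] [DecidableEq I] [DecidableEq J] (S : Finset J)
    (K : J → Finset I) (R : Finset I) : Decidable (IsPart S K R) := by
  unfold IsPart
  infer_instance

namespace IsPart

variable {H J I : Type} {S : Finset J} {K : J → Finset I} {R : Finset I} (h : IsPart S K R)

theorem single (j : J) (K : J → Finset I) : IsPart {j} K (K j) := by
  refine ⟨fun i => by simp, fun j₁ h₁ j₂ h₂ i _ _ => ?_⟩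
  rw [Finset.mem_singleton.1 h₁, Finset.mem_singleton.1 h₂]

/-- Blocks of blocks: a decomposition into the sets `K j` is refined by decomposing each of the
resulting sets `L j`. -/
theorem trans {N : I → Finset H} {L : J → Finset H} {M : Finset H} (h : IsPart S K R)
    (hN : ∀ j ∈ S, IsPart (K j) N (L j)) (hL : IsPart S L M) : IsPart R N M := by
  refine ⟨fun x => ?_, fun i hi i' hi' x hx hx' => ?_⟩
  · rw [hL.1]
    constructor
    · rintro ⟨j, hj, hx⟩
      obtain ⟨i, hi, hx⟩ := ((hN j hj).1 x).1 hx
      exact ⟨i, (h.1 i).2 ⟨j, hj, hi⟩, hx⟩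
    · rintro ⟨i, hi, hx⟩
      obtain ⟨j, hj, hi⟩ := (h.1 i).1 hi
      exact ⟨j, hj, ((hN j hj).1 x).2 ⟨i, hi, hx⟩⟩
  · obtain ⟨j, hj, hi⟩ := (h.1 i).1 hi
    obtain ⟨j', hj', hi'⟩ := (h.1 i').1 hi'
    obtain rfl := hL.2 j hj j' hj' x (((hN j hj).1 x).2 ⟨i, hi, hx⟩)
      (((hN j' hj').1 x).2 ⟨i', hi', hx'⟩)
    exact (hN j hj).2 i hi i' hi' x hx hx'

/-- The bijection from the disjoint union of the `K j` to `R`. -/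
noncomputable def equiv : (Σ j : S, K j.1) ≃ R :=
  Equiv.ofBijective (fun p => ⟨p.2.1, (h.1 _).2 ⟨p.1.1, p.1.2, p.2.2⟩⟩) (by
    constructor
    · rintro ⟨⟨j, hj⟩, ⟨i, hi⟩⟩ ⟨⟨j', hj'⟩, ⟨i', hi'⟩⟩ hii
      obtain rfl : i = i' := congrArg Subtype.val hii
      obtain rfl : j = j' := h.2 j hj j' hj' i hi hi'
      rfl
    · rintro ⟨i, hi⟩
      obtain ⟨j, hj, hi⟩ := (h.1 i).1 hi
      exact ⟨⟨⟨j, hj⟩, ⟨i, hi⟩⟩, rfl⟩)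

theorem equiv_symm (i : R) : (h.equiv.symm i).2.1 = i.1 :=
  congrArg Subtype.val (h.equiv.apply_symm_apply i)

theorem equiv_symm_eq (i : R) (j : S) (hi : i.1 ∈ K j.1) : h.equiv.symm i = ⟨j, ⟨i.1, hi⟩⟩ :=
  h.equiv.symm_apply_eq.2 (Subtype.ext rfl)

end IsPart

variable {D : DSet.{u}}

theorem res_edge_degen {A : Type} [Finite A] [Subsingleton A] [Nonempty A] (e : (cor A).Edge)
    (x : D.obj (op eta)) : res (edgeMap _ e) (res (degen A) x) = x := by
  rw [res_edge]
  exact res_id x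

/-- The operations whose inputs are labelled by a set `S` of variables. -/
abbrev El {I : Type} (c : I → Obj D) (S : Finset I) (X : Obj D) : Type u :=
  Cell (fun i : S => c i.1) X

section

variable {I J H : Type} {S : Finset J} {b : J → Obj D} {c : I → Obj D} {K : J → Finset I}
  {R : Finset I} {Y : Obj D}

/-- The composite is formed on a tree with two levels, but it is characterised by its value on any
tree in which the operations appear as restrictions of one element. This universal form is what
makes the laws of substitution computable. -/
theorem exists_bind (hD : Segal D) (g : El b S Y) (f : ∀ j, El c (K j) (b j)) (h : IsPart S K R) :
    ∃ w : El c R Y, ∀ (T : Tree) (z : D.obj (op T)) (γ : cor S ⟶ T) (φ : ∀ j : S, cor (K j.1) ⟶ T)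
      (τ : cor R ⟶ T), res γ z = g.1 → (∀ j : S, res (φ j) z = (f j.1).1) → ed τ rt = ed γ rt →
      (∀ j, ed (φ j) rt = ed γ (leaf j)) →
      (∀ (i : R) (j : S) (hi : i.1 ∈ K j.1), ed τ (leaf i) = ed (φ j) (leaf ⟨i.1, hi⟩)) →
      w.1 = res τ z := by
  obtain ⟨x, hx, hx'⟩ := hD.exists_tree2 (K := fun j : S => K j.1) g.1 (fun j => (f j.1).1)
    fun j => (f j.1).2.1.trans (g.2.2 j).symm
  refine ⟨⟨res (totMap h.equiv) x, ?_, fun i => ?_⟩, fun T z γ φ τ h1 h2 h3 h4 h5 => ?_⟩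
  · have := res_edge (lowMap (K := fun j : S => K j.1)) rt x
    rw [hx] at this
    rw [res_edge]
    exact this.symm.trans g.2.1
  · have := res_edge (upMap (K := fun j : S => K j.1) (h.equiv.symm i).1)
      (leaf (h.equiv.symm i).2) x
    rw [hx'] at this
    rw [res_edge]
    exact this.symm.trans (((f _).2.2 _).trans (congrArg c (h.equiv_symm i)))
  · obtain ⟨m, hm, hm'⟩ := exists_tree2_hom γ φ h4
    obtain rfl : res m z = x := hD.1.tree2_ext (by rw [res_res, hm, hx, h1]) fun j => by
      rw [res_res, hm', hx', h2]
    change res (totMap h.equiv) (res m z) = _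
    rw [res_res]
    congr 1
    refine cor_hom_ext (h3.trans (congrArg (fun k => ed k rt) hm).symm).symm fun i => ?_
    have hi : i.1 ∈ K (h.equiv.symm i).1.1 := h.equiv_symm i ▸ (h.equiv.symm i).2.2
    refine Eq.trans ?_ (h5 i (h.equiv.symm i).1 hi).symm
    rw [← hm' (h.equiv.symm i).1]
    change ed m (top2 (h.equiv.symm i)) = ed m (top2 _)
    rw [← h.equiv_symm_eq]

variable [hD : Fact (IsStrictlyFullyKan D)]

/-- Substitution. -/
noncomputable def bind (g : El b S Y) (f : ∀ j, El c (K j) (b j)) (h : IsPart S K R) : El c R Y :=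
  (exists_bind hD.out.segal g f h).choose

theorem bind_eq {g : El b S Y} {f : ∀ j, El c (K j) (b j)} {h : IsPart S K R} {T : Tree}
    (z : D.obj (op T)) (γ : cor S ⟶ T) (φ : ∀ j : S, cor (K j.1) ⟶ T)
    (τ : cor R ⟶ T) (h1 : res γ z = g.1) (h2 : ∀ j : S, res (φ j) z = (f j.1).1)
    (h3 : ed τ rt = ed γ rt) (h4 : ∀ j, ed (φ j) rt = ed γ (leaf j))
    (h5 : ∀ (i : R) (j : S) (hi : i.1 ∈ K j.1), ed τ (leaf i) = ed (φ j) (leaf ⟨i.1, hi⟩)) :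
    (bind g f h).1 = res τ z :=
  (exists_bind hD.out.segal g f h).choose_spec T z γ φ τ h1 h2 h3 h4 h5

/-- Substitution is associative. -/
theorem bind_bind {e : H → Obj D} {N : I → Finset H} {L : J → Finset H} {M : Finset H}
    (g : El b S Y) (f : ∀ j, El c (K j) (b j)) (k : ∀ i, El e (N i) (c i)) (h1 : IsPart S K R)
    (h2 : IsPart R N M) (h3 : ∀ j, IsPart (K j) N (L j)) (h4 : IsPart S L M) :
    bind (bind g f h1) k h2 = bind g (fun j => bind (f j) k (h3 j)) h4 := by
  -- `π` and `ρ` send a variable to the block that contains it, so that all operations live on one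
  -- element `z` of the tree with three levels. Both iterated substitutions are the restriction of
  -- `z` to the total operation.
  let π : R → S := fun r => (h1.equiv.symm r).1
  let ρ : M → R := fun m => (h2.equiv.symm m).1
  have hπ : ∀ (r : R) (j : S), r.1 ∈ K j.1 → π r = j := fun r j hr =>
    congrArg Sigma.fst (h1.equiv_symm_eq r j hr)
  have hπ' : ∀ r : R, r.1 ∈ K (π r).1 := fun r => h1.equiv_symm r ▸ (h1.equiv.symm r).2.2
  have hρ : ∀ (m : M) (r : R), m.1 ∈ N r.1 → ρ m = r := fun m r hr =>
    congrArg Sigma.fst (h2.equiv_symm_eq m r hr)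
  have hρ' : ∀ m : M, m.1 ∈ N (ρ m).1 := fun r => h2.equiv_symm r ▸ (h2.equiv.symm r).2.2
  let l : ∀ j : S, K j.1 → R := fun j i => ⟨i.1, (h1.1 _).2 ⟨j.1, j.2, i.2⟩⟩
  let l' : ∀ r : R, N r.1 → M := fun r i => ⟨i.1, (h2.1 _).2 ⟨r.1, r.2, i.2⟩⟩
  have hl : ∀ j, Function.Injective (l j) := fun j i i' hi =>
    Subtype.ext (congrArg (fun r : R => r.1) hi)
  have hm : ∀ j, Function.Injective (l' j) := fun j i i' hi =>
    Subtype.ext (congrArg (fun r : M => r.1) hi)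
  have hl' : ∀ j, Set.range (l j) = π ⁻¹' {j} := by
    intro j
    ext r
    exact ⟨fun ⟨i, hi⟩ => hi ▸ hπ _ _ i.2, fun hr => ⟨⟨r.1, by
      obtain rfl : π r = j := hr
      exact hπ' r⟩, rfl⟩⟩
  have hm' : ∀ r, Set.range (l' r) = ρ ⁻¹' {r} := by
    intro j
    ext r
    exact ⟨fun ⟨i, hi⟩ => hi ▸ hρ _ _ i.2, fun hr => ⟨⟨r.1, by
      obtain rfl : ρ r = j := hr
      exact hρ' r⟩, rfl⟩⟩
  obtain ⟨z, hz1, hz2, hz3⟩ := hD.out.segal.exists_tree3 (c := fun r : R => c r.1)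
    (e := fun m : M => e m.1) (b := fun j : S => b j.1) g hl hl' (fun j => f j.1) hm hm'
    fun r => k r.1
  have ho : ∀ j, (tree3 π ρ).IsOpSet (Set.range fun i => sec3 (l j i)) (mid3 j) := fun j => by
    have := opSet3_mid (π := π) (ρ := ρ) j
    rwa [← hl' j, ← Set.range_comp] at this
  have ho' : ∀ r, (tree3 π ρ).IsOpSet (Set.range fun i => top3 (l' r i)) (sec3 r) := fun r => by
    have := opSet3_sec (π := π) (ρ := ρ) r
    rwa [← hm' r, ← Set.range_comp] at this
  let l'' : ∀ j : S, L j.1 → M := fun j i => ⟨i.1, (h4.1 _).2 ⟨j.1, j.2, i.2⟩⟩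
  have ho'' : ∀ j, (tree3 π ρ).IsOpSet (Set.range fun i => top3 (l'' j i)) (mid3 j) := fun j => by
    have := opSet3_mid_sec (π := π) (ρ := ρ) j
    convert this using 1
    refine (Set.range_comp top3 (l'' j)).trans (congrArg (top3 '' ·) ?_)
    ext m
    constructor
    · rintro ⟨i, rfl⟩
      obtain ⟨r, hr, hi⟩ := ((h3 j.1).1 _).1 i.2
      refine (congrArg π (hρ (l'' j i) (l j ⟨r, hr⟩) hi)).trans (hπ _ _ hr)
    · intro hm
      refine ⟨⟨m.1, ((h3 j.1).1 _).2 ⟨(ρ m).1, ?_, hρ' m⟩⟩, rfl⟩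
      obtain rfl : π (ρ m) = j := hm
      exact hπ' _
  have hl'' : ∀ j, Function.Injective (l'' j) := fun j i i' hi =>
    Subtype.ext (congrArg (fun r : M => r.1) hi)
  let γ : cor S ⟶ tree3 π ρ := corHom mid3 root3 mid3_injective opSet3_low
  let φ : ∀ j : S, cor (K j.1) ⟶ tree3 π ρ := fun j =>
    corHom _ (mid3 j) (sec3_injective.comp (hl j)) (ho j)
  let ψ : ∀ r : R, cor (N r.1) ⟶ tree3 π ρ := fun r =>
    corHom _ (sec3 r) (top3_injective.comp (hm r)) (ho' r)
  let χ : ∀ j : S, cor (L j.1) ⟶ tree3 π ρ := fun j =>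
    corHom _ (mid3 j) (top3_injective.comp (hl'' j)) (ho'' j)
  let σ : cor R ⟶ tree3 π ρ := corHom sec3 root3 sec3_injective opSet3_low_mid
  let τ : cor M ⟶ tree3 π ρ := corHom top3 root3 top3_injective opSet3_total
  have hφ : ∀ j, res (φ j) z = (f j.1).1 := fun j => hz2 j _ rfl fun _ => rfl
  have hψ : ∀ r, res (ψ r) z = (k r.1).1 := fun r => hz3 r _ rfl fun _ => rfl
  refine Subtype.ext ?_
  refine (bind_eq z σ ψ τ ?_ hψ rfl (fun _ => rfl) fun _ _ _ => rfl).trans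
    (bind_eq z γ χ τ hz1 (fun j => ?_) rfl (fun _ => rfl) fun _ _ _ => rfl).symm
  · exact (bind_eq z γ φ σ hz1 hφ rfl (fun _ => rfl) fun _ _ _ => rfl).symm
  · exact (bind_eq z (φ j) (fun i => ψ (l j i)) (χ j) (hφ j) (fun i => hψ _) rfl (fun _ => rfl)
      fun _ _ _ => rfl).symm

/-- A variable as an operation. -/
def var {i : I} (hX : c i = Y) : El c {i} Y :=
  ⟨res (degen ({i} : Finset I)) Y, res_edge_degen _ Y, fun j =>
    (res_edge_degen _ Y).trans (hX.symm.trans (congrArg c (Finset.mem_singleton.1 j.2).symm))⟩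

theorem bind_var (j : J) (f : ∀ j, El c (K j) (b j)) (h : IsPart {j} K (K j)) :
    bind (var (c := b) rfl) f h = f j := by
  -- An element `j'` of `{j}` equals `j` only propositionally, so the comparison of the operations
  -- is made by a map of corollas.
  have key : ∀ j' : ({j} : Finset J), ∃ φ : cor (K j'.1) ⟶ cor (K j),
      res φ (f j).1 = (f j'.1).1 ∧ ed φ rt = rt ∧
        ∀ x hx hx', ed φ (leaf ⟨x, hx⟩) = leaf ⟨x, hx'⟩ := by
    rintro ⟨j', hj'⟩
    obtain rfl := Finset.mem_singleton.1 hj'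
    exact ⟨𝟙 _, res_id _, rfl, fun _ _ _ => rfl⟩
  choose φ h1 h2 h3 using key
  refine Subtype.ext ((bind_eq (f j).1 (degen _ ≫ edgeMap _ rt) φ (𝟙 _) ?_ h1 rfl h2
    fun i j' hi => (h3 j' _ _ _).symm).trans (res_id _))
  rw [← res_res, (f j).2.1]
  rfl

theorem bind_id (g : El b S Y) (h : IsPart S (fun j => {j}) S) :
    bind g (fun _ => var (c := b) rfl) h = g := by
  refine Subtype.ext ((bind_eq g.1 (𝟙 _) (fun j => degen _ ≫ edgeMap _ (leaf j)) (𝟙 _)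
    (res_id _) (fun j => ?_) rfl (fun _ => rfl) fun i j hi => ?_).trans (res_id _))
  · rw [← res_res, g.2.2]
    rfl
  · exact congrArg leaf (Subtype.ext (Finset.mem_singleton.1 hi))

/-- The unary operations. -/
abbrev Un (X Z : Obj D) : Type u := El (fun _ : Unit => X) {()} Z

variable {X Z W : Obj D}

theorem isPart_const (R : Finset I) : IsPart {()} (fun _ : Unit => R) R :=
  IsPart.single () fun _ => R

/-- Postcomposition with a unary operation. -/
noncomputable def ap (f : Un X Z) (x : El c R X) : El c R Z :=
  bind f (fun _ => x) (isPart_const R)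

theorem ap_bind (f : Un Y Z) (g : El b S Y) (k : ∀ j, El c (K j) (b j)) (h : IsPart S K R) :
    ap f (bind g k h) = bind (ap f g) k h :=
  (bind_bind f (fun _ => g) k _ h (fun _ => h) _).symm

theorem ap_var (x : El c R X) : ap (var rfl) x = x :=
  bind_var (b := fun _ : Unit => X) () (fun _ => x) _

theorem ap_id (f : Un X Z) : ap f (var rfl) = f := bind_id f _

theorem ap_ap (f : Un X Y) (g : Un Y Z) (x : El c R X) : ap g (ap f x) = ap (ap g f) x :=
  ap_bind g f _ _

/-- Existence and uniqueness of fillers for the outer horn of a tree with two vertices, whose lower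
vertex is unary. Every operation thus has the universal property of a tensor product of its inputs.
-/
theorem ap_existsUnique (x : El c R X) (t : El c R Z) : ∃! f : Un X Z, ap f x = t := by
  have h := isPart_const R
  have hf : ∀ (f : Un X Z) (z : D.obj (op (tree2 fun _ : ({()} : Finset Unit) => R))),
      res lowMap z = f.1 → res (upMap (K := fun _ : ({()} : Finset Unit) => R) default) z = x.1 →
      (ap f x).1 = res (totMap h.equiv) z := by
    intro f z h1 h2
    refine bind_eq z lowMap upMap _ h1 (fun j => ?_) rfl (fun _ => rfl) fun i j hi => ?_
    · rw [Unique.eq_default j]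
      exact h2
    · exact congrArg top2 (h.equiv_symm_eq i j hi)
  obtain ⟨z, h1, h2⟩ := hD.out.exists_div (J := ({()} : Finset Unit)) h.equiv (fun i => rfl) x.1 t.1
    fun i => (x.2.2 i).trans (t.2.2 i).symm
  have hlow : ∀ z : D.obj (op (tree2 fun _ : ({()} : Finset Unit) => R)),
      res (edgeMap _ rt) (res (lowMap (K := fun _ : ({()} : Finset Unit) => R)) z) =
      res (edgeMap _ rt) (res (totMap h.equiv) z) := fun z => by
    rw [res_edge, res_edge]
    rfl
  have hlow' : ∀ (z : D.obj (op (tree2 fun _ : ({()} : Finset Unit) => R))) j,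
      res (edgeMap _ (leaf j)) (res (lowMap (K := fun _ : ({()} : Finset Unit) => R)) z) =
      res (edgeMap _ rt) (res (upMap (K := fun _ : ({()} : Finset Unit) => R) default) z) :=
    fun z j => by
    rw [res_edge, res_edge, Unique.eq_default j]
    rfl
  refine ⟨⟨res lowMap z, ?_, fun j => ?_⟩, Subtype.ext ((hf _ z rfl h1).trans h2),
    fun f hf' => Subtype.ext ?_⟩
  · rw [hlow, h2, t.2.1]
  · rw [hlow', h1, x.2.1]
  · obtain ⟨z', h1', h2'⟩ := hD.out.segal.exists_tree2
      (K := fun _ : ({()} : Finset Unit) => R) f.1 (fun _ => x.1)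
      fun j => x.2.1.trans (f.2.2 j).symm
    have : z = z' := hD.out.div_unique h.equiv (h1.trans (h2' _).symm) (by
      rw [h2, ← hf f z' h1' (h2' _), hf'])
    exact h1'.symm.trans (congrArg (res lowMap) this.symm)

theorem ap_injective (x : El c R X) : Function.Injective fun f : Un X Z => ap f x :=
  fun f _ h => (ap_existsUnique x (ap f x)).unique rfl (Eq.symm h)

end

end Dendroidal

namespace Dendroidal

open Dendroidal.Tree

variable {D : DSet.{u}} [hD : Fact (IsStrictlyFullyKan D)]

/-! ### The groupoid of objects and unary operations -/

noncomputable instance : Category.{u} (Obj D) where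
  Hom := Un
  id _ := var rfl
  comp f g := ap g f
  id_comp {X Y} f := ap_id (X := X) (Z := Y) f
  comp_id f := ap_var f
  assoc f g h := ap_ap g h f

section

variable {I J : Type} {S : Finset J} {b : J → Obj D} {c : I → Obj D} {K : J → Finset I}
  {R : Finset I} {X Y Z : Obj D}

/-- Postcomposition of an operation with a morphism. -/
noncomputable def app (f : X ⟶ Z) (x : El c R X) : El c R Z :=
  ap (show Un X Z from f) x

theorem app_id (x : El c R X) : app (𝟙 X) x = x := ap_var x

theorem app_comp (f : X ⟶ Y) (g : Y ⟶ Z) (x : El c R X) : app (f ≫ g) x = app g (app f x) :=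
  (ap_ap (X := X) (Y := Y) (Z := Z) f g x).symm

theorem app_bind (f : Y ⟶ Z) (g : El b S Y) (k : ∀ j, El c (K j) (b j)) (h : IsPart S K R) :
    app f (bind g k h) = bind (app f g) k h :=
  ap_bind (Y := Y) (Z := Z) f g k h

/-- The tool for all coherence laws: morphisms with the same source and target are equal as soon as
they agree on one operation. -/
theorem app_ext (x : El c R X) {f g : X ⟶ Z} (h : app f x = app g x) : f = g := ap_injective x h

/-- The morphism that takes one operation to another one with the same inputs. -/
noncomputable def quo (x : El c R X) (t : El c R Z) : X ⟶ Z := (ap_existsUnique x t).choose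

theorem app_quo (x : El c R X) (t : El c R Z) : app (quo x t) x = t :=
  (ap_existsUnique x t).choose_spec.1

/-- The isomorphism that takes one operation to another one with the same inputs. -/
noncomputable def quoIso (x : El c R X) (t : El c R Z) : X ≅ Z where
  hom := quo x t
  inv := quo t x
  hom_inv_id := app_ext x (by rw [app_comp, app_quo, app_quo, app_id])
  inv_hom_id := app_ext t (by rw [app_comp, app_quo, app_quo, app_id])

end

/-- A morphism is the quotient of its value on a variable by that variable, and quotients are
invertible. -/
theorem isGroupoid_obj : IsGroupoid (Obj D) where
  all_isIso {X Y} f := by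
    have : f = (quoIso (c := fun _ : Unit => X) (R := {()}) (var rfl : El _ _ X)
      (app f (var rfl))).hom := by
      refine app_ext (var rfl : El (fun _ : Unit => X) {()} X) ?_
      exact (app_quo _ _).symm
    rw [this]
    infer_instance

/-! ### The tensor product -/

/-- The family with the members `x` and `y`. -/
def two {β : Bool → Sort*} (x : β false) (y : β true) : ∀ b, β b
  | false => x
  | true => y

/-- A filler of the horn of a binary corolla that misses the root. Any filler will do, by
`ap_existsUnique`. -/
theorem exists_tensor (X Y : Obj D) : ∃ Z : Obj D,
    Nonempty (El (two (β := fun _ => Obj D) X Y) Finset.univ Z) := by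
  obtain ⟨x, hx⟩ := hD.out.exists_corolla (A := (Finset.univ : Finset Bool)) rt
    (fun e _ => Option.elim e X fun i => two (β := fun _ => Obj D) X Y i.1)
  exact ⟨_, ⟨x, rfl, fun i => hx (leaf i) fun h => nomatch h⟩⟩

variable (D) in
theorem exists_unit : ∃ Z : Obj D, Nonempty (El (I := Empty) (D := D) Empty.elim ∅ Z) := by
  obtain ⟨x, hx⟩ := hD.out.exists_corolla (A := (∅ : Finset Empty)) rt
    (fun e h => match e, h with
      | none, h => (h rfl).elim
      | some i, _ => i.1.elim)
  exact ⟨_, ⟨x, rfl, fun i => i.1.elim⟩⟩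

section

variable {I J : Type} {A B S S' S'' R R' M : Finset J} {b : J → Obj D} {c : I → Obj D}
  {K : J → Finset I} {X Y Z : Obj D}

/-- The set `R` is the disjoint union of `S` and `S'`. -/
abbrev IsPair {I : Type} (S S' R : Finset I) : Prop :=
  IsPart Finset.univ (two (β := fun _ => Finset I) S S') R

/-- The tensor product of two operations. -/
noncomputable def ten₀ (x : El b S X) (y : El b S' Y) (h : IsPair S S' R) :
    El b R (exists_tensor X Y).choose :=
  bind (exists_tensor X Y).choose_spec.some
    (fun j => two (β := fun j => El b (two (β := fun _ => Finset J) S S' j)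
      (two (β := fun _ => Obj D) X Y j)) x y j) h

theorem IsPair.trans {A A' M : Finset I} (d : IsPair S S' R) (h : IsPart S K A) (h' : IsPart S' K A')
    (hA : IsPair A A' M) : IsPart R K M :=
  IsPart.trans d (fun j _ => by cases j; exacts [h, h']) hA

/-- Associativity of substitution, with the chosen binary operation as the outermost one. -/
theorem bind_ten₀ {A A' M : Finset I} (x : El b S X) (y : El b S' Y) (d : IsPair S S' R)
    (k : ∀ j, El c (K j) (b j)) (h : IsPart S K A) (h' : IsPart S' K A') (hA : IsPair A A' M)
    (hR : IsPart R K M) : bind (ten₀ x y d) k hR = ten₀ (bind x k h) (bind y k h') hA := by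
  refine (bind_bind (L := two (β := fun _ => Finset I) A A') _ _ _ d hR
    (fun j => by cases j; exacts [h, h']) hA).trans ?_
  unfold ten₀
  congr 1
  funext j
  cases j <;> rfl

theorem isPart_empty (K : J → Finset I) : IsPart ∅ K ∅ := ⟨by simp, by simp⟩

/-- The unit as an operation. -/
noncomputable def un₀ : El c ∅ (exists_unit D).choose :=
  bind (K := fun _ => ∅) (exists_unit D).choose_spec.some (fun j => j.elim) (isPart_empty _)

theorem bind_un₀ (k : ∀ j, El c (K j) (b j)) (h : IsPart ∅ K ∅) : bind un₀ k h = un₀ := by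
  refine (bind_bind (L := fun _ => ∅) _ _ _ _ h (fun j => j.elim) (isPart_empty _)).trans ?_
  unfold un₀
  congr 1
  funext j
  exact j.elim

end

/-- The family with the members `x`, `y` and `z`. -/
def three {β : Fin 3 → Sort*} (x : β 0) (y : β 1) (z : β 2) : ∀ b, β b
  | 0 => x
  | 1 => y
  | 2 => z

section

variable (X Y Z : Obj D)

/-- The operation `(X, Y, Z) ↦ (X ⊗ Y) ⊗ Z`. -/
noncomputable def tenL := ten₀ (b := three (β := fun _ => Obj D) X Y Z) (R := {0, 1, 2})
  (ten₀ (R := {0, 1}) (var (i := 0) (Y := X) rfl) (var (i := 1) (Y := Y) rfl) (by decide))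
  (var (i := 2) (Y := Z) rfl) (by decide)

/-- The operation `(X, Y, Z) ↦ X ⊗ (Y ⊗ Z)`. -/
noncomputable def tenR := ten₀ (b := three (β := fun _ => Obj D) X Y Z) (R := {0, 1, 2})
  (var (i := 0) (Y := X) rfl)
  (ten₀ (R := {1, 2}) (var (i := 1) (Y := Y) rfl) (var (i := 2) (Y := Z) rfl) (by decide))
  (by decide)

/-- The operation `(X, Y) ↦ X ⊗ Y`. -/
noncomputable def ten2 := ten₀ (b := two (β := fun _ => Obj D) X Y) (R := {false, true})
  (var (i := false) (Y := X) rfl) (var (i := true) (Y := Y) rfl) (by decide)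

/-- The operation `(X, Y) ↦ Y ⊗ X`. -/
noncomputable def ten2' := ten₀ (b := two (β := fun _ => Obj D) X Y) (R := {false, true})
  (var (i := true) (Y := Y) rfl) (var (i := false) (Y := X) rfl) (by decide)

/-- The operation `X ↦ 1 ⊗ X`. -/
noncomputable def unL := ten₀ (b := fun _ : Unit => X) (R := {()}) un₀ (var (i := ()) (Y := X) rfl)
  (by decide)

/-- The operation `X ↦ X ⊗ 1`. -/
noncomputable def unR := ten₀ (b := fun _ : Unit => X) (R := {()}) (var (i := ()) (Y := X) rfl) un₀
  (by decide)

variable {X Y} in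
/-- The tensor product of morphisms. -/
noncomputable def tenHom {X' Y' : Obj D} (f : X ⟶ X') (g : Y ⟶ Y') :=
  quo (ten2 X Y) (ten₀ (R := {false, true}) (app f (var (i := false) (Y := X) rfl))
    (app g (var (i := true) (Y := Y) rfl)) (by decide))

end

/-- Each structure morphism is the quotient of two operations in the same variables, such as `(X, Y,
Z) ↦ (X ⊗ Y) ⊗ Z` and `(X, Y, Z) ↦ X ⊗ (Y ⊗ Z)` for the associator. -/
noncomputable instance : MonoidalCategoryStruct (Obj D) where
  tensorObj X Y := (exists_tensor X Y).choose
  tensorUnit := (exists_unit D).choose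
  whiskerLeft X _ _ f := tenHom (𝟙 X) f
  whiskerRight f Y := tenHom f (𝟙 Y)
  tensorHom f g := tenHom f g
  associator X Y Z := quoIso (tenL X Y Z) (tenR X Y Z)
  leftUnitor X := quoIso (unL X) (var rfl)
  rightUnitor X := quoIso (unR X) (var rfl)

section

variable {I J : Type} {A B S S' S'' R R' M : Finset J} {b : J → Obj D} {c : I → Obj D}
  {K : J → Finset I} {X Y Z X' Y' : Obj D}

/-- The tensor product of two operations. -/
noncomputable def ten (x : El b S X) (y : El b S' Y) (h : IsPair S S' R) : El b R (X ⊗ Y) :=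
  ten₀ x y h

/-- The unit as an operation. -/
noncomputable def un : El c ∅ (𝟙_ (Obj D)) := un₀

theorem bind_ten {A A' M : Finset I} (x : El b S X) (y : El b S' Y) (d : IsPair S S' R)
    (k : ∀ j, El c (K j) (b j)) (h : IsPart S K A) (h' : IsPart S' K A') (hA : IsPair A A' M)
    (hR : IsPart R K M) : bind (ten x y d) k hR = ten (bind x k h) (bind y k h') hA :=
  bind_ten₀ x y d k h h' hA hR

theorem bind_un (k : ∀ j, El c (K j) (b j)) (h : IsPart ∅ K ∅) : bind un k h = un :=
  bind_un₀ k h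

theorem bind_ten_two {b : J → Obj D} {c : I → Obj D} {K : J → Finset I} {i j : J} {P : Finset J}
    {A : Finset I} (k : ∀ j, El c (K j) (b j)) (d : IsPair {i} {j} P) (hA : IsPair (K i) (K j) A)
    (h : IsPart P K A) :
    bind (ten (var (c := b) (i := i) rfl) (var (c := b) (i := j) rfl) d) k h = ten (k i) (k j) hA := by
  rw [bind_ten _ _ _ _ (IsPart.single _ _) (IsPart.single _ _) hA, bind_var, bind_var]

/-- For variables this is the definition of the tensor product of morphisms as a quotient;
substituting `x` and `y` for the variables gives the general case. The associator, the unitors and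
the symmetry are treated in the same way. -/
theorem app_ten (f : X ⟶ X') (g : Y ⟶ Y') (x : El b S X) (y : El b S' Y) (h : IsPair S S' R) :
    app (f ⊗ₘ g) (ten x y h) = ten (app f x) (app g y) h := by
  let K := two (β := fun _ => Finset J) S S'
  let k : ∀ j, El b (K j) (two (β := fun _ => Obj D) X Y j) := two x y
  have h' : IsPair (K false) (K true) R := h
  have hK : IsPart {false, true} K R :=
    IsPair.trans (by decide : IsPair {false} {true} _) (IsPart.single _ _) (IsPart.single _ _) h'
  have h1 : bind (ten2 X Y) k hK = ten x y h := bind_ten_two k _ h' hK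
  refine (congrArg (app (f ⊗ₘ g)) h1).symm.trans ((app_bind _ _ _ _).trans ?_)
  refine (congrArg (fun z => bind z k hK) (app_quo _ _)).trans ?_
  refine (bind_ten _ _ _ k (IsPart.single _ _) (IsPart.single _ _) h' hK).trans ?_
  refine congrArg₂ (fun u v => ten u v h) ?_ ?_
  · exact (app_bind _ _ _ _).symm.trans (congrArg (app f) (bind_var _ _ _))
  · exact (app_bind _ _ _ _).symm.trans (congrArg (app g) (bind_var _ _ _))

theorem app_assoc (x : El b S X) (y : El b S' Y) (z : El b S'' Z) (h1 : IsPair S S' A)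
    (h2 : IsPair A S'' R) (h3 : IsPair S' S'' B) (h4 : IsPair S B R) :
    app (α_ X Y Z).hom (ten (ten x y h1) z h2) = ten x (ten y z h3) h4 := by
  let K := three (β := fun _ => Finset J) S S' S''
  let k : ∀ j, El b (K j) (three (β := fun _ => Obj D) X Y Z j) := three x y z
  have h1' : IsPair (K 0) (K 1) A := h1
  have h2' : IsPair A (K 2) R := h2
  have h3' : IsPair (K 1) (K 2) B := h3
  have h4' : IsPair (K 0) B R := h4
  have hA : IsPart {0, 1} K A :=
    IsPair.trans (by decide : IsPair ({0} : Finset (Fin 3)) {1} _) (IsPart.single 0 K)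
      (IsPart.single 1 K) h1
  have hB : IsPart {1, 2} K B :=
    IsPair.trans (by decide : IsPair ({1} : Finset (Fin 3)) {2} _) (IsPart.single 1 K)
      (IsPart.single 2 K) h3
  have hK : IsPart {0, 1, 2} K R :=
    IsPair.trans (by decide : IsPair ({0, 1} : Finset (Fin 3)) {2} _) hA (IsPart.single 2 K) h2
  have hL : bind (tenL X Y Z) k hK = ten (ten x y h1) z h2 := by
    refine (bind_ten _ _ _ k hA (IsPart.single 2 K) h2' hK).trans ?_
    refine congrArg₂ (fun u v => ten u v h2) ?_ (bind_var _ _ _)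
    exact bind_ten_two k _ h1' hA
  have hR : bind (tenR X Y Z) k hK = ten x (ten y z h3) h4 := by
    refine (bind_ten _ _ _ k (IsPart.single 0 K) hB h4' hK).trans ?_
    refine congrArg₂ (fun u v => ten u v h4) (bind_var _ _ _) ?_
    exact bind_ten_two k _ h3' hB
  rw [← hL, app_bind, ← hR]
  exact congrArg (fun z => bind z k hK) (app_quo _ _)

theorem app_leftUnitor (x : El b S X) (h : IsPair ∅ S S) :
    app (λ_ X).hom (ten un x h) = x := by
  have hK := isPart_const S
  have hL : bind (unL X) (fun _ => x) hK = ten un x h := by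
    refine (bind_ten _ _ _ _ (isPart_empty _) (isPart_const S) h hK).trans ?_
    exact congrArg₂ (fun u v => ten u v h) (bind_un _ _)
      (bind_var (b := fun _ : Unit => X) () (fun _ => x) _)
  rw [← hL, app_bind]
  exact (congrArg (fun z => bind z (fun _ => x) hK) (app_quo _ _)).trans
    (bind_var (b := fun _ : Unit => X) () (fun _ => x) _)

theorem app_rightUnitor (x : El b S X) (h : IsPair S ∅ S) :
    app (ρ_ X).hom (ten x un h) = x := by
  have hK := isPart_const S
  have hL : bind (unR X) (fun _ => x) hK = ten x un h := by
    refine (bind_ten _ _ _ _ (isPart_const S) (isPart_empty _) h hK).trans ?_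
    exact congrArg₂ (fun u v => ten u v h)
      (bind_var (b := fun _ : Unit => X) () (fun _ => x) _) (bind_un _ _)
  rw [← hL, app_bind]
  exact (congrArg (fun z => bind z (fun _ => x) hK) (app_quo _ _)).trans
    (bind_var (b := fun _ : Unit => X) () (fun _ => x) _)

end

end Dendroidal

/-! ### Coherence of the tensor product, and tensor inverses -/

namespace Dendroidal

open Dendroidal.Tree

variable {D : DSet.{u}}

/-- Four objects, as variables. -/
theorem exists_vars (W X Y Z : Obj D) : ∃ c : Fin 4 → Obj D, Nonempty (El c {0} W) ∧
    Nonempty (El c {1} X) ∧ Nonempty (El c {2} Y) ∧ Nonempty (El c {3} Z) := by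
  refine ⟨![W, X, Y, Z], ⟨var rfl⟩, ⟨var rfl⟩, ⟨var rfl⟩, ⟨var rfl⟩⟩

variable [hD : Fact (IsStrictlyFullyKan D)]

section

variable {J : Type} {S S' R : Finset J} {b : J → Obj D} {X Y X' Y' : Obj D}

theorem app_whiskerLeft (f : Y ⟶ Y') (x : El b S X) (y : El b S' Y) (h : IsPair S S' R) :
    app (X ◁ f) (ten x y h) = ten x (app f y) h :=
  (app_ten (𝟙 X) f x y h).trans (by rw [app_id])

theorem app_whiskerRight (f : X ⟶ X') (x : El b S X) (y : El b S' Y) (h : IsPair S S' R) :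
    app (f ▷ Y) (ten x y h) = ten (app f x) y h :=
  (app_ten f (𝟙 Y) x y h).trans (by rw [app_id])

end

theorem pair01 : IsPair {0} {1} ({0, 1} : Finset (Fin 4)) := by decide
theorem pair12 : IsPair {1} {2} ({1, 2} : Finset (Fin 4)) := by decide
theorem pair23 : IsPair {2} {3} ({2, 3} : Finset (Fin 4)) := by decide
theorem pair01_2 : IsPair {0, 1} {2} ({0, 1, 2} : Finset (Fin 4)) := by decide
theorem pair0_12 : IsPair {0} {1, 2} ({0, 1, 2} : Finset (Fin 4)) := by decide

/-- Each axiom is checked on a tensor product of distinct variables, where the structure morphisms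
merely rebracket. The pentagon is the reason for having four variables. -/
noncomputable instance : MonoidalCategory (Obj D) :=
  MonoidalCategory.ofTensorHom
    (id_tensorHom_id := fun X Y => by
      obtain ⟨c, ⟨x⟩, ⟨y⟩, -⟩ := exists_vars X Y X X
      refine app_ext (ten x y pair01) ?_
      rw [app_ten, app_id, app_id, app_id])
    (id_tensorHom := fun _ _ _ _ => rfl)
    (tensorHom_id := fun _ _ => rfl)
    (tensorHom_comp_tensorHom := fun {X _ _ Y _ _} _ _ _ _ => by
      obtain ⟨c, ⟨x⟩, ⟨y⟩, -⟩ := exists_vars X Y X X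
      refine app_ext (ten x y pair01) ?_
      rw [app_comp, app_ten, app_ten, app_ten, app_comp, app_comp])
    (associator_naturality := fun {X Y Z _ _ _} _ _ _ => by
      obtain ⟨c, ⟨x⟩, ⟨y⟩, ⟨z⟩, -⟩ := exists_vars X Y Z X
      refine app_ext (ten (ten x y pair01) z pair01_2) ?_
      rw [app_comp, app_comp, app_ten, app_ten, app_assoc _ _ _ _ _ pair12 pair0_12,
        app_assoc _ _ _ _ _ pair12 pair0_12, app_ten, app_ten])
    (leftUnitor_naturality := fun {X _} _ => by
      obtain ⟨c, ⟨x⟩, -⟩ := exists_vars X X X X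
      refine app_ext (ten un x (by decide : IsPair ∅ {0} ({0} : Finset (Fin 4)))) ?_
      rw [app_comp, app_comp, app_ten, app_id, app_leftUnitor, app_leftUnitor])
    (rightUnitor_naturality := fun {X _} _ => by
      obtain ⟨c, ⟨x⟩, -⟩ := exists_vars X X X X
      refine app_ext (ten x un (by decide : IsPair {0} ∅ ({0} : Finset (Fin 4)))) ?_
      rw [app_comp, app_comp, app_ten, app_id, app_rightUnitor, app_rightUnitor])
    (pentagon := fun W X Y Z => by
      obtain ⟨c, ⟨w⟩, ⟨x⟩, ⟨y⟩, ⟨z⟩⟩ := exists_vars W X Y Z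
      have h1 : IsPair {0, 1, 2} {3} ({0, 1, 2, 3} : Finset (Fin 4)) := by decide
      have h2 : IsPair {1, 2} {3} ({1, 2, 3} : Finset (Fin 4)) := by decide
      have h3 : IsPair {1} {2, 3} ({1, 2, 3} : Finset (Fin 4)) := by decide
      have h4 : IsPair {0} {1, 2, 3} ({0, 1, 2, 3} : Finset (Fin 4)) := by decide
      have h5 : IsPair {0, 1} {2, 3} ({0, 1, 2, 3} : Finset (Fin 4)) := by decide
      refine app_ext (ten (ten (ten w x pair01) y pair01_2) z h1) ?_
      rw [app_comp, app_comp, app_comp, app_ten, app_id, app_assoc _ _ _ _ _ pair12 pair0_12,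
        app_assoc _ _ _ _ _ h2 h4, app_ten, app_id, app_assoc _ _ _ _ _ pair23 h3,
        app_assoc _ _ _ _ _ pair23 h5, app_assoc _ _ _ _ _ h3 h4])
    (triangle := fun X Y => by
      obtain ⟨c, ⟨x⟩, ⟨y⟩, -⟩ := exists_vars X Y X X
      have h1 : IsPair {0} ∅ ({0} : Finset (Fin 4)) := by decide
      have h2 : IsPair ∅ {1} ({1} : Finset (Fin 4)) := by decide
      refine app_ext (ten (ten x un h1) y pair01) ?_
      rw [app_comp, app_assoc _ _ _ _ _ h2 pair01, app_ten, app_ten, app_id, app_id,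
        app_leftUnitor, app_rightUnitor])

/-- The symmetry of the tensor product. -/
noncomputable def braid (X Y : Obj D) : X ⊗ Y ≅ Y ⊗ X := quoIso (ten2 X Y) (ten2' X Y)

section

variable {J : Type} {S S' S'' A B R : Finset J} {b : J → Obj D} {X Y Z : Obj D}

theorem IsPair.symm (h : IsPair S S' R) : IsPair S' S R := by
  refine ⟨fun i => (h.1 i).trans ?_, fun j _ j' _ i hi hi' => ?_⟩
  · simp [or_comm, two]
  · have := h.2 (!j) (Finset.mem_univ _) (!j') (Finset.mem_univ _) i
      (by cases j <;> exact hi) (by cases j' <;> exact hi')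
    simpa using this

theorem app_braid (x : El b S X) (y : El b S' Y) (h : IsPair S S' R) (h' : IsPair S' S R) :
    app (braid X Y).hom (ten x y h) = ten y x h' := by
  let K := two (β := fun _ => Finset J) S S'
  let k : ∀ j, El b (K j) (two (β := fun _ => Obj D) X Y j) := two x y
  have h1 : IsPair (K false) (K true) R := h
  have h1' : IsPair (K true) (K false) R := h'
  have hK : IsPart {false, true} K R :=
    IsPair.trans (by decide : IsPair {false} {true} _) (IsPart.single _ _) (IsPart.single _ _) h1
  have h2 : bind (ten2 X Y) k hK = ten x y h := bind_ten_two k _ h1 hK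
  refine (congrArg (app (braid X Y).hom) h2).symm.trans ((app_bind _ _ _ _).trans ?_)
  refine (congrArg (fun z => bind z k hK) (app_quo _ _)).trans ?_
  exact bind_ten_two k _ h1' hK

theorem app_assoc_inv (x : El b S X) (y : El b S' Y) (z : El b S'' Z) (h1 : IsPair S S' A)
    (h2 : IsPair A S'' R) (h3 : IsPair S' S'' B) (h4 : IsPair S B R) :
    app (α_ X Y Z).inv (ten x (ten y z h3) h4) = ten (ten x y h1) z h2 := by
  rw [← app_assoc x y z h1 h2 h3 h4, ← app_comp, Iso.hom_inv_id, app_id]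

end

noncomputable instance : SymmetricCategory (Obj D) where
  braiding := braid
  braiding_naturality_right X Y _ _ := by
    obtain ⟨c, ⟨x⟩, ⟨y⟩, -⟩ := exists_vars X Y X X
    refine app_ext (ten x y pair01) ?_
    rw [app_comp, app_comp, app_whiskerLeft, app_braid _ _ _ pair01.symm,
      app_braid _ _ _ pair01.symm, app_whiskerRight]
  braiding_naturality_left {X _} _ Y := by
    obtain ⟨c, ⟨x⟩, ⟨y⟩, -⟩ := exists_vars X Y X X
    refine app_ext (ten x y pair01) ?_
    rw [app_comp, app_comp, app_whiskerRight, app_braid _ _ _ pair01.symm,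
      app_braid _ _ _ pair01.symm, app_whiskerLeft]
  hexagon_forward X Y Z := by
    obtain ⟨c, ⟨x⟩, ⟨y⟩, ⟨z⟩, -⟩ := exists_vars X Y Z X
    have h1 : IsPair {2} {0} ({0, 2} : Finset (Fin 4)) := by decide
    have h2 : IsPair {1} {0, 2} ({0, 1, 2} : Finset (Fin 4)) := by decide
    have h3 : IsPair {0, 1} {2} ({0, 1, 2} : Finset (Fin 4)) := by decide
    refine app_ext (ten (ten x y pair01) z pair01_2) ?_
    rw [app_comp, app_comp, app_comp, app_comp, app_assoc _ _ _ _ _ pair12 pair0_12,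
      app_braid _ _ _ pair0_12.symm, app_assoc _ _ _ _ _ h1 h2, app_whiskerRight,
      app_braid _ _ _ pair01.symm, app_assoc _ _ _ _ _ h1.symm h2, app_whiskerLeft,
      app_braid _ _ _ h1]
  hexagon_reverse X Y Z := by
    obtain ⟨c, ⟨x⟩, ⟨y⟩, ⟨z⟩, -⟩ := exists_vars X Y Z X
    have h1 : IsPair {2} {0} ({0, 2} : Finset (Fin 4)) := by decide
    have h2 : IsPair {0, 2} {1} ({0, 1, 2} : Finset (Fin 4)) := by decide
    refine app_ext (ten x (ten y z pair12) pair0_12) ?_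
    rw [app_comp, app_comp, app_comp, app_comp, app_assoc_inv _ _ _ pair01 pair01_2,
      app_braid _ _ _ pair01_2.symm, app_assoc_inv _ _ _ h1 h2, app_whiskerLeft,
      app_braid _ _ _ pair12.symm, app_assoc_inv _ _ _ h1.symm h2, app_whiskerRight,
      app_braid _ _ _ h1]
  symmetry X Y := by
    obtain ⟨c, ⟨x⟩, ⟨y⟩, -⟩ := exists_vars X Y X X
    refine app_ext (ten x y pair01) ?_
    change app ((braid X Y).hom ≫ (braid Y X).hom) _ = _
    rw [app_comp, app_braid _ _ _ pair01.symm, app_braid _ _ _ pair01, app_id]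

theorem app_braiding {J : Type} {S S' R : Finset J} {b : J → Obj D} {X Y : Obj D} (x : El b S X)
    (y : El b S' Y) (h : IsPair S S' R) (h' : IsPair S' S R) :
    app (β_ X Y).hom (ten x y h) = ten y x h' := app_braid x y h h'

/-- Every object has a tensor inverse. -/
theorem exists_inverse (X : Obj D) : ∃ Y : Obj D, Nonempty (X ⊗ Y ≅ 𝟙_ (Obj D)) := by
  -- The horn of a binary corolla that misses its second leaf, with `X` on the first leaf and the
  -- unit on the root. The filler is an operation from `X` and the new object to the unit, and its
  -- quotient by the tensor product is the required isomorphism.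
  obtain ⟨x, hx⟩ := hD.out.exists_corolla (A := (Finset.univ : Finset Bool))
    (leaf ⟨true, Finset.mem_univ _⟩) (fun e _ => Option.elim e (𝟙_ (Obj D)) fun _ => X)
  let Y : Obj D := res (edgeMap _ (leaf ⟨true, Finset.mem_univ _⟩)) x
  have hy : Nonempty (El (two (β := fun _ => Obj D) X Y) Finset.univ (𝟙_ (Obj D))) := by
    refine ⟨⟨x, ⟨hx rt (fun h => nomatch h), ?_⟩⟩⟩
    rintro ⟨_ | _, _⟩
    · exact hx (leaf ⟨false, _⟩) fun h => nomatch h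
    · rfl
  obtain ⟨t⟩ := hy
  exact ⟨Y, ⟨quoIso (ten (var (c := two (β := fun _ => Obj D) X Y) (i := false) (Y := X) rfl)
    (var (i := true) (Y := Y) rfl) (by decide)) t⟩⟩

theorem isPicard_obj : SymMonCat.IsPicard ⟨Obj D⟩ := ⟨isGroupoid_obj, exists_inverse⟩

end Dendroidal

namespace Dendroidal

open Dendroidal.Tree

/-! ### Iterated tensor products of variables -/

theorem isPair_iff {I : Type} {S S' R : Finset I} :
    IsPair S S' R ↔ (∀ i, i ∈ R ↔ i ∈ S ∨ i ∈ S') ∧ ∀ i ∈ S, i ∉ S' := by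
  constructor
  · refine fun h => ⟨fun i => (h.1 i).trans (by simp [two]), fun i hi hi' => ?_⟩
    have := h.2 false (Finset.mem_univ _) true (Finset.mem_univ _) i hi hi'
    exact nomatch this
  · refine fun h => ⟨fun i => (h.1 i).trans (by simp [two]), fun j _ j' _ i hi hi' => ?_⟩
    cases j <;> cases j'
    · rfl
    · exact (h.2 i hi hi').elim
    · exact (h.2 i hi' hi).elim
    · rfl

/-- The set `R` consists of the members of the list `L`, which has no repetitions. -/
def OfList {I : Type} (L : List I) (R : Finset I) : Prop := L.Nodup ∧ ∀ i, i ∈ R ↔ i ∈ L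

namespace OfList

variable {I : Type} {L L' : List I} {R S : Finset I} {i : I}

theorem unique (h : OfList L R) (h' : OfList L S) : R = S :=
  Finset.ext fun i => (h.2 i).trans (h'.2 i).symm

theorem toFinset [DecidableEq I] (h : L.Nodup) : OfList L L.toFinset := ⟨h, fun i => by simp⟩

theorem perm (h : OfList L R) (hL : L.Perm L') : OfList L' R :=
  ⟨hL.nodup_iff.1 h.1, fun i => (h.2 i).trans hL.mem_iff⟩

theorem cons_pair (h : OfList (i :: L) R) (h' : OfList L S) : IsPair {i} S R := by
  refine isPair_iff.2 ⟨fun j => ?_, fun j hj => ?_⟩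
  · rw [h.2, h'.2, List.mem_cons, Finset.mem_singleton]
  · rw [Finset.mem_singleton.1 hj, h'.2]
    exact (List.nodup_cons.1 h.1).1

theorem append_pair {S' : Finset I} (h : OfList (L ++ L') R) (hS : OfList L S)
    (hS' : OfList L' S') : IsPair S S' R := by
  refine isPair_iff.2 ⟨fun j => ?_, fun j hj hj' => ?_⟩
  · rw [h.2, hS.2, hS'.2, List.mem_append]
  · exact (List.nodup_append.1 h.1).2.2 j ((hS.2 j).1 hj) j ((hS'.2 j).1 hj') rfl

theorem finRange (n : ℕ) : OfList (List.finRange n) Finset.univ :=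
  ⟨List.nodup_finRange n, fun i => by simp⟩

theorem eq_empty (h : OfList [] R) : R = ∅ := h.unique ⟨List.nodup_nil, by simp⟩

end OfList

variable {D : DSet.{u}} [hD : Fact (IsStrictlyFullyKan D)]

section

variable {I J : Type} [DecidableEq I] [DecidableEq J] {c : I → Obj D}

/-- The tensor product of a list of variables. -/
noncomputable def tl (c : I → Obj D) :
    (L : List I) → (R : Finset I) → OfList L R → El c R (tens c L)
  | [], _, h => h.eq_empty ▸ un
  | _ :: L, _, h => ten (var rfl) (tl c L L.toFinset (OfList.toFinset h.1.of_cons))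
      (h.cons_pair (OfList.toFinset h.1.of_cons))

theorem tl_nil (h : OfList ([] : List I) ∅) : tl c [] ∅ h = un := rfl

theorem tl_cons {i : I} {L : List I} {R S : Finset I} (h : OfList (i :: L) R) (hS : OfList L S)
    (hp : IsPair {i} S R) : tl c (i :: L) R h = ten (var rfl) (tl c L S hS) hp := by
  obtain rfl := hS.unique (OfList.toFinset hS.1)
  rfl

/-- An operation in a set of variables carries no order, so the tensor product of the variables in
one order is carried to that in another order by the canonical morphism. The swap of two adjacent
factors is the only case with content. -/
theorem app_can {L L' : List I} {s : tens c L ⟶ tens c L'} (hs : Can c s) :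
    ∀ (R : Finset I) (h : OfList L R) (h' : OfList L' R), app s (tl c L R h) = tl c L' R h' := by
  induction hs with
  | id L => exact fun R h _ => app_id _
  | @cons i L L' f hf ih =>
    intro R h h'
    have hS := OfList.toFinset h.1.of_cons
    have hS' := hS.perm hf.perm
    rw [tl_cons h hS (h.cons_pair hS), tl_cons h' hS' (h'.cons_pair hS'), app_whiskerLeft, ih _ hS hS']
  | swap i j L =>
    intro R h h'
    have hL := OfList.toFinset h.1.of_cons.of_cons
    have h1 := OfList.toFinset h.1.of_cons
    have h2 := OfList.toFinset h'.1.of_cons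
    have hij : i ≠ j := fun hij => (List.nodup_cons.1 h.1).1 (by simp [hij])
    have h3 : OfList [i, j] {i, j} := ⟨by simp [hij], by simp⟩
    have h4 : OfList [j] {j} := ⟨by simp, by simp⟩
    have h5 : IsPair {i} {j} {i, j} := h3.cons_pair h4
    have h6 : IsPair {i, j} L.toFinset R := OfList.append_pair (L := [i, j]) h h3 hL
    rw [tl_cons h h1 (h.cons_pair h1), tl_cons h1 hL (h1.cons_pair hL),
      tl_cons h' h2 (h'.cons_pair h2), tl_cons h2 hL (h2.cons_pair hL), swap, app_comp, app_comp,
      app_assoc_inv _ _ _ h5 h6, app_whiskerRight, app_braiding _ _ h5 h5.symm, app_assoc]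
  | @comp L L' L'' f g hf hg ih ih' =>
    intro R h h'
    rw [app_comp, ih R h (h.perm hf.perm), ih']

theorem app_split (A L : List I) {R S S' : Finset I} (h : OfList (A ++ L) R) (hS : OfList A S)
    (hS' : OfList L S') (hp : IsPair S S' R) :
    app (split c A L) (tl c (A ++ L) R h) = ten (tl c A S hS) (tl c L S' hS') hp := by
  induction A generalizing R S with
  | nil =>
    obtain rfl := hS.eq_empty
    obtain rfl : R = S' := h.unique hS'
    refine (congrArg (app (λ_ (tens c L)).inv) (app_leftUnitor (tl c L R hS') hp).symm).trans ?_
    rw [← app_comp, Iso.hom_inv_id, app_id, tl_nil]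
  | cons i A ih =>
    have h1 : OfList (A ++ L) _ := OfList.toFinset h.1.of_cons
    have h2 := OfList.toFinset hS.1.of_cons
    have h3 := h1.append_pair h2 hS'
    have h' : OfList (i :: (A ++ L)) R := h
    refine (congrArg (app (split c (i :: A) L)) (tl_cons h' h1 (h'.cons_pair h1))).trans ?_
    rw [tl_cons hS h2 (hS.cons_pair h2), split, app_comp, app_whiskerLeft, ih h1 h2 h3,
      app_assoc_inv]

/-- The block-wise tensor product of morphisms becomes substitution: the variables of `tl b L` are
replaced by the values of the morphisms `φ j`. -/
theorem app_blockMap {r : I → Obj D} {b : J → Obj D} {K : J → List I}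
    (φ : ∀ j, tens r (K j) ⟶ b j) {N : J → Finset I} (hN : ∀ j, OfList (K j) (N j)) (L : List J)
    {R : Finset I} {S : Finset J} (hR : OfList (L.flatMap K) R) (hS : OfList L S)
    (hp : IsPart S N R) : app (blockMap φ L) (tl r (L.flatMap K) R hR) =
      bind (tl b L S hS) (fun j => app (φ j) (tl r (K j) (N j) (hN j))) hp := by
  induction L generalizing R S with
  | nil =>
    obtain rfl := hS.eq_empty
    obtain rfl := hR.eq_empty
    rw [tl_nil (c := b), bind_un]
    exact app_id _
  | cons j L ih =>
    have h1 := OfList.toFinset hS.1.of_cons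
    have hR' : OfList (K j ++ L.flatMap K) R := hR
    have h2 := OfList.toFinset (List.nodup_append.1 hR'.1).2.1
    have h3 := hR'.append_pair (hN j) h2
    have h4 : IsPart L.toFinset N (L.flatMap K).toFinset := by
      refine ⟨fun i => ?_, fun j₁ hj₁ j₂ hj₂ => hp.2 j₁ ?_ j₂ ?_⟩
      · rw [h2.2, List.mem_flatMap]
        exact exists_congr fun j' => by rw [h1.2, (hN j').2]
      · exact (hS.2 _).2 (List.mem_cons_of_mem _ ((h1.2 _).1 hj₁))
      · exact (hS.2 _).2 (List.mem_cons_of_mem _ ((h1.2 _).1 hj₂))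
    rw [tl_cons hS h1 (hS.cons_pair h1), bind_ten _ _ _ _ (IsPart.single j N) h4 h3, bind_var,
      ← ih h2 h1 h4, ← app_ten, ← app_split _ _ hR', ← app_comp]
    rfl

theorem app_relabel {r : I → Obj D} {a : J → Obj D} (k : J → I) (hk : ∀ j, r (k j) = a j)
    (L : List J) {R : Finset I} {S : Finset J} (hR : OfList (L.map k) R) (hS : OfList L S)
    (hp : IsPart S (fun j => {k j}) R) : app (relabel k hk L) (tl r (L.map k) R hR) =
      bind (tl a L S hS) (fun j => var (c := r) (hk j)) hp := by
  obtain rfl : a = fun j => r (k j) := (funext hk).symm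
  induction L generalizing R S with
  | nil =>
    obtain rfl := hS.eq_empty
    obtain rfl := hR.eq_empty
    rw [tl_nil (c := fun j => r (k j)), bind_un]
    exact app_id _
  | cons j L ih =>
    have h1 := OfList.toFinset hS.1.of_cons
    have hR' : OfList (k j :: L.map k) R := hR
    have h2 := OfList.toFinset hR'.1.of_cons
    have h4 : IsPart L.toFinset (fun j => {k j}) (L.map k).toFinset := by
      refine ⟨fun i => ?_, fun j₁ hj₁ j₂ hj₂ => hp.2 j₁ ?_ j₂ ?_⟩
      · rw [h2.2, List.mem_map]
        exact exists_congr fun j' => by rw [h1.2, Finset.mem_singleton, eq_comm]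
      · exact (hS.2 _).2 (List.mem_cons_of_mem _ ((h1.2 _).1 hj₁))
      · exact (hS.2 _).2 (List.mem_cons_of_mem _ ((h1.2 _).1 hj₂))
    rw [tl_cons hS h1 (hS.cons_pair h1), bind_ten _ _ _ _ (IsPart.single j _) h4
      (hR'.cons_pair h2), bind_var j (fun j => var (c := r) (hk j)), ← ih h2 h1 h4]
    refine (congrArg (app (relabel k hk (j :: L))) (tl_cons hR' h2 (hR'.cons_pair h2))).trans ?_
    refine (app_ten _ _ _ _ _).trans ?_
    rw [eqToHom_refl, app_id]

end

/-! ### Operations of the operad as operations of the dendroidal set -/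

section

variable {n m : ℕ} {c : Fin n → Obj D} {d : Obj D}

/-- The operation of a dendroidal set given by a morphism from a tensor product. -/
noncomputable def opEl (p : tens c (List.finRange n) ⟶ d) : El c Finset.univ d :=
  app p (tl c (List.finRange n) Finset.univ (OfList.finRange n))

/-- Together with surjectivity this is unique division by the tensor product of the variables; it
identifies the operations of the operad of `Obj D` with those of `D`. -/
theorem opEl_injective : Function.Injective (opEl (c := c) (d := d)) := fun _ _ h => app_ext _ h

theorem opEl_surjective : Function.Surjective (opEl (c := c) (d := d)) := fun x =>
  ⟨quo (tl c (List.finRange n) Finset.univ (OfList.finRange n)) x, app_quo _ _⟩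

/-- Composition in the operad of `Obj D` consists of a reordering, relabellings and a block map. The
reordering does nothing to operations in sets of variables, and the other two are substitutions. -/
theorem opEl_opComp {k : Fin n → ℕ} (e : (Σ j, Fin (k j)) ≃ Fin m)
    {b : Fin n → Obj D} {a : (j : Fin n) → Fin (k j) → Obj D} {r : Fin m → Obj D}
    (hr : ∀ j i, r (e ⟨j, i⟩) = a j i) (g : tens b (List.finRange n) ⟶ d)
    (f : (j : Fin n) → (tens (a j) (List.finRange (k j)) ⟶ b j)) {N : Fin n → Finset (Fin m)}
    (hN : ∀ j, IsPart Finset.univ (fun i => {e ⟨j, i⟩}) (N j)) (hp : IsPart Finset.univ N Finset.univ) :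
    opEl (opComp e hr g f) =
      bind (opEl g) (fun j => bind (opEl (f j)) (fun i => var (hr j i)) (hN j)) hp := by
  have hN' : ∀ j, OfList ((List.finRange (k j)).map fun i => e ⟨j, i⟩) (N j) := fun j => by
    refine ⟨(List.nodup_finRange _).map (e.injective.comp sigma_mk_injective), fun i => ?_⟩
    rw [(hN j).1]
    simp [eq_comm]
  obtain ⟨s, hs, hs'⟩ := opComp_rel e hr g f
  have hR := (OfList.finRange m).perm hs.perm
  rw [opEl, hs', app_comp, app_can hs _ _ hR, app_comp, app_blockMap _ hN' _ hR (OfList.finRange n) hp,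
    app_bind]
  congr 1
  funext j
  rw [app_comp, app_relabel _ _ _ (hN' j) (OfList.finRange _) (hN j), app_bind]
  rfl

/-- The identity of the operad is a right unitor, because the bracketing ends with the unit; on
operations it must become the degenerate one. The condition on all maps to `eta` avoids fixing a
particular degeneracy. -/
theorem app_rightUnitor_tl {X : Obj D} {R : Finset (Fin 1)} (hR : R = {0}) (h : OfList [0] R)
    (w : El (fun _ : Fin 1 => X) R X) (hw : ∀ k : cor R ⟶ eta, res k X = w.1) :
    app (ρ_ X).hom (tl (fun _ => X) [0] R h) = w := by
  subst hR
  have h0 : OfList ([] : List (Fin 1)) ∅ := ⟨List.nodup_nil, by simp⟩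
  rw [tl_cons h h0 (h.cons_pair h0), tl_nil]
  exact (app_rightUnitor _ _).trans (Subtype.ext (hw _))

end

end Dendroidal

namespace Dendroidal

open Dendroidal.Tree

/-! ### A strictly fully Kan dendroidal set as a nerve -/

section

variable {T : Tree} {n : ℕ} {a : Fin n → T.Edge} {d : T.Edge}

/-- An operation of a tree as a map from a corolla. -/
def opHom (o : T.IsOp a d) : cor (Finset.univ : Finset (Fin n)) ⟶ T :=
  corHom (fun i => a i.1) d (o.isOpSet.1.comp Subtype.val_injective) (by
    convert o.isOpSet.2 using 1
    exact (Function.Surjective.range_comp (fun i => ⟨⟨i, Finset.mem_univ i⟩, rfl⟩) a))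

end

variable {D : DSet.{u}} [hD : Fact (IsStrictlyFullyKan D)]

section

variable {T : Tree}

/-- The value of an element of a dendroidal set on an edge. -/
def edgeObj (x : D.obj (op T)) (e : T.Edge) : Obj D := res (edgeMap T e) x

/-- The value of an element of a dendroidal set on an operation. -/
def value (x : D.obj (op T)) {n : ℕ} {a : Fin n → T.Edge} {d : T.Edge} (o : T.IsOp a d) :
    El (fun i => edgeObj x (a i)) Finset.univ (edgeObj x d) :=
  ⟨res (opHom o) x, res_edge _ _ _, fun _ => res_edge _ _ _⟩

theorem value_id (x : D.obj (op T)) (e : T.Edge) :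
    value x (IsOp.id e) = opEl (c := fun _ : Fin 1 => edgeObj x e) (ρ_ (edgeObj x e)).hom := by
  refine (app_rightUnitor_tl rfl _ (value x (IsOp.id e)) fun k => ?_).symm
  exact (res_res _ _ _).trans (congrArg (fun k => res k x) (hom_ext (cor_cases rfl fun _ => rfl)))

theorem value_comp (x : D.obj (op T)) {n m : ℕ} {k : Fin n → ℕ} (e : (Σ j, Fin (k j)) ≃ Fin m)
    {b : Fin n → T.Edge} {a : (j : Fin n) → Fin (k j) → T.Edge} {r : Fin m → T.Edge} {d : T.Edge}
    (hr : ∀ j i, r (e ⟨j, i⟩) = a j i) (g : T.IsOp b d) (f : ∀ j, T.IsOp (a j) (b j))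
    {G : tens (fun j => edgeObj x (b j)) (List.finRange n) ⟶ edgeObj x d} (hG : opEl G = value x g)
    {F : ∀ j, tens (fun i => edgeObj x (a j i)) (List.finRange (k j)) ⟶
      edgeObj x (b j)} (hF : ∀ j, opEl (F j) = value x (f j)) :
    value x (IsOp.comp e hr g f) = opEl (opComp e
      (r := fun i => edgeObj x (r i))
      (fun j i => congrArg (edgeObj x) (hr j i)) G F) := by
  -- `N j` is the set of positions that the inputs of the operation number `j` take in the
  -- composite.
  let N : Fin n → Finset (Fin m) := fun j => Finset.univ.image fun i => e ⟨j, i⟩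
  have hNmem : ∀ j i, i ∈ N j ↔ (e.symm i).1 = j := by
    intro j i
    simp only [N, Finset.mem_image, Finset.mem_univ, true_and]
    constructor
    · rintro ⟨i, rfl⟩
      rw [Equiv.symm_apply_apply]
    · rintro rfl
      exact ⟨_, e.apply_symm_apply i⟩
  have hN : ∀ j, IsPart Finset.univ (fun i => {e ⟨j, i⟩}) (N j) := by
    refine fun j => ⟨fun i => ?_, fun i _ i' _ p hp hp' => ?_⟩
    · simp [N, eq_comm]
    · have := e.injective ((Finset.mem_singleton.1 hp).symm.trans (Finset.mem_singleton.1 hp'))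
      exact eq_of_heq (Sigma.mk.inj this).2
  have hp : IsPart Finset.univ N Finset.univ := by
    refine ⟨fun i => by simp [hNmem], fun j _ j' _ i hi hi' => ?_⟩
    rw [← (hNmem j i).1 hi, (hNmem j' i).1 hi']
  have hrinj := (IsOp.comp e hr g f).isOpSet.1
  have ho : ∀ j, T.IsOpSet (Set.range fun i : N j => r i.1) (b j) := by
    intro j
    convert (f j).isOpSet.2 using 1
    ext y
    constructor
    · rintro ⟨⟨i, hi⟩, rfl⟩
      obtain ⟨i, -, rfl⟩ := Finset.mem_image.1 hi
      exact ⟨i, (hr j i).symm⟩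
    · rintro ⟨i, rfl⟩
      exact ⟨⟨e ⟨j, i⟩, Finset.mem_image.2 ⟨i, Finset.mem_univ _, rfl⟩⟩, hr j i⟩
  let φ : ∀ j, cor (N j) ⟶ T := fun j =>
    corHom (fun i : N j => r i.1) (b j) (hrinj.comp Subtype.val_injective) (ho j)
  rw [opEl_opComp e _ G F hN hp]
  -- All operations involved are restrictions of `x`, so the substitutions are evaluated on `T`
  -- itself. The inner substitution, by degenerate operations, only renames the inputs of `f j` into
  -- positions in `N j`.
  refine Subtype.ext (Eq.symm (bind_eq x (opHom g) (fun j => φ j.1) (opHom (IsOp.comp e hr g f))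
    (congrArg Subtype.val hG).symm (fun j => ?_) rfl (fun _ => rfl) fun _ _ _ => rfl))
  refine (bind_eq x (opHom (f j.1)) (fun i => degen _ ≫ edgeMap T (a j.1 i.1)) (φ j.1)
    (congrArg Subtype.val (hF j.1)).symm (fun i => ?_) rfl (fun _ => rfl) fun i i' hi => ?_).symm
  · exact (res_res _ _ _).symm
  · refine Eq.trans ?_ (hr j.1 i'.1)
    exact congrArg r (Finset.mem_singleton.1 hi)

/-- The map of operads given by an element of a dendroidal set. -/
noncomputable def toHom (x : D.obj (op T)) : Operad.Hom T.operad (symOperad (Obj D)) where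
  col := edgeObj x
  map o := (opEl_surjective (value x o.down)).choose
  map_id e := opEl_injective ((opEl_surjective _).choose_spec.trans (value_id x e))
  map_comp e _ _ _ _ hr g f := opEl_injective ((opEl_surjective _).choose_spec.trans
    (value_comp x e hr g.down (fun j => (f j).down) (opEl_surjective _).choose_spec
      fun _ => (opEl_surjective _).choose_spec))

theorem opEl_toHom (x : D.obj (op T)) {n : ℕ} {a : Fin n → T.Edge} {d : T.Edge} (o : T.IsOp a d) :
    opEl ((toHom x).map (d := d) ⟨o⟩) = value x o := (opEl_surjective (value x o)).choose_spec

theorem hom_symOperad_ext {F G : Operad.Hom T.operad (symOperad (Obj D))} (hc : F.col = G.col)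
    (h : ∀ v, (opEl (F.map ⟨enum_isOp v⟩)).1 = (opEl (G.map ⟨enum_isOp v⟩)).1) : F = G := by
  refine IsOp.hom_ext hc fun v => ?_
  have hv := h v
  clear h
  obtain ⟨c, F, _, _⟩ := F
  obtain ⟨c', G, _, _⟩ := G
  obtain rfl : c = c' := hc
  exact heq_of_eq (opEl_injective (Subtype.ext hv))

theorem toHom_res {S : Tree} (f : S ⟶ T) (x : D.obj (op T)) :
    toHom (res f x) = Operad.Hom.trans f (toHom x) := by
  refine hom_symOperad_ext (funext fun e => res_edge f e x) fun v => ?_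
  rw [opEl_toHom]
  refine Eq.trans ?_ (congrArg Subtype.val (opEl_toHom x (f.map ⟨enum_isOp v⟩).down)).symm
  exact (res_res _ _ _).trans (congrArg (fun k => res k x) (cor_hom_ext rfl fun _ => rfl))

theorem range_opHom (v : T.Vertex) :
    (Set.range fun i => ed (opHom (enum_isOp v)) (leaf i)) = inp v := by
  refine Eq.trans ?_ (range_enum v)
  exact Function.Surjective.range_comp (f := fun i : (Finset.univ : Finset (Fin (arity v))) => i.1)
    (fun i => ⟨⟨i, Finset.mem_univ i⟩, rfl⟩) (enum v)

/-- Both sides are determined by colours and the operations of the vertices: the right-hand side by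
freeness of the operad of `T`, the left-hand side by the Segal condition. On vertices the bijection
is `opEl`. -/
theorem toHom_bijective (T : Tree) : Function.Bijective (toHom (D := D) (T := T)) := by
  constructor
  · intro x y hxy
    refine hD.out.separated.ext' (fun v => opHom (enum_isOp v)) (fun v => rfl) range_opHom
      (fun e => congrArg (fun F : Operad.Hom T.operad (symOperad (Obj D)) => F.col e) hxy)
      fun v => ?_
    refine (congrArg Subtype.val (opEl_toHom x (enum_isOp v))).symm.trans
      (Eq.trans ?_ (congrArg Subtype.val (opEl_toHom y (enum_isOp v))))
    rw [hxy]
  · intro F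
    let s : ∀ v, El (fun i => (F.col (enum v i) : Obj D)) Finset.univ (F.col (T.out v) : Obj D) :=
      fun v => opEl (F.map ⟨enum_isOp v⟩)
    obtain ⟨x, hx, hx'⟩ := hD.out.segal.exists_fill (fun v => opHom (enum_isOp v)) (fun v => rfl)
      range_opHom F.col (fun v => (s v).1) (fun v => (s v).2.1) fun v => (s v).2.2
    refine ⟨x, hom_symOperad_ext (funext hx) fun v => ?_⟩
    rw [opEl_toHom]
    exact hx' v

variable (D) in
/-- A strictly fully Kan dendroidal set is the nerve of its symmetric monoidal category. -/
noncomputable def isoNerve : D ≅ SymMonCat.nerve.obj ⟨Obj D⟩ :=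
  NatIso.ofComponents (fun T => (Equiv.ofBijective _ (toHom_bijective T.unop)).toIso) (by
    rintro ⟨T⟩ ⟨S⟩ ⟨f⟩
    ext x
    exact toHom_res f x)

end

end Dendroidal

/-- The nerve `N_d` sends Picard groupoids to strictly fully Kan dendroidal sets, and the resulting
functor between the two full subcategories is an equivalence of categories. -/
theorem corollary3p3 :
    ∃ h : ∀ C : Dendroidal.SymMonCat.IsPicard.{u}.FullSubcategory,
        Dendroidal.IsStrictlyFullyKan.{u} (Dendroidal.SymMonCat.nerve.{u}.obj C.obj),
      (Dendroidal.IsStrictlyFullyKan.{u}.lift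
        (Dendroidal.SymMonCat.IsPicard.{u}.ι ⋙ Dendroidal.SymMonCat.nerve.{u}) h).IsEquivalence := by
  refine ⟨fun C => Dendroidal.isStrictlyFullyKan_nerve C.obj C.property, ?_⟩
  -- Full faithfulness passes from the nerve to the restricted functor by instances. Essential
  -- surjectivity is given by the Picard groupoid of objects and unary operations.
  exact
    { essSurj := ⟨fun D => by
        have : Fact (Dendroidal.IsStrictlyFullyKan D.obj) := ⟨D.property⟩
        exact ⟨⟨⟨Dendroidal.Obj D.obj⟩, Dendroidal.isPicard_obj⟩,
          ⟨ObjectProperty.isoMk _ (Dendroidal.isoNerve D.obj).symm⟩⟩⟩ }
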